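/- An instance of the single-level discrete improvable knapsack problem with unit improvement costs consists of $n\ge 0$ items with profits $p_i\in\mathbb{R}$, weights $w_i$ and improved weights $\hat w_i$, a knapsack budget $B\ge 0$ and an improvement budget $k\in\mathbb{N}$, $k\ge 1$, where $0\le \hat w_i\le w_i$ and $\hat w_i\le B$ for all $i$. The problem (iK-ds) is to maximize $\sum_i p_i x_i$ over $x,y\in\{0,1\}^n$ with $y\le x$, $\sum_i w_i x_i-\sum_i (w_i-\hat w_i)y_i\le B$ and $\sum_i y_i\le k$; let $\mathrm{OPT}$ be its optimal value. For disjoint sets $J,\hat J$ of items, $(J,\hat J)$ denotes the solution that packs the items of $J$ unimproved and those of $\hat J$ improved, and $p(J,\hat J)=\sum_{i\in J\cup\hat J}p_i$ is its profit. Let (CKP') be the problem of maximizing $\sum_i p_i(x_i+\hat x_i)$ over $x,\hat x\in\{0,1\}^n$ with $\sum_i w_ix_i+\sum_i\hat w_i\hat x_i\le B$ and $\sum_i\hat x_i\le k$. Its LP relaxation replaces $\{0,1\}$ by $[0,1]$; a basic solution of the relaxation is a feasible point at which $2n$ linearly independent constraints are tight. Algorithm. Compute an optimal basic solution $(x,\hat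 x)$ of the LP relaxation of (CKP'). Let $J=\{i: x_i=1\}$, $\hat J=\{i:\hat x_i=1\}$, and let $F$ be the set of fractional variables (those with value strictly between $0$ and $1$). Return a solution of maximum profit among the following candidates: (a) $(J,\emptyset)$ and $(\emptyset,\hat J)$, if $F=\emptyset$; (b) $(\emptyset,\{i\})$, $(J,\emptyset)$ and $(\emptyset,\hat J)$, if $F$ consists of one variable, belonging to item $i$; (c) $(\emptyset,\{i\})$, $(J,\emptyset)$ and $(\emptyset,\hat J\cup\{j\})$, if $F$ consists of two variables, belonging to items $i$ and $j$ with $\hat w_i\ge\hat w_j$. Theorem. For every such instance: 1. Every basic solution of the LP relaxation of (CKP') has at most two fractional variables; if it has exactly two, they are $\hat x_i$ and $\hat x_j$ for some $i\ne j$, and $\hat x_i+\hat x_j=1$. 2. The optimal value of (CKP') is at least $\mathrm{OPT}$. 3. For every optimal basic solution of the LP relaxation, one of the cases (a), (b), (c) applies, all candidates are feasible for (iK-ds), and their profits add up to at least $\mathrm{OPT}$. 4. Every solution that the algorithm can return is feasible for (iK-ds) and has profit at least $\mathrm{OPT}/3$. Moreover, the algorithm runs in linear time: there are one program for a real random access machine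 (unit-cost addition, truncated subtraction and comparison of index registers; unit-cost $+,-,\times,/$ and comparison of exact real numbers, with rational constants; indexed arrays; no rounding) and a constant $K$ such that on every instance with $n$ items the program halts after at most $K(n+1)$ steps and outputs a solution that the algorithm can return. -/

import Mathlib

namespace ImprovableKnapsack

/-! ### The single-level discrete improvable knapsack problem with unit improvement costs -/

/-- The data of an instance with `n` items: profits `p`, original weights `w`, improved weights
`wHat`, the knapsack budget `B`, and the improvement budget `k` (every improvement costs `1`). -/
structure KnapsackData (n : ℕ) where
  p : Fin n → ℝ
  w : Fin n → ℝ
  wHat : Fin n → ℝ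
  B : ℝ
  k : ℕ

variable {n : ℕ}

/-- The standing assumptions on an instance: budgets admit the empty packing and at least one
improvement, improved weights are nonnegative and do not exceed the original ones, and every item
fits into the knapsack in its improved form. Profits are arbitrary reals. -/
structure KnapsackData.Valid (I : KnapsackData n) : Prop where
  B_nonneg : 0 ≤ I.B
  k_pos : 1 ≤ I.k
  wHat_nonneg : ∀ i, 0 ≤ I.wHat i
  wHat_le_w : ∀ i, I.wHat i ≤ I.w i
  wHat_le_B : ∀ i, I.wHat i ≤ I.B

/-- Feasibility for (iK-ds) with unit costs: `x i = 1` if item `i` is packed, `y i = 1` if it is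
improved. -/
structure KnapsackData.Feasible (I : KnapsackData n) (x y : Fin n → ℝ) : Prop where
  x_binary : ∀ i, x i = 0 ∨ x i = 1
  y_binary : ∀ i, y i = 0 ∨ y i = 1
  y_le_x : ∀ i, y i ≤ x i
  weight : ∑ i, I.w i * x i - ∑ i, (I.w i - I.wHat i) * y i ≤ I.B
  cost : ∑ i, y i ≤ I.k

/-- `v` is the optimal objective value of (iK-ds). -/
def KnapsackData.IsOptValue (I : KnapsackData n) (v : ℝ) : Prop :=
  IsGreatest {v | ∃ x y, I.Feasible x y ∧ v = ∑ i, I.p i * x i} v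

/-- A pair `(J, Ĵ)`: the items packed with their original weight and the items packed with their
improved weight. -/
structure Selection (n : ℕ) where
  plain : Finset (Fin n)
  improved : Finset (Fin n)

/-- The packing vector `x` of a selection. -/
def Selection.x (S : Selection n) (i : Fin n) : ℝ :=
  if i ∈ S.plain ∪ S.improved then 1 else 0

/-- The improvement vector `y` of a selection. -/
def Selection.y (S : Selection n) (i : Fin n) : ℝ :=
  if i ∈ S.improved then 1 else 0

/-- A selection that uses no item in both forms and whose vectors are feasible for (iK-ds). -/
def KnapsackData.FeasibleSelection (I : KnapsackData n) (S : Selection n) : Prop :=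
  Disjoint S.plain S.improved ∧ I.Feasible S.x S.y

/-- The profit of a selection. -/
noncomputable def KnapsackData.profit (I : KnapsackData n) (S : Selection n) : ℝ :=
  ∑ i, I.p i * S.x i

/-! ### The cardinality-constrained knapsack problem CKP' on doubled items -/

/-- The `2n` variables: `Sum.inl i` is the variable of the unimproved copy of item `i`, and
`Sum.inr i` the one of its improved copy. -/
abbrev CopyVar (n : ℕ) := Fin n ⊕ Fin n

/-- The item that a variable is a copy of. -/
def CopyVar.item (v : CopyVar n) : Fin n := Sum.elim id id v

/-- The inequality constraints of the LP relaxation of CKP'. -/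
inductive Constr (n : ℕ) where
  | knapsack : Constr n
  | cardinality : Constr n
  | lower (v : CopyVar n) : Constr n
  | upper (v : CopyVar n) : Constr n

/-- Left-hand side coefficients; each constraint reads `∑ v, row c v * z v ≤ rhs c`. -/
noncomputable def KnapsackData.row (I : KnapsackData n) : Constr n → CopyVar n → ℝ
  | .knapsack => Sum.elim I.w I.wHat
  | .cardinality => Sum.elim (fun _ => 0) (fun _ => 1)
  | .lower v => -Pi.single v 1
  | .upper v => Pi.single v 1

/-- Right-hand sides. -/
noncomputable def KnapsackData.rhs (I : KnapsackData n) : Constr n → ℝ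
  | .knapsack => I.B
  | .cardinality => I.k
  | .lower _ => 0
  | .upper _ => 1

/-- Objective function of CKP'. -/
noncomputable def KnapsackData.value (I : KnapsackData n) (z : CopyVar n → ℝ) : ℝ :=
  ∑ i, I.p i * (z (Sum.inl i) + z (Sum.inr i))

/-- Feasibility for the LP relaxation of CKP'. -/
def KnapsackData.LPFeasible (I : KnapsackData n) (z : CopyVar n → ℝ) : Prop :=
  ∀ c, ∑ v, I.row c v * z v ≤ I.rhs c

/-- Feasibility for CKP' itself. -/
def KnapsackData.CKPFeasible (I : KnapsackData n) (z : CopyVar n → ℝ) : Prop :=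
  I.LPFeasible z ∧ ∀ v, z v = 0 ∨ z v = 1

/-- `v` is the optimal objective value of CKP'. -/
def KnapsackData.IsCKPOptValue (I : KnapsackData n) (v : ℝ) : Prop :=
  IsGreatest {v | ∃ z, I.CKPFeasible z ∧ v = I.value z} v

/-- The constraint `c` holds with equality at `z`. -/
def KnapsackData.Tight (I : KnapsackData n) (z : CopyVar n → ℝ) (c : Constr n) : Prop :=
  ∑ v, I.row c v * z v = I.rhs c

/-- Basic (feasible) solutions of the LP relaxation: feasible points at which `2n` linearly
independent constraints are tight, that is, the rows of the tight constraints have full rank. -/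
def KnapsackData.IsBasic (I : KnapsackData n) (z : CopyVar n → ℝ) : Prop :=
  I.LPFeasible z ∧ Submodule.span ℝ (I.row '' {c | I.Tight z c}) = ⊤

/-- Basic solutions that are optimal for the LP relaxation. -/
def KnapsackData.IsOptimalBasic (I : KnapsackData n) (z : CopyVar n → ℝ) : Prop :=
  I.IsBasic z ∧ ∀ z', I.LPFeasible z' → I.value z' ≤ I.value z

/-! ### The algorithm -/

open Classical in
/-- The fractional variables of `z`. -/
noncomputable def fractional (z : CopyVar n → ℝ) : Finset (CopyVar n) :=
  Finset.univ.filter fun v => 0 < z v ∧ z v < 1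

open Classical in
/-- The items that `z` packs integrally with their original weight. -/
noncomputable def integralPlain (z : CopyVar n → ℝ) : Finset (Fin n) :=
  Finset.univ.filter fun i => z (Sum.inl i) = 1

open Classical in
/-- The items that `z` packs integrally with their improved weight. -/
noncomputable def integralImproved (z : CopyVar n → ℝ) : Finset (Fin n) :=
  Finset.univ.filter fun i => z (Sum.inr i) = 1

/-- The list of candidate solutions that the algorithm builds from a solution `z` of the LP
relaxation, according to the number of fractional variables. -/
inductive Candidates (I : KnapsackData n) (z : CopyVar n → ℝ) : List (Selection n) → Prop
  | none (h : fractional z = ∅) :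
      Candidates I z [⟨integralPlain z, ∅⟩, ⟨∅, integralImproved z⟩]
  | one (v : CopyVar n) (h : fractional z = {v}) :
      Candidates I z
        [⟨∅, {v.item}⟩, ⟨integralPlain z, ∅⟩, ⟨∅, integralImproved z⟩]
  | two (u v : CopyVar n) (huv : u ≠ v) (h : fractional z = {u, v})
      (hw : I.wHat v.item ≤ I.wHat u.item) :
      Candidates I z
        [⟨∅, {u.item}⟩, ⟨integralPlain z, ∅⟩, ⟨∅, integralImproved z ∪ {v.item}⟩]

/-- `S` is a possible result of the algorithm: a candidate of maximal profit among the candidates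
built from some optimal basic solution of the LP relaxation of CKP'. -/
def AlgorithmReturns (I : KnapsackData n) (S : Selection n) : Prop :=
  ∃ z L, I.IsOptimalBasic z ∧ Candidates I z L ∧ S ∈ L ∧ ∀ T ∈ L, I.profit T ≤ I.profit S

/-! ### A real random access machine

Structured programs over index (natural number) and real registers and finitely many index and real
arrays, with recursive parameterless procedures. Each operation (evaluation of an operator,
constant, register or array access; assignment; test; call) costs one step. The index arithmetic
is addition and truncated subtraction; the real arithmetic is `+ - * /` and comparison, with
rational constants and without rounding. -/

/-- A memory configuration: registers, and arrays addressed by an array name and an index. -/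
structure Memory where
  ireg : ℕ → ℕ
  rreg : ℕ → ℝ
  iarr : ℕ → ℕ → ℕ
  rarr : ℕ → ℕ → ℝ

/-- Index expressions. -/
inductive IExp where
  | const (c : ℕ)
  | reg (r : ℕ)
  | get (a : ℕ) (i : IExp)
  | add (e f : IExp)
  | sub (e f : IExp)

/-- Value of an index expression. -/
def IExp.eval (s : Memory) : IExp → ℕ
  | .const c => c
  | .reg r => s.ireg r
  | .get a i => s.iarr a (i.eval s)
  | .add e f => e.eval s + f.eval s
  | .sub e f => e.eval s - f.eval s

/-- Number of operations in an index expression. -/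
def IExp.cost : IExp → ℕ
  | .const _ => 1
  | .reg _ => 1
  | .get _ i => 1 + i.cost
  | .add e f => 1 + e.cost + f.cost
  | .sub e f => 1 + e.cost + f.cost

/-- Real expressions. -/
inductive RExp where
  | const (q : ℚ)
  | cast (i : IExp)
  | reg (r : ℕ)
  | get (a : ℕ) (i : IExp)
  | add (e f : RExp)
  | sub (e f : RExp)
  | mul (e f : RExp)
  | div (e f : RExp)

/-- Value of a real expression. -/
noncomputable def RExp.eval (s : Memory) : RExp → ℝ
  | .const q => q
  | .cast i => (i.eval s : ℝ)
  | .reg r => s.rreg r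
  | .get a i => s.rarr a (i.eval s)
  | .add e f => e.eval s + f.eval s
  | .sub e f => e.eval s - f.eval s
  | .mul e f => e.eval s * f.eval s
  | .div e f => e.eval s / f.eval s

/-- Number of operations in a real expression. -/
def RExp.cost : RExp → ℕ
  | .const _ => 1
  | .cast i => 1 + i.cost
  | .reg _ => 1
  | .get _ i => 1 + i.cost
  | .add e f => 1 + e.cost + f.cost
  | .sub e f => 1 + e.cost + f.cost
  | .mul e f => 1 + e.cost + f.cost
  | .div e f => 1 + e.cost + f.cost

/-- Tests. -/
inductive BExp where
  | ile (e f : IExp)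
  | rle (e f : RExp)
  | not (b : BExp)
  | and (b c : BExp)

/-- Truth of a test. -/
def BExp.Holds (s : Memory) : BExp → Prop
  | .ile e f => e.eval s ≤ f.eval s
  | .rle e f => e.eval s ≤ f.eval s
  | .not b => ¬ b.Holds s
  | .and b c => b.Holds s ∧ c.Holds s

/-- Number of operations in a test. -/
def BExp.cost : BExp → ℕ
  | .ile e f => 1 + e.cost + f.cost
  | .rle e f => 1 + e.cost + f.cost
  | .not b => 1 + b.cost
  | .and b c => 1 + b.cost + c.cost

/-- Commands. -/
inductive Cmd where
  | skip
  | iset (r : ℕ) (e : IExp)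
  | rset (r : ℕ) (e : RExp)
  | istore (a : ℕ) (i : IExp) (e : IExp)
  | rstore (a : ℕ) (i : IExp) (e : RExp)
  | seq (c d : Cmd)
  | ite (b : BExp) (c d : Cmd)
  | while (b : BExp) (c : Cmd)
  | call (f : ℕ)

/-- The memory after setting an index register. -/
def Memory.iset (s : Memory) (r v : ℕ) : Memory :=
  { s with ireg := Function.update s.ireg r v }

/-- The memory after setting a real register. -/
noncomputable def Memory.rset (s : Memory) (r : ℕ) (v : ℝ) : Memory :=
  { s with rreg := Function.update s.rreg r v }

/-- The memory after writing into an index array. -/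
def Memory.istore (s : Memory) (a i v : ℕ) : Memory :=
  { s with iarr := Function.update s.iarr a (Function.update (s.iarr a) i v) }

/-- The memory after writing into a real array. -/
noncomputable def Memory.rstore (s : Memory) (a i : ℕ) (v : ℝ) : Memory :=
  { s with rarr := Function.update s.rarr a (Function.update (s.rarr a) i v) }

/-- A program: a main command and a finite list of procedure bodies. -/
structure Program where
  main : Cmd
  procs : List Cmd

/-- `Exec procs c s t s'`: the command `c`, started in memory `s`, halts after exactly `t` steps
in memory `s'`. Calling a procedure that does not exist does not halt. -/
inductive Exec (procs : List Cmd) : Cmd → Memory → ℕ → Memory → Prop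
  | skip (s : Memory) : Exec procs .skip s 1 s
  | iset (r : ℕ) (e : IExp) (s : Memory) :
      Exec procs (.iset r e) s (1 + e.cost) (s.iset r (e.eval s))
  | rset (r : ℕ) (e : RExp) (s : Memory) :
      Exec procs (.rset r e) s (1 + e.cost) (s.rset r (e.eval s))
  | istore (a : ℕ) (i e : IExp) (s : Memory) :
      Exec procs (.istore a i e) s (1 + i.cost + e.cost) (s.istore a (i.eval s) (e.eval s))
  | rstore (a : ℕ) (i : IExp) (e : RExp) (s : Memory) :
      Exec procs (.rstore a i e) s (1 + i.cost + e.cost) (s.rstore a (i.eval s) (e.eval s))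
  | seq {c d : Cmd} {s s' s'' : Memory} {t t' : ℕ}
      (hc : Exec procs c s t s') (hd : Exec procs d s' t' s'') :
      Exec procs (.seq c d) s (t + t') s''
  | ite_true {b : BExp} {c d : Cmd} {s s' : Memory} {t : ℕ}
      (hb : b.Holds s) (hc : Exec procs c s t s') :
      Exec procs (.ite b c d) s (1 + b.cost + t) s'
  | ite_false {b : BExp} {c d : Cmd} {s s' : Memory} {t : ℕ}
      (hb : ¬ b.Holds s) (hd : Exec procs d s t s') :
      Exec procs (.ite b c d) s (1 + b.cost + t) s'
  | while_true {b : BExp} {c : Cmd} {s s' s'' : Memory} {t t' : ℕ}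
      (hb : b.Holds s) (hc : Exec procs c s t s') (hw : Exec procs (.while b c) s' t' s'') :
      Exec procs (.while b c) s (1 + b.cost + t + t') s''
  | while_false {b : BExp} {c : Cmd} {s : Memory} (hb : ¬ b.Holds s) :
      Exec procs (.while b c) s (1 + b.cost) s
  | call {f : ℕ} {c : Cmd} {s s' : Memory} {t : ℕ}
      (hf : procs[f]? = some c) (hc : Exec procs c s t s') :
      Exec procs (.call f) s (1 + t) s'

/-- A family indexed by the items, stored as an array (zero beyond its end). -/
noncomputable def toArray (f : Fin n → ℝ) (i : ℕ) : ℝ :=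
  if h : i < n then f ⟨i, h⟩ else 0

/-- The initial memory: `n` and `k` in index registers `0` and `1`, `B` in real register `0`, the
profits, weights and improved weights in real arrays `0`, `1` and `2`, and zeros elsewhere. -/
noncomputable def KnapsackData.input (I : KnapsackData n) : Memory where
  ireg r := if r = 0 then n else if r = 1 then I.k else 0
  rreg r := if r = 0 then I.B else 0
  iarr _ _ := 0
  rarr a :=
    if a = 0 then toArray I.p else if a = 1 then toArray I.w
    else if a = 2 then toArray I.wHat else fun _ => 0

/-- The selection written in a memory: index arrays `0` and `1` hold the entry `1` at exactly the
items packed unimproved and improved, respectively. -/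
def Memory.output (s : Memory) (n : ℕ) : Selection n where
  plain := Finset.univ.filter fun i => s.iarr 0 i = 1
  improved := Finset.univ.filter fun i => s.iarr 1 i = 1

/-- The program `P` carries out the algorithm in linear time: for some constant `K`, on every valid
instance with `n` items it halts after at most `K * (n + 1)` steps, and its output is a result of
the algorithm. -/
def Program.RunsAlgorithmInLinearTime (P : Program) : Prop :=
  ∃ K : ℕ, ∀ (n : ℕ) (I : KnapsackData n), I.Valid →
    ∃ (t : ℕ) (s : Memory), Exec P.procs P.main I.input t s ∧ t ≤ K * (n + 1) ∧
      AlgorithmReturns I (s.output n)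

end ImprovableKnapsack

open ImprovableKnapsack

namespace ImprovableKnapsack

variable {n : ℕ}

/-! ### The linear programming relaxation -/

section Relaxation

variable {I : KnapsackData n} {z : CopyVar n → ℝ}

/-! Approximation. Splitting every item into an unimproved and an improved copy embeds (iK-ds) into
(CKP'), so the LP optimum is at least `OPT`. Only two LP constraints are not bounds on a single
variable, hence a basic solution has at most two fractional variables (`card_fractional_le_two`). If
it has two, the knapsack row alone cannot determine them, so the cardinality row is tight; since `k`
is an integer, the fractional improved copies then sum to an integer, which leaves only two improved
copies with sum 1 (`fractional_of_card_eq_two`). Weights are nonnegative, so a variable that is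
positive in an optimal solution has nonnegative profit, and the LP value is at most the profit of
the integral parts plus the full profits of the fractional items (`value_le_sum_candidates`). This
total is spread over at most three candidates. The delicate one rounds up the lighter of two
fractional items: the two copies occupy a convex combination of their weights, which is at least the
smaller weight.

Linear time, dual side. With slack columns the LP has two equality rows, and its dual minimizes a
convex function of two variables, a linear term plus weighted hinges, one per column. Its minimum is
found by prune and search in the style of Megiddo and Dyer. An oracle decides on which side of a
given line the minimum points lie: it minimizes along the line and then minimizes the directional
derivative to either side (`query_spec`). In each round the hinge lines are split at the median
slope and paired, and two oracle calls at median intersection points confine the minimum points to a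
wedge that a sixteenth of the lines do not enter (`prunable_card`); such hinges are linear on the
wedge and are absorbed into the linear term (`pruned_isMinPt`). The sizes decrease geometrically
(`search_spec`). All one-variable minimizations are weighted medians, computed by a linear-time
recursive selection (`select_spec`).

Linear time, primal side. At the dual minimum, the steepest direction to each side along the first
coordinate gives a primal vector that satisfies complementary slackness and the second row, with the
first row at most, respectively at least, its right-hand side (`recover_spec`). A convex combination
satisfies both rows and is optimal. It is made basic by sweeping over the columns with two
independent columns kept as a basis: each fractional column is expressed in the basis and moved
until it becomes zero or replaces a basis column that reaches a bound (`moveStep_wp`). Only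
fractional variables move, so complementary slackness, and with it optimality, survives. What is
left outside the basis is integral, which makes the solution basic (`isOptimalBasic_solution`), and
the candidates are read off. -/

theorem sum_row_knapsack (I : KnapsackData n) (z : CopyVar n → ℝ) :
    ∑ v, I.row .knapsack v * z v
      = ∑ i, I.w i * z (Sum.inl i) + ∑ i, I.wHat i * z (Sum.inr i) := by
  simp [KnapsackData.row, Fintype.sum_sum_type]

theorem sum_row_cardinality (I : KnapsackData n) (z : CopyVar n → ℝ) :
    ∑ v, I.row .cardinality v * z v = ∑ i, z (Sum.inr i) := by
  simp [KnapsackData.row, Fintype.sum_sum_type]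

theorem sum_row_lower (I : KnapsackData n) (z : CopyVar n → ℝ) (v : CopyVar n) :
    ∑ u, I.row (.lower v) u * z u = -z v := by
  simp only [KnapsackData.row, Pi.neg_apply, neg_mul, Finset.sum_neg_distrib, Pi.single_apply,
    ite_mul, one_mul, zero_mul]
  simp

theorem sum_row_upper (I : KnapsackData n) (z : CopyVar n → ℝ) (v : CopyVar n) :
    ∑ u, I.row (.upper v) u * z u = z v := by
  simp only [KnapsackData.row, Pi.single_apply, ite_mul, one_mul, zero_mul]
  simp

theorem lpFeasible_iff : I.LPFeasible z ↔
    ∑ i, I.w i * z (Sum.inl i) + ∑ i, I.wHat i * z (Sum.inr i) ≤ I.B ∧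
    ∑ i, z (Sum.inr i) ≤ I.k ∧ ∀ v, 0 ≤ z v ∧ z v ≤ 1 := by
  constructor
  · intro h
    refine ⟨?_, ?_, fun v => ⟨?_, ?_⟩⟩
    · rw [← sum_row_knapsack]; exact h .knapsack
    · rw [← sum_row_cardinality]; exact h .cardinality
    · have := h (.lower v); rw [sum_row_lower] at this
      simp only [KnapsackData.rhs] at this; linarith
    · have := h (.upper v); rw [sum_row_upper] at this; exact this
  · rintro ⟨h1, h2, h3⟩ c
    cases c with
    | knapsack => rw [sum_row_knapsack]; exact h1
    | cardinality => rw [sum_row_cardinality]; exact h2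
    | lower v => rw [sum_row_lower]; simp only [KnapsackData.rhs]; linarith [(h3 v).1]
    | upper v => rw [sum_row_upper]; exact (h3 v).2

/-- A feasible point is basic if and only if no nonzero direction keeps all tight constraints
tight. -/
theorem span_tight_eq_top_iff :
    Submodule.span ℝ (I.row '' {c | I.Tight z c}) = ⊤ ↔
      ∀ d : CopyVar n → ℝ, (∀ c, I.Tight z c → ∑ v, I.row c v * d v = 0) → d = 0 := by
  constructor
  · intro h d hd
    -- The direction is read as a functional; it annihilates the tight rows and hence their span.
    let φ : (CopyVar n → ℝ) →ₗ[ℝ] ℝ := ∑ v, (d v) • LinearMap.proj v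
    have hφ : ∀ x, φ x = ∑ v, x v * d v := by
      intro x; simp [φ, mul_comm]
    have hker : Submodule.span ℝ (I.row '' {c | I.Tight z c}) ≤ LinearMap.ker φ := by
      rw [Submodule.span_le]
      rintro _ ⟨c, hc, rfl⟩
      simp only [SetLike.mem_coe, LinearMap.mem_ker, hφ]
      exact hd c hc
    rw [h] at hker
    funext v
    have : φ (Pi.single v 1) = 0 := hker trivial
    rw [hφ] at this
    simpa [Pi.single_apply] using this
  · intro h
    by_contra hne
    -- A proper subspace lies in the kernel of a nonzero functional, whose coordinates form a
    -- direction that keeps the tight rows.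
    obtain ⟨f, hf, hle⟩ := Submodule.exists_le_ker_of_lt_top _ (lt_top_iff_ne_top.2 hne)
    apply hf
    have hfx : ∀ x, f x = ∑ v, x v * f (Pi.single v 1) := by
      intro x
      conv_lhs => rw [LinearMap.pi_apply_eq_sum_univ f x]
      refine Finset.sum_congr rfl fun v _ => ?_
      rw [smul_eq_mul]
      congr 2
      funext u
      simp [Pi.single_apply, eq_comm]
    have h0 := h (fun v => f (Pi.single v 1)) (fun c hc => by
      rw [← hfx]
      exact hle (Submodule.subset_span ⟨c, hc, rfl⟩))
    ext v
    simpa using congrFun h0 v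

theorem mem_fractional {v : CopyVar n} : v ∈ fractional z ↔ 0 < z v ∧ z v < 1 := by
  simp [fractional]

theorem mem_integralPlain {i : Fin n} : i ∈ integralPlain z ↔ z (Sum.inl i) = 1 := by
  simp [integralPlain]

theorem mem_integralImproved {i : Fin n} : i ∈ integralImproved z ↔ z (Sum.inr i) = 1 := by
  simp [integralImproved]

theorem tight_lower_iff {v : CopyVar n} : I.Tight z (.lower v) ↔ z v = 0 := by
  rw [KnapsackData.Tight, sum_row_lower]; simp [KnapsackData.rhs]

theorem tight_upper_iff {v : CopyVar n} : I.Tight z (.upper v) ↔ z v = 1 := by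
  rw [KnapsackData.Tight, sum_row_upper]; simp [KnapsackData.rhs]

theorem eq_zero_or_one_of_not_mem_fractional (hz : I.LPFeasible z) {v : CopyVar n}
    (hv : v ∉ fractional z) : z v = 0 ∨ z v = 1 := by
  obtain ⟨h0, h1⟩ := (lpFeasible_iff.1 hz).2.2 v
  rw [mem_fractional] at hv
  rcases h0.lt_or_eq with h | h
  · exact Or.inr (le_antisymm h1 (not_lt.1 fun h' => hv ⟨h, h'⟩))
  · exact Or.inl h.symm

/-- At a basic solution a direction supported on the fractional variables vanishes if it keeps the
tight ones among the knapsack and the cardinality constraints tight. -/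
theorem basic_direction (hz : I.IsBasic z) (d : CopyVar n → ℝ)
    (hd : ∀ v, v ∉ fractional z → d v = 0)
    (hk : I.Tight z .knapsack → ∑ v, I.row .knapsack v * d v = 0)
    (hc : I.Tight z .cardinality → ∑ v, I.row .cardinality v * d v = 0) : d = 0 := by
  refine span_tight_eq_top_iff.1 hz.2 d fun c h => ?_
  cases c with
  | knapsack => exact hk h
  | cardinality => exact hc h
  | lower v =>
    rw [sum_row_lower, hd v, neg_zero]
    rw [tight_lower_iff] at h
    rw [mem_fractional, h]; simp
  | upper v =>
    rw [sum_row_upper, hd v]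
    rw [tight_upper_iff] at h
    rw [mem_fractional, h]; simp

/-- A basic solution is determined by its fractional variables: conversely, a feasible point is
basic if such directions vanish. -/
theorem isBasic_of_direction (hz : I.LPFeasible z)
    (h : ∀ d : CopyVar n → ℝ, (∀ v, v ∉ fractional z → d v = 0) →
      (I.Tight z .knapsack → ∑ v, I.row .knapsack v * d v = 0) →
      (I.Tight z .cardinality → ∑ v, I.row .cardinality v * d v = 0) → d = 0) : I.IsBasic z := by
  refine ⟨hz, span_tight_eq_top_iff.2 fun d hd => h d (fun v hv => ?_) (hd _) (hd _)⟩
  rcases eq_zero_or_one_of_not_mem_fractional hz hv with h0 | h1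
  · have := hd (.lower v) (tight_lower_iff.2 h0)
    rw [sum_row_lower] at this; linarith
  · have := hd (.upper v) (tight_upper_iff.2 h1)
    rwa [sum_row_upper] at this

/-- Apart from the bounds there are only two rows. The coefficient pairs of three fractional
variables are linearly dependent, and a dependence is a direction that `basic_direction` excludes.
-/
theorem card_fractional_le_two (hz : I.IsBasic z) : (fractional z).card ≤ 2 := by
  classical
  by_contra hlt
  push Not at hlt
  let f : fractional z → Fin 2 → ℝ :=
    fun v => ![I.row .knapsack v, I.row .cardinality v]
  have hdep : ¬ LinearIndependent ℝ f := by
    intro hli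
    have := hli.fintype_card_le_finrank
    simp at this
    omega
  rw [Fintype.not_linearIndependent_iff] at hdep
  obtain ⟨g, hg, v, hv⟩ := hdep
  let d : CopyVar n → ℝ := fun u => if h : u ∈ fractional z then g ⟨u, h⟩ else 0
  have hsum : ∀ r : CopyVar n → ℝ, ∑ u, r u * d u = ∑ u : fractional z, g u * r u := by
    intro r
    rw [← Finset.sum_subset (Finset.subset_univ (fractional z)), ← Finset.sum_attach,
      Finset.univ_eq_attach]
    · refine Finset.sum_congr rfl fun u _ => ?_
      simp [d, mul_comm]
    · intro u _ hu; simp [d, hu]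
  have hd0 := basic_direction hz d (fun u hu => by simp [d, hu])
    (fun _ => by
      rw [hsum]
      simpa [f, Finset.sum_apply] using congrFun hg 0)
    (fun _ => by
      rw [hsum]
      simpa [f, Finset.sum_apply] using congrFun hg 1)
  apply hv
  have := congrFun hd0 v
  simpa [d] using this

/-- Splits off an integer: once the cardinality constraint is tight, the fractional improved copies
must sum to an integer. -/
theorem sum_improved (hz : I.LPFeasible z) :
    ∑ i, z (Sum.inr i) = (integralImproved z).card
      + ∑ i with Sum.inr i ∈ fractional z, z (Sum.inr i) := by
  classical
  rw [← Finset.sum_filter_add_sum_filter_not Finset.univ (fun i => Sum.inr i ∈ fractional z),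
    add_comm]
  congr 1
  rw [← Finset.sum_filter_add_sum_filter_not _ (fun i => z (Sum.inr i) = 1)]
  have h1 : ∑ i ∈ (Finset.univ.filter fun i => Sum.inr i ∉ fractional z).filter
      (fun i => z (Sum.inr i) = 1), z (Sum.inr i) = (integralImproved z).card := by
    rw [Finset.sum_congr rfl (g := fun _ => (1 : ℝ)) (fun i hi => (Finset.mem_filter.1 hi).2)]
    rw [Finset.sum_const, nsmul_one]
    congr 2
    ext i
    simp only [Finset.mem_filter, Finset.mem_univ, true_and, mem_integralImproved, mem_fractional]
    constructor
    · exact fun h => h.2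
    · intro h; rw [h]; simp
  rw [h1]
  rw [Finset.sum_eq_zero, add_zero]
  intro i hi
  simp only [Finset.mem_filter, Finset.mem_univ, true_and] at hi
  exact (eq_zero_or_one_of_not_mem_fractional hz hi.1).resolve_right hi.2

theorem eq_one_of_intCast {a : ℝ} (h0 : 0 < a) (h2 : a < 2) {m : ℤ} (h : a = m) : a = 1 := by
  subst h
  have h0' : (0 : ℤ) < m := by exact_mod_cast h0
  have h2' : m < (2 : ℤ) := by exact_mod_cast h2
  have : m = 1 := by omega
  simp [this]

/-- The cardinality row must be tight and involve one of the two variables, since the knapsack row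
by itself leaves a free direction in their plane. Then the fractional improved copies sum to an
integer strictly between 0 and 2. A single fractional copy cannot have the value 1, so both
variables are improved copies. -/
theorem fractional_of_card_eq_two (hz : I.IsBasic z) (h2 : (fractional z).card = 2) :
    ∃ i j : Fin n, i ≠ j ∧ fractional z = {Sum.inr i, Sum.inr j} ∧
      z (Sum.inr i) + z (Sum.inr j) = 1 := by
  classical
  obtain ⟨u, v, huv, huv'⟩ := Finset.card_eq_two.1 h2
  have hu : u ∈ fractional z := by simp [huv']
  have hv : v ∈ fractional z := by simp [huv']
  -- a direction supported on `u` and `v`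
  have key : ∀ a b : ℝ,
      (I.Tight z .knapsack → I.row .knapsack u * a + I.row .knapsack v * b = 0) →
      (I.Tight z .cardinality → I.row .cardinality u * a + I.row .cardinality v * b = 0) →
      a = 0 ∧ b = 0 := by
    intro a b hk hc
    let d : CopyVar n → ℝ := Pi.single u a + Pi.single v b
    have hsum : ∀ r : CopyVar n → ℝ, ∑ t, r t * d t = r u * a + r v * b := by
      intro r
      simp [d, mul_add, Finset.sum_add_distrib, Pi.single_apply]
    have hd := basic_direction hz d
      (fun t ht => by
        rw [huv'] at ht
        simp only [Finset.mem_insert, Finset.mem_singleton, not_or] at ht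
        simp [d, ht.1, ht.2])
      (fun h => by rw [hsum]; exact hk h) (fun h => by rw [hsum]; exact hc h)
    have h1 := congrFun hd u
    have h2 := congrFun hd v
    simp only [d, Pi.add_apply, Pi.single_apply, huv, Ne.symm huv, if_true, if_false,
      Pi.zero_apply] at h1 h2
    constructor <;> linarith
  -- otherwise the knapsack constraint alone would have to determine both variables
  have key2 : ¬ (I.Tight z .cardinality →
      I.row .cardinality u = 0 ∧ I.row .cardinality v = 0) := by
    intro hc
    obtain ⟨h1, h2⟩ := key (I.row .knapsack v) (-I.row .knapsack u) (fun _ => by ring)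
      (fun h => by rw [(hc h).1, (hc h).2]; ring)
    -- The previous direction forces the knapsack coefficient of `u` to be zero, so that even the
    -- unit vector at `u` keeps both rows.
    obtain ⟨h3, _⟩ := key 1 0 (fun _ => by rw [neg_eq_zero.1 h2]; ring)
      (fun h => by rw [(hc h).1]; ring)
    exact one_ne_zero h3
  push Not at key2
  obtain ⟨hc, hne⟩ := key2
  have hcard := hc
  rw [KnapsackData.Tight, sum_row_cardinality, sum_improved hz.1] at hcard
  simp only [KnapsackData.rhs] at hcard
  obtain ⟨hu0, hu1⟩ := mem_fractional.1 hu
  obtain ⟨hv0, hv1⟩ := mem_fractional.1 hv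
  rcases u with i | i <;> rcases v with j | j
  · exact absurd rfl (hne rfl)
  · have : (Finset.univ.filter fun t => (Sum.inr t : CopyVar n) ∈ fractional z) = {j} := by
      ext t; simp [huv']
    rw [this, Finset.sum_singleton] at hcard
    have := eq_one_of_intCast hv0 (by linarith) (m := (I.k : ℤ) - (integralImproved z).card)
      (by push_cast; linarith)
    linarith
  · have : (Finset.univ.filter fun t => (Sum.inr t : CopyVar n) ∈ fractional z) = {i} := by
      ext t; simp [huv']
    rw [this, Finset.sum_singleton] at hcard
    have := eq_one_of_intCast hu0 (by linarith) (m := (I.k : ℤ) - (integralImproved z).card)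
      (by push_cast; linarith)
    linarith
  · have hij : i ≠ j := fun h => huv (by rw [h])
    have : (Finset.univ.filter fun t => (Sum.inr t : CopyVar n) ∈ fractional z) = {i, j} := by
      ext t; simp [huv']
    rw [this, Finset.sum_pair hij] at hcard
    exact ⟨i, j, hij, huv', eq_one_of_intCast (by linarith) (by linarith)
      (m := (I.k : ℤ) - (integralImproved z).card) (by push_cast; linarith)⟩

end Relaxation

/-! ### Optimal values -/

section Values

variable {I : KnapsackData n}

theorem finite_binary (ι : Type*) [Finite ι] : {x : ι → ℝ | ∀ i, x i = 0 ∨ x i = 1}.Finite := by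
  have : {x : ι → ℝ | ∀ i, x i = 0 ∨ x i = 1} = Set.pi Set.univ fun _ => ({0, 1} : Set ℝ) := by
    ext x; simp [Set.mem_pi]
  rw [this]
  exact Set.Finite.pi fun _ => Set.toFinite _

theorem exists_isOptValue (hI : I.Valid) : ∃ opt, I.IsOptValue opt := by
  set S := {v | ∃ x y, I.Feasible x y ∧ v = ∑ i, I.p i * x i} with hS
  have hfin : S.Finite := by
    refine (((finite_binary (Fin n)).prod (finite_binary (Fin n))).image
      (fun q : (Fin n → ℝ) × (Fin n → ℝ) => ∑ i, I.p i * q.1 i)).subset ?_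
    rintro v ⟨x, y, h, rfl⟩
    exact ⟨(x, y), ⟨h.x_binary, h.y_binary⟩, rfl⟩
  have hne : S.Nonempty := ⟨_, 0, 0,
    { x_binary := by simp, y_binary := by simp, y_le_x := by simp
      weight := by simpa using hI.B_nonneg
      cost := by simp }, rfl⟩
  exact hfin.isCompact.exists_isGreatest hne

theorem exists_isCKPOptValue (hI : I.Valid) : ∃ ckp, I.IsCKPOptValue ckp := by
  set S := {v | ∃ z, I.CKPFeasible z ∧ v = I.value z} with hS
  have hfin : S.Finite := by
    refine ((finite_binary (CopyVar n)).image I.value).subset ?_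
    rintro v ⟨z, h, rfl⟩
    exact ⟨z, h.2, rfl⟩
  have hne : S.Nonempty := by
    refine ⟨_, 0, ⟨lpFeasible_iff.2 ⟨?_, ?_, ?_⟩, by simp⟩, rfl⟩
    · simpa using hI.B_nonneg
    · simp
    · simp
  exact hfin.isCompact.exists_isGreatest hne

/-- The unimproved copies receive `x - y` and the improved ones `y`; the constraint `y ≤ x` makes
the difference binary. -/
theorem optValue_le_ckpOptValue {opt ckp : ℝ} (h1 : I.IsOptValue opt) (h2 : I.IsCKPOptValue ckp) :
    opt ≤ ckp := by
  obtain ⟨⟨x, y, h, rfl⟩, -⟩ := h1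
  refine h2.2 ⟨Sum.elim (fun i => x i - y i) y, ⟨lpFeasible_iff.2 ⟨?_, ?_, ?_⟩, ?_⟩, ?_⟩
  · have := h.weight
    rw [← Finset.sum_sub_distrib] at this
    simp only [Sum.elim_inl, Sum.elim_inr]
    rw [← Finset.sum_add_distrib]
    convert this using 2
    ring
  · simpa using h.cost
  · rintro (i | i)
    · have := h.y_le_x i
      rcases h.x_binary i with hx | hx <;> rcases h.y_binary i with hy | hy <;>
        simp only [Sum.elim_inl, hx, hy] at this ⊢ <;> norm_num at *
    · rcases h.y_binary i with hy | hy <;> simp [hy]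
  · rintro (i | i)
    · have := h.y_le_x i
      rcases h.x_binary i with hx | hx <;> rcases h.y_binary i with hy | hy <;>
        simp only [Sum.elim_inl, hx, hy] at this ⊢ <;> norm_num at *
    · exact h.y_binary i
  · simp [KnapsackData.value]

end Values

/-! ### Candidates -/

section Candidates

variable {I : KnapsackData n} {z : CopyVar n → ℝ}

theorem profit_plain (J : Finset (Fin n)) : I.profit ⟨J, ∅⟩ = ∑ i ∈ J, I.p i := by
  simp [KnapsackData.profit, Selection.x]

theorem profit_improved (J : Finset (Fin n)) : I.profit ⟨∅, J⟩ = ∑ i ∈ J, I.p i := by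
  simp [KnapsackData.profit, Selection.x]

theorem value_eq_sum (I : KnapsackData n) (z : CopyVar n → ℝ) :
    I.value z = ∑ v : CopyVar n, I.p v.item * z v := by
  simp [KnapsackData.value, Fintype.sum_sum_type, CopyVar.item, mul_add, Finset.sum_add_distrib]

/-- Both rows have nonnegative coefficients, so `z v` may be lowered to zero; if the profit were
negative, this would increase the value. -/
theorem profit_nonneg_of_pos (hI : I.Valid) (hz : I.LPFeasible z)
    (ho : ∀ z', I.LPFeasible z' → I.value z' ≤ I.value z) {v : CopyVar n} (hv : 0 < z v) :
    0 ≤ I.p v.item := by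
  classical
  by_contra hneg
  push Not at hneg
  have hle : ∀ u, Function.update z v 0 u ≤ z u := by
    intro u
    by_cases h : u = v
    · subst h; simpa using hv.le
    · simp [h]
  obtain ⟨h1, h2, h3⟩ := lpFeasible_iff.1 hz
  have hf : I.LPFeasible (Function.update z v 0) := by
    refine lpFeasible_iff.2 ⟨le_trans (add_le_add ?_ ?_) h1, le_trans ?_ h2, fun u => ⟨?_, ?_⟩⟩
    · exact Finset.sum_le_sum fun i _ =>
        mul_le_mul_of_nonneg_left (hle _) ((hI.wHat_nonneg i).trans (hI.wHat_le_w i))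
    · exact Finset.sum_le_sum fun i _ => mul_le_mul_of_nonneg_left (hle _) (hI.wHat_nonneg i)
    · exact Finset.sum_le_sum fun i _ => hle _
    · by_cases h : u = v
      · subst h; simp
      · simpa [h] using (h3 u).1
    · exact (hle u).trans (h3 u).2
  have hval := ho _ hf
  rw [value_eq_sum, value_eq_sum, ← Finset.add_sum_erase _ _ (Finset.mem_univ v),
    ← Finset.add_sum_erase _ (fun u => I.p u.item * z u) (Finset.mem_univ v)] at hval
  rw [Finset.sum_congr rfl (g := fun u => I.p u.item * z u) (fun u hu => by
    simp [Finset.ne_of_mem_erase hu])] at hval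
  simp only [Function.update_self, mul_zero, zero_add] at hval
  nlinarith

theorem value_eq_integral_add_fractional (hz : I.LPFeasible z) :
    I.value z = ∑ i ∈ integralPlain z, I.p i + ∑ i ∈ integralImproved z, I.p i
      + ∑ v ∈ fractional z, I.p v.item * z v := by
  classical
  have hsplit : ∀ v, I.p v.item * z v = (if z v = 1 then I.p v.item else 0)
      + (if v ∈ fractional z then I.p v.item * z v else 0) := by
    intro v
    by_cases hv : v ∈ fractional z
    · have := (mem_fractional.1 hv).2.ne
      simp [hv, this]
    · rcases eq_zero_or_one_of_not_mem_fractional hz hv with h | h <;> simp [hv, h]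
  rw [value_eq_sum, Finset.sum_congr rfl fun v _ => hsplit v, Finset.sum_add_distrib]
  congr 1
  · rw [Fintype.sum_sum_type]
    simp [integralPlain, integralImproved, Finset.sum_filter, CopyVar.item]
  · simp

theorem feasible_plain (hI : I.Valid) (hz : I.LPFeasible z) :
    I.FeasibleSelection ⟨integralPlain z, ∅⟩ := by
  classical
  obtain ⟨h1, h2, h3⟩ := lpFeasible_iff.1 hz
  refine ⟨by simp, ⟨fun i => ?_, fun i => ?_, fun i => ?_, ?_, ?_⟩⟩
  · by_cases h : i ∈ integralPlain z <;> simp [Selection.x, h]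
  · simp [Selection.y]
  · by_cases h : i ∈ integralPlain z <;> simp [Selection.x, Selection.y, h]
  · simp only [Selection.x, Selection.y, Finset.union_empty, Finset.notMem_empty, if_false,
      mul_zero, Finset.sum_const_zero, sub_zero]
    refine le_trans (Finset.sum_le_sum fun i _ => ?_) (le_trans (le_add_of_nonneg_right
      (Finset.sum_nonneg fun i _ => mul_nonneg (hI.wHat_nonneg i) (h3 _).1)) h1)
    refine mul_le_mul_of_nonneg_left ?_ ((hI.wHat_nonneg i).trans (hI.wHat_le_w i))
    by_cases h : i ∈ integralPlain z
    · simp [h, mem_integralPlain.1 h]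
    · simpa [h] using (h3 _).1
  · simp [Selection.y]

theorem feasible_improved {S : Finset (Fin n)} (hw : ∑ i ∈ S, I.wHat i ≤ I.B)
    (hc : S.card ≤ I.k) : I.FeasibleSelection ⟨∅, S⟩ := by
  classical
  refine ⟨by simp, ⟨fun i => ?_, fun i => ?_, fun i => ?_, ?_, ?_⟩⟩
  · by_cases h : i ∈ S <;> simp [Selection.x, h]
  · by_cases h : i ∈ S <;> simp [Selection.y, h]
  · simp [Selection.x, Selection.y]
  · rw [← Finset.sum_sub_distrib]
    refine le_trans (le_of_eq ?_) hw
    simp [Selection.x, Selection.y, Finset.sum_ite_mem]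
  · simpa [Selection.y] using hc

theorem feasible_single (hI : I.Valid) (i : Fin n) : I.FeasibleSelection ⟨∅, {i}⟩ :=
  feasible_improved (by simpa using hI.wHat_le_B i) (by simpa using hI.k_pos)

/-- The fractional contribution is retained because it pays for rounding up the lighter of two
fractional items. -/
theorem sum_wHat_integralImproved_add (hI : I.Valid) (hz : I.LPFeasible z) :
    ∑ i ∈ integralImproved z, I.wHat i
      + ∑ i with Sum.inr i ∈ fractional z, I.wHat i * z (Sum.inr i) ≤ I.B := by
  classical
  obtain ⟨h1, h2, h3⟩ := lpFeasible_iff.1 hz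
  refine le_trans ?_ (le_trans (le_add_of_nonneg_left (Finset.sum_nonneg fun i _ =>
    mul_nonneg ((hI.wHat_nonneg i).trans (hI.wHat_le_w i)) (h3 (Sum.inl i)).1)) h1)
  simp only [integralImproved, Finset.sum_filter, ← Finset.sum_add_distrib]
  refine Finset.sum_le_sum fun i _ => ?_
  have hw := hI.wHat_nonneg i
  have h0 := h3 (Sum.inr i)
  by_cases h : z (Sum.inr i) = 1
  · simp [h, mem_fractional]
  · by_cases h' : Sum.inr i ∈ fractional z
    · simp [h, h']
    · simp [h, h', mul_nonneg hw h0.1]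

theorem feasible_integralImproved (hI : I.Valid) (hz : I.LPFeasible z) :
    I.FeasibleSelection ⟨∅, integralImproved z⟩ := by
  classical
  obtain ⟨h1, h2, h3⟩ := lpFeasible_iff.1 hz
  refine feasible_improved ?_ ?_
  · refine le_trans (le_add_of_nonneg_right (Finset.sum_nonneg fun i _ =>
      mul_nonneg (hI.wHat_nonneg i) (h3 _).1)) (sum_wHat_integralImproved_add hI hz)
  · rw [sum_improved hz] at h2
    have : (0 : ℝ) ≤ ∑ i with Sum.inr i ∈ fractional z, z (Sum.inr i) :=
      Finset.sum_nonneg fun i _ => (h3 _).1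
    have h : ((integralImproved z).card : ℝ) ≤ I.k := by linarith
    exact_mod_cast h

/-- With two fractional variables, the lighter one can be rounded up once the heavier one is
rounded down. -/
theorem feasible_integralImproved_union (hI : I.Valid) (hz : I.LPFeasible z) {i j : Fin n}
    (hij : i ≠ j) (hf : fractional z = {Sum.inr i, Sum.inr j})
    (hs : z (Sum.inr i) + z (Sum.inr j) = 1) (hw : I.wHat j ≤ I.wHat i) :
    I.FeasibleSelection ⟨∅, integralImproved z ∪ {j}⟩ := by
  classical
  obtain ⟨h1, h2, h3⟩ := lpFeasible_iff.1 hz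
  have hj : j ∉ integralImproved z := by
    have : Sum.inr j ∈ fractional z := by simp [hf]
    rw [mem_integralImproved]
    exact (mem_fractional.1 this).2.ne
  have hset : (Finset.univ.filter fun t => (Sum.inr t : CopyVar n) ∈ fractional z) = {i, j} := by
    ext t; simp [hf]
  have hdisj : Disjoint (integralImproved z) {j} := by simpa using hj
  refine feasible_improved ?_ ?_
  · have hle := sum_wHat_integralImproved_add hI hz
    rw [hset, Finset.sum_pair hij] at hle
    rw [Finset.sum_union hdisj, Finset.sum_singleton]
    have h0 := (h3 (Sum.inr i)).1
    -- The two fractional copies occupy a convex combination of their weights, hence at least the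
    -- smaller weight.
    have : I.wHat j * z (Sum.inr i) ≤ I.wHat i * z (Sum.inr i) :=
      mul_le_mul_of_nonneg_right hw h0
    have e : z (Sum.inr j) = 1 - z (Sum.inr i) := by linarith
    rw [e] at hle
    linarith
  · rw [sum_improved hz, hset, Finset.sum_pair hij, hs] at h2
    rw [Finset.card_union_of_disjoint hdisj, Finset.card_singleton]
    exact_mod_cast h2

theorem exists_candidates (hz : I.IsBasic z) : ∃ L, Candidates I z L := by
  classical
  have h := card_fractional_le_two hz
  interval_cases hc : (fractional z).card
  · exact ⟨_, .none (Finset.card_eq_zero.1 hc)⟩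
  · obtain ⟨v, hv⟩ := Finset.card_eq_one.1 hc
    exact ⟨_, .one v hv⟩
  · obtain ⟨u, v, huv, huv'⟩ := Finset.card_eq_two.1 hc
    rcases le_total (I.wHat v.item) (I.wHat u.item) with hw | hw
    · exact ⟨_, .two u v huv huv' hw⟩
    · exact ⟨_, .two v u huv.symm (by rw [huv', Finset.pair_comm]) hw⟩

/-- The fractional variables of a case with two of them, in either order. -/
theorem candidates_two (hz : I.IsBasic z) {u v : CopyVar n} (huv : u ≠ v)
    (h : fractional z = {u, v}) :
    ∃ i j, i ≠ j ∧ u = Sum.inr i ∧ v = Sum.inr j ∧ z (Sum.inr i) + z (Sum.inr j) = 1 := by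
  obtain ⟨i, j, hij, hf, hs⟩ :=
    fractional_of_card_eq_two hz (by rw [h, Finset.card_pair huv])
  have hu : u ∈ ({Sum.inr i, Sum.inr j} : Finset (CopyVar n)) := by rw [← hf, h]; simp
  have hv : v ∈ ({Sum.inr i, Sum.inr j} : Finset (CopyVar n)) := by rw [← hf, h]; simp
  simp only [Finset.mem_insert, Finset.mem_singleton] at hu hv
  rcases hu with rfl | rfl <;> rcases hv with rfl | rfl
  · exact absurd rfl huv
  · exact ⟨i, j, hij, rfl, rfl, hs⟩
  · exact ⟨j, i, hij.symm, rfl, rfl, by linarith⟩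
  · exact absurd rfl huv

theorem candidates_feasible (hI : I.Valid) (hz : I.IsBasic z) {L : List (Selection n)}
    (hL : Candidates I z L) : ∀ S ∈ L, I.FeasibleSelection S := by
  have hp := feasible_plain hI hz.1
  have hi := feasible_integralImproved hI hz.1
  cases hL with
  | none h => simp [hp, hi]
  | one v h => simp [hp, hi, feasible_single hI]
  | two u v huv h hw =>
    obtain ⟨i, j, hij, rfl, rfl, hs⟩ := candidates_two hz huv h
    have := feasible_integralImproved_union hI hz.1 hij h hs hw
    simp only [List.mem_cons, List.not_mem_nil, or_false]
    rintro S (rfl | rfl | rfl)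
    · exact feasible_single hI _
    · exact hp
    · exact this

theorem optValue_le_value {opt : ℝ} (hI : I.Valid) (ho : I.IsOptValue opt)
    (hz : ∀ z', I.LPFeasible z' → I.value z' ≤ I.value z) : opt ≤ I.value z := by
  obtain ⟨ckp, hckp⟩ := exists_isCKPOptValue hI
  refine (optValue_le_ckpOptValue ho hckp).trans ?_
  obtain ⟨⟨z', h, rfl⟩, -⟩ := hckp
  exact hz z' h.1

/-- The integral parts are candidates or contained in one, and a fractional variable contributes at
most the full profit of its item, which is nonnegative. With two fractional variables, `j` is not
yet in `integralImproved z`, so its profit is added in full. -/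
theorem value_le_sum_candidates (hI : I.Valid) (hz : I.IsOptimalBasic z) {L : List (Selection n)}
    (hL : Candidates I z L) : I.value z ≤ (L.map I.profit).sum := by
  classical
  have hval := value_eq_integral_add_fractional (I := I) hz.1.1
  have hpos : ∀ v ∈ fractional z, I.p v.item * z v ≤ I.p v.item := by
    intro v hv
    obtain ⟨h0, h1⟩ := mem_fractional.1 hv
    have := profit_nonneg_of_pos hI hz.1.1 hz.2 h0
    nlinarith
  cases hL with
  | none h =>
    rw [h, Finset.sum_empty] at hval
    simp only [List.map_cons, List.map_nil, List.sum_cons, List.sum_nil, profit_plain,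
      profit_improved]
    linarith
  | one v h =>
    have := hpos v (by simp [h])
    rw [h, Finset.sum_singleton] at hval
    simp only [List.map_cons, List.map_nil, List.sum_cons, List.sum_nil, profit_plain,
      profit_improved, Finset.sum_singleton]
    linarith
  | two u v huv h hw =>
    have hu := hpos u (by simp [h])
    have hv := hpos v (by simp [h])
    rw [h, Finset.sum_pair huv] at hval
    obtain ⟨i, j, hij, rfl, rfl, hs⟩ := candidates_two hz.1 huv h
    have hj : j ∉ integralImproved z := by
      have : Sum.inr j ∈ fractional z := by simp [h]
      rw [mem_integralImproved]
      exact (mem_fractional.1 this).2.ne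
    have hdisj : Disjoint (integralImproved z) {j} := by simpa using hj
    simp only [CopyVar.item, Sum.elim_inr, id_eq] at *
    simp only [List.map_cons, List.map_nil, List.sum_cons, List.sum_nil, profit_plain,
      profit_improved, Finset.sum_singleton, Finset.sum_union hdisj]
    linarith

/-- Three profits sum to at most three times the largest. Without fractional variables there are
only two candidates, and since profits may be negative, the factor 3 then needs one candidate of
nonnegative profit. -/
theorem value_le_three_mul (hI : I.Valid) (hz : I.IsOptimalBasic z) {L : List (Selection n)}
    (hL : Candidates I z L) {S : Selection n} (hmax : ∀ T ∈ L, I.profit T ≤ I.profit S) :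
    I.value z ≤ 3 * I.profit S := by
  have hsum := value_le_sum_candidates hI hz hL
  cases hL with
  | none h =>
    have h1 := hmax _ (List.mem_cons_self ..)
    have h2 := hmax _ (List.mem_cons_of_mem _ (List.mem_cons_self ..))
    have h0 : 0 ≤ I.profit ⟨integralPlain z, ∅⟩ := by
      rw [profit_plain]
      refine Finset.sum_nonneg fun i hi => ?_
      have hi' := mem_integralPlain.1 hi
      exact profit_nonneg_of_pos (v := Sum.inl i) hI hz.1.1 hz.2 (by rw [hi']; norm_num)
    simp only [List.map_cons, List.map_nil, List.sum_cons, List.sum_nil] at hsum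
    linarith
  | one v h =>
    have h1 := hmax _ (List.mem_cons_self ..)
    have h2 := hmax _ (List.mem_cons_of_mem _ (List.mem_cons_self ..))
    have h3 := hmax _ (List.mem_cons_of_mem _ (List.mem_cons_of_mem _ (List.mem_cons_self ..)))
    simp only [List.map_cons, List.map_nil, List.sum_cons, List.sum_nil] at hsum
    linarith
  | two u v huv h hw =>
    have h1 := hmax _ (List.mem_cons_self ..)
    have h2 := hmax _ (List.mem_cons_of_mem _ (List.mem_cons_self ..))
    have h3 := hmax _ (List.mem_cons_of_mem _ (List.mem_cons_of_mem _ (List.mem_cons_self ..)))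
    simp only [List.map_cons, List.map_nil, List.sum_cons, List.sum_nil] at hsum
    linarith

end Candidates

/-! ### Reasoning about programs -/

section Programs

/-- A memory location: a register or a whole array. -/
inductive Loc where
  | I (r : ℕ)
  | R (r : ℕ)
  | IA (a : ℕ)
  | RA (a : ℕ)
  deriving DecidableEq

/-- The locations that a command may write, where calls may write the locations in `P`. -/
def Cmd.wr (P : List Loc) : Cmd → List Loc
  | .skip => []
  | .iset r _ => [.I r]
  | .rset r _ => [.R r]
  | .istore a _ _ => [.IA a]
  | .rstore a _ _ => [.RA a]
  | .seq c d => c.wr P ++ d.wr P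
  | .ite _ c d => c.wr P ++ d.wr P
  | .while _ c => c.wr P
  | .call _ => P

/-- Two memories agree outside a list of locations. -/
structure Frame (L : List Loc) (s s' : Memory) : Prop where
  ireg : ∀ r, Loc.I r ∉ L → s'.ireg r = s.ireg r
  rreg : ∀ r, Loc.R r ∉ L → s'.rreg r = s.rreg r
  iarr : ∀ a, Loc.IA a ∉ L → s'.iarr a = s.iarr a
  rarr : ∀ a, Loc.RA a ∉ L → s'.rarr a = s.rarr a

theorem Frame.refl (L : List Loc) (s : Memory) : Frame L s s :=
  ⟨fun _ _ => rfl, fun _ _ => rfl, fun _ _ => rfl, fun _ _ => rfl⟩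

theorem Frame.trans {L : List Loc} {s s' s'' : Memory} (h : Frame L s s') (h' : Frame L s' s'') :
    Frame L s s'' :=
  ⟨fun r hr => (h'.ireg r hr).trans (h.ireg r hr), fun r hr => (h'.rreg r hr).trans (h.rreg r hr),
    fun r hr => (h'.iarr r hr).trans (h.iarr r hr), fun r hr => (h'.rarr r hr).trans (h.rarr r hr)⟩

theorem Frame.mono {L L' : List Loc} {s s' : Memory} (h : Frame L s s') (hL : L ⊆ L') :
    Frame L' s s' :=
  ⟨fun r hr => h.ireg r fun hh => hr (hL hh), fun r hr => h.rreg r fun hh => hr (hL hh),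
    fun r hr => h.iarr r fun hh => hr (hL hh), fun r hr => h.rarr r fun hh => hr (hL hh)⟩

section MemoryLemmas

variable (s : Memory) (r v a i : ℕ) (x : ℝ)

@[simp] theorem iset_ireg (r' : ℕ) : (s.iset r v).ireg r' = if r' = r then v else s.ireg r' := by
  simp [Memory.iset, Function.update_apply]
@[simp] theorem iset_rreg : (s.iset r v).rreg = s.rreg := rfl
@[simp] theorem iset_iarr : (s.iset r v).iarr = s.iarr := rfl
@[simp] theorem iset_rarr : (s.iset r v).rarr = s.rarr := rfl
@[simp] theorem rset_ireg : (s.rset r x).ireg = s.ireg := rfl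
@[simp] theorem rset_rreg (r' : ℕ) : (s.rset r x).rreg r' = if r' = r then x else s.rreg r' := by
  simp [Memory.rset, Function.update_apply]
@[simp] theorem rset_iarr : (s.rset r x).iarr = s.iarr := rfl
@[simp] theorem rset_rarr : (s.rset r x).rarr = s.rarr := rfl
@[simp] theorem istore_ireg : (s.istore a i v).ireg = s.ireg := rfl
@[simp] theorem istore_rreg : (s.istore a i v).rreg = s.rreg := rfl
@[simp] theorem istore_iarr (a' : ℕ) : (s.istore a i v).iarr a'
    = if a' = a then Function.update (s.iarr a) i v else s.iarr a' := by
  simp [Memory.istore, Function.update_apply]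
@[simp] theorem istore_rarr : (s.istore a i v).rarr = s.rarr := rfl
@[simp] theorem rstore_ireg : (s.rstore a i x).ireg = s.ireg := rfl
@[simp] theorem rstore_rreg : (s.rstore a i x).rreg = s.rreg := rfl
@[simp] theorem rstore_iarr : (s.rstore a i x).iarr = s.iarr := rfl
@[simp] theorem rstore_rarr (a' : ℕ) : (s.rstore a i x).rarr a'
    = if a' = a then Function.update (s.rarr a) i x else s.rarr a' := by
  simp [Memory.rstore, Function.update_apply]

end MemoryLemmas

/-- A terminating command changes only the locations that it writes. -/
theorem Exec.frame {procs : List Cmd} {P : List Loc}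
    (hP : ∀ c ∈ procs, c.wr P ⊆ P) {c : Cmd} {s s' : Memory} {t : ℕ}
    (h : Exec procs c s t s') : Frame (c.wr P) s s' := by
  induction h with
  | skip s => exact Frame.refl _ _
  | iset r e s =>
    exact ⟨fun r' hr => by simp [Cmd.wr] at hr; simp [hr], fun _ _ => rfl, fun _ _ => rfl,
      fun _ _ => rfl⟩
  | rset r e s =>
    exact ⟨fun _ _ => rfl, fun r' hr => by simp [Cmd.wr] at hr; simp [hr], fun _ _ => rfl,
      fun _ _ => rfl⟩
  | istore a i e s =>
    exact ⟨fun _ _ => rfl, fun _ _ => rfl, fun r' hr => by simp [Cmd.wr] at hr; simp [hr],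
      fun _ _ => rfl⟩
  | rstore a i e s =>
    exact ⟨fun _ _ => rfl, fun _ _ => rfl, fun _ _ => rfl,
      fun r' hr => by simp [Cmd.wr] at hr; simp [hr]⟩
  | seq _ _ ih1 ih2 =>
    exact (ih1.mono (List.subset_append_left _ _)).trans (ih2.mono (List.subset_append_right _ _))
  | ite_true _ _ ih => exact ih.mono (List.subset_append_left _ _)
  | ite_false _ _ ih => exact ih.mono (List.subset_append_right _ _)
  | while_true _ _ _ ih1 ih2 => exact ih1.trans ih2
  | while_false _ => exact Frame.refl _ _
  | call hf _ ih => exact ih.mono (hP _ (List.mem_of_getElem? hf))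

/-- Commands without loops and calls. -/
def Cmd.straight : Cmd → Bool
  | .seq c d => c.straight && d.straight
  | .ite _ c d => c.straight && d.straight
  | .while _ _ => false
  | .call _ => false
  | _ => true

open Classical in
/-- The effect of a command without loops and calls. -/
noncomputable def Cmd.run : Cmd → Memory → Memory
  | .skip, s => s
  | .iset r e, s => s.iset r (e.eval s)
  | .rset r e, s => s.rset r (e.eval s)
  | .istore a i e, s => s.istore a (i.eval s) (e.eval s)
  | .rstore a i e, s => s.rstore a (i.eval s) (e.eval s)
  | .seq c d, s => d.run (c.run s)
  | .ite b c d, s => if b.Holds s then c.run s else d.run s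
  | .while _ _, s => s
  | .call _, s => s

/-- A bound on the number of steps of a command without loops and calls. -/
def Cmd.cost : Cmd → ℕ
  | .skip => 1
  | .iset _ e => 1 + e.cost
  | .rset _ e => 1 + e.cost
  | .istore _ i e => 1 + i.cost + e.cost
  | .rstore _ i e => 1 + i.cost + e.cost
  | .seq c d => c.cost + d.cost
  | .ite b c d => 1 + b.cost + (c.cost + d.cost)
  | .while _ _ => 0
  | .call _ => 0

theorem exec_run (procs : List Cmd) {c : Cmd} (hc : c.straight = true) (s : Memory) :
    ∃ t, t ≤ c.cost ∧ Exec procs c s t (c.run s) := by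
  classical
  induction c generalizing s with
  | skip => exact ⟨1, le_rfl, .skip s⟩
  | iset r e => exact ⟨_, le_rfl, .iset r e s⟩
  | rset r e => exact ⟨_, le_rfl, .rset r e s⟩
  | istore a i e => exact ⟨_, le_rfl, .istore a i e s⟩
  | rstore a i e => exact ⟨_, le_rfl, .rstore a i e s⟩
  | seq c d ihc ihd =>
    simp only [Cmd.straight, Bool.and_eq_true] at hc
    obtain ⟨t, ht, h⟩ := ihc hc.1 s
    obtain ⟨t', ht', h'⟩ := ihd hc.2 (c.run s)
    exact ⟨t + t', add_le_add ht ht', h.seq h'⟩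
  | ite b c d ihc ihd =>
    simp only [Cmd.straight, Bool.and_eq_true] at hc
    obtain ⟨t, ht, h⟩ := ihc hc.1 s
    obtain ⟨t', ht', h'⟩ := ihd hc.2 s
    by_cases hb : b.Holds s
    · refine ⟨1 + b.cost + t, ?_, ?_⟩
      · simp only [Cmd.cost]; omega
      · simp only [Cmd.run, if_pos hb]; exact .ite_true hb h
    · refine ⟨1 + b.cost + t', ?_, ?_⟩
      · simp only [Cmd.cost]; omega
      · simp only [Cmd.run, if_neg hb]; exact .ite_false hb h'
  | _ => simp [Cmd.straight] at hc

theorem run_frame {c : Cmd} (hc : c.straight = true) (s : Memory) : Frame (c.wr []) s (c.run s) := by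
  obtain ⟨t, _, h⟩ := exec_run [] hc s
  exact h.frame (P := []) (by simp)

/-- The weakest precondition of a command without loops and calls. -/
def Cmd.wp : Cmd → (Memory → Prop) → Memory → Prop
  | .skip, Q, s => Q s
  | .iset r e, Q, s => Q (s.iset r (e.eval s))
  | .rset r e, Q, s => Q (s.rset r (e.eval s))
  | .istore a i e, Q, s => Q (s.istore a (i.eval s) (e.eval s))
  | .rstore a i e, Q, s => Q (s.rstore a (i.eval s) (e.eval s))
  | .seq c d, Q, s => c.wp (d.wp Q) s
  | .ite b c d, Q, s => (b.Holds s → c.wp Q s) ∧ (¬ b.Holds s → d.wp Q s)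
  | .while _ _, Q, s => Q s
  | .call _, Q, s => Q s

theorem run_of_wp {c : Cmd} {Q : Memory → Prop} {s : Memory} (h : c.wp Q s) : Q (c.run s) := by
  induction c generalizing s Q with
  | seq c d ihc ihd => exact ihd (ihc h)
  | ite b c d ihc ihd =>
    by_cases hb : b.Holds s
    · simp only [Cmd.run, if_pos hb]; exact ihc (h.1 hb)
    · simp only [Cmd.run, if_neg hb]; exact ihd (h.2 hb)
  | _ => exact h

theorem wp_of_run {c : Cmd} {Q : Memory → Prop} {s : Memory} (hs : c.straight = true)
    (h : Q (c.run s)) : c.wp Q s := by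
  induction c generalizing s Q with
  | seq c d ihc ihd =>
    simp only [Cmd.straight, Bool.and_eq_true] at hs
    exact ihc hs.1 (ihd hs.2 h)
  | ite b c d ihc ihd =>
    simp only [Cmd.straight, Bool.and_eq_true] at hs
    exact ⟨fun hb => ihc hs.1 (by simpa only [Cmd.run, if_pos hb] using h),
      fun hb => ihd hs.2 (by simpa only [Cmd.run, if_neg hb] using h)⟩
  | _ => exact h

/-- Straight-line commands. -/
theorem exec_straight (procs : List Cmd) {c : Cmd} (hc : c.straight = true) {s : Memory}
    {Q : Memory → Prop} (h : c.wp Q s) : ∃ t s', Exec procs c s t s' ∧ t ≤ c.cost ∧ Q s' := by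
  obtain ⟨t, ht, he⟩ := exec_run procs hc s
  exact ⟨t, _, he, ht, run_of_wp h⟩

/-- Loops with a straight-line body whose number of iterations is known. -/
theorem exec_while (procs : List Cmd) {b : BExp} {c : Cmd} (hc : c.straight = true) (K : ℕ)
    (Inv : ℕ → Memory → Prop) {s : Memory} (h0 : Inv 0 s)
    (hstep : ∀ j s', j < K → Inv j s' → b.Holds s' ∧ c.wp (Inv (j + 1)) s')
    (hend : ∀ s', Inv K s' → ¬ b.Holds s') :
    ∃ t s', Exec procs (.while b c) s t s' ∧ t ≤ (K + 1) * (1 + b.cost + c.cost) ∧ Inv K s' := by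
  -- Induction on the number `k` of iterations that remain.
  suffices H : ∀ k ≤ K, ∀ s, Inv (K - k) s → ∃ t s', Exec procs (.while b c) s t s' ∧
      t ≤ (k + 1) * (1 + b.cost + c.cost) ∧ Inv K s' by
    exact H K le_rfl s (by simpa using h0)
  intro k
  induction k with
  | zero =>
    intro _ s hs
    exact ⟨_, s, .while_false (hend s (by simpa using hs)), by omega, by simpa using hs⟩
  | succ k ih =>
    intro hk s hs
    obtain ⟨hb, hinv⟩ := hstep (K - (k + 1)) s (by omega) hs
    replace hinv := run_of_wp hinv
    rw [show K - (k + 1) + 1 = K - k by omega] at hinv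
    obtain ⟨t, ht, hex⟩ := exec_run procs hc s
    obtain ⟨t', s', hex', ht', hi⟩ := ih (by omega) _ hinv
    refine ⟨_, s', .while_true hb hex hex', ?_, hi⟩
    calc 1 + b.cost + t + t' ≤ (1 + b.cost + c.cost) + (k + 1) * (1 + b.cost + c.cost) := by omega
      _ = _ := by ring

/-- The loop `for i := 0, …, m - 1 do c`, where `i` and `m` are index registers. -/
def Cmd.forLoop (i m : ℕ) (c : Cmd) : Cmd :=
  .seq (.iset i (.const 0))
    (.while (.not (.ile (.reg m) (.reg i))) (.seq c (.iset i (.add (.reg i) (.const 1)))))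

/-- The rule for counting loops; the invariant may rely on the locations that the body does not
write. -/
theorem exec_forLoop (procs : List Cmd) {i m : ℕ} {c : Cmd} (hc : c.straight = true)
    (hi : Loc.I i ∉ c.wr []) (hm : Loc.I m ∉ c.wr []) (him : m ≠ i) {s : Memory} {N : ℕ}
    (hN : s.ireg m = N)
    (Inv : ℕ → Memory → Prop) (h0 : Inv 0 (s.iset i 0))
    (hstep : ∀ j s', j < N → s'.ireg i = j → Frame (.I i :: c.wr []) s s' → Inv j s' →
      c.wp (fun s'' => Inv (j + 1) (s''.iset i (j + 1))) s') :
    ∃ t s', Exec procs (.forLoop i m c) s t s' ∧ t ≤ (N + 2) * (10 + c.cost) ∧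
      Inv N s' ∧ Frame (.I i :: c.wr []) s s' := by
  have hframe : ∀ s', Frame (.I i :: c.wr []) s' ((c.run s').iset i (s'.ireg i + 1)) := by
    intro s'
    have h := run_frame hc s'
    exact ⟨fun r hr => by
        simp only [List.mem_cons, Loc.I.injEq, not_or] at hr
        simp [hr.1, h.ireg r hr.2],
      fun r hr => h.rreg r (by simpa using hr), fun r hr => h.iarr r (by simpa using hr),
      fun r hr => h.rarr r (by simpa using hr)⟩
  have hrun : ∀ s', (Cmd.seq c (.iset i (.add (.reg i) (.const 1)))).run s'
      = (c.run s').iset i (s'.ireg i + 1) := by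
    intro s'
    simp only [Cmd.run, IExp.eval]
    rw [(run_frame hc s').ireg i hi]
  have hfm : ∀ s', Frame (.I i :: c.wr []) s s' → s'.ireg m = N := by
    intro s' hf
    rw [hf.ireg m (by simp [hm, him]), hN]
  obtain ⟨t, s', hex, ht, hinv⟩ := exec_while procs
    (b := .not (.ile (.reg m) (.reg i))) (c := .seq c (.iset i (.add (.reg i) (.const 1))))
    (by simp [Cmd.straight, hc]) N
    (fun j s' => Inv j s' ∧ s'.ireg i = j ∧ Frame (.I i :: c.wr []) s s')
    (s := s.iset i 0)
    ⟨h0, by simp, ⟨fun r hr => by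
      simp only [List.mem_cons, Loc.I.injEq, not_or] at hr; simp [hr.1], fun _ _ => rfl,
      fun _ _ => rfl, fun _ _ => rfl⟩⟩
    (by
      rintro j s' hj ⟨h1, h2, h3⟩
      refine ⟨?_, ?_⟩
      · simp only [BExp.Holds, IExp.eval, hfm s' h3, h2]; omega
      · apply wp_of_run (by simp [Cmd.straight, hc])
        rw [hrun, h2]
        refine ⟨run_of_wp (hstep j s' hj h2 h3 h1), by simp, ?_⟩
        have := hframe s'
        rw [h2] at this
        exact h3.trans this)
    (by
      rintro s' ⟨h1, h2, h3⟩
      simp only [BExp.Holds, IExp.eval, hfm s' h3, h2]; omega)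
  refine ⟨_, s', .seq (.iset i _ s) hex, ?_, hinv.1, hinv.2.2⟩
  simp only [IExp.cost, BExp.cost, Cmd.cost] at ht ⊢
  nlinarith

end Programs

infixr:70 " ;; " => Cmd.seq

/-! ### Weighted selection -/

section Selection

/-- The median of three numbers. -/
noncomputable def med3 (a b c : ℝ) : ℝ :=
  if a ≤ b then if b ≤ c then b else if a ≤ c then c else a
  else if a ≤ c then a else if b ≤ c then c else b

/-- A threshold that is at least the median is at least two of the three elements. This factor of
two is what makes medians of triples useful pivots. -/
theorem two_mul_le_med3_le (a b c t : ℝ) :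
    2 * (if med3 a b c ≤ t then (1 : ℝ) else 0)
      ≤ (if a ≤ t then 1 else 0) + (if b ≤ t then 1 else 0) + (if c ≤ t then 1 else 0) := by
  unfold med3
  split_ifs <;> first | (exfalso; linarith) | norm_num

theorem two_mul_ge_med3_le (a b c t : ℝ) :
    2 * (if t ≤ med3 a b c then (1 : ℝ) else 0)
      ≤ (if t ≤ a then 1 else 0) + (if t ≤ b then 1 else 0) + (if t ≤ c then 1 else 0) := by
  unfold med3
  split_ifs <;> first | (exfalso; linarith) | norm_num

/-- The at most two elements beyond the last full triple are dropped, which only loses nonnegative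
terms. -/
theorem sum_range_div_three_le (f : ℕ → ℝ) (hf : ∀ j, 0 ≤ f j) (m : ℕ) :
    ∑ i ∈ Finset.range (m / 3), (f (3 * i) + f (3 * i + 1) + f (3 * i + 2))
      ≤ ∑ j ∈ Finset.range m, f j := by
  have h : ∀ K, ∑ i ∈ Finset.range K, (f (3 * i) + f (3 * i + 1) + f (3 * i + 2))
      = ∑ j ∈ Finset.range (3 * K), f j := by
    intro K
    induction K with
    | zero => simp
    | succ K ih =>
      rw [Finset.sum_range_succ, ih, show 3 * (K + 1) = 3 * K + 1 + 1 + 1 by ring,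
        Finset.sum_range_succ, Finset.sum_range_succ, Finset.sum_range_succ]
      ring
  rw [h]
  exact Finset.sum_le_sum_of_subset_of_nonneg
    (Finset.range_subset_range.2 (by omega)) fun j _ _ => hf j

/-- Groups of three elements, of which the median is written to index `cnt` of the target. -/
def compressBody : Cmd :=
  .rset 5 (.get 3 (.add (.reg 6) (.reg 21))) ;;
  .rset 6 (.get 3 (.add (.add (.reg 6) (.reg 21)) (.const 1))) ;;
  .rset 7 (.get 3 (.add (.add (.reg 6) (.reg 21)) (.const 2))) ;;
  .ite (.rle (.reg 5) (.reg 6))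
    (.ite (.rle (.reg 6) (.reg 7)) (.rset 8 (.reg 6))
      (.ite (.rle (.reg 5) (.reg 7)) (.rset 8 (.reg 7)) (.rset 8 (.reg 5))))
    (.ite (.rle (.reg 5) (.reg 7)) (.rset 8 (.reg 5))
      (.ite (.rle (.reg 6) (.reg 7)) (.rset 8 (.reg 7)) (.rset 8 (.reg 6)))) ;;
  .rstore 3 (.add (.reg 7) (.reg 20)) (.reg 8) ;;
  .rstore 4 (.add (.reg 7) (.reg 20)) (.const 1) ;;
  .iset 20 (.add (.reg 20) (.const 1)) ;;
  .iset 21 (.add (.reg 21) (.const 3))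

/-- Write the medians of consecutive triples of the segment at index register `6` of length in
index register `5` to the address in index register `7`, with weights one, and count them in
index register `20`. -/
def compress : Cmd :=
  .iset 20 (.const 0) ;; .iset 21 (.const 0) ;;
  .while (.ile (.add (.reg 21) (.const 3)) (.reg 5)) compressBody

/-- The target starts beyond the source segment, so no triple is overwritten before it is read. -/
theorem compress_spec (procs : List Cmd) (s : Memory) (hsd : s.ireg 6 + s.ireg 5 ≤ s.ireg 7) :
    ∃ t s', Exec procs compress s t s' ∧ t ≤ (s.ireg 5 + 2) * 200 ∧
      s'.ireg 20 = s.ireg 5 / 3 ∧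
      (∀ i < s.ireg 5 / 3, s'.rarr 4 (s.ireg 7 + i) = 1 ∧
        s'.rarr 3 (s.ireg 7 + i) = med3 (s.rarr 3 (s.ireg 6 + 3 * i))
          (s.rarr 3 (s.ireg 6 + 3 * i + 1)) (s.rarr 3 (s.ireg 6 + 3 * i + 2))) ∧
      (∀ i < s.ireg 7, s'.rarr 3 i = s.rarr 3 i ∧ s'.rarr 4 i = s.rarr 4 i) := by
  obtain ⟨t, s', hex, ht, hinv⟩ := exec_while procs
    (b := .ile (.add (.reg 21) (.const 3)) (.reg 5)) (c := compressBody) rfl (s.ireg 5 / 3)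
    (fun j s' => s'.ireg 20 = j ∧ s'.ireg 21 = 3 * j ∧ s'.ireg 5 = s.ireg 5 ∧
      s'.ireg 6 = s.ireg 6 ∧ s'.ireg 7 = s.ireg 7 ∧
      (∀ i < j, s'.rarr 4 (s.ireg 7 + i) = 1 ∧
        s'.rarr 3 (s.ireg 7 + i) = med3 (s.rarr 3 (s.ireg 6 + 3 * i))
          (s.rarr 3 (s.ireg 6 + 3 * i + 1)) (s.rarr 3 (s.ireg 6 + 3 * i + 2))) ∧
      (∀ i < s.ireg 7, s'.rarr 3 i = s.rarr 3 i ∧ s'.rarr 4 i = s.rarr 4 i))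
    (s := (s.iset 20 0).iset 21 0) (by simp)
    (by
      rintro j s1 hj ⟨h1, h2, h3, h4, h5, h6, h7⟩
      refine ⟨by simp only [BExp.Holds, IExp.eval, h2, h3]; omega, ?_⟩
      have e0 := (h7 (s.ireg 6 + 3 * j) (by omega)).1
      have e1 := (h7 (s.ireg 6 + 3 * j + 1) (by omega)).1
      have e2 := (h7 (s.ireg 6 + 3 * j + 2) (by omega)).1
      have hfin : ∀ x : ℝ, x = med3 (s.rarr 3 (s.ireg 6 + 3 * j))
          (s.rarr 3 (s.ireg 6 + 3 * j + 1)) (s.rarr 3 (s.ireg 6 + 3 * j + 2)) →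
          (∀ i ≤ j, Function.update (s1.rarr 4) (s.ireg 7 + j) 1 (s.ireg 7 + i) = 1 ∧
            Function.update (s1.rarr 3) (s.ireg 7 + j) x (s.ireg 7 + i)
              = med3 (s.rarr 3 (s.ireg 6 + 3 * i)) (s.rarr 3 (s.ireg 6 + 3 * i + 1))
                (s.rarr 3 (s.ireg 6 + 3 * i + 2))) ∧
          (∀ i < s.ireg 7, Function.update (s1.rarr 3) (s.ireg 7 + j) x i = s.rarr 3 i ∧
            Function.update (s1.rarr 4) (s.ireg 7 + j) 1 i = s.rarr 4 i) := by
        rintro x rfl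
        constructor
        · intro i hi
          rcases hi.lt_or_eq with hi | rfl
          · obtain ⟨h6a, h6b⟩ := h6 i hi
            simp [hi.ne, h6a, h6b]
          · simp
        · intro i hi
          have hne : i ≠ s.ireg 7 + j := by omega
          simp [hne, h7 i hi]
      simp only [compressBody, Cmd.wp, IExp.eval, RExp.eval, BExp.Holds]
      simp [h1, h2, h3, h4, h5, e0, e1, e2, mul_add]
      refine ⟨fun ha => ⟨fun hb => hfin _ ?_, fun hb => ⟨fun hc => hfin _ ?_,
        fun hc => hfin _ ?_⟩⟩, fun ha => ⟨fun hb => hfin _ ?_, fun hb => ⟨fun hc => hfin _ ?_,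
        fun hc => hfin _ ?_⟩⟩⟩
      all_goals simp_all [med3, not_le.2])
    (by
      rintro s1 ⟨h1, h2, h3, -⟩
      simp only [BExp.Holds, IExp.eval, h2, h3]; omega)
  refine ⟨_, s', (Exec.iset 20 _ s).seq ((Exec.iset 21 _ _).seq hex), ?_, hinv.1,
    hinv.2.2.2.2.2.1, hinv.2.2.2.2.2.2⟩
  have hc : 1 + BExp.cost (.ile (.add (.reg 21) (.const 3)) (.reg 5)) + compressBody.cost ≤ 150 := by
    decide
  have : t ≤ (s.ireg 5 / 3 + 1) * 150 := ht.trans (Nat.mul_le_mul_left _ hc)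
  simp only [IExp.cost]
  omega

/-- The weights of the elements above the pivot, and of those not below it. -/
def partitionSums : Cmd :=
  .rset 3 (.const 0) ;; .rset 4 (.const 0) ;;
  .forLoop 4 3
    (.rset 5 (.get 3 (.add (.reg 2) (.reg 4))) ;; .rset 6 (.get 4 (.add (.reg 2) (.reg 4))) ;;
      .ite (.not (.rle (.reg 5) (.reg 2))) (.rset 3 (.add (.reg 3) (.reg 6))) .skip ;;
      .ite (.rle (.reg 2) (.reg 5)) (.rset 4 (.add (.reg 4) (.reg 6))) .skip)

theorem partitionSums_spec (procs : List Cmd) (s : Memory) :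
    ∃ t s', Exec procs partitionSums s t s' ∧ t ≤ (s.ireg 3 + 2) * 100 ∧
      s'.rreg 3 = ∑ j ∈ Finset.range (s.ireg 3),
        (if s.rreg 2 < s.rarr 3 (s.ireg 2 + j) then s.rarr 4 (s.ireg 2 + j) else 0) ∧
      s'.rreg 4 = ∑ j ∈ Finset.range (s.ireg 3),
        (if s.rreg 2 ≤ s.rarr 3 (s.ireg 2 + j) then s.rarr 4 (s.ireg 2 + j) else 0) := by
  obtain ⟨t, s', hex, ht, ⟨h3, h4⟩, -⟩ := exec_forLoop procs (i := 4) (m := 3)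
    (c := .rset 5 (.get 3 (.add (.reg 2) (.reg 4))) ;; .rset 6 (.get 4 (.add (.reg 2) (.reg 4))) ;;
      .ite (.not (.rle (.reg 5) (.reg 2))) (.rset 3 (.add (.reg 3) (.reg 6))) .skip ;;
      .ite (.rle (.reg 2) (.reg 5)) (.rset 4 (.add (.reg 4) (.reg 6))) .skip)
    rfl (by decide) (by decide) (by decide) (s := (s.rset 3 0).rset 4 0) (N := s.ireg 3) (by simp)
    (fun k s' => s'.rreg 3 = ∑ j ∈ Finset.range k,
        (if s.rreg 2 < s.rarr 3 (s.ireg 2 + j) then s.rarr 4 (s.ireg 2 + j) else 0) ∧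
      s'.rreg 4 = ∑ j ∈ Finset.range k,
        (if s.rreg 2 ≤ s.rarr 3 (s.ireg 2 + j) then s.rarr 4 (s.ireg 2 + j) else 0))
    (by simp)
    (by
      rintro j s1 hj hi hf ⟨h3, h4⟩
      have e2 : s1.ireg 2 = s.ireg 2 := hf.ireg 2 (by decide)
      have er : s1.rreg 2 = s.rreg 2 := (hf.rreg 2 (by decide)).trans (by simp)
      have e3 : s1.rarr 3 = s.rarr 3 := hf.rarr 3 (by decide)
      have e4 : s1.rarr 4 = s.rarr 4 := hf.rarr 4 (by decide)
      simp only [Cmd.wp, IExp.eval, RExp.eval, BExp.Holds]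
      simp only [iset_rreg, rset_rreg, rset_ireg, rset_rarr, Finset.sum_range_succ, hi, h3, h4, e2,
        er, e3, e4]
      norm_num
      refine ⟨fun h1 => ⟨fun h2 => ?_, fun h2 => ?_⟩, fun h1 => ⟨fun h2 => ?_, fun h2 => ?_⟩⟩ <;>
        simp_all [not_lt.2, not_le.2])
  refine ⟨_, s', (Exec.rset 3 _ s).seq ((Exec.rset 4 _ _).seq (by simpa [RExp.eval] using hex)),
    ?_, h3, h4⟩
  refine (add_le_add_right (add_le_add_right ht _) _).trans ?_
  simp only [RExp.cost, Cmd.cost, IExp.cost, BExp.cost]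
  omega

/-- Keep the elements above the pivot (for the sign `1`) or below it (for the sign `-1`). -/
def keepSide : Cmd :=
  .iset 5 (.const 0) ;;
  .forLoop 4 3
    (.rset 5 (.get 3 (.add (.reg 2) (.reg 4))) ;; .rset 6 (.get 4 (.add (.reg 2) (.reg 4))) ;;
      .ite (.not (.rle (.mul (.reg 9) (.sub (.reg 5) (.reg 2))) (.const 0)))
        (.rstore 3 (.add (.reg 2) (.reg 5)) (.reg 5) ;; .rstore 4 (.add (.reg 2) (.reg 5)) (.reg 6) ;;
          .iset 5 (.add (.reg 5) (.const 1))) .skip)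

/-- Quantifying over all `φ` expresses equality of multisets of element-weight pairs: constants give
the length, the second coordinate gives the total weight, and indicators give properties of the
elements. Compaction in place is safe because the write position never overtakes the read position.
-/
theorem keepSide_spec (procs : List Cmd) (s : Memory) :
    ∃ t s', Exec procs keepSide s t s' ∧ t ≤ (s.ireg 3 + 2) * 100 ∧
      (∀ i < s.ireg 2, s'.rarr 3 i = s.rarr 3 i ∧ s'.rarr 4 i = s.rarr 4 i) ∧
      ∀ φ : ℝ → ℝ → ℝ,
        ∑ i ∈ Finset.range (s'.ireg 5), φ (s'.rarr 3 (s.ireg 2 + i)) (s'.rarr 4 (s.ireg 2 + i))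
          = ∑ j ∈ Finset.range (s.ireg 3),
            if 0 < s.rreg 9 * (s.rarr 3 (s.ireg 2 + j) - s.rreg 2) then
              φ (s.rarr 3 (s.ireg 2 + j)) (s.rarr 4 (s.ireg 2 + j)) else 0 := by
  obtain ⟨t, s', hex, ht, ⟨-, -, h3, h4⟩, -⟩ := exec_forLoop procs (i := 4) (m := 3)
    (c := .rset 5 (.get 3 (.add (.reg 2) (.reg 4))) ;; .rset 6 (.get 4 (.add (.reg 2) (.reg 4))) ;;
      .ite (.not (.rle (.mul (.reg 9) (.sub (.reg 5) (.reg 2))) (.const 0)))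
        (.rstore 3 (.add (.reg 2) (.reg 5)) (.reg 5) ;; .rstore 4 (.add (.reg 2) (.reg 5)) (.reg 6) ;;
          .iset 5 (.add (.reg 5) (.const 1))) .skip)
    rfl (by decide) (by decide) (by decide) (s := s.iset 5 0) (N := s.ireg 3) (by simp)
    (fun k s' => s'.ireg 5 ≤ k ∧
      (∀ i, k ≤ i → s'.rarr 3 (s.ireg 2 + i) = s.rarr 3 (s.ireg 2 + i) ∧
        s'.rarr 4 (s.ireg 2 + i) = s.rarr 4 (s.ireg 2 + i)) ∧
      (∀ i < s.ireg 2, s'.rarr 3 i = s.rarr 3 i ∧ s'.rarr 4 i = s.rarr 4 i) ∧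
      ∀ φ : ℝ → ℝ → ℝ,
        ∑ i ∈ Finset.range (s'.ireg 5), φ (s'.rarr 3 (s.ireg 2 + i)) (s'.rarr 4 (s.ireg 2 + i))
          = ∑ j ∈ Finset.range k,
            if 0 < s.rreg 9 * (s.rarr 3 (s.ireg 2 + j) - s.rreg 2) then
              φ (s.rarr 3 (s.ireg 2 + j)) (s.rarr 4 (s.ireg 2 + j)) else 0)
    (by simp)
    (by
      rintro j s1 hj hi hf ⟨h1, h2, h3, h4⟩
      have e2 : s1.ireg 2 = s.ireg 2 := hf.ireg 2 (by decide)
      have er : s1.rreg 2 = s.rreg 2 := (hf.rreg 2 (by decide)).trans (by simp)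
      have e9 : s1.rreg 9 = s.rreg 9 := (hf.rreg 9 (by decide)).trans (by simp)
      simp only [Cmd.wp, IExp.eval, RExp.eval, BExp.Holds]
      simp [hi, e2, er, e9, (h2 j le_rfl).1, (h2 j le_rfl).2]
      refine ⟨fun hb => ⟨h1, ?_, ?_, ?_⟩, fun hb => ⟨by omega, ?_, h3, ?_⟩⟩
      · intro i hi
        have : i ≠ s1.ireg 5 := by omega
        simp [this, h2 i (by omega)]
      · intro i hi
        have : i ≠ s.ireg 2 + s1.ireg 5 := by omega
        simp [this, h3 i hi]
      · intro φ
        rw [Finset.sum_range_succ, Finset.sum_range_succ, ← h4 φ, if_pos hb]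
        congr 1
        · refine Finset.sum_congr rfl fun i hi => ?_
          have : i ≠ s1.ireg 5 := (Finset.mem_range.1 hi).ne
          simp [this]
        · simp
      · exact fun i hi => h2 i (by omega)
      · intro φ
        rw [h4 φ, Finset.sum_range_succ, if_neg (not_lt.2 hb), add_zero])
  refine ⟨_, s', (Exec.iset 5 _ s).seq (by simpa [IExp.eval] using hex), ?_, h3, h4⟩
  refine (add_le_add_right ht _).trans ?_
  simp only [RExp.cost, Cmd.cost, IExp.cost, BExp.cost]
  omega


end Selection

/-! ### Linear-time selection with medians of medians as pivots -/

section Selection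

/-- Going back from the medians to the elements doubles the guaranteed count on either side of a
threshold, while the length triples. -/
theorem count_med3 {A A' : ℕ → ℝ} {m : ℕ}
    (h : ∀ i < m / 3, A' i = med3 (A (3 * i)) (A (3 * i + 1)) (A (3 * i + 2))) (t : ℝ) :
    2 * ∑ i ∈ Finset.range (m / 3), (if A' i ≤ t then (1 : ℝ) else 0)
        ≤ ∑ j ∈ Finset.range m, (if A j ≤ t then (1 : ℝ) else 0) ∧
      2 * ∑ i ∈ Finset.range (m / 3), (if t ≤ A' i then (1 : ℝ) else 0)
        ≤ ∑ j ∈ Finset.range m, (if t ≤ A j then (1 : ℝ) else 0) := by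
  constructor
  · refine le_trans ?_ (sum_range_div_three_le _ (fun j => by split_ifs <;> norm_num) m)
    rw [Finset.mul_sum]
    refine Finset.sum_le_sum fun i hi => ?_
    rw [h i (Finset.mem_range.1 hi)]
    exact two_mul_le_med3_le _ _ _ _
  · refine le_trans ?_ (sum_range_div_three_le _ (fun j => by split_ifs <;> norm_num) m)
    rw [Finset.mul_sum]
    refine Finset.sum_le_sum fun i hi => ?_
    rw [h i (Finset.mem_range.1 hi)]
    exact two_mul_ge_med3_le _ _ _ _

/-- Choose a pivot: an element of the segment in small cases, and otherwise the median of the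
medians of medians, found by a recursive call. -/
def choosePivot : Cmd :=
  (.iset 6 (.reg 2) ;; .iset 5 (.reg 3) ;; .iset 7 (.add (.reg 2) (.reg 3))) ;; compress ;;
  (.iset 6 (.reg 7) ;; .iset 5 (.reg 20) ;; .iset 7 (.add (.reg 6) (.reg 5))) ;; compress ;;
  .ite (.ile (.reg 20) (.const 0)) (.rset 2 (.get 3 (.reg 2)))
    ((.istore 2 (.sub (.reg 7) (.const 1)) (.reg 2) ;;
      .istore 3 (.sub (.reg 7) (.const 1)) (.reg 3) ;;
      .rstore 5 (.sub (.reg 7) (.const 1)) (.reg 1) ;;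
      .iset 2 (.reg 7) ;; .iset 3 (.reg 20) ;; .rset 1 (.div (.cast (.reg 20)) (.const 2))) ;;
      .call 0 ;;
      (.iset 3 (.get 3 (.sub (.reg 2) (.const 1))) ;;
        .rset 1 (.get 5 (.sub (.reg 2) (.const 1))) ;;
        .iset 2 (.get 2 (.sub (.reg 2) (.const 1)))))

/-- Weighted selection: for the segment of length in index register `3` at the address in index
register `2`, with elements in array `3` and weights in array `4`, find a threshold such that the
weight above it is at most the number in register `1`, and the weight not below it is at least
that. -/
def select : Cmd :=
  .ite (.ile (.reg 3) (.const 0)) (.rset 2 (.const 0))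
    (choosePivot ;; partitionSums ;;
      .ite (.not (.rle (.reg 3) (.reg 1)))
        (.rset 9 (.const 1) ;; keepSide ;; .iset 3 (.reg 5) ;; .call 0)
        (.ite (.not (.rle (.reg 1) (.reg 4)))
          ((.rset 1 (.sub (.reg 1) (.reg 4)) ;; .rset 9 (.const (-1))) ;; keepSide ;;
            .iset 3 (.reg 5) ;; .call 0)
          .skip))

/-- The locations that selection may write. -/
def selectWr : List Loc :=
  [.I 2, .I 3, .I 4, .I 5, .I 6, .I 7, .I 20, .I 21, .R 1, .R 2, .R 3, .R 4, .R 5, .R 6, .R 7,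
    .R 8, .R 9, .IA 2, .IA 3, .RA 3, .RA 4, .RA 5]

-- The frame rule for recursive calls needs a list of locations that is closed under the procedure
-- body, with its own calls included.
set_option maxRecDepth 8000 in
theorem select_wr : ∀ c ∈ [select], c.wr selectWr ⊆ selectWr := by
  intro c hc
  rw [List.mem_singleton] at hc
  subst hc
  decide

/-- The specification of selection on segments of length `m`. -/
def SelectSpec (K D m : ℕ) : Prop :=
  ∀ s : Memory, s.ireg 3 = m → (∀ j < m, 0 ≤ s.rarr 4 (s.ireg 2 + j)) → 0 ≤ s.rreg 1 →
    s.rreg 1 ≤ ∑ j ∈ Finset.range m, s.rarr 4 (s.ireg 2 + j) →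
    ∃ t s', Exec [select] (.call 0) s t s' ∧ t ≤ K * m + D ∧ s'.ireg 2 = s.ireg 2 ∧
      (∀ i < s.ireg 2, s'.rarr 3 i = s.rarr 3 i ∧ s'.rarr 4 i = s.rarr 4 i ∧
        s'.rarr 5 i = s.rarr 5 i ∧ s'.iarr 2 i = s.iarr 2 i ∧ s'.iarr 3 i = s.iarr 3 i) ∧
      ∑ j ∈ Finset.range m,
        (if s'.rreg 2 < s.rarr 3 (s.ireg 2 + j) then s.rarr 4 (s.ireg 2 + j) else 0)
        ≤ s.rreg 1 ∧
      s.rreg 1 ≤ ∑ j ∈ Finset.range m,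
        (if s'.rreg 2 ≤ s.rarr 3 (s.ireg 2 + j) then s.rarr 4 (s.ireg 2 + j) else 0)

-- At least half of the `m / 9` second-level medians lie on either side of the pivot, ties included,
-- and two rounds of triples multiply this by four, so `2 * (m / 9)` elements lie on either side.
-- One round would not suffice: recursing on a third in order to discard a third leaves the total
-- size at `m`, whereas here the sizes add up to `m - m / 9`.
set_option maxHeartbeats 1000000 in
theorem choosePivot_spec {K D m : ℕ} (hm : 0 < m) (ih : 0 < m / 9 → SelectSpec K D (m / 9))
    (s : Memory) (h3 : s.ireg 3 = m) :
    ∃ t s', Exec [select] choosePivot s t s' ∧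
      t ≤ (if m / 9 = 0 then 0 else K * (m / 9) + D) + (m + 2) * 700 ∧
      s'.ireg 2 = s.ireg 2 ∧ s'.ireg 3 = m ∧ s'.rreg 1 = s.rreg 1 ∧
      (∀ i < s.ireg 2 + m, s'.rarr 3 i = s.rarr 3 i ∧ s'.rarr 4 i = s.rarr 4 i) ∧
      (∀ i < s.ireg 2, s'.rarr 5 i = s.rarr 5 i ∧ s'.iarr 2 i = s.iarr 2 i ∧
        s'.iarr 3 i = s.iarr 3 i) ∧
      ((max 1 (2 * (m / 9)) : ℕ) : ℝ) ≤ ∑ j ∈ Finset.range m,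
        (if s.rarr 3 (s.ireg 2 + j) ≤ s'.rreg 2 then (1 : ℝ) else 0) ∧
      ((max 1 (2 * (m / 9)) : ℕ) : ℝ) ≤ ∑ j ∈ Finset.range m,
        (if s'.rreg 2 ≤ s.rarr 3 (s.ireg 2 + j) then (1 : ℝ) else 0) := by
  set lo := s.ireg 2 with hlo
  -- first round of medians
  set s1 := ((s.iset 6 lo).iset 5 m).iset 7 (lo + m) with hs1
  obtain ⟨t1, _, E1, ht1, rfl⟩ := exec_straight [select]
    (c := .iset 6 (.reg 2) ;; .iset 5 (.reg 3) ;; .iset 7 (.add (.reg 2) (.reg 3))) rfl (s := s)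
    (Q := fun s' => s' = s1) (by simp [Cmd.wp, IExp.eval, h3, hs1, ← hlo])
  obtain ⟨t2, s2, E2, ht2, a20, ahi, alo⟩ := compress_spec [select] s1 (by simp [hs1])
  have F2 := E2.frame (P := selectWr) select_wr
  have e1_5 : s1.ireg 5 = m := by simp [hs1]
  have e1_6 : s1.ireg 6 = lo := by simp [hs1]
  have e1_7 : s1.ireg 7 = lo + m := by simp [hs1]
  rw [e1_5] at ht2 a20 ahi
  rw [e1_7] at ahi alo
  rw [e1_6] at ahi
  have e2_2 : s2.ireg 2 = lo := by rw [F2.ireg 2 (by decide)]; simp [hs1, hlo]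
  have e2_3 : s2.ireg 3 = m := by rw [F2.ireg 3 (by decide)]; simp [hs1, h3]
  have e2_7 : s2.ireg 7 = lo + m := by rw [F2.ireg 7 (by decide), e1_7]
  have e2_r : s2.rreg 1 = s.rreg 1 := by rw [F2.rreg 1 (by decide)]; simp [hs1]
  have e2_5 : s2.rarr 5 = s.rarr 5 := by rw [F2.rarr 5 (by decide)]; simp [hs1]
  have e2_i2 : s2.iarr 2 = s.iarr 2 := by rw [F2.iarr 2 (by decide)]; simp [hs1]
  have e2_i3 : s2.iarr 3 = s.iarr 3 := by rw [F2.iarr 3 (by decide)]; simp [hs1]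
  -- second round of medians
  set s3 := ((s2.iset 6 (lo + m)).iset 5 (m / 3)).iset 7 (lo + m + m / 3) with hs3
  obtain ⟨t3, _, E3, ht3, rfl⟩ := exec_straight [select]
    (c := .iset 6 (.reg 7) ;; .iset 5 (.reg 20) ;; .iset 7 (.add (.reg 6) (.reg 5))) rfl (s := s2)
    (Q := fun s' => s' = s3) (by simp [Cmd.wp, IExp.eval, e2_7, a20, hs3])
  obtain ⟨t4, s4, E4, ht4, b20, bhi, blo⟩ := compress_spec [select] s3 (by simp [hs3])
  have F4 := E4.frame (P := selectWr) select_wr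
  have e3_5 : s3.ireg 5 = m / 3 := by simp [hs3]
  have e3_6 : s3.ireg 6 = lo + m := by simp [hs3]
  have e3_7 : s3.ireg 7 = lo + m + m / 3 := by simp [hs3]
  have hdiv : m / 3 / 3 = m / 9 := by rw [Nat.div_div_eq_div_mul]
  rw [e3_5] at ht4 b20 bhi
  rw [e3_7] at bhi blo
  rw [e3_6] at bhi
  rw [hdiv] at b20 bhi
  have e4_2 : s4.ireg 2 = lo := by rw [F4.ireg 2 (by decide)]; simp [hs3, e2_2]
  have e4_3 : s4.ireg 3 = m := by rw [F4.ireg 3 (by decide)]; simp [hs3, e2_3]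
  have e4_7 : s4.ireg 7 = lo + m + m / 3 := by rw [F4.ireg 7 (by decide), e3_7]
  have e4_r : s4.rreg 1 = s.rreg 1 := by rw [F4.rreg 1 (by decide)]; simp [hs3, e2_r]
  have e4_5 : s4.rarr 5 = s.rarr 5 := by rw [F4.rarr 5 (by decide)]; simp [hs3, e2_5]
  have e4_i2 : s4.iarr 2 = s.iarr 2 := by rw [F4.iarr 2 (by decide)]; simp [hs3, e2_i2]
  have e4_i3 : s4.iarr 3 = s.iarr 3 := by rw [F4.iarr 3 (by decide)]; simp [hs3, e2_i3]
  have e4_lo : ∀ i < lo + m, s4.rarr 3 i = s.rarr 3 i ∧ s4.rarr 4 i = s.rarr 4 i := by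
    intro i hi
    have h1 := blo i (by omega)
    have h2 := alo i hi
    simp only [hs3, iset_rarr] at h1
    simp only [hs1, iset_rarr] at h2
    exact ⟨h1.1.trans h2.1, h1.2.trans h2.2⟩
  -- the medians as functions
  have hA1 := fun t => count_med3 (A := fun j => s.rarr 3 (lo + j))
    (A' := fun i => s2.rarr 3 (lo + m + i)) (m := m) (fun i hi => by
      have := (ahi i hi).2
      simpa [hs1, add_assoc] using this) t
  have hA2 := fun t => count_med3 (A := fun j => s2.rarr 3 (lo + m + j))
    (A' := fun i => s4.rarr 3 (lo + m + m / 3 + i)) (m := m / 3) (fun i hi => by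
      rw [hdiv] at hi
      have := (bhi i hi).2
      simpa [hs3, add_assoc] using this) t
  rw [hdiv] at hA2
  have Epre := fun {c t s'} (h : Exec [select] c s4 t s') => E1.seq (E2.seq (E3.seq (E4.seq h)))
  by_cases hκ : m / 9 = 0
  · -- a small segment
    refine ⟨_, _, Epre (.ite_true (by simp [BExp.Holds, IExp.eval, b20, hκ])
      (.rset 2 (.get 3 (.reg 2)) s4)), ?_, by simp [e4_2], by simp [e4_3], by simp [e4_r],
      by simpa using e4_lo, by simp [e4_5, e4_i2, e4_i3], ?_, ?_⟩
    · simp only [IExp.cost, RExp.cost, BExp.cost, Cmd.cost, hκ, if_true] at *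
      omega
    · have h0 : s4.rarr 3 lo = s.rarr 3 (lo + 0) := (e4_lo lo (by omega)).1
      simp only [hκ, RExp.eval, IExp.eval, rset_rreg, if_true, e4_2, h0]
      have := Finset.single_le_sum (f := fun j => if s.rarr 3 (lo + j) ≤ s.rarr 3 (lo + 0) then
        (1 : ℝ) else 0) (fun j _ => by split_ifs <;> norm_num) (Finset.mem_range.2 hm)
      simpa using this
    · have h0 : s4.rarr 3 lo = s.rarr 3 (lo + 0) := (e4_lo lo (by omega)).1
      simp only [hκ, RExp.eval, IExp.eval, rset_rreg, if_true, e4_2, h0]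
      have := Finset.single_le_sum (f := fun j => if s.rarr 3 (lo + 0) ≤ s.rarr 3 (lo + j) then
        (1 : ℝ) else 0) (fun j _ => by split_ifs <;> norm_num) (Finset.mem_range.2 hm)
      simpa using this
  · -- the recursive call
    -- The second-level medians start at `q`. The registers are saved at `q - 1`, just below the
    -- segment of the recursive call, which preserves all entries below its segment.
    set q := lo + m + m / 3 with hq
    obtain ⟨t5, s5, E5, ht5, ⟨c2, c3, cr, c33, c34, ci2, ci3, c5⟩⟩ := exec_straight [select]
      (c := .istore 2 (.sub (.reg 7) (.const 1)) (.reg 2) ;;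
        .istore 3 (.sub (.reg 7) (.const 1)) (.reg 3) ;;
        .rstore 5 (.sub (.reg 7) (.const 1)) (.reg 1) ;;
        .iset 2 (.reg 7) ;; .iset 3 (.reg 20) ;; .rset 1 (.div (.cast (.reg 20)) (.const 2))) rfl
      (s := s4) (Q := fun s5 => s5.ireg 2 = q ∧ s5.ireg 3 = m / 9 ∧ s5.rreg 1 = (m / 9 : ℕ) / 2 ∧
        s5.rarr 3 = s4.rarr 3 ∧ s5.rarr 4 = s4.rarr 4 ∧
        s5.iarr 2 = Function.update (s.iarr 2) (q - 1) lo ∧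
        s5.iarr 3 = Function.update (s.iarr 3) (q - 1) m ∧
        s5.rarr 5 = Function.update (s.rarr 5) (q - 1) (s.rreg 1))
      (by
        simp only [Cmd.wp, IExp.eval, RExp.eval]
        simp [e4_2, e4_3, e4_7, e4_r, e4_5, e4_i2, e4_i3, b20])
    have hW1 : ∑ j ∈ Finset.range (m / 9), s5.rarr 4 (q + j) = (m / 9 : ℕ) := by
      rw [Finset.sum_congr rfl (g := fun _ => (1 : ℝ)) fun j hj => by
        rw [c34, (bhi j (Finset.mem_range.1 hj)).1]]
      simp
    obtain ⟨t6, s6, E6, ht6, d2, dlo, dle, dge⟩ := ih (by omega) s5 c3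
      (fun j hj => by rw [c2, c34, (bhi j hj).1]; norm_num)
      (by rw [cr]; positivity)
      (by rw [cr, c2, hW1]; exact div_le_self (by positivity) (by norm_num))
    rw [c2] at d2 dlo
    have hq1 : q - 1 < q := by omega
    obtain ⟨t7, s7, E7, ht7, ⟨f2, f3, f1, fT, fW, f5, fi2, fi3, fr⟩⟩ := exec_straight [select]
      (c := .iset 3 (.get 3 (.sub (.reg 2) (.const 1))) ;;
        .rset 1 (.get 5 (.sub (.reg 2) (.const 1))) ;;
        .iset 2 (.get 2 (.sub (.reg 2) (.const 1)))) rfl (s := s6)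
      (Q := fun s7 => s7.ireg 2 = lo ∧ s7.ireg 3 = m ∧ s7.rreg 1 = s.rreg 1 ∧
        s7.rarr 3 = s6.rarr 3 ∧ s7.rarr 4 = s6.rarr 4 ∧ s7.rarr 5 = s6.rarr 5 ∧
        s7.iarr 2 = s6.iarr 2 ∧ s7.iarr 3 = s6.iarr 3 ∧ s7.rreg 2 = s6.rreg 2)
      (by
        simp only [Cmd.wp, IExp.eval, RExp.eval]
        simp [d2, (dlo _ hq1).2.2.1, (dlo _ hq1).2.2.2.1, (dlo _ hq1).2.2.2.2, ci2, ci3, c5])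
    refine ⟨_, s7, Epre (.ite_false (by simp [BExp.Holds, IExp.eval, b20, hκ])
      (E5.seq (E6.seq E7))), ?_, f2, f3, f1, ?_, ?_, ?_, ?_⟩
    · simp only [IExp.cost, RExp.cost, BExp.cost, Cmd.cost, hκ, if_false] at *
      omega
    · intro i hi
      have h1 := dlo i (by omega)
      rw [fT, fW, h1.1, h1.2.1, c33, c34]
      exact e4_lo i hi
    · intro i hi
      have h1 := dlo i (by omega)
      have hne : i ≠ q - 1 := by omega
      rw [f5, fi2, fi3, h1.2.2.1, h1.2.2.2.1, h1.2.2.2.2, c5, ci2, ci3]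
      simp [hne]
    · rw [fr]
      have h1 := (hA1 (s6.rreg 2)).1
      have h2 := (hA2 (s6.rreg 2)).1
      rw [c2, cr, c33, c34] at dle
      -- All weights are one, so the weight above the pivot is complementary to the number of
      -- elements at most the pivot.
      have h3 : ∑ i ∈ Finset.range (m / 9),
          (if s4.rarr 3 (q + i) ≤ s6.rreg 2 then (1 : ℝ) else 0)
          = (m / 9 : ℕ) - ∑ j ∈ Finset.range (m / 9),
            (if s6.rreg 2 < s4.rarr 3 (q + j) then s4.rarr 4 (q + j) else 0) := by
        rw [eq_sub_iff_add_eq, ← Finset.sum_add_distrib]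
        rw [Finset.sum_congr rfl (g := fun _ => (1 : ℝ)) fun j hj => by
          rw [(bhi j (Finset.mem_range.1 hj)).1]
          by_cases h : s4.rarr 3 (q + j) ≤ s6.rreg 2
          · simp [h, not_lt.2 h]
          · simp [h, not_le.1 h]]
        simp
      have h4 : (max 1 (2 * (m / 9)) : ℕ) = 2 * (m / 9) := by omega
      rw [h4, Nat.cast_mul, Nat.cast_two]
      linarith
    · rw [fr]
      have h1 := (hA1 (s6.rreg 2)).2
      have h2 := (hA2 (s6.rreg 2)).2
      rw [c2, cr, c33, c34] at dge
      have h3 : ∑ i ∈ Finset.range (m / 9),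
          (if s6.rreg 2 ≤ s4.rarr 3 (q + i) then (1 : ℝ) else 0)
          = ∑ j ∈ Finset.range (m / 9),
            (if s6.rreg 2 ≤ s4.rarr 3 (q + j) then s4.rarr 4 (q + j) else 0) :=
        Finset.sum_congr rfl fun j hj => by rw [(bhi j (Finset.mem_range.1 hj)).1]
      have h4 : (max 1 (2 * (m / 9)) : ℕ) = 2 * (m / 9) := by omega
      rw [h4, Nat.cast_mul, Nat.cast_two]
      linarith

/-- The test function that counts violations of `R` sums to zero on the right, hence on the left. In
this way multiset identities transfer pointwise properties. -/
theorem forall_of_sum_filter {a b a' b' : ℕ → ℝ} {m m' : ℕ} {P : ℕ → Prop} [DecidablePred P]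
    (h : ∀ φ : ℝ → ℝ → ℝ, ∑ i ∈ Finset.range m', φ (a' i) (b' i)
      = ∑ j ∈ Finset.range m, if P j then φ (a j) (b j) else 0)
    (R : ℝ → ℝ → Prop) (hR : ∀ j < m, P j → R (a j) (b j)) : ∀ i < m', R (a' i) (b' i) := by
  classical
  have h1 := h fun x y => if R x y then 0 else 1
  rw [Finset.sum_eq_zero (s := Finset.range m)] at h1
  · intro i hi
    rw [Finset.sum_eq_zero_iff_of_nonneg (fun i _ => by split_ifs <;> norm_num)] at h1
    by_contra hne
    simpa [hne] using h1 i (Finset.mem_range.2 hi)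
  · intro j hj
    by_cases hP : P j
    · simp [hP, hR j (Finset.mem_range.1 hj) hP]
    · simp [hP]

/-- The discarded elements are at most `p ≤ t`: they do not occur in the strict sum, and they can
only enlarge the other one. -/
theorem select_above {T W : ℕ → ℝ} {m : ℕ} {p t α : ℝ} (hW : ∀ j < m, 0 ≤ W j)
    (hα : α < ∑ j ∈ Finset.range m, if p < T j then W j else 0)
    (h1 : ∑ j ∈ Finset.range m, (if p < T j then (if t < T j then W j else 0) else 0) ≤ α)
    (h2 : α ≤ ∑ j ∈ Finset.range m, (if p < T j then (if t ≤ T j then W j else 0) else 0)) :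
    ∑ j ∈ Finset.range m, (if t < T j then W j else 0) ≤ α ∧
      α ≤ ∑ j ∈ Finset.range m, (if t ≤ T j then W j else 0) := by
  -- For `t < p` the filtered strict sum would be the whole weight above `p`, which exceeds `α`.
  have hp : p ≤ t := by
    by_contra hlt
    push Not at hlt
    refine absurd (h1.trans_lt hα) (not_lt.2 (le_of_eq (Finset.sum_congr rfl fun j _ => ?_)))
    split_ifs <;> first | (exfalso; linarith) | rfl
  constructor
  · refine le_trans (le_of_eq (Finset.sum_congr rfl fun j _ => ?_)) h1
    split_ifs <;> first | (exfalso; linarith) | rfl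
  · refine h2.trans (Finset.sum_le_sum fun j hj => ?_)
    have := hW j (Finset.mem_range.1 hj)
    split_ifs <;> linarith

/-- The threshold lies below `p`, since otherwise the kept elements would contribute nothing to the
second sum, which must be positive. All discarded elements are therefore above `t`, and both sums
change by exactly the weight that was subtracted from `α`. -/
theorem select_below {T W : ℕ → ℝ} {m : ℕ} {p t α : ℝ}
    (hα : ∑ j ∈ Finset.range m, (if p ≤ T j then W j else 0) < α)
    (h1 : ∑ j ∈ Finset.range m, (if T j < p then (if t < T j then W j else 0) else 0)
      ≤ α - ∑ j ∈ Finset.range m, (if p ≤ T j then W j else 0))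
    (h2 : α - ∑ j ∈ Finset.range m, (if p ≤ T j then W j else 0)
      ≤ ∑ j ∈ Finset.range m, (if T j < p then (if t ≤ T j then W j else 0) else 0)) :
    ∑ j ∈ Finset.range m, (if t < T j then W j else 0) ≤ α ∧
      α ≤ ∑ j ∈ Finset.range m, (if t ≤ T j then W j else 0) := by
  have hp : t < p := by
    by_contra hlt
    push Not at hlt
    have h0 : ∑ j ∈ Finset.range m, (if T j < p then (if t ≤ T j then W j else 0) else 0) = 0 :=
      Finset.sum_eq_zero fun j _ => by split_ifs <;> first | (exfalso; linarith) | rfl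
    rw [h0] at h2
    linarith
  constructor
  · rw [le_sub_iff_add_le, ← Finset.sum_add_distrib] at h1
    refine le_trans (le_of_eq (Finset.sum_congr rfl fun j _ => ?_)) h1
    split_ifs <;> first | (exfalso; linarith) | ring
  · rw [sub_le_iff_le_add, ← Finset.sum_add_distrib] at h2
    refine le_trans h2 (le_of_eq (Finset.sum_congr rfl fun j _ => ?_))
    split_ifs <;> first | (exfalso; linarith) | ring

theorem sum_le_add_sum_not {m : ℕ} (P Q : ℕ → Prop) [DecidablePred P] [DecidablePred Q]
    (h : ∀ j, P j → ¬ Q j) :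
    ∑ j ∈ Finset.range m, (if P j then (1 : ℝ) else 0)
      + ∑ j ∈ Finset.range m, (if Q j then (1 : ℝ) else 0) ≤ m := by
  rw [← Finset.sum_add_distrib]
  calc _ ≤ ∑ j ∈ Finset.range m, (1 : ℝ) := Finset.sum_le_sum fun j _ => by
        by_cases hP : P j
        · simp [hP, h j hP]
        · by_cases hQ : Q j <;> simp [hP, hQ]
    _ = m := by simp

set_option maxHeartbeats 1000000 in
/-- Selection runs in linear time. -/
theorem select_spec (m : ℕ) : SelectSpec 20000 100 m := by
  induction m using Nat.strong_induction_on with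
  | _ m ih =>
  intro s h3 hW h0 hsum
  rcases Nat.eq_zero_or_pos m with hm | hm
  · refine ⟨_, _, .call (c := select) rfl (.ite_true (by simp [BExp.Holds, IExp.eval, h3, hm])
      (.rset 2 (.const 0) s)), ?_, rfl, by simp, ?_, ?_⟩
    · simp only [IExp.cost, RExp.cost, BExp.cost]; omega
    · simpa [hm] using h0
    · simpa [hm] using hsum
  obtain ⟨t1, s1, E1, ht1, a2, a3, a1, aT, aS, cle, cge⟩ :=
    choosePivot_spec hm (fun _ => ih (m / 9) (by omega)) s h3
  obtain ⟨t2, s2, E2, ht2, b3, b4⟩ := partitionSums_spec [select] s1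
  have F2 := E2.frame (P := selectWr) select_wr
  set lo := s.ireg 2 with hlo
  set p := s1.rreg 2 with hp
  have eT : ∀ j < m, s1.rarr 3 (lo + j) = s.rarr 3 (lo + j) := fun j hj => (aT _ (by omega)).1
  have eW : ∀ j < m, s1.rarr 4 (lo + j) = s.rarr 4 (lo + j) := fun j hj => (aT _ (by omega)).2
  rw [a3, a2, Finset.sum_congr rfl fun j hj => by
    rw [eT j (Finset.mem_range.1 hj), eW j (Finset.mem_range.1 hj)]] at b3 b4
  rw [a3] at ht2
  have c1 : s2.rreg 1 = s.rreg 1 := by rw [F2.rreg 1 (by decide), a1]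
  have c2 : s2.rreg 2 = p := by rw [F2.rreg 2 (by decide)]
  have ci2 : s2.ireg 2 = lo := by rw [F2.ireg 2 (by decide), a2]
  have ci3 : s2.ireg 3 = m := by rw [F2.ireg 3 (by decide), a3]
  have cT : s2.rarr 3 = s1.rarr 3 := by rw [F2.rarr 3 (by decide)]
  have cW : s2.rarr 4 = s1.rarr 4 := by rw [F2.rarr 4 (by decide)]
  have c5 : s2.rarr 5 = s1.rarr 5 := by rw [F2.rarr 5 (by decide)]
  have cI2 : s2.iarr 2 = s1.iarr 2 := by rw [F2.iarr 2 (by decide)]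
  have cI3 : s2.iarr 3 = s1.iarr 3 := by rw [F2.iarr 3 (by decide)]
  have Epre := fun {t s'} (h : Exec [select] _ s2 t s') =>
    Exec.call (f := 0) (c := select) (procs := [select]) rfl
      (.ite_false (c := .rset 2 (.const 0)) (b := .ile (.reg 3) (.const 0)) (s := s)
      (by simp [BExp.Holds, IExp.eval, h3]; omega) (E1.seq (E2.seq h)))
  -- one side of the pivot
  have side : ∀ (ε α' : ℝ) (P : ℕ → Prop) [DecidablePred P],
      (∀ j, P j ↔ 0 < ε * (s.rarr 3 (lo + j) - p)) →
      ((max 1 (2 * (m / 9)) : ℕ) : ℝ) + ∑ j ∈ Finset.range m, (if P j then (1 : ℝ) else 0) ≤ m →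
      0 ≤ α' →
      (α' ≤ ∑ j ∈ Finset.range m, if P j then s.rarr 4 (lo + j) else 0) →
      ∀ s3 : Memory, s3.ireg 2 = lo → s3.ireg 3 = m → s3.rreg 1 = α' → s3.rreg 2 = p →
      s3.rreg 9 = ε → s3.rarr = s2.rarr → s3.iarr = s2.iarr →
      ∃ t s', Exec [select] (keepSide ;; .iset 3 (.reg 5) ;; .call 0) s3 t s' ∧
        t ≤ (m + 2) * 100 + 10 + 20000 * (m - max 1 (2 * (m / 9))) + 100 ∧
        s'.ireg 2 = lo ∧
        (∀ i < lo, s'.rarr 3 i = s.rarr 3 i ∧ s'.rarr 4 i = s.rarr 4 i ∧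
          s'.rarr 5 i = s.rarr 5 i ∧ s'.iarr 2 i = s.iarr 2 i ∧ s'.iarr 3 i = s.iarr 3 i) ∧
        ∑ j ∈ Finset.range m, (if P j then
          (if s'.rreg 2 < s.rarr 3 (lo + j) then s.rarr 4 (lo + j) else 0) else 0) ≤ α' ∧
        α' ≤ ∑ j ∈ Finset.range m, (if P j then
          (if s'.rreg 2 ≤ s.rarr 3 (lo + j) then s.rarr 4 (lo + j) else 0) else 0) := by
    intro ε α' P _ hP hcount h0' hα' s3 d2 d3 d1 dp d9 dr di
    obtain ⟨t4, s4, E4, ht4, elo, eφ⟩ := keepSide_spec [select] s3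
    have F4 := E4.frame (P := selectWr) select_wr
    rw [d2, d3, d9, dp] at eφ
    rw [d2] at elo
    rw [d3] at ht4
    have eφ' : ∀ φ : ℝ → ℝ → ℝ, ∑ i ∈ Finset.range (s4.ireg 5),
        φ (s4.rarr 3 (lo + i)) (s4.rarr 4 (lo + i)) = ∑ j ∈ Finset.range m,
          if P j then φ (s.rarr 3 (lo + j)) (s.rarr 4 (lo + j)) else 0 := by
      intro φ
      rw [eφ]
      refine Finset.sum_congr rfl fun j hj => ?_
      have hj := Finset.mem_range.1 hj
      rw [dr, cT, cW, eT j hj, eW j hj]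
      simp only [hP]
    have hcard : s4.ireg 5 ≤ m - max 1 (2 * (m / 9)) := by
      have := eφ' fun _ _ => 1
      rw [← this] at hcount
      simp only [Finset.sum_const, Finset.card_range, nsmul_one] at hcount
      have : max 1 (2 * (m / 9)) + s4.ireg 5 ≤ m := by exact_mod_cast hcount
      omega
    set s5 := s4.iset 3 (s4.ireg 5) with hs5
    have g2 : s5.ireg 2 = lo := by simp [hs5, F4.ireg 2 (by decide), d2]
    have g1 : s5.rreg 1 = α' := by simp [hs5, F4.rreg 1 (by decide), d1]
    obtain ⟨t6, s6, E6, ht6, f2, flo, fle, fge⟩ := ih (s4.ireg 5) (by omega) s5 (by simp [hs5])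
      (by
        rw [g2]
        exact forall_of_sum_filter eφ' (fun _ y => 0 ≤ y) (fun j hj _ => hW j hj))
      (by rw [g1]; exact h0')
      (by
        rw [g1, g2]
        refine hα'.trans (le_of_eq ?_)
        exact (eφ' fun _ y => y).symm)
    rw [g2] at f2 flo fle fge
    rw [g1] at fle fge
    refine ⟨_, s6, E4.seq ((Exec.iset 3 _ _).seq E6), ?_, f2, ?_, ?_, ?_⟩
    · simp only [IExp.cost]
      have := Nat.mul_le_mul_left 20000 hcard
      omega
    · intro i hi
      obtain ⟨g3, g4, g5, gi2, gi3⟩ := flo i hi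
      refine ⟨g3.trans ?_, g4.trans ?_, g5.trans ?_, gi2.trans ?_, gi3.trans ?_⟩
      · exact (elo i hi).1.trans (by rw [dr, cT]; exact (aT i (by omega)).1)
      · exact (elo i hi).2.trans (by rw [dr, cW]; exact (aT i (by omega)).2)
      · simp only [hs5, iset_rarr]
        rw [F4.rarr 5 (by decide), dr, c5]; exact (aS i hi).1
      · simp only [hs5, iset_iarr]
        rw [F4.iarr 2 (by decide), di, cI2]; exact (aS i hi).2.1
      · simp only [hs5, iset_iarr]
        rw [F4.iarr 3 (by decide), di, cI3]; exact (aS i hi).2.2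
    · refine le_trans (le_of_eq ?_) fle
      exact (eφ' fun x y => if s6.rreg 2 < x then y else 0).symm
    · refine fge.trans (le_of_eq ?_)
      exact eφ' fun x y => if s6.rreg 2 ≤ x then y else 0
  have hmax1 : 1 ≤ max 1 (2 * (m / 9)) := le_max_left _ _
  have hmax2 : max 1 (2 * (m / 9)) = if m / 9 = 0 then 1 else 2 * (m / 9) := by
    split_ifs <;> omega
  by_cases hb1 : s.rreg 1 < s2.rreg 3
  · obtain ⟨t3, s3, E3, ht3, rfl⟩ := exec_straight [select] (c := .rset 9 (.const 1)) rfl (s := s2)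
      (Q := fun s' => s' = s2.rset 9 1) (by simp [Cmd.wp, RExp.eval])
    obtain ⟨t4, s4, E4, ht4, d2, dlo, dle, dge⟩ := side 1 (s.rreg 1)
      (fun j => p < s.rarr 3 (lo + j)) (fun j => by simp)
      (by
        refine le_trans (add_le_add_left cle _) ?_
        exact sum_le_add_sum_not _ _ fun j h => not_lt.2 h)
      h0 (by rw [← b3]; exact hb1.le) (s2.rset 9 1) (by simp [ci2]) (by simp [ci3]) (by simp [c1])
      (by simp [c2]) (by simp) rfl rfl
    refine ⟨_, s4, Epre (.ite_true (by simpa [BExp.Holds, RExp.eval, c1] using hb1) (E3.seq E4)),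
      ?_, d2, dlo, ?_⟩
    · simp only [IExp.cost, RExp.cost, BExp.cost, Cmd.cost] at *
      rw [hmax2] at ht4
      -- At least `max 1 (2 * (m / 9))` elements are discarded. For `m < 9` the saved `20000` covers
      -- the work on at most eight elements. Otherwise the two recursive calls have total size at
      -- most `m - m / 9`, and since `m` is less than `9 * (m / 9) + 9`, the saved `20000 * (m / 9)`
      -- covers the linear work and the second additive constant.
      split_ifs at * <;> omega
    · exact select_above hW (by rw [← b3]; exact hb1) dle dge
  by_cases hb2 : s2.rreg 4 < s.rreg 1
  · obtain ⟨t3, s3, E3, ht3, rfl⟩ := exec_straight [select]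
      (c := .rset 1 (.sub (.reg 1) (.reg 4)) ;; .rset 9 (.const (-1))) rfl (s := s2)
      (Q := fun s' => s' = (s2.rset 1 (s.rreg 1 - s2.rreg 4)).rset 9 (-1))
      (by simp [Cmd.wp, RExp.eval, c1])
    obtain ⟨t4, s4, E4, ht4, d2, dlo, dle, dge⟩ := side (-1) (s.rreg 1 - s2.rreg 4)
      (fun j => s.rarr 3 (lo + j) < p) (fun j => by simp)
      (by
        refine le_trans (add_le_add_left cge _) ?_
        exact sum_le_add_sum_not _ _ fun j h => not_lt.2 h)
      (by linarith)
      (by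
        rw [sub_le_iff_le_add, b4, ← Finset.sum_add_distrib]
        refine hsum.trans (le_of_eq (Finset.sum_congr rfl fun j _ => ?_))
        split_ifs <;> first | (exfalso; linarith) | ring)
      ((s2.rset 1 (s.rreg 1 - s2.rreg 4)).rset 9 (-1))
      (by simp [ci2]) (by simp [ci3]) (by simp) (by simp [c2]) (by simp) rfl rfl
    refine ⟨_, s4, Epre (.ite_false (by simpa [BExp.Holds, RExp.eval, c1] using hb1)
      (.ite_true (by simpa [BExp.Holds, RExp.eval, c1] using hb2) (E3.seq E4))), ?_, d2, dlo, ?_⟩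
    · simp only [IExp.cost, RExp.cost, BExp.cost, Cmd.cost] at *
      rw [hmax2] at ht4
      split_ifs at * <;> omega
    · rw [b4] at hb2 dle dge
      exact select_below hb2 dle dge
  · refine ⟨_, s2, Epre (.ite_false (by simpa [BExp.Holds, RExp.eval, c1] using hb1)
      (.ite_false (by simpa [BExp.Holds, RExp.eval, c1] using hb2) (.skip s2))), ?_, ci2, ?_, ?_, ?_⟩
    · simp only [IExp.cost, RExp.cost, BExp.cost] at *
      split_ifs at * <;> omega
    · intro i hi
      rw [cT, cW, c5, cI2, cI3]
      exact ⟨(aT i (by omega)).1, (aT i (by omega)).2, aS i hi⟩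
    · rw [c2]
      push Not at hb1
      rwa [b3] at hb1
    · rw [c2]
      push Not at hb2
      rwa [b4] at hb2

end Selection

/-! ### Piecewise linear convex functions -/

section Piecewise

/-- A convex piecewise linear function of one variable. -/
noncomputable def pw1 (m : ℕ) (g a b : ℕ → ℝ) (r t : ℝ) : ℝ :=
  r * t + ∑ v ∈ Finset.range m, b v * max (g v - a v * t) 0

/-- A convex piecewise linear function of two variables, given by weighted lines
`y = γ v - σ v * x`. -/
noncomputable def pw2 (m : ℕ) (γ σ b : ℕ → ℝ) (r₁ r₂ x y : ℝ) : ℝ :=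
  r₁ * x + r₂ * y + ∑ v ∈ Finset.range m, b v * max (γ v - σ v * x - y) 0

/-- Far to the right the slope is `α`, far to the left it is `α` minus the total weight. A function
that is bounded below has a nonnegative slope at the right end and a nonpositive one at the left
end. This provides the range condition of selection. -/
theorem weighted_bounds {m : ℕ} {τ ω : ℕ → ℝ} {α M : ℝ}
    (hM : ∀ t, M ≤ pw1 m τ (fun _ => 1) ω α t) :
    0 ≤ α ∧ α ≤ ∑ v ∈ Finset.range m, ω v := by
  set T := ∑ v ∈ Finset.range m, |τ v| with hT
  have hle : ∀ v ∈ Finset.range m, |τ v| ≤ T := fun v hv =>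
    Finset.single_le_sum (f := fun v => |τ v|) (fun _ _ => abs_nonneg _) hv
  constructor
  · by_contra hneg
    push Not at hneg
    -- A point beyond all breakpoints, so far out that the linear term falls below `M`.
    have h := hM (T + |M - α * T| / (-α) + T + 1 - T)
    have hs : 0 ≤ |M - α * T| / (-α) := div_nonneg (abs_nonneg _) (by linarith)
    rw [pw1, Finset.sum_eq_zero, add_zero] at h
    · have h1 : α * (|M - α * T| / (-α)) = -|M - α * T| := by
        rw [div_neg, mul_neg, ← mul_div_assoc, mul_div_cancel_left₀ _ hneg.ne]
      have h2 := neg_abs_le (M - α * T)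
      nlinarith
    · intro v hv
      have := (abs_le.1 (hle v hv)).2
      rw [max_eq_right (by linarith), mul_zero]
  · by_contra hneg
    push Not at hneg
    set S := ∑ v ∈ Finset.range m, ω v with hS
    set U := ∑ v ∈ Finset.range m, ω v * τ v with hU
    have key : ∀ t, t ≤ -T → pw1 m τ (fun _ => 1) ω α t = (α - S) * t + U := by
      intro t ht
      rw [pw1, hS, hU, sub_mul, Finset.sum_mul]
      rw [Finset.sum_congr rfl (g := fun v => ω v * τ v - ω v * t) fun v hv => by
        have := (abs_le.1 (hle v hv)).1
        rw [max_eq_left (by linarith)]; ring, Finset.sum_sub_distrib]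
      ring
    have hs : 0 ≤ |M - U + (α - S) * T| / (α - S) := div_nonneg (abs_nonneg _) (by linarith)
    have h := hM (-T - |M - U + (α - S) * T| / (α - S) - 1)
    rw [key _ (by linarith)] at h
    have h1 : (α - S) * (|M - U + (α - S) * T| / (α - S)) = |M - U + (α - S) * T| := by
      have : α - S ≠ 0 := by linarith
      field_simp
    have h2 := neg_le_abs (M - U + (α - S) * T)
    nlinarith

/-- The two conditions say that the right derivative at `t` is nonnegative and the left derivative
nonpositive, which for a convex function means a minimum. So a weighted selection threshold is a
minimum point. -/
theorem weighted_min {m : ℕ} {τ ω : ℕ → ℝ} {α t : ℝ} (hω : ∀ v < m, 0 ≤ ω v)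
    (h1 : ∑ v ∈ Finset.range m, (if t < τ v then ω v else 0) ≤ α)
    (h2 : α ≤ ∑ v ∈ Finset.range m, (if t ≤ τ v then ω v else 0)) (u : ℝ) :
    pw1 m τ (fun _ => 1) ω α t ≤ pw1 m τ (fun _ => 1) ω α u := by
  rcases le_total t u with htu | htu
  · have h : ∑ v ∈ Finset.range m, (ω v * max (τ v - 1 * t) 0 - ω v * max (τ v - 1 * u) 0)
        ≤ (u - t) * ∑ v ∈ Finset.range m, (if t < τ v then ω v else 0) := by
      rw [Finset.mul_sum]
      refine Finset.sum_le_sum fun v hv => ?_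
      have hw := hω v (Finset.mem_range.1 hv)
      rw [← mul_sub]
      split_ifs with h
      · rw [mul_comm]
        refine mul_le_mul_of_nonneg_right ?_ hw
        rw [max_eq_left (by linarith)]
        linarith [le_max_left (τ v - 1 * u) 0]
      · rw [max_eq_right (by linarith), max_eq_right (by linarith)]; simp
    rw [Finset.sum_sub_distrib] at h
    have h3 := mul_le_mul_of_nonneg_left h1 (sub_nonneg.2 htu)
    simp only [pw1]
    nlinarith
  · have h : (t - u) * ∑ v ∈ Finset.range m, (if t ≤ τ v then ω v else 0)
        ≤ ∑ v ∈ Finset.range m, (ω v * max (τ v - 1 * u) 0 - ω v * max (τ v - 1 * t) 0) := by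
      rw [Finset.mul_sum]
      refine Finset.sum_le_sum fun v hv => ?_
      have hw := hω v (Finset.mem_range.1 hv)
      rw [← mul_sub]
      split_ifs with h
      · rw [mul_comm]
        refine mul_le_mul_of_nonneg_left ?_ hw
        rw [max_eq_left (by linarith : (0 : ℝ) ≤ τ v - 1 * t)]
        linarith [le_max_left (τ v - 1 * u) 0]
      · rw [max_eq_right (by linarith : τ v - 1 * t ≤ 0), mul_zero, sub_zero]
        exact mul_nonneg hw (le_max_right _ _)
    rw [Finset.sum_sub_distrib] at h
    have h3 := mul_le_mul_of_nonneg_left h2 (sub_nonneg.2 htu)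
    simp only [pw1]
    nlinarith

/-- All pieces of a function of one variable can be turned into the same direction. -/
theorem pw1_eq_weighted {m : ℕ} {g a b τ ω : ℕ → ℝ} {r α : ℝ}
    (hτ : ∀ v < m, τ v = g v / a v) (hω : ∀ v < m, ω v = if 0 ≤ a v then b v * a v else -(b v * a v))
    (hα : α = r + ∑ v ∈ Finset.range m, if 0 ≤ a v then 0 else -(b v * a v)) :
    ∃ C, ∀ t, pw1 m g a b r t = pw1 m τ (fun _ => 1) ω α t + C := by
  -- A piece with negative `a v` is turned by `max s 0 = s + max (-s) 0`; the slope of `s` goes into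
  -- `α` and its constant into `C`. A piece with `a v = 0` is constant and gets weight zero, so that
  -- the quotient `g v / a v` does not matter.
  refine ⟨∑ v ∈ Finset.range m, (if a v = 0 then b v * max (g v) 0 else
    if 0 ≤ a v then 0 else b v * g v), fun t => ?_⟩
  rw [pw1, pw1, hα, add_mul, add_assoc, add_assoc, Finset.sum_mul,
    ← Finset.sum_add_distrib, ← Finset.sum_add_distrib]
  congr 1
  refine Finset.sum_congr rfl fun v hv => ?_
  have hv := Finset.mem_range.1 hv
  rw [hτ v hv, hω v hv]
  rcases lt_trichotomy (a v) 0 with h | h | h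
  · rw [if_neg (not_le.2 h), if_neg (not_le.2 h), if_neg h.ne, if_neg (not_le.2 h), one_mul]
    have e : g v - a v * t = a v * (g v / a v - t) := by
      have := h.ne; field_simp
    have e2 : b v * g v = b v * a v * (g v / a v) := by
      have := h.ne; field_simp
    rw [e, e2]
    rcases le_total (g v / a v) t with h' | h'
    · rw [max_eq_left (mul_nonneg_of_nonpos_of_nonpos h.le (by linarith)),
        max_eq_right (by linarith)]
      ring
    · rw [max_eq_right (mul_nonpos_of_nonpos_of_nonneg h.le (by linarith)),
        max_eq_left (by linarith)]
      ring
  · simp [h]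
  · rw [if_pos h.le, if_pos h.le, if_neg h.ne', if_pos h.le, one_mul]
    have e : g v - a v * t = a v * (g v / a v - t) := by
      have := h.ne'; field_simp
    have e2 : max (a v * (g v / a v - t)) 0 = a v * max (g v / a v - t) 0 := by
      rw [mul_max_of_nonneg _ _ h.le, mul_zero]
    rw [e, e2]
    ring

theorem pw2_line (m : ℕ) (γ σ b : ℕ → ℝ) (r₁ r₂ x₀ y₀ dx dy t : ℝ) :
    pw2 m γ σ b r₁ r₂ (x₀ + t * dx) (y₀ + t * dy)
      = r₁ * x₀ + r₂ * y₀ + pw1 m (fun v => γ v - σ v * x₀ - y₀) (fun v => σ v * dx + dy) b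
        (r₁ * dx + r₂ * dy) t := by
  have : ∀ v, γ v - σ v * (x₀ + t * dx) - (y₀ + t * dy)
      = γ v - σ v * x₀ - y₀ - (σ v * dx + dy) * t := fun v => by ring
  simp only [pw2, pw1, this]
  ring

theorem pw2_convex {m : ℕ} {γ σ b : ℕ → ℝ} (hb : ∀ v < m, 0 ≤ b v) (r₁ r₂ : ℝ)
    (x y x' y' s : ℝ) (h0 : 0 ≤ s) (h1 : s ≤ 1) :
    pw2 m γ σ b r₁ r₂ ((1 - s) * x + s * x') ((1 - s) * y + s * y')
      ≤ (1 - s) * pw2 m γ σ b r₁ r₂ x y + s * pw2 m γ σ b r₁ r₂ x' y' := by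
  have h : ∑ v ∈ Finset.range m, b v * max (γ v - σ v * ((1 - s) * x + s * x')
      - ((1 - s) * y + s * y')) 0 ≤
      (1 - s) * ∑ v ∈ Finset.range m, b v * max (γ v - σ v * x - y) 0
      + s * ∑ v ∈ Finset.range m, b v * max (γ v - σ v * x' - y') 0 := by
    rw [Finset.mul_sum, Finset.mul_sum, ← Finset.sum_add_distrib]
    refine Finset.sum_le_sum fun v hv => ?_
    have hw := hb v (Finset.mem_range.1 hv)
    rw [mul_left_comm, mul_left_comm s, ← mul_add]
    refine mul_le_mul_of_nonneg_left (max_le ?_ ?_) hw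
    · have e1 := mul_le_mul_of_nonneg_left (le_max_left (γ v - σ v * x - y) 0) (sub_nonneg.2 h1)
      have e2 := mul_le_mul_of_nonneg_left (le_max_left (γ v - σ v * x' - y') 0) h0
      linarith
    · have e1 := mul_nonneg (sub_nonneg.2 h1) (le_max_right (γ v - σ v * x - y) 0)
      have e2 := mul_nonneg h0 (le_max_right (γ v - σ v * x' - y') 0)
      linarith
  simp only [pw2]
  linarith

/-- The directional derivative of `pw2` at `(x, y)`. -/
noncomputable def pw2Deriv (m : ℕ) (γ σ b : ℕ → ℝ) (r₁ r₂ x y ex ey : ℝ) : ℝ :=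
  r₁ * ex + r₂ * ey + ∑ v ∈ Finset.range m, b v * (if γ v - σ v * x - y = 0 then
    max (-(σ v * ex + ey)) 0 else if 0 ≤ γ v - σ v * x - y then -(σ v * ex + ey) else 0)

/-! ### One-sided directional derivatives -/

section Derivative

variable {m : ℕ} {γ σ b : ℕ → ℝ} {r₁ r₂ x y : ℝ}

/-- The subgradient inequality, which holds for every hinge separately. -/
theorem pw2_add_ge (hb : ∀ v < m, 0 ≤ b v) (ex ey : ℝ) :
    pw2 m γ σ b r₁ r₂ x y + pw2Deriv m γ σ b r₁ r₂ x y ex ey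
      ≤ pw2 m γ σ b r₁ r₂ (x + ex) (y + ey) := by
  have h : ∑ v ∈ Finset.range m, b v * max (γ v - σ v * x - y) 0 +
      ∑ v ∈ Finset.range m, b v * (if γ v - σ v * x - y = 0 then
        max (-(σ v * ex + ey)) 0 else if 0 ≤ γ v - σ v * x - y then -(σ v * ex + ey) else 0) ≤
      ∑ v ∈ Finset.range m, b v * max (γ v - σ v * (x + ex) - (y + ey)) 0 := by
    rw [← Finset.sum_add_distrib]
    refine Finset.sum_le_sum fun v hv => ?_
    have hw := hb v (Finset.mem_range.1 hv)
    rw [← mul_add]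
    refine mul_le_mul_of_nonneg_left ?_ hw
    have e : γ v - σ v * (x + ex) - (y + ey) = γ v - σ v * x - y - (σ v * ex + ey) := by ring
    rw [e]
    generalize γ v - σ v * x - y = g
    generalize σ v * ex + ey = h
    split_ifs with h1 h2
    · rw [h1]; simp
    · rw [max_eq_left h2]; exact le_trans (by linarith) (le_max_left _ _)
    · rw [max_eq_right (by linarith)]; simp
  simp only [pw2, pw2Deriv]
  linarith

/-- There are finitely many hinges, and each is linear along a sufficiently short initial piece of a
ray; so no limits are needed when working with the derivative. -/
theorem pw2_add_eq (ex ey : ℝ) :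
    ∃ s > 0, pw2 m γ σ b r₁ r₂ (x + s * ex) (y + s * ey)
      = pw2 m γ σ b r₁ r₂ x y + s * pw2Deriv m γ σ b r₁ r₂ x y ex ey := by
  have hev : ∀ v ∈ Finset.range m, ∀ᶠ s in nhdsWithin (0 : ℝ) (Set.Ioi 0),
      max (γ v - σ v * x - y - s * (σ v * ex + ey)) 0 = max (γ v - σ v * x - y) 0
        + s * (if γ v - σ v * x - y = 0 then
        max (-(σ v * ex + ey)) 0 else if 0 ≤ γ v - σ v * x - y then -(σ v * ex + ey) else 0) := by
    intro v _
    generalize γ v - σ v * x - y = g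
    generalize σ v * ex + ey = h
    have hc : Filter.Tendsto (fun s => g - s * h) (nhdsWithin (0 : ℝ) (Set.Ioi 0)) (nhds g) := by
      have : Continuous fun s : ℝ => g - s * h := by fun_prop
      have := (this.tendsto 0).mono_left (nhdsWithin_le_nhds (s := Set.Ioi 0))
      simpa using this
    rcases lt_trichotomy g 0 with hg | hg | hg
    · filter_upwards [hc.eventually (gt_mem_nhds hg)] with s hs
      rw [if_neg hg.ne, if_neg (not_le.2 hg), max_eq_right hs.le, max_eq_right hg.le]; ring
    · filter_upwards [self_mem_nhdsWithin] with s hs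
      have hs : 0 < s := hs
      rw [hg, if_pos rfl, max_self, zero_add, mul_max_of_nonneg _ _ hs.le]
      simp
    · filter_upwards [hc.eventually (lt_mem_nhds hg)] with s hs
      rw [if_neg hg.ne', if_pos hg.le, max_eq_left hs.le, max_eq_left hg.le]; ring
  obtain ⟨s, hs, hs0⟩ := (((Filter.eventually_all_finset _).2 hev).and
    (self_mem_nhdsWithin : ∀ᶠ s in nhdsWithin (0 : ℝ) (Set.Ioi 0), s ∈ Set.Ioi 0)).exists
  refine ⟨s, hs0, ?_⟩
  simp only [pw2, pw2Deriv]
  rw [mul_add s, Finset.mul_sum]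
  have : ∑ v ∈ Finset.range m, b v * max (γ v - σ v * (x + s * ex) - (y + s * ey)) 0
      = ∑ v ∈ Finset.range m, b v * max (γ v - σ v * x - y) 0
      + ∑ v ∈ Finset.range m, s * (b v * (if γ v - σ v * x - y = 0 then
        max (-(σ v * ex + ey)) 0 else if 0 ≤ γ v - σ v * x - y then -(σ v * ex + ey) else 0)) := by
    rw [← Finset.sum_add_distrib]
    refine Finset.sum_congr rfl fun v hv => ?_
    have e : γ v - σ v * (x + s * ex) - (y + s * ey)
      = γ v - σ v * x - y - s * (σ v * ex + ey) := by ring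
    rw [e, hs v hv]; ring
  rw [this]; ring

theorem pw2Deriv_smul {κ : ℝ} (hκ : 0 ≤ κ) (ex ey : ℝ) :
    pw2Deriv m γ σ b r₁ r₂ x y (κ * ex) (κ * ey) = κ * pw2Deriv m γ σ b r₁ r₂ x y ex ey := by
  simp only [pw2Deriv]
  rw [mul_add, Finset.mul_sum]
  congr 1
  · ring
  · refine Finset.sum_congr rfl fun v _ => ?_
    have e : -(σ v * (κ * ex) + κ * ey) = κ * -(σ v * ex + ey) := by ring
    rw [e]
    split_ifs
    · rw [mul_left_comm κ, mul_max_of_nonneg _ _ hκ, mul_zero]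
    · ring
    · ring

/-- Convexity makes the derivative sublinear in the direction, together with `pw2Deriv_smul`. -/
theorem pw2Deriv_add_le (hb : ∀ v < m, 0 ≤ b v) (ex ey ex' ey' : ℝ) :
    pw2Deriv m γ σ b r₁ r₂ x y (ex + ex') (ey + ey')
      ≤ pw2Deriv m γ σ b r₁ r₂ x y ex ey + pw2Deriv m γ σ b r₁ r₂ x y ex' ey' := by
  have h : ∑ v ∈ Finset.range m, b v * (if γ v - σ v * x - y = 0 then
      max (-(σ v * (ex + ex') + (ey + ey'))) 0 else if 0 ≤ γ v - σ v * x - y then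
        -(σ v * (ex + ex') + (ey + ey')) else 0) ≤
      ∑ v ∈ Finset.range m, b v * (if γ v - σ v * x - y = 0 then
        max (-(σ v * ex + ey)) 0 else if 0 ≤ γ v - σ v * x - y then -(σ v * ex + ey) else 0) +
      ∑ v ∈ Finset.range m, b v * (if γ v - σ v * x - y = 0 then
        max (-(σ v * ex' + ey')) 0 else
          if 0 ≤ γ v - σ v * x - y then -(σ v * ex' + ey') else 0) := by
    rw [← Finset.sum_add_distrib]
    refine Finset.sum_le_sum fun v hv => ?_
    rw [← mul_add]
    refine mul_le_mul_of_nonneg_left ?_ (hb v (Finset.mem_range.1 hv))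
    split_ifs
    · refine max_le ?_ (add_nonneg (le_max_right _ _) (le_max_right _ _))
      linarith [le_max_left (-(σ v * ex + ey)) 0, le_max_left (-(σ v * ex' + ey')) 0]
    · linarith
    · linarith
  simp only [pw2Deriv]
  linarith

/-- Only the hinges whose lines pass through the point remain as hinges, the others are linear at
first order. Hence the search for a steepest direction is again a `pw1` problem in `u`. -/
theorem pw2Deriv_line (ε ex ey dx dy u : ℝ) :
    pw2Deriv m γ σ b r₁ r₂ x y (ε * ex + u * dx) (ε * ey + u * dy)
      = ε * (r₁ * ex + r₂ * ey - ∑ v ∈ Finset.range m, (if γ v - σ v * x - y = 0 then 0 else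
          if 0 ≤ γ v - σ v * x - y then b v * (σ v * ex + ey) else 0)) +
        pw1 m (fun v => -(ε * (σ v * ex + ey))) (fun v => σ v * dx + dy)
          (fun v => if γ v - σ v * x - y = 0 then b v else 0)
          (r₁ * dx + r₂ * dy - ∑ v ∈ Finset.range m, (if γ v - σ v * x - y = 0 then 0 else
          if 0 ≤ γ v - σ v * x - y then b v * (σ v * dx + dy) else 0)) u := by
  simp only [pw2Deriv, pw1]
  rw [mul_sub, sub_mul, Finset.mul_sum, Finset.sum_mul]
  have : ∀ A B C D E F : ℝ, A + (D - E + F) = B → A = B - D + E - F := by intros; linarith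
  have h : ∑ v ∈ Finset.range m, b v * (if γ v - σ v * x - y = 0 then
      max (-(σ v * (ε * ex + u * dx) + (ε * ey + u * dy))) 0 else
        if 0 ≤ γ v - σ v * x - y then -(σ v * (ε * ex + u * dx) + (ε * ey + u * dy)) else 0) =
      ∑ v ∈ Finset.range m, (if γ v - σ v * x - y = 0 then b v else 0) *
        max (-(ε * (σ v * ex + ey)) - (σ v * dx + dy) * u) 0
      - ∑ v ∈ Finset.range m, ε * (if γ v - σ v * x - y = 0 then 0 else
          if 0 ≤ γ v - σ v * x - y then b v * (σ v * ex + ey) else 0)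
      - ∑ v ∈ Finset.range m, (if γ v - σ v * x - y = 0 then 0 else
          if 0 ≤ γ v - σ v * x - y then b v * (σ v * dx + dy) else 0) * u := by
    rw [← Finset.sum_sub_distrib, ← Finset.sum_sub_distrib]
    refine Finset.sum_congr rfl fun v _ => ?_
    have e : -(σ v * (ε * ex + u * dx) + (ε * ey + u * dy))
      = -(ε * (σ v * ex + ey)) - (σ v * dx + dy) * u := by ring
    rw [e]
    split_ifs <;> ring
  rw [h]
  ring

end Derivative

/-- `(x, y)` is a minimum point of `f`. -/
def IsMinPt (f : ℝ → ℝ → ℝ) (x y : ℝ) : Prop := ∀ x' y', f x y ≤ f x' y'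

/-! ### Locating the minimum points relative to a line -/

section Query

variable {m : ℕ} {γ σ b : ℕ → ℝ} {r₁ r₂ x y dx dy ex ey : ℝ}

theorem deriv_nonneg_of_line (hline : ∀ t, pw2 m γ σ b r₁ r₂ x y
    ≤ pw2 m γ σ b r₁ r₂ (x + t * dx) (y + t * dy)) (u : ℝ) :
    0 ≤ pw2Deriv m γ σ b r₁ r₂ x y (u * dx) (u * dy) := by
  obtain ⟨s, hs, h⟩ := pw2_add_eq (m := m) (γ := γ) (σ := σ) (b := b) (r₁ := r₁) (r₂ := r₂)
    (x := x) (y := y) (u * dx) (u * dy)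
  have := hline (s * u)
  rw [mul_assoc, mul_assoc, h] at this
  have h' : 0 ≤ s * pw2Deriv m γ σ b r₁ r₂ x y (u * dx) (u * dy) := by linarith
  exact nonneg_of_mul_nonneg_right h' hs

/-- By subadditivity the derivative along the line, which is nonnegative, is at most the derivative
in question plus the one in the fixed direction `-ε e`. -/
theorem deriv_bddBelow (hb : ∀ v < m, 0 ≤ b v) (hline : ∀ t, pw2 m γ σ b r₁ r₂ x y
    ≤ pw2 m γ σ b r₁ r₂ (x + t * dx) (y + t * dy)) (ε : ℝ) :
    ∃ M, ∀ u, M ≤ pw2Deriv m γ σ b r₁ r₂ x y (ε * ex + u * dx) (ε * ey + u * dy) := by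
  refine ⟨-pw2Deriv m γ σ b r₁ r₂ x y (-(ε * ex)) (-(ε * ey)), fun u => ?_⟩
  have h1 := deriv_nonneg_of_line hline u
  have h2 := pw2Deriv_add_le (r₁ := r₁) (r₂ := r₂) (γ := γ) (σ := σ) (x := x) (y := y) hb
    (ε * ex + u * dx) (ε * ey + u * dy) (-(ε * ex)) (-(ε * ey))
  have e1 : ε * ex + u * dx + -(ε * ex) = u * dx := by ring
  have e2 : ε * ey + u * dy + -(ε * ey) = u * dy := by ring
  rw [e1, e2] at h2
  linarith

/-- If no direction to either side of the line descends, the minimum on the line is global. -/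
theorem isMinPt_of_deriv_nonneg (hb : ∀ v < m, 0 ≤ b v) (hdet : dx * ey - dy * ex ≠ 0)
    (hline : ∀ t, pw2 m γ σ b r₁ r₂ x y ≤ pw2 m γ σ b r₁ r₂ (x + t * dx) (y + t * dy))
    (h1 : ∀ u, 0 ≤ pw2Deriv m γ σ b r₁ r₂ x y (1 * ex + u * dx) (1 * ey + u * dy))
    (h2 : ∀ u, 0 ≤ pw2Deriv m γ σ b r₁ r₂ x y (-1 * ex + u * dx) (-1 * ey + u * dy)) :
    IsMinPt (pw2 m γ σ b r₁ r₂) x y := by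
  intro x' y'
  -- Cramer's rule: the coordinates of the displacement in the basis of the transversal direction
  -- and the direction of the line.
  set κ := (dx * (y' - y) - dy * (x' - x)) / (dx * ey - dy * ex) with hκ
  set u := ((x' - x) * ey - (y' - y) * ex) / (dx * ey - dy * ex) with hu
  have ex1 : x' - x = κ * ex + u * dx := by rw [hκ, hu]; field_simp; ring
  have ey1 : y' - y = κ * ey + u * dy := by rw [hκ, hu]; field_simp; ring
  have hD : 0 ≤ pw2Deriv m γ σ b r₁ r₂ x y (x' - x) (y' - y) := by
    rw [ex1, ey1]
    rcases lt_trichotomy κ 0 with h | h | h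
    · have := mul_nonneg (neg_nonneg.2 h.le) (h2 (u / (-κ)))
      rw [← pw2Deriv_smul (neg_nonneg.2 h.le)] at this
      have h0 : -κ * (u / -κ) = u := mul_div_cancel₀ _ (neg_ne_zero.2 h.ne)
      rwa [show -κ * (-1 * ex + u / -κ * dx) = κ * ex + u * dx by linear_combination dx * h0,
        show -κ * (-1 * ey + u / -κ * dy) = κ * ey + u * dy by linear_combination dy * h0] at this
    · rw [h, zero_mul, zero_add, zero_mul, zero_add]
      exact deriv_nonneg_of_line hline u
    · have := mul_nonneg h.le (h1 (u / κ))
      rw [← pw2Deriv_smul h.le] at this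
      have h0 : κ * (u / κ) = u := mul_div_cancel₀ _ h.ne'
      rwa [show κ * (1 * ex + u / κ * dx) = κ * ex + u * dx by linear_combination dx * h0,
        show κ * (1 * ey + u / κ * dy) = κ * ey + u * dy by linear_combination dy * h0] at this
  have := pw2_add_ge (r₁ := r₁) (r₂ := r₂) (γ := γ) (σ := σ) (x := x) (y := y) hb (x' - x) (y' - y)
  rw [add_sub_cancel, add_sub_cancel] at this
  linarith

/-- A descending direction to one side shows where the minimum points are. -/
theorem side_of_deriv_neg (hb : ∀ v < m, 0 ≤ b v) {lx ly lc ε u : ℝ}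
    (hline : ∀ x' y', lx * x' + ly * y' + lc = 0 →
      pw2 m γ σ b r₁ r₂ x y ≤ pw2 m γ σ b r₁ r₂ x' y')
    (hq : lx * x + ly * y + lc = 0) (hd : lx * dx + ly * dy = 0) (he : lx * ex + ly * ey = 1)
    (hε : ε * ε = 1)
    (hneg : pw2Deriv m γ σ b r₁ r₂ x y (ε * ex + u * dx) (ε * ey + u * dy) < 0)
    {x' y' : ℝ} (hmin : IsMinPt (pw2 m γ σ b r₁ r₂) x' y') :
    0 < ε * (lx * x' + ly * y' + lc) := by
  obtain ⟨s, hs, h⟩ := pw2_add_eq (m := m) (γ := γ) (σ := σ) (b := b) (r₁ := r₁) (r₂ := r₂)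
    (x := x) (y := y) (ε * ex + u * dx) (ε * ey + u * dy)
  set p₁ := x + s * (ε * ex + u * dx) with hp₁
  set p₂ := y + s * (ε * ey + u * dy) with hp₂
  have hp : ε * (lx * p₁ + ly * p₂ + lc) = s := by
    have : lx * p₁ + ly * p₂ + lc = (lx * x + ly * y + lc) + s * (ε * (lx * ex + ly * ey)
      + u * (lx * dx + ly * dy)) := by rw [hp₁, hp₂]; ring
    rw [this, hq, hd, he]
    linear_combination s * hε
  have hFp : pw2 m γ σ b r₁ r₂ p₁ p₂ < pw2 m γ σ b r₁ r₂ x y := by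
    rw [h]; nlinarith
  by_contra hle
  push Not at hle
  set L := ε * (lx * x' + ly * y' + lc) with hL
  -- The parameter at which the segment from the minimum point to the better point crosses the line.
  -- By convexity the value there is at most that of the better point, which is below the minimum on
  -- the line.
  set θ := -L / (s - L) with hθ
  have hsL : 0 < s - L := by linarith
  have hθ0 : 0 ≤ θ := div_nonneg (by linarith) hsL.le
  have hθ1 : θ ≤ 1 := by rw [hθ, div_le_one hsL]; linarith
  have hc := pw2_convex (γ := γ) (σ := σ) hb r₁ r₂ x' y' p₁ p₂ θ hθ0 hθ1
  have hz : lx * ((1 - θ) * x' + θ * p₁) + ly * ((1 - θ) * y' + θ * p₂) + lc = 0 := by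
    have h3 : ε * (lx * ((1 - θ) * x' + θ * p₁) + ly * ((1 - θ) * y' + θ * p₂) + lc)
        = (1 - θ) * L + θ * s := by rw [← hp, hL]; ring
    have h4 : (1 - θ) * L + θ * s = 0 := by rw [hθ]; field_simp; ring
    have h5 : ε ≠ 0 := by rintro rfl; norm_num at hε
    rw [h4] at h3
    exact (mul_eq_zero.1 h3).resolve_left h5
  have h6 := hline _ _ hz
  have h7 := hmin p₁ p₂
  nlinarith

end Query

/-- Pruning: if the minimum points of `f` lie strictly inside a wedge on which the convex
function `f'` differs from `f` by a constant only, then `f'` can replace `f`. -/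
theorem prune_isMinPt {f f' : ℝ → ℝ → ℝ} {K l₁x l₁y l₁c l₂x l₂y l₂c : ℝ}
    (hf' : ∀ x y x' y' s, 0 ≤ s → s ≤ 1 → f' ((1 - s) * x + s * x') ((1 - s) * y + s * y')
      ≤ (1 - s) * f' x y + s * f' x' y')
    (heq : ∀ x y, 0 ≤ l₁x * x + l₁y * y + l₁c → 0 ≤ l₂x * x + l₂y * y + l₂c →
      f' x y + K = f x y)
    (hin : ∀ x y, IsMinPt f x y → 0 < l₁x * x + l₁y * y + l₁c ∧ 0 < l₂x * x + l₂y * y + l₂c)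
    (hex : ∃ x y, IsMinPt f x y) :
    (∃ x y, IsMinPt f' x y) ∧ ∀ x y, IsMinPt f' x y → IsMinPt f x y := by
  obtain ⟨x, y, hmin⟩ := hex
  obtain ⟨hx1, hx2⟩ := hin x y hmin
  have hfq := heq x y hx1.le hx2.le
  -- Along the segment towards `(x', y')`, this is positive exactly strictly inside the wedge.
  let ψ : ℝ → ℝ → ℝ → ℝ := fun x' y' s =>
    min (l₁x * ((1 - s) * x + s * x') + l₁y * ((1 - s) * y + s * y') + l₁c)
      (l₂x * ((1 - s) * x + s * x') + l₂y * ((1 - s) * y + s * y') + l₂c)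
  have hψc : ∀ x' y', Continuous (ψ x' y') := fun x' y' => by fun_prop
  have hψ0 : ∀ x' y', 0 < ψ x' y' 0 := fun x' y' => by
    simp only [ψ]; refine lt_min ?_ ?_ <;> simpa
  -- Near `(x, y)` the two functions differ by a constant, so this point is a local minimum of `f'`,
  -- and convexity makes it a global one.
  have hmin' : IsMinPt f' x y := by
    intro x' y'
    have hev : ∀ᶠ s in nhdsWithin (0 : ℝ) (Set.Ioi 0), 0 < ψ x' y' s :=
      ((hψc x' y').tendsto 0).mono_left nhdsWithin_le_nhds |>.eventually (lt_mem_nhds (hψ0 x' y'))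
    have hev1 : ∀ᶠ s in nhdsWithin (0 : ℝ) (Set.Ioi 0), s < 1 :=
      nhdsWithin_le_nhds (gt_mem_nhds one_pos)
    obtain ⟨s, ⟨hs, hs1⟩, hs0⟩ := ((hev.and hev1).and
      (self_mem_nhdsWithin : ∀ᶠ s in nhdsWithin (0 : ℝ) (Set.Ioi 0), s ∈ Set.Ioi 0)).exists
    have hs0 : 0 < s := hs0
    obtain ⟨h1, h2⟩ := lt_min_iff.1 hs
    have e := heq _ _ h1.le h2.le
    have h3 := hmin ((1 - s) * x + s * x') ((1 - s) * y + s * y')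
    have h4 := hf' x y x' y' s hs0.le hs1.le
    have : s * f' x y ≤ s * f' x' y' := by linarith
    exact le_of_mul_le_mul_left this hs0
  refine ⟨⟨x, y, hmin'⟩, fun x' y' h' => ?_⟩
  have hval : f' x' y' = f' x y := le_antisymm (h' _ _) (hmin' _ _)
  by_cases hins : 0 < ψ x' y' 1
  · obtain ⟨h1, h2⟩ := lt_min_iff.1 hins
    simp only [sub_self, zero_mul, one_mul, zero_add] at h1 h2
    have e := heq _ _ h1.le h2.le
    intro x'' y''
    rw [← e, hval, hfq]
    exact hmin _ _
  · exfalso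
    push Not at hins
    -- If a minimum point of `f'` were not strictly inside, the segment to it would meet the
    -- boundary of the wedge. By convexity that boundary point minimizes `f'`, hence also `f`,
    -- although all minimum points of `f` lie strictly inside.
    obtain ⟨s, ⟨hs0, hs1⟩, hs⟩ := intermediate_value_Icc' zero_le_one
      (hψc x' y').continuousOn (show (0 : ℝ) ∈ Set.Icc (ψ x' y' 1) (ψ x' y' 0) from
        ⟨hins, (hψ0 x' y').le⟩)
    have h1 : 0 ≤ ψ x' y' s := hs.ge
    obtain ⟨ha, hb⟩ := le_min_iff.1 h1
    have e := heq _ _ ha hb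
    have h4 := hf' x y x' y' s hs0 hs1
    rw [hval] at h4
    have hm : IsMinPt f ((1 - s) * x + s * x') ((1 - s) * y + s * y') := by
      intro x'' y''
      rw [← e]
      have := hmin x'' y''
      linarith
    obtain ⟨h5, h6⟩ := hin _ _ hm
    have := lt_min h5 h6
    change 0 < ψ x' y' s at this
    linarith

end Piecewise

/-! ### Minimizing along lines -/

section Lines

/-- The slopes and breakpoints for the minimization of a function of one variable. -/
def breakpoints : Cmd :=
  .rset 1 (.reg 10) ;;
  .forLoop 10 8
    (.rstore 3 (.reg 10) (.div (.get 6 (.reg 10)) (.get 7 (.reg 10))) ;;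
      .ite (.rle (.const 0) (.get 7 (.reg 10)))
        (.rstore 4 (.reg 10) (.mul (.get 8 (.reg 10)) (.get 7 (.reg 10))))
        (.rstore 4 (.reg 10) (.sub (.const 0) (.mul (.get 8 (.reg 10)) (.get 7 (.reg 10)))) ;;
          .rset 1 (.sub (.reg 1) (.mul (.get 8 (.reg 10)) (.get 7 (.reg 10))))))

/-- Minimize the function `pw1` with the data in arrays `6`, `7`, `8` and register `10`. -/
def minimize : Cmd :=
  breakpoints ;; (.iset 2 (.const 0) ;; .iset 3 (.reg 8)) ;; .call 0

theorem breakpoints_spec (procs : List Cmd) (s : Memory) :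
    ∃ t s', Exec procs breakpoints s t s' ∧ t ≤ (s.ireg 8 + 2) * 100 ∧
      (∀ v < s.ireg 8, s'.rarr 3 v = s.rarr 6 v / s.rarr 7 v) ∧
      (∀ v < s.ireg 8, s'.rarr 4 v = if 0 ≤ s.rarr 7 v then s.rarr 8 v * s.rarr 7 v else
        -(s.rarr 8 v * s.rarr 7 v)) ∧
      s'.rreg 1 = s.rreg 10 + ∑ v ∈ Finset.range (s.ireg 8),
        if 0 ≤ s.rarr 7 v then 0 else -(s.rarr 8 v * s.rarr 7 v) := by
  obtain ⟨t, s', hex, ht, ⟨h1, h2, h3⟩, -⟩ := exec_forLoop procs (i := 10) (m := 8)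
    (c := .rstore 3 (.reg 10) (.div (.get 6 (.reg 10)) (.get 7 (.reg 10))) ;;
      .ite (.rle (.const 0) (.get 7 (.reg 10)))
        (.rstore 4 (.reg 10) (.mul (.get 8 (.reg 10)) (.get 7 (.reg 10))))
        (.rstore 4 (.reg 10) (.sub (.const 0) (.mul (.get 8 (.reg 10)) (.get 7 (.reg 10)))) ;;
          .rset 1 (.sub (.reg 1) (.mul (.get 8 (.reg 10)) (.get 7 (.reg 10))))))
    rfl (by decide) (by decide) (by decide) (s := s.rset 1 (s.rreg 10)) (N := s.ireg 8) (by simp)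
    (fun k s' => (∀ v < k, s'.rarr 3 v = s.rarr 6 v / s.rarr 7 v) ∧
      (∀ v < k, s'.rarr 4 v = if 0 ≤ s.rarr 7 v then s.rarr 8 v * s.rarr 7 v else
        -(s.rarr 8 v * s.rarr 7 v)) ∧
      s'.rreg 1 = s.rreg 10 + ∑ v ∈ Finset.range k,
        if 0 ≤ s.rarr 7 v then 0 else -(s.rarr 8 v * s.rarr 7 v))
    (by simp)
    (by
      rintro j s1 hj hi hf ⟨h1, h2, h3⟩
      have e6 : s1.rarr 6 = s.rarr 6 := hf.rarr 6 (by decide)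
      have e7 : s1.rarr 7 = s.rarr 7 := hf.rarr 7 (by decide)
      have e8 : s1.rarr 8 = s.rarr 8 := hf.rarr 8 (by decide)
      simp only [Cmd.wp, IExp.eval, RExp.eval, BExp.Holds]
      simp only [iset_rreg, rset_rreg, rset_rarr, iset_rarr, rstore_rarr, rstore_ireg, rstore_rreg,
        Finset.sum_range_succ, hi, h3, e6, e7, e8, Nat.lt_succ_iff]
      norm_num
      refine ⟨fun h => ⟨?_, ?_, ?_⟩, fun h => ⟨?_, ?_, ?_⟩⟩
      · intro v hv
        rcases hv.lt_or_eq with h' | rfl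
        · simp [h'.ne, h1 v h']
        · simp
      · intro v hv
        rcases hv.lt_or_eq with h' | rfl
        · simp [h'.ne, h2 v h']
        · simp [h]
      · simp [h]
      · intro v hv
        rcases hv.lt_or_eq with h' | rfl
        · simp [h'.ne, h1 v h']
        · simp
      · intro v hv
        rcases hv.lt_or_eq with h' | rfl
        · simp [h'.ne, h2 v h']
        · simp [not_le.2 h]
      · simp [not_le.2 h]; ring)
  refine ⟨_, s', (Exec.rset 1 _ s).seq (by simpa [RExp.eval] using hex), ?_, h1, h2, h3⟩
  refine (add_le_add_right ht _).trans ?_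
  simp only [RExp.cost, Cmd.cost, IExp.cost, BExp.cost]
  omega

/-- The locations that `minimize` may write. -/
def minimizeWr : List Loc := .I 10 :: selectWr

set_option maxRecDepth 8000 in
theorem minimize_wr : minimize.wr selectWr ⊆ minimizeWr := by decide

/-- Boundedness from below yields, through `weighted_bounds`, that the selection target lies between
zero and the total weight. -/
theorem minimize_spec (s : Memory) (hb : ∀ v < s.ireg 8, 0 ≤ s.rarr 8 v)
    (hM : ∃ M, ∀ t, M ≤ pw1 (s.ireg 8) (s.rarr 6) (s.rarr 7) (s.rarr 8) (s.rreg 10) t) :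
    ∃ t s', Exec [select] minimize s t s' ∧ t ≤ (s.ireg 8 + 2) * 20200 ∧
      Frame minimizeWr s s' ∧
      ∀ u, pw1 (s.ireg 8) (s.rarr 6) (s.rarr 7) (s.rarr 8) (s.rreg 10) (s'.rreg 2)
        ≤ pw1 (s.ireg 8) (s.rarr 6) (s.rarr 7) (s.rarr 8) (s.rreg 10) u := by
  obtain ⟨t1, s1, E1, ht1, hτ, hω, hα⟩ := breakpoints_spec [select] s
  have F1 := E1.frame (P := selectWr) select_wr
  obtain ⟨C, hC⟩ := pw1_eq_weighted (r := s.rreg 10) hτ hω hα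
  obtain ⟨M, hM⟩ := hM
  have hbd := weighted_bounds (M := M - C) (fun t => by have := hM t; rw [hC] at this; linarith)
  have hω0 : ∀ v < s.ireg 8, 0 ≤ s1.rarr 4 v := by
    intro v hv
    rw [hω v hv]
    split_ifs with h
    · exact mul_nonneg (hb v hv) h
    · exact neg_nonneg.2 (mul_nonpos_of_nonneg_of_nonpos (hb v hv) (not_le.1 h).le)
  obtain ⟨t2, s2, E2, ht2, rfl⟩ := exec_straight [select]
    (c := .iset 2 (.const 0) ;; .iset 3 (.reg 8)) rfl (s := s1)
    (Q := fun s' => s' = (s1.iset 2 0).iset 3 (s.ireg 8))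
    (by simp [Cmd.wp, IExp.eval, F1.ireg 8 (by decide)])
  obtain ⟨t3, s3, E3, ht3, -, -, hle, hge⟩ := select_spec (s.ireg 8)
    ((s1.iset 2 0).iset 3 (s.ireg 8)) (by simp) (by simpa using hω0) (by simpa using hbd.1)
    (by simpa using hbd.2)
  have E := E1.seq (E2.seq E3)
  refine ⟨_, s3, E, ?_, (E.frame select_wr).mono minimize_wr, fun u => ?_⟩
  · simp only [Cmd.cost, IExp.cost] at ht2
    omega
  · rw [hC, hC]
    have := weighted_min hω0 (by simpa using hle) (by simpa using hge) u
    linarith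

/-- Fill the arrays for the minimization of `pw2` along a line. -/
def fillLine : Cmd :=
  .rset 10 (.add (.mul (.reg 11) (.reg 15)) (.mul (.reg 12) (.reg 16))) ;;
  .forLoop 10 8
    (.rstore 6 (.reg 10) (.sub (.sub (.get 9 (.reg 10)) (.mul (.get 10 (.reg 10)) (.reg 13)))
        (.reg 14)) ;;
      .rstore 7 (.reg 10) (.add (.mul (.get 10 (.reg 10)) (.reg 15)) (.reg 16)) ;;
      .rstore 8 (.reg 10) (.get 11 (.reg 10)))

/-- Minimize `pw2` along the line through the point in registers `13` and `14` with the direction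
in registers `15` and `16`; the result is a point in registers `21` and `22`. -/
def minimizeLine : Cmd :=
  fillLine ;; minimize ;;
  (.rset 21 (.add (.reg 13) (.mul (.reg 2) (.reg 15))) ;;
    .rset 22 (.add (.reg 14) (.mul (.reg 2) (.reg 16))))

/-- The function of two variables with the data in arrays `9`, `10`, `11`. -/
noncomputable def Memory.pw2 (s : Memory) : ℝ → ℝ → ℝ :=
  ImprovableKnapsack.pw2 (s.ireg 8) (s.rarr 9) (s.rarr 10) (s.rarr 11) (s.rreg 11) (s.rreg 12)

theorem fillLine_spec (procs : List Cmd) (s : Memory) :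
    ∃ t s', Exec procs fillLine s t s' ∧ t ≤ (s.ireg 8 + 2) * 100 ∧
      (∀ v < s.ireg 8, s'.rarr 6 v = s.rarr 9 v - s.rarr 10 v * s.rreg 13 - s.rreg 14 ∧
        s'.rarr 7 v = s.rarr 10 v * s.rreg 15 + s.rreg 16 ∧ s'.rarr 8 v = s.rarr 11 v) ∧
      s'.rreg 10 = s.rreg 11 * s.rreg 15 + s.rreg 12 * s.rreg 16 := by
  obtain ⟨t, s', hex, ht, h1, hf⟩ := exec_forLoop procs (i := 10) (m := 8)
    (c := .rstore 6 (.reg 10) (.sub (.sub (.get 9 (.reg 10)) (.mul (.get 10 (.reg 10)) (.reg 13)))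
        (.reg 14)) ;;
      .rstore 7 (.reg 10) (.add (.mul (.get 10 (.reg 10)) (.reg 15)) (.reg 16)) ;;
      .rstore 8 (.reg 10) (.get 11 (.reg 10)))
    rfl (by decide) (by decide) (by decide)
    (s := s.rset 10 (s.rreg 11 * s.rreg 15 + s.rreg 12 * s.rreg 16)) (N := s.ireg 8) (by simp)
    (fun k s' => ∀ v < k, s'.rarr 6 v = s.rarr 9 v - s.rarr 10 v * s.rreg 13 - s.rreg 14 ∧
        s'.rarr 7 v = s.rarr 10 v * s.rreg 15 + s.rreg 16 ∧ s'.rarr 8 v = s.rarr 11 v)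
    (by simp)
    (by
      rintro j s1 hj hi hf h1
      have e9 : s1.rarr 9 = s.rarr 9 := hf.rarr 9 (by decide)
      have e10 : s1.rarr 10 = s.rarr 10 := hf.rarr 10 (by decide)
      have e11 : s1.rarr 11 = s.rarr 11 := hf.rarr 11 (by decide)
      have r13 : s1.rreg 13 = s.rreg 13 := (hf.rreg 13 (by decide)).trans (by simp)
      have r14 : s1.rreg 14 = s.rreg 14 := (hf.rreg 14 (by decide)).trans (by simp)
      have r15 : s1.rreg 15 = s.rreg 15 := (hf.rreg 15 (by decide)).trans (by simp)
      have r16 : s1.rreg 16 = s.rreg 16 := (hf.rreg 16 (by decide)).trans (by simp)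
      simp only [Cmd.wp, IExp.eval, RExp.eval]
      intro v hv
      rcases (Nat.lt_succ_iff.1 hv).lt_or_eq with h' | rfl
      · simp [hi, h'.ne, h1 v h']
      · simp [hi, e9, e10, e11, r13, r14, r15, r16])
  refine ⟨_, s', (Exec.rset 10 _ s).seq (by simpa [RExp.eval] using hex), ?_, h1, ?_⟩
  · refine (add_le_add_right ht _).trans ?_
    simp only [RExp.cost, Cmd.cost, IExp.cost]
    omega
  · rw [hf.rreg 10 (by decide)]; simp

theorem pw1_congr {m : ℕ} {g a b g' a' b' : ℕ → ℝ} {r t : ℝ}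
    (h : ∀ v < m, g v = g' v ∧ a v = a' v ∧ b v = b' v) : pw1 m g a b r t = pw1 m g' a' b' r t := by
  simp only [pw1]
  congr 1
  refine Finset.sum_congr rfl fun v hv => ?_
  obtain ⟨h1, h2, h3⟩ := h v (Finset.mem_range.1 hv)
  rw [h1, h2, h3]

/-- The locations that the minimization along a line may write. -/
def queryWr : List Loc :=
  [.R 10, .R 19, .R 21, .R 22, .R 23, .R 24, .RA 6, .RA 7, .RA 8] ++ minimizeWr

set_option maxRecDepth 8000 in
theorem minimizeLine_wr : minimizeLine.wr selectWr ⊆ queryWr := by decide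

theorem minimizeLine_spec (s : Memory) (hb : ∀ v < s.ireg 8, 0 ≤ s.rarr 11 v)
    (hex : ∃ x y, IsMinPt s.pw2 x y) :
    ∃ t s', Exec [select] minimizeLine s t s' ∧ t ≤ (s.ireg 8 + 2) * 20400 ∧
      Frame queryWr s s' ∧
      (∃ t, s'.rreg 21 = s.rreg 13 + t * s.rreg 15 ∧ s'.rreg 22 = s.rreg 14 + t * s.rreg 16) ∧
      ∀ t, s.pw2 (s'.rreg 21) (s'.rreg 22)
        ≤ s.pw2 (s.rreg 13 + t * s.rreg 15) (s.rreg 14 + t * s.rreg 16) := by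
  obtain ⟨t1, s1, E1, ht1, h1, h10⟩ := fillLine_spec [select] s
  have F1 := E1.frame (P := selectWr) select_wr
  have e8 : s1.ireg 8 = s.ireg 8 := F1.ireg 8 (by decide)
  have hline : ∀ t, s.pw2 (s.rreg 13 + t * s.rreg 15) (s.rreg 14 + t * s.rreg 16)
      = s.rreg 11 * s.rreg 13 + s.rreg 12 * s.rreg 14 +
        pw1 (s1.ireg 8) (s1.rarr 6) (s1.rarr 7) (s1.rarr 8) (s1.rreg 10) t := by
    intro t
    rw [Memory.pw2, pw2_line, h10, e8]
    congr 1
    refine pw1_congr fun v hv => ?_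
    obtain ⟨a, b, c⟩ := h1 v hv
    exact ⟨a.symm, b.symm, c.symm⟩
  obtain ⟨x, y, hmin⟩ := hex
  obtain ⟨t2, s2, E2, ht2, F2, h2⟩ := minimize_spec s1
    (by intro v hv; rw [e8] at hv; rw [(h1 v hv).2.2]; exact hb v hv)
    ⟨s.pw2 x y - (s.rreg 11 * s.rreg 13 + s.rreg 12 * s.rreg 14), fun t => by
      have := hmin (s.rreg 13 + t * s.rreg 15) (s.rreg 14 + t * s.rreg 16)
      rw [hline] at this; linarith⟩
  have r13 : s2.rreg 13 = s.rreg 13 := (F2.rreg 13 (by decide)).trans (F1.rreg 13 (by decide))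
  have r14 : s2.rreg 14 = s.rreg 14 := (F2.rreg 14 (by decide)).trans (F1.rreg 14 (by decide))
  have r15 : s2.rreg 15 = s.rreg 15 := (F2.rreg 15 (by decide)).trans (F1.rreg 15 (by decide))
  have r16 : s2.rreg 16 = s.rreg 16 := (F2.rreg 16 (by decide)).trans (F1.rreg 16 (by decide))
  obtain ⟨t3, s3, E3, ht3, h21, h22⟩ := exec_straight [select]
    (c := .rset 21 (.add (.reg 13) (.mul (.reg 2) (.reg 15))) ;;
      .rset 22 (.add (.reg 14) (.mul (.reg 2) (.reg 16)))) rfl (s := s2)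
    (Q := fun s' => s'.rreg 21 = s.rreg 13 + s2.rreg 2 * s.rreg 15 ∧
      s'.rreg 22 = s.rreg 14 + s2.rreg 2 * s.rreg 16)
    (by simp [Cmd.wp, RExp.eval, r13, r14, r15, r16])
  have E := E1.seq (E2.seq E3)
  refine ⟨_, s3, E, ?_, (E.frame select_wr).mono minimizeLine_wr, ⟨_, h21, h22⟩, fun t => ?_⟩
  · simp only [Cmd.cost, RExp.cost] at ht3
    rw [e8] at ht2
    omega
  · rw [h21, h22, hline, hline]
    have := h2 t
    linarith

/-- Fill the arrays for the minimization of the directional derivative at the point in registers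
`21` and `22`, over the directions that consist of the direction in registers `17` and `18` with
the sign in register `19` and a multiple of the direction in registers `15` and `16`. -/
def fillDeriv : Cmd :=
  .rset 10 (.add (.mul (.reg 11) (.reg 15)) (.mul (.reg 12) (.reg 16))) ;;
  .rset 23 (.add (.mul (.reg 11) (.reg 17)) (.mul (.reg 12) (.reg 18))) ;;
  .forLoop 10 8
    (.rset 5 (.sub (.sub (.get 9 (.reg 10)) (.mul (.get 10 (.reg 10)) (.reg 21))) (.reg 22)) ;;
      .rset 6 (.add (.mul (.get 10 (.reg 10)) (.reg 17)) (.reg 18)) ;;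
      .rset 7 (.add (.mul (.get 10 (.reg 10)) (.reg 15)) (.reg 16)) ;;
      .rstore 6 (.reg 10) (.sub (.const 0) (.mul (.reg 19) (.reg 6))) ;;
      .rstore 7 (.reg 10) (.reg 7) ;;
      .ite (.rle (.const 0) (.reg 5))
        (.ite (.rle (.reg 5) (.const 0)) (.rstore 8 (.reg 10) (.get 11 (.reg 10)))
          (.rstore 8 (.reg 10) (.const 0) ;;
            .rset 10 (.sub (.reg 10) (.mul (.get 11 (.reg 10)) (.reg 7))) ;;
            .rset 23 (.sub (.reg 23) (.mul (.get 11 (.reg 10)) (.reg 6)))))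
        (.rstore 8 (.reg 10) (.const 0)))

/-- The directional derivative at the minimizing direction. -/
def evalDeriv : Cmd :=
  .rset 24 (.add (.mul (.reg 19) (.reg 23)) (.mul (.reg 10) (.reg 2))) ;;
  .forLoop 10 8
    (.rset 5 (.sub (.get 6 (.reg 10)) (.mul (.get 7 (.reg 10)) (.reg 2))) ;;
      .ite (.rle (.const 0) (.reg 5))
        (.rset 24 (.add (.reg 24) (.mul (.get 8 (.reg 10)) (.reg 5)))) .skip)

theorem fillDeriv_spec (procs : List Cmd) (s : Memory) :
    ∃ t s', Exec procs fillDeriv s t s' ∧ t ≤ (s.ireg 8 + 2) * 200 ∧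
      (∀ v < s.ireg 8,
        s'.rarr 6 v = -(s.rreg 19 * (s.rarr 10 v * s.rreg 17 + s.rreg 18)) ∧
        s'.rarr 7 v = s.rarr 10 v * s.rreg 15 + s.rreg 16 ∧
        s'.rarr 8 v = if s.rarr 9 v - s.rarr 10 v * s.rreg 21 - s.rreg 22 = 0 then s.rarr 11 v
          else 0) ∧
      s'.rreg 10 = s.rreg 11 * s.rreg 15 + s.rreg 12 * s.rreg 16
        - ∑ v ∈ Finset.range (s.ireg 8),
          (if s.rarr 9 v - s.rarr 10 v * s.rreg 21 - s.rreg 22 = 0 then 0 else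
          if 0 ≤ s.rarr 9 v - s.rarr 10 v * s.rreg 21 - s.rreg 22 then
            s.rarr 11 v * (s.rarr 10 v * s.rreg 15 + s.rreg 16) else 0) ∧
      s'.rreg 23 = s.rreg 11 * s.rreg 17 + s.rreg 12 * s.rreg 18
        - ∑ v ∈ Finset.range (s.ireg 8),
          (if s.rarr 9 v - s.rarr 10 v * s.rreg 21 - s.rreg 22 = 0 then 0 else
          if 0 ≤ s.rarr 9 v - s.rarr 10 v * s.rreg 21 - s.rreg 22 then
            s.rarr 11 v * (s.rarr 10 v * s.rreg 17 + s.rreg 18) else 0) := by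
  obtain ⟨t, s', hex, ht, ⟨h1, h2, h3⟩, hf⟩ := exec_forLoop procs (i := 10) (m := 8)
    (c := .rset 5 (.sub (.sub (.get 9 (.reg 10)) (.mul (.get 10 (.reg 10)) (.reg 21)))
        (.reg 22)) ;;
      .rset 6 (.add (.mul (.get 10 (.reg 10)) (.reg 17)) (.reg 18)) ;;
      .rset 7 (.add (.mul (.get 10 (.reg 10)) (.reg 15)) (.reg 16)) ;;
      .rstore 6 (.reg 10) (.sub (.const 0) (.mul (.reg 19) (.reg 6))) ;;
      .rstore 7 (.reg 10) (.reg 7) ;;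
      .ite (.rle (.const 0) (.reg 5))
        (.ite (.rle (.reg 5) (.const 0)) (.rstore 8 (.reg 10) (.get 11 (.reg 10)))
          (.rstore 8 (.reg 10) (.const 0) ;;
            .rset 10 (.sub (.reg 10) (.mul (.get 11 (.reg 10)) (.reg 7))) ;;
            .rset 23 (.sub (.reg 23) (.mul (.get 11 (.reg 10)) (.reg 6)))))
        (.rstore 8 (.reg 10) (.const 0)))
    rfl (by decide) (by decide) (by decide)
    (s := (s.rset 10 (s.rreg 11 * s.rreg 15 + s.rreg 12 * s.rreg 16)).rset 23
      (s.rreg 11 * s.rreg 17 + s.rreg 12 * s.rreg 18)) (N := s.ireg 8) (by simp)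
    (fun k s' => (∀ v < k,
        s'.rarr 6 v = -(s.rreg 19 * (s.rarr 10 v * s.rreg 17 + s.rreg 18)) ∧
        s'.rarr 7 v = s.rarr 10 v * s.rreg 15 + s.rreg 16 ∧
        s'.rarr 8 v = if s.rarr 9 v - s.rarr 10 v * s.rreg 21 - s.rreg 22 = 0 then s.rarr 11 v
          else 0) ∧
      s'.rreg 10 = s.rreg 11 * s.rreg 15 + s.rreg 12 * s.rreg 16
        - ∑ v ∈ Finset.range k,
          (if s.rarr 9 v - s.rarr 10 v * s.rreg 21 - s.rreg 22 = 0 then 0 else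
          if 0 ≤ s.rarr 9 v - s.rarr 10 v * s.rreg 21 - s.rreg 22 then
            s.rarr 11 v * (s.rarr 10 v * s.rreg 15 + s.rreg 16) else 0) ∧
      s'.rreg 23 = s.rreg 11 * s.rreg 17 + s.rreg 12 * s.rreg 18
        - ∑ v ∈ Finset.range k,
          (if s.rarr 9 v - s.rarr 10 v * s.rreg 21 - s.rreg 22 = 0 then 0 else
          if 0 ≤ s.rarr 9 v - s.rarr 10 v * s.rreg 21 - s.rreg 22 then
            s.rarr 11 v * (s.rarr 10 v * s.rreg 17 + s.rreg 18) else 0))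
    (by simp)
    (by
      rintro j s1 hj hi hf ⟨h1, h2, h3⟩
      have e9 : s1.rarr 9 = s.rarr 9 := hf.rarr 9 (by decide)
      have e10 : s1.rarr 10 = s.rarr 10 := hf.rarr 10 (by decide)
      have e11 : s1.rarr 11 = s.rarr 11 := hf.rarr 11 (by decide)
      have r15 : s1.rreg 15 = s.rreg 15 := (hf.rreg 15 (by decide)).trans (by simp)
      have r16 : s1.rreg 16 = s.rreg 16 := (hf.rreg 16 (by decide)).trans (by simp)
      have r17 : s1.rreg 17 = s.rreg 17 := (hf.rreg 17 (by decide)).trans (by simp)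
      have r18 : s1.rreg 18 = s.rreg 18 := (hf.rreg 18 (by decide)).trans (by simp)
      have r19 : s1.rreg 19 = s.rreg 19 := (hf.rreg 19 (by decide)).trans (by simp)
      have r21 : s1.rreg 21 = s.rreg 21 := (hf.rreg 21 (by decide)).trans (by simp)
      have r22 : s1.rreg 22 = s.rreg 22 := (hf.rreg 22 (by decide)).trans (by simp)
      simp only [Cmd.wp, IExp.eval, RExp.eval, BExp.Holds]
      simp only [iset_rreg, rset_rreg, rset_rarr, rset_ireg, iset_rarr, rstore_rarr, rstore_ireg,
        rstore_rreg, Finset.sum_range_succ, hi, h2, h3, e9, e10, e11, r15, r16, r17, r18, r19, r21,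
        r22, Nat.lt_succ_iff]
      generalize hg : s.rarr 9 j - s.rarr 10 j * s.rreg 21 - s.rreg 22 = g
      simp [-sub_nonneg]
      refine ⟨fun ha => ⟨fun hb => ?_, fun hb => ?_⟩, fun ha => ?_⟩
      · have h0 : g = 0 := le_antisymm hb ha
        refine ⟨?_, by simp [h0], by simp [h0]⟩
        intro v hv
        rcases hv.lt_or_eq with h' | rfl
        · simpa [h'.ne] using h1 v h'
        · simp [hg, h0]
      · refine ⟨?_, by simp [hb.ne', ha]; ring, by simp [hb.ne', ha]; ring⟩
        intro v hv
        rcases hv.lt_or_eq with h' | rfl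
        · simpa [h'.ne] using h1 v h'
        · simp [hg, hb.ne']
      · refine ⟨?_, by simp [ha.ne, not_le.2 ha], by simp [ha.ne, not_le.2 ha]⟩
        intro v hv
        rcases hv.lt_or_eq with h' | rfl
        · simpa [h'.ne] using h1 v h'
        · simp [hg, ha.ne])
  refine ⟨_, s', (Exec.rset 10 _ s).seq ((Exec.rset 23 _ _).seq (by simpa [RExp.eval] using hex)),
    ?_, h1, h2, h3⟩
  refine (add_le_add_right (add_le_add_right ht _) _).trans ?_
  simp only [RExp.cost, Cmd.cost, IExp.cost, BExp.cost]
  omega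

theorem evalDeriv_spec (procs : List Cmd) (s : Memory) :
    ∃ t s', Exec procs evalDeriv s t s' ∧ t ≤ (s.ireg 8 + 2) * 100 ∧
      s'.rreg 24 = s.rreg 19 * s.rreg 23 +
        pw1 (s.ireg 8) (s.rarr 6) (s.rarr 7) (s.rarr 8) (s.rreg 10) (s.rreg 2) := by
  obtain ⟨t, s', hex, ht, h1, hf⟩ := exec_forLoop procs (i := 10) (m := 8)
    (c := .rset 5 (.sub (.get 6 (.reg 10)) (.mul (.get 7 (.reg 10)) (.reg 2))) ;;
      .ite (.rle (.const 0) (.reg 5))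
        (.rset 24 (.add (.reg 24) (.mul (.get 8 (.reg 10)) (.reg 5)))) .skip)
    rfl (by decide) (by decide) (by decide)
    (s := s.rset 24 (s.rreg 19 * s.rreg 23 + s.rreg 10 * s.rreg 2)) (N := s.ireg 8) (by simp)
    (fun k s' => s'.rreg 24 = s.rreg 19 * s.rreg 23 +
        pw1 k (s.rarr 6) (s.rarr 7) (s.rarr 8) (s.rreg 10) (s.rreg 2))
    (by simp [pw1])
    (by
      rintro j s1 hj hi hf h1
      have e6 : s1.rarr 6 = s.rarr 6 := hf.rarr 6 (by decide)
      have e7 : s1.rarr 7 = s.rarr 7 := hf.rarr 7 (by decide)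
      have e8 : s1.rarr 8 = s.rarr 8 := hf.rarr 8 (by decide)
      have r2 : s1.rreg 2 = s.rreg 2 := (hf.rreg 2 (by decide)).trans (by simp)
      simp only [Cmd.wp, IExp.eval, RExp.eval, BExp.Holds]
      simp only [iset_rreg, rset_rreg, rset_rarr, rset_ireg, hi, h1, e6, e7, e8, r2, pw1,
        Finset.sum_range_succ]
      generalize s.rarr 6 j - s.rarr 7 j * s.rreg 2 = g
      simp [-sub_nonneg]
      refine ⟨fun h => ?_, fun h => ?_⟩
      · rw [max_eq_left (by linarith)]; ring
      · right; linarith)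
  refine ⟨_, s', (Exec.rset 24 _ s).seq (by simpa [RExp.eval] using hex), ?_, h1⟩
  refine (add_le_add_right ht _).trans ?_
  simp only [RExp.cost, Cmd.cost, IExp.cost, BExp.cost]
  omega

end Lines

/-! ### The oracle for the side of a line -/

section Query

/-- Minimize the directional derivative at the point in registers `21` and `22`; register `2`
receives the multiple of the direction of the line, and register `24` the derivative. -/
def steepest : Cmd := fillDeriv ;; minimize ;; evalDeriv

/-- The locations that `steepest` may write. -/
def steepestWr : List Loc :=
  [.R 10, .R 23, .R 24, .RA 6, .RA 7, .RA 8] ++ minimizeWr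

set_option maxRecDepth 8000 in
theorem steepest_wr : steepest.wr selectWr ⊆ steepestWr := by decide

/-- The directional derivative, at the point in registers `21` and `22`, in the direction given by
the sign `ε` and the multiple `u`. -/
noncomputable def Memory.deriv (s : Memory) (ε u : ℝ) : ℝ :=
  pw2Deriv (s.ireg 8) (s.rarr 9) (s.rarr 10) (s.rarr 11) (s.rreg 11) (s.rreg 12)
    (s.rreg 21) (s.rreg 22) (ε * s.rreg 17 + u * s.rreg 15) (ε * s.rreg 18 + u * s.rreg 16)

/-- Minimality along the line is what bounds the derivative below over all directions to one side,
so that its minimum in `u` can be computed. -/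
theorem steepest_spec (s : Memory) (hb : ∀ v < s.ireg 8, 0 ≤ s.rarr 11 v)
    (hline : ∀ t, s.pw2 (s.rreg 21) (s.rreg 22)
      ≤ s.pw2 (s.rreg 21 + t * s.rreg 15) (s.rreg 22 + t * s.rreg 16)) :
    ∃ t s', Exec [select] steepest s t s' ∧ t ≤ (s.ireg 8 + 2) * 20500 ∧ Frame steepestWr s s' ∧
      s'.rreg 24 = s.deriv (s.rreg 19) (s'.rreg 2) ∧
      ∀ u, s'.rreg 24 ≤ s.deriv (s.rreg 19) u := by
  obtain ⟨t1, s1, E1, ht1, h1, h10, h23⟩ := fillDeriv_spec [select] s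
  have F1 := E1.frame (P := selectWr) select_wr
  have e8 : s1.ireg 8 = s.ireg 8 := F1.ireg 8 (by decide)
  have e19 : s1.rreg 19 = s.rreg 19 := F1.rreg 19 (by decide)
  have hd : ∀ u, s.deriv (s.rreg 19) u = s.rreg 19 * s1.rreg 23 +
      pw1 (s1.ireg 8) (s1.rarr 6) (s1.rarr 7) (s1.rarr 8) (s1.rreg 10) u := by
    intro u
    rw [Memory.deriv, pw2Deriv_line, h10, h23, e8]
    congr 1
    refine pw1_congr fun v hv => ?_
    obtain ⟨a, b, c⟩ := h1 v hv
    exact ⟨a.symm, b.symm, c.symm⟩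
  obtain ⟨M, hM⟩ := deriv_bddBelow (ex := s.rreg 17) (ey := s.rreg 18) hb hline (s.rreg 19)
  obtain ⟨t2, s2, E2, ht2, F2, h2⟩ := minimize_spec s1
    (by
      intro v hv; rw [e8] at hv; rw [(h1 v hv).2.2]
      split_ifs
      · exact hb v hv
      · exact le_rfl)
    ⟨M - s.rreg 19 * s1.rreg 23, fun u => by
      have := hM u
      rw [← Memory.deriv, hd] at this
      linarith⟩
  obtain ⟨t3, s3, E3, ht3, h3⟩ := evalDeriv_spec [select] s2
  have F3 := E3.frame (P := selectWr) select_wr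
  have a6 : s2.rarr 6 = s1.rarr 6 := F2.rarr 6 (by decide)
  have a7 : s2.rarr 7 = s1.rarr 7 := F2.rarr 7 (by decide)
  have a8 : s2.rarr 8 = s1.rarr 8 := F2.rarr 8 (by decide)
  have r8 : s2.ireg 8 = s1.ireg 8 := F2.ireg 8 (by decide)
  have r19 : s2.rreg 19 = s1.rreg 19 := F2.rreg 19 (by decide)
  have r23 : s2.rreg 23 = s1.rreg 23 := F2.rreg 23 (by decide)
  have r10 : s2.rreg 10 = s1.rreg 10 := F2.rreg 10 (by decide)
  have e2 : s3.rreg 2 = s2.rreg 2 := F3.rreg 2 (by decide)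
  have E := E1.seq (E2.seq E3)
  have h24 : s3.rreg 24 = s.deriv (s.rreg 19) (s3.rreg 2) := by
    rw [hd, e2, h3, a6, a7, a8, r8, r19, r23, r10, e19]
  refine ⟨_, s3, E, ?_, (E.frame select_wr).mono steepest_wr, h24, fun u => ?_⟩
  · rw [r8] at ht3
    rw [e8] at ht2 ht3
    omega
  · rw [h24, hd, hd, e2]
    have := h2 u
    linarith

/-- Determine on which side of a line the minimum points of `pw2` are. The line is given by a base
point (registers `13`, `14`) and a direction (registers `15`, `16`), its sides by a vector
(registers `17`, `18`); register `19` receives the sign of the side, or zero if the point in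
registers `21` and `22` is a minimum point. -/
def query : Cmd :=
  minimizeLine ;; .rset 19 (.const 1) ;; steepest ;;
    .ite (.rle (.const 0) (.reg 24))
      (.rset 19 (.const (-1)) ;; steepest ;;
        .ite (.rle (.const 0) (.reg 24)) (.rset 19 (.const 0)) .skip) .skip

set_option maxRecDepth 8000 in
theorem query_wr : query.wr selectWr ⊆ queryWr := by decide

theorem Memory.pw2_congr {s s' : Memory} (h8 : s'.ireg 8 = s.ireg 8) (h9 : s'.rarr 9 = s.rarr 9)
    (h10 : s'.rarr 10 = s.rarr 10) (h11 : s'.rarr 11 = s.rarr 11) (r11 : s'.rreg 11 = s.rreg 11)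
    (r12 : s'.rreg 12 = s.rreg 12) : s'.pw2 = s.pw2 := by
  unfold Memory.pw2
  rw [h8, h9, h10, h11, r11, r12]

-- At the best point of the line, a descending direction to one side forces all minimum points
-- strictly to that side; if there is none on either side, the point is globally minimal. The line
-- enters both as the equation `lx * x + ly * y + lc = 0` and as a parametrization, and the
-- transversal direction is scaled to raise the left side by one.
set_option maxHeartbeats 1000000 in
theorem query_spec (s : Memory) (hb : ∀ v < s.ireg 8, 0 ≤ s.rarr 11 v)
    (hex : ∃ x y, IsMinPt s.pw2 x y) {lx ly lc : ℝ}
    (hline : ∀ x y, lx * x + ly * y + lc = 0 →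
      ∃ t, x = s.rreg 13 + t * s.rreg 15 ∧ y = s.rreg 14 + t * s.rreg 16)
    (hbase : lx * s.rreg 13 + ly * s.rreg 14 + lc = 0)
    (hd : lx * s.rreg 15 + ly * s.rreg 16 = 0) (he : lx * s.rreg 17 + ly * s.rreg 18 = 1)
    (hdet : s.rreg 15 * s.rreg 18 - s.rreg 16 * s.rreg 17 ≠ 0) :
    ∃ t s', Exec [select] query s t s' ∧ t ≤ (s.ireg 8 + 2) * 61500 ∧ Frame queryWr s s' ∧
      (s'.rreg 19 = 0 ∧ IsMinPt s.pw2 (s'.rreg 21) (s'.rreg 22) ∨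
      (s'.rreg 19 = 1 ∨ s'.rreg 19 = -1) ∧
        ∀ x y, IsMinPt s.pw2 x y → 0 < s'.rreg 19 * (lx * x + ly * y + lc)) := by
  obtain ⟨t1, s1, E1, ht1, F1, ⟨τ, h21, h22⟩, hm⟩ := minimizeLine_spec s hb hex
  have hq : lx * s1.rreg 21 + ly * s1.rreg 22 + lc = 0 := by
    rw [h21, h22]; linear_combination hbase + τ * hd
  have hl : ∀ x' y', lx * x' + ly * y' + lc = 0 →
      s.pw2 (s1.rreg 21) (s1.rreg 22) ≤ s.pw2 x' y' := by
    intro x' y' h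
    obtain ⟨t, rfl, rfl⟩ := hline x' y' h
    exact hm t
  have hl' : ∀ t, s.pw2 (s1.rreg 21) (s1.rreg 22)
      ≤ s.pw2 (s1.rreg 21 + t * s.rreg 15) (s1.rreg 22 + t * s.rreg 16) := fun t =>
    hl _ _ (by linear_combination hq + t * hd)
  have key : ∀ (ε : ℝ) (s0 : Memory), Frame steepestWr (s1.rset 19 ε) s0 → ∃ t s',
      Exec [select] steepest (s0.rset 19 ε) t s' ∧ t ≤ (s.ireg 8 + 2) * 20500 ∧
      Frame steepestWr (s0.rset 19 ε) s' ∧ (∃ u, s'.rreg 24 = pw2Deriv (s.ireg 8) (s.rarr 9)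
        (s.rarr 10) (s.rarr 11) (s.rreg 11) (s.rreg 12) (s1.rreg 21) (s1.rreg 22)
        (ε * s.rreg 17 + u * s.rreg 15) (ε * s.rreg 18 + u * s.rreg 16)) ∧
      ∀ u, s'.rreg 24 ≤ pw2Deriv (s.ireg 8) (s.rarr 9)
        (s.rarr 10) (s.rarr 11) (s.rreg 11) (s.rreg 12) (s1.rreg 21) (s1.rreg 22)
        (ε * s.rreg 17 + u * s.rreg 15) (ε * s.rreg 18 + u * s.rreg 16) := by
    intro ε s0 F0
    have g8 : s0.ireg 8 = s.ireg 8 := (F0.ireg 8 (by decide)).trans (F1.ireg 8 (by decide))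
    have a9 : s0.rarr 9 = s.rarr 9 := (F0.rarr 9 (by decide)).trans (F1.rarr 9 (by decide))
    have a10 : s0.rarr 10 = s.rarr 10 := (F0.rarr 10 (by decide)).trans (F1.rarr 10 (by decide))
    have a11 : s0.rarr 11 = s.rarr 11 := (F0.rarr 11 (by decide)).trans (F1.rarr 11 (by decide))
    have hr : ∀ r, r ≠ 19 → Loc.R r ∉ steepestWr → (s0.rset 19 ε).rreg r = s1.rreg r := by
      intro r h19 hr
      rw [rset_rreg, if_neg h19, F0.rreg r hr, rset_rreg, if_neg h19]
    have hr' : ∀ r, r ≠ 19 → Loc.R r ∉ steepestWr → Loc.R r ∉ queryWr →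
        (s0.rset 19 ε).rreg r = s.rreg r := fun r h1 h2 h3 => (hr r h1 h2).trans (F1.rreg r h3)
    have r11 := hr' 11 (by decide) (by decide) (by decide)
    have r12 := hr' 12 (by decide) (by decide) (by decide)
    have r15 := hr' 15 (by decide) (by decide) (by decide)
    have r16 := hr' 16 (by decide) (by decide) (by decide)
    have r17 := hr' 17 (by decide) (by decide) (by decide)
    have r18 := hr' 18 (by decide) (by decide) (by decide)
    have r21 := hr 21 (by decide) (by decide)
    have r22 := hr 22 (by decide) (by decide)
    have hp : (s0.rset 19 ε).pw2 = s.pw2 := Memory.pw2_congr g8 a9 a10 a11 r11 r12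
    obtain ⟨t, s', E, ht, F, h24, hle⟩ := steepest_spec (s0.rset 19 ε)
      (by simpa only [rset_ireg, rset_rarr, g8, a11] using hb)
      (by rw [hp, r15, r16, r21, r22]; exact hl')
    have hε : (s0.rset 19 ε).rreg 19 = ε := by simp
    simp only [Memory.deriv, rset_ireg, rset_rarr, g8, a9, a10, a11, r11, r12, r15, r16, r17, r18,
      r21, r22, hε] at h24 hle
    refine ⟨t, s', E, ?_, F, ⟨_, h24⟩, hle⟩
    rw [rset_ireg, g8] at ht
    exact ht
  obtain ⟨t2, s2, E2, ht2, F2, ⟨u2, h2⟩, h2'⟩ := key 1 (s1.rset 19 1) (Frame.refl _ _)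
  have e2 : (s1.rset 19 1).rset 19 1 = s1.rset 19 1 := by simp [Memory.rset]
  rw [e2] at E2 F2
  have E2' : Exec [select] (.rset 19 (.const 1)) s1 (1 + (RExp.const 1).cost) (s1.rset 19 1) := by
    have := Exec.rset (procs := [select]) 19 (.const 1) s1
    simpa [RExp.eval] using this
  have r19 : s2.rreg 19 = 1 := (F2.rreg 19 (by decide)).trans (by simp)
  have q21 : s2.rreg 21 = s1.rreg 21 := (F2.rreg 21 (by decide)).trans (by simp)
  have q22 : s2.rreg 22 = s1.rreg 22 := (F2.rreg 22 (by decide)).trans (by simp)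
  by_cases hc : 0 ≤ s2.rreg 24
  · have F2' : Frame steepestWr (s1.rset 19 (-1)) (s2.rset 19 (-1)) := by
      refine ⟨fun r hr => ?_, fun r hr => ?_, fun r hr => ?_, fun r hr => ?_⟩
      · simpa using F2.ireg r hr
      · by_cases h : r = 19
        · simp [h]
        · simpa [h] using F2.rreg r hr
      · simpa using F2.iarr r hr
      · simpa using F2.rarr r hr
    obtain ⟨t3, s3, E3, ht3, F3, ⟨u3, h3⟩, h3'⟩ := key (-1) (s2.rset 19 (-1)) F2'
    have e3 : (s2.rset 19 (-1)).rset 19 (-1) = s2.rset 19 (-1) := by simp [Memory.rset]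
    rw [e3] at E3 F3
    have E3' : Exec [select] (.rset 19 (.const (-1))) s2 (1 + (RExp.const (-1)).cost)
        (s2.rset 19 (-1)) := by
      have := Exec.rset (procs := [select]) 19 (.const (-1)) s2
      simpa [RExp.eval] using this
    have r19' : s3.rreg 19 = -1 := (F3.rreg 19 (by decide)).trans (by simp)
    have p21 : s3.rreg 21 = s1.rreg 21 := ((F3.rreg 21 (by decide)).trans (by simp)).trans q21
    have p22 : s3.rreg 22 = s1.rreg 22 := ((F3.rreg 22 (by decide)).trans (by simp)).trans q22
    by_cases hc' : 0 ≤ s3.rreg 24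
    · have E4 : Exec [select] (.rset 19 (.const 0)) s3 (1 + (RExp.const 0).cost)
          (s3.rset 19 0) := by
        have := Exec.rset (procs := [select]) 19 (.const 0) s3
        simpa [RExp.eval] using this
      have E := E1.seq (E2'.seq (E2.seq (Exec.ite_true (d := .skip)
        (show (BExp.rle (.const 0) (.reg 24)).Holds s2 by simpa [BExp.Holds, RExp.eval] using hc)
        (E3'.seq (E3.seq (Exec.ite_true (d := .skip)
        (show (BExp.rle (.const 0) (.reg 24)).Holds s3 by simpa [BExp.Holds, RExp.eval] using hc')
        E4))))))
      refine ⟨_, _, E, ?_, (E.frame select_wr).mono query_wr, Or.inl ⟨by simp, ?_⟩⟩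
      · simp only [BExp.cost, RExp.cost]; omega
      · simp only [rset_rreg, p21, p22]
        exact isMinPt_of_deriv_nonneg hb hdet hl' (fun u => hc.trans (h2' u))
          (fun u => hc'.trans (h3' u))
    · have E := E1.seq (E2'.seq (E2.seq (Exec.ite_true (d := .skip)
        (show (BExp.rle (.const 0) (.reg 24)).Holds s2 by simpa [BExp.Holds, RExp.eval] using hc)
        (E3'.seq (E3.seq (Exec.ite_false (c := .rset 19 (.const 0))
        (show ¬ (BExp.rle (.const 0) (.reg 24)).Holds s3 by
          simpa [BExp.Holds, RExp.eval] using hc')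
        (Exec.skip s3)))))))
      refine ⟨_, _, E, ?_, (E.frame select_wr).mono query_wr, Or.inr ⟨Or.inr r19', ?_⟩⟩
      · simp only [BExp.cost, RExp.cost]; omega
      · intro x y hmin
        rw [r19']
        rw [h3] at hc'
        exact side_of_deriv_neg hb hl hq hd he (by norm_num) (not_le.1 hc') hmin
  · have E := E1.seq (E2'.seq (E2.seq (Exec.ite_false
        (c := (.rset 19 (.const (-1)) ;; steepest ;;
          .ite (.rle (.const 0) (.reg 24)) (.rset 19 (.const 0)) .skip))
        (show ¬ (BExp.rle (.const 0) (.reg 24)).Holds s2 by simpa [BExp.Holds, RExp.eval] using hc)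
        (Exec.skip s2))))
    refine ⟨_, _, E, ?_, (E.frame select_wr).mono query_wr, Or.inr ⟨Or.inl r19, ?_⟩⟩
    · simp only [BExp.cost, RExp.cost]; omega
    · intro x y hmin
      rw [r19]
      rw [h2] at hc
      exact side_of_deriv_neg hb hl hq hd he (by norm_num) (not_le.1 hc) hmin

end Query

/-! ### Prune and search -/

section Prune

/-- Whichever side the oracle reports, at least half of the elements lie on the other side of the
median or on it. -/
theorem half_le_of_median {N : ℕ} {a : ℕ → ℝ} {M ε : ℝ}
    (h1 : ∑ v ∈ Finset.range N, (if M < a v then (1 : ℝ) else 0) ≤ N / 2)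
    (h2 : (N : ℝ) / 2 ≤ ∑ v ∈ Finset.range N, (if M ≤ a v then (1 : ℝ) else 0))
    (hε : ε = 1 ∨ ε = -1) :
    (N : ℝ) / 2 ≤ ∑ v ∈ Finset.range N, (if 0 ≤ ε * (M - a v) then (1 : ℝ) else 0) := by
  rcases hε with rfl | rfl
  · have : ∑ v ∈ Finset.range N, (if 0 ≤ 1 * (M - a v) then (1 : ℝ) else 0) =
        ∑ v ∈ Finset.range N, (1 - if M < a v then (1 : ℝ) else 0) := by
      refine Finset.sum_congr rfl fun v _ => ?_
      by_cases h : M < a v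
      · rw [if_neg (by linarith), if_pos h]; ring
      · rw [if_pos (by linarith), if_neg h]; ring
    rw [this, Finset.sum_sub_distrib]
    simp only [Finset.sum_const, Finset.card_range, nsmul_eq_mul, mul_one]
    linarith
  · refine h2.trans (le_of_eq (Finset.sum_congr rfl fun v _ => ?_))
    congr 1
    rw [eq_iff_iff]
    constructor <;> intro h <;> linarith

/-- The lines that may be pruned. -/
def Prunable (s₀ xm εx νm εν γ σ : ℝ) : Prop :=
  0 ≤ εν * (νm - (γ - (σ - s₀) * xm)) ∧ 0 ≤ εν * εx * (σ - s₀)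

/-- In the coordinates `x` and `y + s₀ * x`, the oracle answers confine the minimum points to an
open quadrant with corner `(xm, νm)`, and a line has slope `-(σ - s₀)`. The lines cross at `(X, V)`
in the closed opposite quadrant. Their slopes have opposite signs or vanish, so from the crossing
one of them runs away from the quadrant of the minimum points and never enters it. -/
theorem prunable_or {s₀ xm εx νm εν γ σ γ' σ' X V : ℝ} (hεν : εν = 1 ∨ εν = -1)
    (hεx : εx = 1 ∨ εx = -1) (hσ : σ ≤ s₀) (hσ' : s₀ ≤ σ')
    (hX : X = (γ' - γ) / (σ' - σ)) (hV : V = γ - (σ - s₀) * X)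
    (h1 : 0 ≤ εx * (xm - X)) (h2 : 0 ≤ εν * (νm - V)) :
    Prunable s₀ xm εx νm εν γ σ ∨ Prunable s₀ xm εx νm εν γ' σ' := by
  have key : ∀ g a, g - (a - s₀) * X = V → 0 ≤ εν * εx * (a - s₀) →
      Prunable s₀ xm εx νm εν g a := by
    intro g a hg ha
    refine ⟨?_, ha⟩
    have hx : εx * εx = 1 := by rcases hεx with rfl | rfl <;> norm_num
    have : εν * (νm - (g - (a - s₀) * xm))
        = εν * (νm - V) + εν * εx * (a - s₀) * (εx * (xm - X)) := by
      rw [← hg]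
      linear_combination (-(εν * (a - s₀) * (xm - X))) * hx
    rw [this]
    exact add_nonneg h2 (mul_nonneg ha h1)
  have hε : εν * εx = 1 ∨ εν * εx = -1 := by
    rcases hεν with rfl | rfl <;> rcases hεx with rfl | rfl <;> norm_num
  rcases hε with h | h
  -- Equal slopes are both `s₀`. The quotient `X` is then a division by zero, but it is irrelevant
  -- for a line that is horizontal in these coordinates.
  · rcases eq_or_ne σ σ' with he | he
    · left
      exact key _ _ hV.symm (by rw [h]; linarith)
    · right
      refine key _ _ ?_ (by rw [h]; linarith)
      have : (σ' - σ) * X = γ' - γ := by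
        rw [hX]; exact mul_div_cancel₀ _ (sub_ne_zero.2 he.symm)
      rw [hV]; linarith
  · left
    exact key _ _ hV.symm (by rw [h]; linarith)

open Classical in
/-- In each round, a sixteenth of the lines can be pruned. -/
theorem prunable_card {m l r h h' : ℕ} {γ σ gL sL gR sR X V U : ℕ → ℝ} {s₀ xm εx νm εν : ℝ}
    (hL : ∀ φ : ℝ → ℝ → ℝ, ∑ i ∈ Finset.range l, φ (gL i) (sL i)
      = ∑ v ∈ Finset.range m, if σ v ≤ s₀ then φ (γ v) (σ v) else 0)
    (hR : ∀ φ : ℝ → ℝ → ℝ, ∑ i ∈ Finset.range r, φ (gR i) (sR i)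
      = ∑ v ∈ Finset.range m, if s₀ ≤ σ v then φ (γ v) (σ v) else 0)
    (hh : h = min l r)
    (hX : ∀ i < h, X i = (gR i - gL i) / (sR i - sL i))
    (hV : ∀ i < h, V i = gL i - (sL i - s₀) * X i)
    (hU : ∀ φ : ℝ → ℝ, ∑ i ∈ Finset.range h', φ (U i)
      = ∑ i ∈ Finset.range h, if 0 ≤ εx * (xm - X i) then φ (V i) else 0)
    (m1 : ∑ v ∈ Finset.range m, (if s₀ < σ v then (1 : ℝ) else 0) ≤ m / 2)
    (m2 : (m : ℝ) / 2 ≤ ∑ v ∈ Finset.range m, (if s₀ ≤ σ v then (1 : ℝ) else 0))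
    (x1 : ∑ v ∈ Finset.range h, (if xm < X v then (1 : ℝ) else 0) ≤ h / 2)
    (x2 : (h : ℝ) / 2 ≤ ∑ v ∈ Finset.range h, (if xm ≤ X v then (1 : ℝ) else 0))
    (n1 : ∑ v ∈ Finset.range h', (if νm < U v then (1 : ℝ) else 0) ≤ h' / 2)
    (n2 : (h' : ℝ) / 2 ≤ ∑ v ∈ Finset.range h', (if νm ≤ U v then (1 : ℝ) else 0))
    (hεx : εx = 1 ∨ εx = -1) (hεν : εν = 1 ∨ εν = -1) :
    (m : ℝ) / 16 ≤ ∑ v ∈ Finset.range m,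
      (if Prunable s₀ xm εx νm εν (γ v) (σ v) then (1 : ℝ) else 0) := by
  have hl : (m : ℝ) / 2 ≤ l := by
    have e := hL fun _ _ => 1
    have e2 := half_le_of_median m1 m2 (Or.inl rfl)
    simp only [Finset.sum_const, Finset.card_range, nsmul_eq_mul, mul_one] at e
    rw [e]
    refine e2.trans (le_of_eq (Finset.sum_congr rfl fun v _ => ?_))
    simp
  have hr : (m : ℝ) / 2 ≤ r := by
    have e := hR fun _ _ => 1
    simp only [Finset.sum_const, Finset.card_range, nsmul_eq_mul, mul_one] at e
    rw [e]
    exact m2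
  have hm : (m : ℝ) / 2 ≤ h := by
    rw [hh]; push_cast; exact le_min hl hr
  have hh' : (h : ℝ) / 2 ≤ h' := by
    have e := hU fun _ => 1
    simp only [Finset.sum_const, Finset.card_range, nsmul_eq_mul, mul_one] at e
    rw [e]
    exact half_le_of_median x1 x2 hεx
  have hgood := half_le_of_median n1 n2 hεν
  rw [hU fun x => if 0 ≤ εν * (νm - x) then 1 else 0] at hgood
  set P : ℝ → ℝ → ℝ := fun g a => if Prunable s₀ xm εx νm εν g a then 1 else 0 with hP
  have hP0 : ∀ g a, 0 ≤ P g a := fun g a => by simp only [hP]; split_ifs <;> norm_num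
  have hsL : ∀ i < l, sL i ≤ s₀ :=
    forall_of_sum_filter hL (fun _ a => a ≤ s₀) fun j _ h => h
  have hsR : ∀ i < r, s₀ ≤ sR i :=
    forall_of_sum_filter hR (fun _ a => s₀ ≤ a) fun j _ h => h
  have h1 : (∑ i ∈ Finset.range h, if 0 ≤ εx * (xm - X i) then
      (if 0 ≤ εν * (νm - V i) then (1 : ℝ) else 0) else 0)
      ≤ ∑ i ∈ Finset.range h, (P (gL i) (sL i) + P (gR i) (sR i)) := by
    refine Finset.sum_le_sum fun i hi => ?_
    have hi := Finset.mem_range.1 hi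
    have a := hP0 (gL i) (sL i)
    have b := hP0 (gR i) (sR i)
    split_ifs with c d
    · rcases prunable_or hεν hεx (hsL i (by omega)) (hsR i (by omega)) (hX i hi) (hV i hi) c d
        with e | e
      · have : P (gL i) (sL i) = 1 := if_pos e
        linarith
      · have : P (gR i) (sR i) = 1 := if_pos e
        linarith
    · linarith
    · linarith
  rw [Finset.sum_add_distrib] at h1
  have h2 : ∑ i ∈ Finset.range h, P (gL i) (sL i) ≤ ∑ i ∈ Finset.range l, P (gL i) (sL i) :=
    Finset.sum_le_sum_of_subset_of_nonneg (Finset.range_mono (by omega)) fun _ _ _ => hP0 _ _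
  have h3 : ∑ i ∈ Finset.range h, P (gR i) (sR i) ≤ ∑ i ∈ Finset.range r, P (gR i) (sR i) :=
    Finset.sum_le_sum_of_subset_of_nonneg (Finset.range_mono (by omega)) fun _ _ _ => hP0 _ _
  rw [hL] at h2
  rw [hR] at h3
  have h4 : ∀ Q : ℕ → Prop, (∑ v ∈ Finset.range m, if Q v then P (γ v) (σ v) else 0)
      ≤ ∑ v ∈ Finset.range m, P (γ v) (σ v) := fun Q =>
    Finset.sum_le_sum fun v _ => by
      split_ifs
      · exact le_rfl
      · exact hP0 _ _
  -- There are at least `m / 2` pairs, of which `m / 4` survive the first median and `m / 8` the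
  -- second, each with a prunable line. A line of slope `s₀` belongs to both halves and may be
  -- counted twice, which leaves `m / 16`.
  have h5 := h4 fun v => σ v ≤ s₀
  have h6 := h4 fun v => s₀ ≤ σ v
  linarith

theorem sum_update_append {M : Type*} [AddCommMonoid M] (φ : ℝ → M) (f : ℕ → ℝ) (l : ℕ) (x : ℝ) :
    ∑ i ∈ Finset.range (l + 1), φ (Function.update f l x i)
      = ∑ i ∈ Finset.range l, φ (f i) + φ x := by
  rw [Finset.sum_range_succ]
  congr 1
  · refine Finset.sum_congr rfl fun i hi => ?_
    rw [Function.update_of_ne (Finset.mem_range.1 hi).ne]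
  · simp

theorem sum_update_append₂ {M : Type*} [AddCommMonoid M] (φ : ℝ → ℝ → M) (f g : ℕ → ℝ) (l : ℕ)
    (x y : ℝ) :
    ∑ i ∈ Finset.range (l + 1), φ (Function.update f l x i) (Function.update g l y i)
      = ∑ i ∈ Finset.range l, φ (f i) (g i) + φ x y := by
  rw [Finset.sum_range_succ]
  congr 1
  · refine Finset.sum_congr rfl fun i hi => ?_
    rw [Function.update_of_ne (Finset.mem_range.1 hi).ne,
      Function.update_of_ne (Finset.mem_range.1 hi).ne]
  · simp

theorem sum_update_append₃ {M : Type*} [AddCommMonoid M] (φ : ℝ → ℝ → ℝ → M) (f g h : ℕ → ℝ)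
    (l : ℕ) (x y z : ℝ) :
    ∑ i ∈ Finset.range (l + 1), φ (Function.update f l x i) (Function.update g l y i)
      (Function.update h l z i) = ∑ i ∈ Finset.range l, φ (f i) (g i) (h i) + φ x y z := by
  rw [Finset.sum_range_succ]
  congr 1
  · refine Finset.sum_congr rfl fun i hi => ?_
    rw [Function.update_of_ne (Finset.mem_range.1 hi).ne,
      Function.update_of_ne (Finset.mem_range.1 hi).ne,
      Function.update_of_ne (Finset.mem_range.1 hi).ne]
  · simp

/-- Compute a median of an array whose length is in an index register. -/
def median (a m : ℕ) : Cmd :=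
  .forLoop 10 m (.rstore 3 (.reg 10) (.get a (.reg 10)) ;; .rstore 4 (.reg 10) (.const 1)) ;;
  (.iset 2 (.const 0) ;; .iset 3 (.reg m) ;; .rset 1 (.div (.cast (.reg m)) (.const 2))) ;; .call 0

theorem median_spec {a m : ℕ} (ha : a ≠ 3) (ha' : a ≠ 4) (hm : m ≠ 10) (hm' : m ≠ 2) (s : Memory) :
    ∃ t s', Exec [select] (median a m) s t s' ∧ t ≤ (s.ireg m + 2) * 20100 ∧
      ∑ v ∈ Finset.range (s.ireg m), (if s'.rreg 2 < s.rarr a v then (1 : ℝ) else 0)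
        ≤ s.ireg m / 2 ∧
      (s.ireg m : ℝ) / 2
        ≤ ∑ v ∈ Finset.range (s.ireg m), (if s'.rreg 2 ≤ s.rarr a v then (1 : ℝ) else 0) := by
  obtain ⟨t1, s1, E1, ht1, h1, F1⟩ := exec_forLoop [select] (i := 10) (m := m)
    (c := .rstore 3 (.reg 10) (.get a (.reg 10)) ;; .rstore 4 (.reg 10) (.const 1))
    rfl (by simp [Cmd.wr]) (by simp [Cmd.wr]) hm (s := s) (N := s.ireg m) rfl
    (fun k s' => ∀ v < k, s'.rarr 3 v = s.rarr a v ∧ s'.rarr 4 v = 1)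
    (by simp)
    (by
      rintro j s1 hj hi hf h1
      have ea : s1.rarr a = s.rarr a := hf.rarr a (by simp [Cmd.wr, ha, ha'])
      simp only [Cmd.wp, IExp.eval, RExp.eval]
      intro v hv
      rcases (Nat.lt_succ_iff.1 hv).lt_or_eq with h' | rfl
      · simp [hi, h'.ne, h1 v h']
      · simp [hi, ea])
  have em : s1.ireg m = s.ireg m := F1.ireg m (by simp [Cmd.wr, hm])
  obtain ⟨t2, s2, E2, ht2, rfl⟩ := exec_straight [select]
    (c := .iset 2 (.const 0) ;; .iset 3 (.reg m) ;;
      .rset 1 (.div (.cast (.reg m)) (.const 2))) rfl (s := s1)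
    (Q := fun s' => s' = ((s1.iset 2 0).iset 3 (s.ireg m)).rset 1 (s.ireg m / 2))
    (by
      simp only [Cmd.wp, IExp.eval, RExp.eval, iset_ireg, if_neg hm', em]
      split_ifs with h
      · rw [h] at em; simp
      · simp)
  obtain ⟨t3, s3, E3, ht3, -, -, hle, hge⟩ := select_spec (s.ireg m)
    (((s1.iset 2 0).iset 3 (s.ireg m)).rset 1 (s.ireg m / 2)) (by simp)
    (by intro j hj; simp [(h1 j hj).2]) (by simp; positivity)
    (by
      simp only [rset_rreg, if_true, rset_rarr, iset_rarr, rset_ireg, iset_ireg]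
      simp only [show (2 : ℕ) ≠ 3 by decide, if_false, zero_add]
      rw [Finset.sum_congr rfl fun j hj => (h1 j (Finset.mem_range.1 hj)).2]
      simp)
  refine ⟨_, s3, E1.seq (E2.seq E3), ?_, ?_, ?_⟩
  · simp only [Cmd.cost, IExp.cost, RExp.cost] at ht1 ht2
    omega
  · refine le_trans (le_of_eq (Finset.sum_congr rfl fun j hj => ?_)) (hle.trans (by simp))
    simp [h1 j (Finset.mem_range.1 hj)]
  · refine le_trans (by simp) (hge.trans (le_of_eq (Finset.sum_congr rfl fun j hj => ?_)))
    simp [h1 j (Finset.mem_range.1 hj)]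

/-- Split the lines into those whose slopes are at most, and those whose slopes are at least, the
value in register `25`. -/
def splitLines : Cmd :=
  .iset 11 (.const 0) ;; .iset 12 (.const 0) ;;
  .forLoop 10 8
    (.ite (.rle (.get 10 (.reg 10)) (.reg 25))
        (.rstore 17 (.reg 11) (.get 9 (.reg 10)) ;; .rstore 18 (.reg 11) (.get 10 (.reg 10)) ;;
          .iset 11 (.add (.reg 11) (.const 1))) .skip ;;
      .ite (.rle (.reg 25) (.get 10 (.reg 10)))
        (.rstore 19 (.reg 12) (.get 9 (.reg 10)) ;; .rstore 20 (.reg 12) (.get 10 (.reg 10)) ;;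
          .iset 12 (.add (.reg 12) (.const 1))) .skip)

/-- Lines whose slope equals the median go to both halves, so that each half receives at least half
of the lines. -/
theorem splitLines_spec (procs : List Cmd) (s : Memory) :
    ∃ t s', Exec procs splitLines s t s' ∧ t ≤ (s.ireg 8 + 2) * 100 ∧
      (∀ φ : ℝ → ℝ → ℝ, ∑ i ∈ Finset.range (s'.ireg 11), φ (s'.rarr 17 i) (s'.rarr 18 i)
        = ∑ v ∈ Finset.range (s.ireg 8),
          if s.rarr 10 v ≤ s.rreg 25 then φ (s.rarr 9 v) (s.rarr 10 v) else 0) ∧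
      (∀ φ : ℝ → ℝ → ℝ, ∑ i ∈ Finset.range (s'.ireg 12), φ (s'.rarr 19 i) (s'.rarr 20 i)
        = ∑ v ∈ Finset.range (s.ireg 8),
          if s.rreg 25 ≤ s.rarr 10 v then φ (s.rarr 9 v) (s.rarr 10 v) else 0) ∧
      s'.ireg 11 ≤ s.ireg 8 := by
  obtain ⟨t, s', hex, ht, ⟨h1, h2, h3⟩, -⟩ := exec_forLoop procs (i := 10) (m := 8)
    (c := .ite (.rle (.get 10 (.reg 10)) (.reg 25))
        (.rstore 17 (.reg 11) (.get 9 (.reg 10)) ;; .rstore 18 (.reg 11) (.get 10 (.reg 10)) ;;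
          .iset 11 (.add (.reg 11) (.const 1))) .skip ;;
      .ite (.rle (.reg 25) (.get 10 (.reg 10)))
        (.rstore 19 (.reg 12) (.get 9 (.reg 10)) ;; .rstore 20 (.reg 12) (.get 10 (.reg 10)) ;;
          .iset 12 (.add (.reg 12) (.const 1))) .skip)
    rfl (by decide) (by decide) (by decide) (s := (s.iset 11 0).iset 12 0) (N := s.ireg 8) (by simp)
    (fun k s' => (∀ φ : ℝ → ℝ → ℝ,
        ∑ i ∈ Finset.range (s'.ireg 11), φ (s'.rarr 17 i) (s'.rarr 18 i)
        = ∑ v ∈ Finset.range k,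
          if s.rarr 10 v ≤ s.rreg 25 then φ (s.rarr 9 v) (s.rarr 10 v) else 0) ∧
      (∀ φ : ℝ → ℝ → ℝ, ∑ i ∈ Finset.range (s'.ireg 12), φ (s'.rarr 19 i) (s'.rarr 20 i)
        = ∑ v ∈ Finset.range k,
          if s.rreg 25 ≤ s.rarr 10 v then φ (s.rarr 9 v) (s.rarr 10 v) else 0) ∧
      s'.ireg 11 ≤ k)
    (by simp)
    (by
      rintro j s1 hj hi hf ⟨h1, h2, h3⟩
      have e9 : s1.rarr 9 = s.rarr 9 := hf.rarr 9 (by decide)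
      have e10 : s1.rarr 10 = s.rarr 10 := hf.rarr 10 (by decide)
      have r25 : s1.rreg 25 = s.rreg 25 := (hf.rreg 25 (by decide)).trans (by simp)
      simp only [Cmd.wp, IExp.eval, RExp.eval, BExp.Holds]
      simp [hi, e9, e10, r25, Finset.sum_range_succ (n := j), ← h1, ← h2]
      refine ⟨fun ha => ⟨fun hb => ⟨?_, ?_, h3⟩, fun hb => ⟨?_, ?_, h3⟩⟩,
        fun ha => ⟨fun hb => ⟨?_, ?_, by omega⟩, fun hb => ⟨?_, ?_, by omega⟩⟩⟩ <;> intro φ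
      · rw [if_pos ha, sum_update_append₂]
      · rw [if_pos hb, sum_update_append₂]
      · rw [if_pos ha, sum_update_append₂]
      · exact fun h => absurd h hb.not_ge
      · exact fun h => absurd h ha.not_ge
      · rw [if_pos hb, sum_update_append₂]
      · exact fun h => absurd h ha.not_ge
      · exact fun h => absurd h hb.not_ge)
  refine ⟨_, s', (Exec.iset 11 _ s).seq ((Exec.iset 12 _ _).seq (by simpa [IExp.eval] using hex)),
    ?_, h1, h2, h3⟩
  refine (add_le_add_right (add_le_add_right ht _) _).trans ?_
  simp only [RExp.cost, Cmd.cost, IExp.cost, BExp.cost]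
  omega

/-- The intersection points of the pairs of lines. -/
def crossLines : Cmd :=
  .iset 13 (.sub (.reg 11) (.sub (.reg 11) (.reg 12))) ;;
  .forLoop 10 13
    (.rset 5 (.div (.sub (.get 19 (.reg 10)) (.get 17 (.reg 10)))
        (.sub (.get 20 (.reg 10)) (.get 18 (.reg 10)))) ;;
      .rstore 21 (.reg 10) (.reg 5) ;;
      .rstore 22 (.reg 10) (.sub (.get 17 (.reg 10))
        (.mul (.sub (.get 18 (.reg 10)) (.reg 25)) (.reg 5))))

theorem crossLines_spec (procs : List Cmd) (s : Memory) :
    ∃ t s', Exec procs crossLines s t s' ∧ t ≤ (s.ireg 11 + 2) * 100 ∧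
      s'.ireg 13 = min (s.ireg 11) (s.ireg 12) ∧
      (∀ i < min (s.ireg 11) (s.ireg 12),
        s'.rarr 21 i = (s.rarr 19 i - s.rarr 17 i) / (s.rarr 20 i - s.rarr 18 i)) ∧
      (∀ i < min (s.ireg 11) (s.ireg 12),
        s'.rarr 22 i = s.rarr 17 i - (s.rarr 18 i - s.rreg 25) * s'.rarr 21 i) := by
  -- With truncated subtraction `a - (a - b)` is the minimum.
  have hmin : s.ireg 11 - (s.ireg 11 - s.ireg 12) = min (s.ireg 11) (s.ireg 12) := by omega
  obtain ⟨t, s', hex, ht, h1, hf⟩ := exec_forLoop procs (i := 10) (m := 13)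
    (c := .rset 5 (.div (.sub (.get 19 (.reg 10)) (.get 17 (.reg 10)))
        (.sub (.get 20 (.reg 10)) (.get 18 (.reg 10)))) ;;
      .rstore 21 (.reg 10) (.reg 5) ;;
      .rstore 22 (.reg 10) (.sub (.get 17 (.reg 10))
        (.mul (.sub (.get 18 (.reg 10)) (.reg 25)) (.reg 5))))
    rfl (by decide) (by decide) (by decide) (s := s.iset 13 (min (s.ireg 11) (s.ireg 12)))
    (N := min (s.ireg 11) (s.ireg 12)) (by simp)
    (fun k s' => ∀ i < k,
        s'.rarr 21 i = (s.rarr 19 i - s.rarr 17 i) / (s.rarr 20 i - s.rarr 18 i) ∧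
        s'.rarr 22 i = s.rarr 17 i - (s.rarr 18 i - s.rreg 25) * s'.rarr 21 i)
    (by simp)
    (by
      rintro j s1 hj hi hf h1
      have e17 : s1.rarr 17 = s.rarr 17 := hf.rarr 17 (by decide)
      have e18 : s1.rarr 18 = s.rarr 18 := hf.rarr 18 (by decide)
      have e19 : s1.rarr 19 = s.rarr 19 := hf.rarr 19 (by decide)
      have e20 : s1.rarr 20 = s.rarr 20 := hf.rarr 20 (by decide)
      have r25 : s1.rreg 25 = s.rreg 25 := (hf.rreg 25 (by decide)).trans (by simp)
      simp only [Cmd.wp, IExp.eval, RExp.eval]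
      intro v hv
      rcases (Nat.lt_succ_iff.1 hv).lt_or_eq with h' | rfl
      · simpa [hi, h'.ne] using h1 v h'
      · simp [hi, e17, e18, e19, e20, r25])
  have E0 : Exec procs (.iset 13 (.sub (.reg 11) (.sub (.reg 11) (.reg 12)))) s _ _ :=
    Exec.iset 13 _ s
  simp only [IExp.eval, hmin] at E0
  refine ⟨_, s', E0.seq hex, ?_, ?_, fun i hi => (h1 i hi).1, fun i hi => (h1 i hi).2⟩
  · refine (add_le_add_right ht _).trans ?_
    simp only [RExp.cost, Cmd.cost, IExp.cost]
    have : min (s.ireg 11) (s.ireg 12) ≤ s.ireg 11 := min_le_left _ _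
    omega
  · rw [hf.ireg 13 (by decide)]; simp

/-- The ordinates of the intersection points that lie beyond the first line of the round. -/
def keepCrossings : Cmd :=
  .iset 14 (.const 0) ;;
  .forLoop 10 13
    (.ite (.rle (.const 0) (.mul (.reg 27) (.sub (.reg 26) (.get 21 (.reg 10)))))
      (.rstore 23 (.reg 14) (.get 22 (.reg 10)) ;; .iset 14 (.add (.reg 14) (.const 1))) .skip)

theorem keepCrossings_spec (procs : List Cmd) (s : Memory) :
    ∃ t s', Exec procs keepCrossings s t s' ∧ t ≤ (s.ireg 13 + 2) * 100 ∧
      (∀ φ : ℝ → ℝ, ∑ i ∈ Finset.range (s'.ireg 14), φ (s'.rarr 23 i)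
        = ∑ v ∈ Finset.range (s.ireg 13),
          if 0 ≤ s.rreg 27 * (s.rreg 26 - s.rarr 21 v) then φ (s.rarr 22 v) else 0) ∧
      s'.ireg 14 ≤ s.ireg 13 := by
  obtain ⟨t, s', hex, ht, ⟨h1, h2⟩, -⟩ := exec_forLoop procs (i := 10) (m := 13)
    (c := .ite (.rle (.const 0) (.mul (.reg 27) (.sub (.reg 26) (.get 21 (.reg 10)))))
      (.rstore 23 (.reg 14) (.get 22 (.reg 10)) ;; .iset 14 (.add (.reg 14) (.const 1))) .skip)
    rfl (by decide) (by decide) (by decide) (s := s.iset 14 0) (N := s.ireg 13) (by simp)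
    (fun k s' => (∀ φ : ℝ → ℝ, ∑ i ∈ Finset.range (s'.ireg 14), φ (s'.rarr 23 i)
        = ∑ v ∈ Finset.range k,
          if 0 ≤ s.rreg 27 * (s.rreg 26 - s.rarr 21 v) then φ (s.rarr 22 v) else 0) ∧
      s'.ireg 14 ≤ k)
    (by simp)
    (by
      rintro j s1 hj hi hf ⟨h1, h2⟩
      have e21 : s1.rarr 21 = s.rarr 21 := hf.rarr 21 (by decide)
      have e22 : s1.rarr 22 = s.rarr 22 := hf.rarr 22 (by decide)
      have r26 : s1.rreg 26 = s.rreg 26 := (hf.rreg 26 (by decide)).trans (by simp)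
      have r27 : s1.rreg 27 = s.rreg 27 := (hf.rreg 27 (by decide)).trans (by simp)
      simp only [Cmd.wp, IExp.eval, RExp.eval, BExp.Holds]
      simp [hi, e21, e22, r26, r27, Finset.sum_range_succ (n := j), ← h1]
      refine ⟨fun ha => ⟨fun φ => ?_, h2⟩, fun ha => ⟨fun φ => ?_, by omega⟩⟩
      · rw [if_pos ha, sum_update_append]
      · exact fun h => absurd h ha.not_ge)
  refine ⟨_, s', (Exec.iset 14 _ s).seq (by simpa [IExp.eval] using hex), ?_, h1, h2⟩
  refine (add_le_add_right ht _).trans ?_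
  simp only [RExp.cost, Cmd.cost, IExp.cost, BExp.cost]
  omega

/-- Remove the prunable lines. -/
def pruneLines : Cmd :=
  .iset 15 (.const 0) ;;
  .forLoop 10 8
    (.rset 5 (.get 9 (.reg 10)) ;; .rset 6 (.get 10 (.reg 10)) ;; .rset 7 (.get 11 (.reg 10)) ;;
      .ite (.and
          (.rle (.const 0) (.mul (.reg 19)
            (.sub (.reg 28) (.sub (.reg 5) (.mul (.sub (.reg 6) (.reg 25)) (.reg 26))))))
          (.rle (.const 0) (.mul (.mul (.reg 19) (.reg 27)) (.sub (.reg 6) (.reg 25)))))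
        (.ite (.rle (.const 0) (.reg 19)) .skip
          (.rset 11 (.sub (.reg 11) (.mul (.reg 7) (.reg 6))) ;;
            .rset 12 (.sub (.reg 12) (.reg 7))))
        (.rstore 9 (.reg 15) (.reg 5) ;; .rstore 10 (.reg 15) (.reg 6) ;;
          .rstore 11 (.reg 15) (.reg 7) ;; .iset 15 (.add (.reg 15) (.const 1)))) ;;
  .iset 8 (.reg 15)

/-- The lines in a memory that may be pruned. -/
def Memory.Prunable (s : Memory) (v : ℕ) : Prop :=
  ImprovableKnapsack.Prunable (s.rreg 25) (s.rreg 26) (s.rreg 27) (s.rreg 28) (s.rreg 19)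
    (s.rarr 9 v) (s.rarr 10 v)

-- On the wedge the hinge of a prunable line is zero for the sign `1` and linear for the sign `-1`.
-- In the second case its linear part moves into registers `11` and `12`, while its constant is
-- dropped. The remaining lines are compacted in place.
open Classical in
set_option maxHeartbeats 1000000 in
theorem pruneLines_spec (procs : List Cmd) (s : Memory) :
    ∃ t s', Exec procs pruneLines s t s' ∧ t ≤ (s.ireg 8 + 2) * 100 ∧
      (∀ φ : ℝ → ℝ → ℝ → ℝ, ∑ i ∈ Finset.range (s'.ireg 8),
        φ (s'.rarr 9 i) (s'.rarr 10 i) (s'.rarr 11 i)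
        = ∑ v ∈ Finset.range (s.ireg 8),
          if s.Prunable v then 0 else φ (s.rarr 9 v) (s.rarr 10 v) (s.rarr 11 v)) ∧
      s'.rreg 11 = s.rreg 11 - ∑ v ∈ Finset.range (s.ireg 8),
        (if s.Prunable v then if 0 ≤ s.rreg 19 then 0 else s.rarr 11 v * s.rarr 10 v else 0) ∧
      s'.rreg 12 = s.rreg 12 - ∑ v ∈ Finset.range (s.ireg 8),
        (if s.Prunable v then if 0 ≤ s.rreg 19 then 0 else s.rarr 11 v else 0) := by
  obtain ⟨t, s', hex, ht, ⟨-, -, h1, h2, h3⟩, -⟩ := exec_forLoop procs (i := 10) (m := 8)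
    (c := .rset 5 (.get 9 (.reg 10)) ;; .rset 6 (.get 10 (.reg 10)) ;;
      .rset 7 (.get 11 (.reg 10)) ;;
      .ite (.and
          (.rle (.const 0) (.mul (.reg 19)
            (.sub (.reg 28) (.sub (.reg 5) (.mul (.sub (.reg 6) (.reg 25)) (.reg 26))))))
          (.rle (.const 0) (.mul (.mul (.reg 19) (.reg 27)) (.sub (.reg 6) (.reg 25)))))
        (.ite (.rle (.const 0) (.reg 19)) .skip
          (.rset 11 (.sub (.reg 11) (.mul (.reg 7) (.reg 6))) ;;
            .rset 12 (.sub (.reg 12) (.reg 7))))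
        (.rstore 9 (.reg 15) (.reg 5) ;; .rstore 10 (.reg 15) (.reg 6) ;;
          .rstore 11 (.reg 15) (.reg 7) ;; .iset 15 (.add (.reg 15) (.const 1))))
    rfl (by decide) (by decide) (by decide) (s := s.iset 15 0) (N := s.ireg 8) (by simp)
    (fun k s' => s'.ireg 15 ≤ k ∧
      (∀ i, k ≤ i → s'.rarr 9 i = s.rarr 9 i ∧ s'.rarr 10 i = s.rarr 10 i ∧
        s'.rarr 11 i = s.rarr 11 i) ∧
      (∀ φ : ℝ → ℝ → ℝ → ℝ, ∑ i ∈ Finset.range (s'.ireg 15),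
        φ (s'.rarr 9 i) (s'.rarr 10 i) (s'.rarr 11 i)
        = ∑ v ∈ Finset.range k,
          if s.Prunable v then 0 else φ (s.rarr 9 v) (s.rarr 10 v) (s.rarr 11 v)) ∧
      s'.rreg 11 = s.rreg 11 - ∑ v ∈ Finset.range k,
        (if s.Prunable v then if 0 ≤ s.rreg 19 then 0 else s.rarr 11 v * s.rarr 10 v else 0) ∧
      s'.rreg 12 = s.rreg 12 - ∑ v ∈ Finset.range k,
        (if s.Prunable v then if 0 ≤ s.rreg 19 then 0 else s.rarr 11 v else 0))
    (by simp)
    (by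
      rintro j s1 hj hi hf ⟨h1, h2, h3, h4, h5⟩
      have r25 : s1.rreg 25 = s.rreg 25 := (hf.rreg 25 (by decide)).trans (by simp)
      have r26 : s1.rreg 26 = s.rreg 26 := (hf.rreg 26 (by decide)).trans (by simp)
      have r27 : s1.rreg 27 = s.rreg 27 := (hf.rreg 27 (by decide)).trans (by simp)
      have r28 : s1.rreg 28 = s.rreg 28 := (hf.rreg 28 (by decide)).trans (by simp)
      have r19 : s1.rreg 19 = s.rreg 19 := (hf.rreg 19 (by decide)).trans (by simp)
      obtain ⟨e9, e10, e11⟩ := h2 j le_rfl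
      have hP : (0 ≤ s.rreg 19 * (s.rreg 28 - (s.rarr 9 j - (s.rarr 10 j - s.rreg 25)
          * s.rreg 26)) ∧ 0 ≤ s.rreg 19 * s.rreg 27 * (s.rarr 10 j - s.rreg 25)) ↔
          s.Prunable j := Iff.rfl
      simp only [Cmd.wp, IExp.eval, RExp.eval, BExp.Holds]
      simp only [rset_rreg, rset_rarr, rset_ireg, rstore_rarr, rstore_ireg, rstore_rreg, iset_rarr,
        iset_rreg, iset_ireg, hi, e9, e10, e11, r25, r26, r27, r28, r19, Rat.cast_zero,
        Finset.sum_range_succ (n := j), ← h3, h4, h5]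
      simp [-sub_nonneg, hP]
      refine ⟨fun ha => ⟨fun hb => ?_, fun hb => ?_⟩, fun ha => ?_⟩
      · refine ⟨by omega, fun i hi => h2 i (by omega), ?_, ?_, ?_⟩ <;> simp [ha, hb]
      · refine ⟨by omega, fun i hi => h2 i (by omega), ?_, ?_, ?_⟩ <;>
          simp [ha, hb.not_ge] <;> ring
      · refine ⟨h1, fun i hi => ?_, ?_, by simp [ha], by simp [ha]⟩
        · have : i ≠ s1.ireg 15 := by omega
          simp [this, h2 i (by omega)]
        · intro φ
          rw [sum_update_append₃, if_neg ha])
  refine ⟨_, s'.iset 8 (s'.ireg 15), (Exec.iset 15 _ s).seq (Exec.seq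
    (by simpa [IExp.eval] using hex) (by simpa [IExp.eval] using Exec.iset 8 (.reg 15) s')),
    ?_, by simpa using h1, by simpa using h2, by simpa using h3⟩
  refine (add_le_add_right (add_le_add_left ht _) _).trans ?_
  simp only [RExp.cost, Cmd.cost, IExp.cost, BExp.cost]
  omega

end Prune

/-! ### Rounds of the search and their geometric decrease -/

section Rounds

/-- Pruning does not add minimum points of the function. -/
theorem pruned_isMinPt {s s' : Memory} [DecidablePred s.Prunable]
    (hb : ∀ v < s.ireg 8, 0 ≤ s.rarr 11 v)
    (h1 : ∀ φ : ℝ → ℝ → ℝ → ℝ, ∑ i ∈ Finset.range (s'.ireg 8),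
        φ (s'.rarr 9 i) (s'.rarr 10 i) (s'.rarr 11 i)
        = ∑ v ∈ Finset.range (s.ireg 8),
          if s.Prunable v then 0 else φ (s.rarr 9 v) (s.rarr 10 v) (s.rarr 11 v))
    (h2 : s'.rreg 11 = s.rreg 11 - ∑ v ∈ Finset.range (s.ireg 8),
        (if s.Prunable v then if 0 ≤ s.rreg 19 then 0 else s.rarr 11 v * s.rarr 10 v else 0))
    (h3 : s'.rreg 12 = s.rreg 12 - ∑ v ∈ Finset.range (s.ireg 8),
        (if s.Prunable v then if 0 ≤ s.rreg 19 then 0 else s.rarr 11 v else 0))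
    (hεx : s.rreg 27 = 1 ∨ s.rreg 27 = -1) (hεν : s.rreg 19 = 1 ∨ s.rreg 19 = -1)
    (hx : ∀ x y, IsMinPt s.pw2 x y → 0 < s.rreg 27 * (x - s.rreg 26))
    (hy : ∀ x y, IsMinPt s.pw2 x y → 0 < s.rreg 19 * (s.rreg 25 * x + y - s.rreg 28))
    (hex : ∃ x y, IsMinPt s.pw2 x y) :
    (∀ v < s'.ireg 8, 0 ≤ s'.rarr 11 v) ∧
    (∃ x y, IsMinPt s'.pw2 x y) ∧ ∀ x y, IsMinPt s'.pw2 x y → IsMinPt s.pw2 x y := by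
  classical
  have hb' : ∀ v < s'.ireg 8, 0 ≤ s'.rarr 11 v := by
    -- The test function counts negative weights, of which there were none before pruning.
    have h4 := h1 fun _ _ c => if 0 ≤ c then 0 else 1
    rw [Finset.sum_eq_zero (s := Finset.range (s.ireg 8))] at h4
    · rw [Finset.sum_eq_zero_iff_of_nonneg (fun i _ => by split_ifs <;> norm_num)] at h4
      intro v hv
      have := h4 v (Finset.mem_range.2 hv)
      by_contra hc
      rw [if_neg hc] at this
      norm_num at this
    · intro v hv
      rw [if_pos (hb v (Finset.mem_range.1 hv))]
      simp
  refine ⟨hb', prune_isMinPt (l₁x := s.rreg 27) (l₁y := 0) (l₁c := -(s.rreg 27 * s.rreg 26))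
    (l₂x := s.rreg 19 * s.rreg 25) (l₂y := s.rreg 19) (l₂c := -(s.rreg 19 * s.rreg 28))
    (K := ∑ v ∈ Finset.range (s.ireg 8),
      (if s.Prunable v then if 0 ≤ s.rreg 19 then 0 else s.rarr 11 v * s.rarr 9 v else 0))
    (fun x y x' y' t h0 h1 => pw2_convex hb' _ _ x y x' y' t h0 h1) ?_ ?_ hex⟩
  · intro x y hx hy
    simp only [Memory.pw2, pw2]
    rw [h2, h3, h1 fun g a c => c * max (g - a * x - y) 0]
    have e : ∀ v, s.rarr 11 v * max (s.rarr 9 v - s.rarr 10 v * x - y) 0 =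
        (if s.Prunable v then 0 else s.rarr 11 v * max (s.rarr 9 v - s.rarr 10 v * x - y) 0) +
        ((if s.Prunable v then if 0 ≤ s.rreg 19 then 0 else s.rarr 11 v * s.rarr 9 v else 0) -
        (if s.Prunable v then if 0 ≤ s.rreg 19 then 0 else s.rarr 11 v * s.rarr 10 v else 0) * x -
        (if s.Prunable v then if 0 ≤ s.rreg 19 then 0 else s.rarr 11 v else 0) * y) := by
      intro v
      by_cases hP : s.Prunable v
      · simp only [if_pos hP]
        obtain ⟨p1, p2⟩ := hP
        have p3 := mul_nonneg p2 hx
        have hx2 : s.rreg 27 * s.rreg 27 = 1 := by rcases hεx with h | h <;> rw [h] <;> norm_num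
        -- The line does not enter the wedge, so the argument of its hinge keeps one sign there.
        have hg : s.rreg 19 * (s.rarr 9 v - s.rarr 10 v * x - y) ≤ 0 := by
          have : s.rreg 19 * (s.rarr 9 v - s.rarr 10 v * x - y) =
            -(s.rreg 19 * (s.rreg 28 - (s.rarr 9 v - (s.rarr 10 v - s.rreg 25) * s.rreg 26)))
            - s.rreg 19 * s.rreg 27 * (s.rarr 10 v - s.rreg 25) *
              (s.rreg 27 * x + 0 * y + -(s.rreg 27 * s.rreg 26))
            - (s.rreg 19 * s.rreg 25 * x + s.rreg 19 * y + -(s.rreg 19 * s.rreg 28)) := by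
            linear_combination (s.rreg 19 * (s.rarr 10 v - s.rreg 25) * (x - s.rreg 26)) * hx2
          linarith
        rcases hεν with h | h
        · rw [h] at hg ⊢
          rw [max_eq_right (by linarith)]
          simp
        · rw [h] at hg ⊢
          rw [max_eq_left (by linarith)]
          norm_num
          ring
      · simp [hP]
    rw [Finset.sum_congr rfl fun v _ => e v]
    simp only [Finset.sum_add_distrib, Finset.sum_sub_distrib, ← Finset.sum_mul]
    ring
  · intro x y h
    have h4 := hx x y h
    have h5 := hy x y h
    exact ⟨by linarith, by linarith⟩

/-- The median slope, the lines on both sides of it, and their intersection points. -/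
structure Memory.Crossed (s : Memory) : Prop where
  m1 : ∑ v ∈ Finset.range (s.ireg 8), (if s.rreg 25 < s.rarr 10 v then (1 : ℝ) else 0)
    ≤ s.ireg 8 / 2
  m2 : (s.ireg 8 : ℝ) / 2
    ≤ ∑ v ∈ Finset.range (s.ireg 8), (if s.rreg 25 ≤ s.rarr 10 v then (1 : ℝ) else 0)
  hL : ∀ φ : ℝ → ℝ → ℝ, ∑ i ∈ Finset.range (s.ireg 11), φ (s.rarr 17 i) (s.rarr 18 i)
    = ∑ v ∈ Finset.range (s.ireg 8),
      if s.rarr 10 v ≤ s.rreg 25 then φ (s.rarr 9 v) (s.rarr 10 v) else 0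
  hR : ∀ φ : ℝ → ℝ → ℝ, ∑ i ∈ Finset.range (s.ireg 12), φ (s.rarr 19 i) (s.rarr 20 i)
    = ∑ v ∈ Finset.range (s.ireg 8),
      if s.rreg 25 ≤ s.rarr 10 v then φ (s.rarr 9 v) (s.rarr 10 v) else 0
  hh : s.ireg 13 = min (s.ireg 11) (s.ireg 12)
  hle : s.ireg 11 ≤ s.ireg 8
  hX : ∀ i < s.ireg 13, s.rarr 21 i = (s.rarr 19 i - s.rarr 17 i) / (s.rarr 20 i - s.rarr 18 i)
  hV : ∀ i < s.ireg 13, s.rarr 22 i = s.rarr 17 i - (s.rarr 18 i - s.rreg 25) * s.rarr 21 i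

/-- The locations on which `Memory.Crossed` depends. -/
def crossedLocs : List Loc :=
  [.I 8, .R 25, .RA 10, .RA 9, .I 11, .I 12, .I 13, .RA 17, .RA 18, .RA 19, .RA 20, .RA 21, .RA 22]

theorem Memory.Crossed.of_frame {s s' : Memory} {L : List Loc} (h : s.Crossed) (F : Frame L s s')
    (hL : ∀ x ∈ crossedLocs, x ∉ L) : s'.Crossed := by
  simp only [crossedLocs, List.mem_cons, List.not_mem_nil, or_false, forall_eq_or_imp,
    forall_eq] at hL
  obtain ⟨h8, h25, h10, h9, h11, h12, h13, h17, h18, h19, h20, h21, h22⟩ := hL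
  obtain ⟨m1, m2, hL, hR, hh, hle, hX, hV⟩ := h
  constructor <;> simpa only [F.ireg _ h8, F.rreg _ h25, F.rarr _ h10, F.rarr _ h9, F.ireg _ h11,
    F.ireg _ h12, F.ireg _ h13, F.rarr _ h17, F.rarr _ h18, F.rarr _ h19, F.rarr _ h20,
    F.rarr _ h21, F.rarr _ h22]

/-- Split the lines at the median slope and intersect them in pairs. -/
def crossing : Cmd :=
  median 10 8 ;; .rset 25 (.reg 2) ;; splitLines ;; crossLines

/-- The locations that `crossing` may write. -/
def crossingWr : List Loc :=
  [.I 10, .I 11, .I 12, .I 13, .R 25, .RA 17, .RA 18, .RA 19, .RA 20, .RA 21, .RA 22] ++ selectWr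

set_option maxRecDepth 8000 in
theorem crossing_wr : crossing.wr selectWr ⊆ crossingWr := by decide

theorem crossing_spec (s : Memory) :
    ∃ t s', Exec [select] crossing s t s' ∧ t ≤ (s.ireg 8 + 2) * 20400 ∧
      Frame crossingWr s s' ∧ s'.Crossed := by
  obtain ⟨t1, s1, E1, ht1, a1, a2⟩ := median_spec (a := 10) (m := 8) (by decide) (by decide)
    (by decide) (by decide) s
  have F1 := E1.frame (P := selectWr) select_wr
  have E2 : Exec [select] (.rset 25 (.reg 2)) s1 _ (s1.rset 25 (s1.rreg 2)) := Exec.rset 25 _ s1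
  have F2 := (E1.seq E2).frame (P := selectWr) select_wr
  set s2 := s1.rset 25 (s1.rreg 2) with hs2
  have r25 : s2.rreg 25 = s1.rreg 2 := by simp [hs2]
  obtain ⟨t3, s3, E3, ht3, c1, c2, c3⟩ := splitLines_spec [select] s2
  have F3 := E3.frame (P := selectWr) select_wr
  obtain ⟨t4, s4, E4, ht4, d1, d2, d3⟩ := crossLines_spec [select] s3
  have F4 := E4.frame (P := selectWr) select_wr
  have F34 := (E3.seq E4).frame (P := selectWr) select_wr
  have E := E1.seq (E2.seq (E3.seq E4))
  have p8 : s2.ireg 8 = s.ireg 8 := F2.ireg 8 (by decide)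
  have p10 : s2.rarr 10 = s.rarr 10 := F2.rarr 10 (by decide)
  have q8 : s4.ireg 8 = s2.ireg 8 := F34.ireg 8 (by decide)
  have q9 : s4.rarr 9 = s2.rarr 9 := F34.rarr 9 (by decide)
  have q10 : s4.rarr 10 = s2.rarr 10 := F34.rarr 10 (by decide)
  have q25 : s4.rreg 25 = s2.rreg 25 := F34.rreg 25 (by decide)
  have f25 : s4.rreg 25 = s3.rreg 25 := F4.rreg 25 (by decide)
  have f11 : s4.ireg 11 = s3.ireg 11 := F4.ireg 11 (by decide)
  have f12 : s4.ireg 12 = s3.ireg 12 := F4.ireg 12 (by decide)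
  have f17 : s4.rarr 17 = s3.rarr 17 := F4.rarr 17 (by decide)
  have f18 : s4.rarr 18 = s3.rarr 18 := F4.rarr 18 (by decide)
  have f19 : s4.rarr 19 = s3.rarr 19 := F4.rarr 19 (by decide)
  have f20 : s4.rarr 20 = s3.rarr 20 := F4.rarr 20 (by decide)
  refine ⟨_, s4, E, ?_, (E.frame select_wr).mono crossing_wr, ?_⟩
  · simp only [RExp.cost]
    rw [p8] at ht3 c3
    omega
  · constructor
    · rw [q8, q10, q25, p8, p10, r25]; exact a1
    · rw [q8, q10, q25, p8, p10, r25]; exact a2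
    · rw [f11, f17, f18, q8, q9, q10, q25]; exact c1
    · rw [f12, f19, f20, q8, q9, q10, q25]; exact c2
    · rw [d1, f11, f12]
    · rw [f11, q8]; exact c3
    · rw [d1, f17, f18, f19, f20]; exact d2
    · rw [d1, f17, f18, f25]; exact d3

/-- The first query of a round, along the vertical line through the median intersection point. -/
def verticalQuery : Cmd :=
  median 21 13 ;;
  (.rset 26 (.reg 2) ;; .rset 13 (.reg 26) ;; .rset 14 (.const 0) ;; .rset 15 (.const 0) ;;
    .rset 16 (.const 1) ;; .rset 17 (.const 1) ;; .rset 18 (.const 0)) ;;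
  query

/-- The second query of a round, along a line of median slope. -/
def slopedQuery : Cmd :=
  .rset 27 (.reg 19) ;; keepCrossings ;; median 23 14 ;;
  (.rset 28 (.reg 2) ;; .rset 13 (.const 0) ;; .rset 14 (.reg 28) ;; .rset 15 (.const 1) ;;
    .rset 16 (.sub (.const 0) (.reg 25)) ;; .rset 17 (.const 0) ;; .rset 18 (.const 1)) ;;
  query

/-- The locations that `verticalQuery` may write. -/
def verticalWr : List Loc :=
  [.R 13, .R 14, .R 15, .R 16, .R 17, .R 18, .R 26] ++ queryWr

/-- The locations that `slopedQuery` may write. -/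
def slopedWr : List Loc :=
  [.R 13, .R 14, .R 15, .R 16, .R 17, .R 18, .R 27, .R 28, .I 14, .RA 23] ++ queryWr

set_option maxRecDepth 8000 in
theorem verticalQuery_wr : verticalQuery.wr selectWr ⊆ verticalWr := by decide

set_option maxRecDepth 8000 in
theorem slopedQuery_wr : slopedQuery.wr selectWr ⊆ slopedWr := by decide

/-- The locations on which `Memory.pw2` depends. -/
def pw2Locs : List Loc := [.I 8, .RA 9, .RA 10, .RA 11, .R 11, .R 12]

theorem Frame.pw2_eq {s s' : Memory} {L : List Loc} (F : Frame L s s')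
    (hL : ∀ x ∈ pw2Locs, x ∉ L) : s'.pw2 = s.pw2 := by
  simp only [pw2Locs, List.mem_cons, List.not_mem_nil, or_false, forall_eq_or_imp,
    forall_eq] at hL
  obtain ⟨h8, h9, h10, h11, r11, r12⟩ := hL
  exact Memory.pw2_congr (F.ireg _ h8) (F.rarr _ h9) (F.rarr _ h10) (F.rarr _ h11) (F.rreg _ r11)
    (F.rreg _ r12)

theorem verticalQuery_spec (s : Memory) (hb : ∀ v < s.ireg 8, 0 ≤ s.rarr 11 v)
    (hex : ∃ x y, IsMinPt s.pw2 x y) (h13 : s.ireg 13 ≤ s.ireg 8) :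
    ∃ t s', Exec [select] verticalQuery s t s' ∧ t ≤ (s.ireg 8 + 2) * 82000 ∧
      Frame verticalWr s s' ∧
      (s'.rreg 19 = 0 ∧ IsMinPt s.pw2 (s'.rreg 21) (s'.rreg 22) ∨
      (s'.rreg 19 = 1 ∨ s'.rreg 19 = -1) ∧
        ∀ x y, IsMinPt s.pw2 x y → 0 < s'.rreg 19 * (x - s'.rreg 26)) ∧
      ∑ v ∈ Finset.range (s.ireg 13), (if s'.rreg 26 < s.rarr 21 v then (1 : ℝ) else 0)
        ≤ s.ireg 13 / 2 ∧
      (s.ireg 13 : ℝ) / 2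
        ≤ ∑ v ∈ Finset.range (s.ireg 13), (if s'.rreg 26 ≤ s.rarr 21 v then (1 : ℝ) else 0) := by
  obtain ⟨t1, s1, E1, ht1, a1, a2⟩ := median_spec (a := 21) (m := 13) (by decide) (by decide)
    (by decide) (by decide) s
  obtain ⟨t2, s2, E2, ht2, b26, b13, b14, b15, b16, b17, b18⟩ := exec_straight [select]
    (c := .rset 26 (.reg 2) ;; .rset 13 (.reg 26) ;; .rset 14 (.const 0) ;; .rset 15 (.const 0) ;;
      .rset 16 (.const 1) ;; .rset 17 (.const 1) ;; .rset 18 (.const 0)) rfl (s := s1)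
    (Q := fun s' => s'.rreg 26 = s1.rreg 2 ∧ s'.rreg 13 = s1.rreg 2 ∧ s'.rreg 14 = 0 ∧
      s'.rreg 15 = 0 ∧ s'.rreg 16 = 1 ∧ s'.rreg 17 = 1 ∧ s'.rreg 18 = 0)
    (by simp [Cmd.wp, RExp.eval])
  have F2 := (E1.seq E2).frame (P := selectWr) select_wr
  have p8 : s2.ireg 8 = s.ireg 8 := F2.ireg 8 (by decide)
  have p11 : s2.rarr 11 = s.rarr 11 := F2.rarr 11 (by decide)
  have hp : s2.pw2 = s.pw2 := F2.pw2_eq (by decide)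
  obtain ⟨t3, s3, E3, ht3, F3, h3⟩ := query_spec s2 (lx := 1) (ly := 0) (lc := -s1.rreg 2)
    (by rw [p8, p11]; exact hb) (by rw [hp]; exact hex)
    (by intro x y h; exact ⟨y, by rw [b13, b15]; linarith, by rw [b14, b16]; ring⟩)
    (by rw [b13, b14]; ring) (by rw [b15, b16]; ring) (by rw [b17, b18]; ring)
    (by rw [b15, b16, b17, b18]; norm_num)
  have E := E1.seq (E2.seq E3)
  have e26 : s3.rreg 26 = s1.rreg 2 := (F3.rreg 26 (by decide)).trans b26
  rw [hp] at h3
  refine ⟨_, s3, E, ?_, (E.frame select_wr).mono verticalQuery_wr, ?_, ?_, ?_⟩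
  · simp only [Cmd.cost, RExp.cost] at ht2
    rw [p8] at ht3
    omega
  · rcases h3 with h | ⟨h, h'⟩
    · exact Or.inl h
    · refine Or.inr ⟨h, fun x y hxy => ?_⟩
      have := h' x y hxy
      rw [e26]
      convert this using 2
      ring
  · rw [e26]; exact a1
  · rw [e26]; exact a2

theorem slopedQuery_spec (s : Memory) (hb : ∀ v < s.ireg 8, 0 ≤ s.rarr 11 v)
    (hex : ∃ x y, IsMinPt s.pw2 x y) (h13 : s.ireg 13 ≤ s.ireg 8) :
    ∃ t s', Exec [select] slopedQuery s t s' ∧ t ≤ (s.ireg 8 + 2) * 82000 ∧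
      Frame slopedWr s s' ∧ s'.rreg 27 = s.rreg 19 ∧
      (s'.rreg 19 = 0 ∧ IsMinPt s.pw2 (s'.rreg 21) (s'.rreg 22) ∨
      (s'.rreg 19 = 1 ∨ s'.rreg 19 = -1) ∧
        ∀ x y, IsMinPt s.pw2 x y → 0 < s'.rreg 19 * (s.rreg 25 * x + y - s'.rreg 28)) ∧
      (∀ φ : ℝ → ℝ, ∑ i ∈ Finset.range (s'.ireg 14), φ (s'.rarr 23 i)
        = ∑ v ∈ Finset.range (s.ireg 13),
          if 0 ≤ s.rreg 19 * (s.rreg 26 - s.rarr 21 v) then φ (s.rarr 22 v) else 0) ∧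
      ∑ v ∈ Finset.range (s'.ireg 14), (if s'.rreg 28 < s'.rarr 23 v then (1 : ℝ) else 0)
        ≤ s'.ireg 14 / 2 ∧
      (s'.ireg 14 : ℝ) / 2
        ≤ ∑ v ∈ Finset.range (s'.ireg 14),
          (if s'.rreg 28 ≤ s'.rarr 23 v then (1 : ℝ) else 0) := by
  have E0 : Exec [select] (.rset 27 (.reg 19)) s _ (s.rset 27 (s.rreg 19)) := Exec.rset 27 _ s
  obtain ⟨t0, s0, E0', ht0, k1, k2⟩ := keepCrossings_spec [select] (s.rset 27 (s.rreg 19))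
  simp only [rset_ireg, rset_rarr, rset_rreg] at k1 k2 ht0
  obtain ⟨t1, s1, E1, ht1, a1, a2⟩ := median_spec (a := 23) (m := 14) (by decide) (by decide)
    (by decide) (by decide) s0
  have F1 := E1.frame (P := selectWr) select_wr
  have F01 := (E0.seq (E0'.seq E1)).frame (P := selectWr) select_wr
  have c25 : s1.rreg 25 = s.rreg 25 := F01.rreg 25 (by decide)
  obtain ⟨t2, s2, E2, ht2, b28, b13, b14, b15, b16, b17, b18⟩ := exec_straight [select]
    (c := .rset 28 (.reg 2) ;; .rset 13 (.const 0) ;; .rset 14 (.reg 28) ;; .rset 15 (.const 1) ;;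
      .rset 16 (.sub (.const 0) (.reg 25)) ;; .rset 17 (.const 0) ;; .rset 18 (.const 1)) rfl
    (s := s1)
    (Q := fun s' => s'.rreg 28 = s1.rreg 2 ∧ s'.rreg 13 = 0 ∧ s'.rreg 14 = s1.rreg 2 ∧
      s'.rreg 15 = 1 ∧ s'.rreg 16 = -s.rreg 25 ∧ s'.rreg 17 = 0 ∧ s'.rreg 18 = 1)
    (by simp [Cmd.wp, RExp.eval, c25])
  have F2 := (E0.seq (E0'.seq (E1.seq E2))).frame (P := selectWr) select_wr
  have F12 := (E1.seq E2).frame (P := selectWr) select_wr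
  have F012 := (E0'.seq (E1.seq E2)).frame (P := selectWr) select_wr
  have p8 : s2.ireg 8 = s.ireg 8 := F2.ireg 8 (by decide)
  have p11 : s2.rarr 11 = s.rarr 11 := F2.rarr 11 (by decide)
  have hp : s2.pw2 = s.pw2 := F2.pw2_eq (by decide)
  obtain ⟨t3, s3, E3, ht3, F3, h3⟩ := query_spec s2 (lx := s.rreg 25) (ly := 1)
    (lc := -s1.rreg 2)
    (by rw [p8, p11]; exact hb) (by rw [hp]; exact hex)
    (by intro x y h; exact ⟨x, by rw [b13, b15]; ring, by rw [b14, b16]; linarith⟩)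
    (by rw [b13, b14]; ring) (by rw [b15, b16]; ring) (by rw [b17, b18]; ring)
    (by rw [b15, b16, b17, b18]; norm_num)
  have E := E0.seq (E0'.seq (E1.seq (E2.seq E3)))
  have e28 : s3.rreg 28 = s1.rreg 2 := (F3.rreg 28 (by decide)).trans b28
  have e14 : s3.ireg 14 = s0.ireg 14 := (F3.ireg 14 (by decide)).trans (F12.ireg 14 (by decide))
  have e23 : s3.rarr 23 = s0.rarr 23 := (F3.rarr 23 (by decide)).trans (F12.rarr 23 (by decide))
  have e27 : s3.rreg 27 = s.rreg 19 := by
    rw [F3.rreg 27 (by decide), F012.rreg 27 (by decide)]; simp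
  rw [hp] at h3
  refine ⟨_, s3, E, ?_, (E.frame select_wr).mono slopedQuery_wr, e27, ?_, ?_, ?_, ?_⟩
  · simp only [Cmd.cost, RExp.cost] at ht2 ⊢
    rw [p8] at ht3
    omega
  · rcases h3 with h | ⟨h, h'⟩
    · exact Or.inl h
    · refine Or.inr ⟨h, fun x y hxy => ?_⟩
      have := h' x y hxy
      rw [e28]
      convert this using 2
      ring
  · rw [e14, e23]; simpa using k1
  · rw [e14, e23, e28]; exact a1
  · rw [e14, e23, e28]; exact a2

/-- A round of the search for a minimum point of `pw2`. -/
def searchRound : Cmd :=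
  crossing ;; verticalQuery ;;
  .ite (.and (.rle (.reg 19) (.const 0)) (.rle (.const 0) (.reg 19))) (.iset 8 (.const 0))
    (slopedQuery ;;
      .ite (.and (.rle (.reg 19) (.const 0)) (.rle (.const 0) (.reg 19))) (.iset 8 (.const 0))
        pruneLines)

/-- The locations that `searchRound` may write. -/
def searchWr : List Loc :=
  [.I 8, .I 11, .I 12, .I 13, .I 14, .I 15, .R 11, .R 12, .R 13, .R 14, .R 15, .R 16, .R 17, .R 18,
    .R 25, .R 26, .R 27, .R 28, .RA 9, .RA 10, .RA 11, .RA 17, .RA 18, .RA 19, .RA 20, .RA 21,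
    .RA 22, .RA 23] ++ queryWr

set_option maxRecDepth 8000 in
theorem searchRound_wr : searchRound.wr selectWr ⊆ searchWr := by decide

-- A round ends either with at most 15/16 of the lines and a function whose minimum points are still
-- minimum points of the old one, or with a point found optimal by the oracle. In the latter case
-- the number of lines is set to zero, which stops the loop.
set_option maxHeartbeats 1000000 in
theorem searchRound_spec (s : Memory) (h0 : 1 ≤ s.ireg 8) (hb : ∀ v < s.ireg 8, 0 ≤ s.rarr 11 v)
    (hex : ∃ x y, IsMinPt s.pw2 x y) :
    ∃ t s', Exec [select] searchRound s t s' ∧ t ≤ s.ireg 8 * 600000 ∧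
      16 * s'.ireg 8 ≤ 15 * s.ireg 8 ∧ (∀ v < s'.ireg 8, 0 ≤ s'.rarr 11 v) ∧
      ((∃ x y, IsMinPt s'.pw2 x y) ∧ (∀ x y, IsMinPt s'.pw2 x y → IsMinPt s.pw2 x y) ∨
      s'.ireg 8 = 0 ∧ IsMinPt s.pw2 (s'.rreg 21) (s'.rreg 22)) := by
  classical
  obtain ⟨t1, s1, E1, ht1, F1, C1⟩ := crossing_spec s
  have p8 : s1.ireg 8 = s.ireg 8 := F1.ireg 8 (by decide)
  have p11 : s1.rarr 11 = s.rarr 11 := F1.rarr 11 (by decide)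
  have hp1 : s1.pw2 = s.pw2 := F1.pw2_eq (by decide)
  have h13 : s1.ireg 13 ≤ s1.ireg 8 := by
    rw [C1.hh]; exact (min_le_left _ _).trans C1.hle
  obtain ⟨t2, s2, E2, ht2, F2, h2, x1, x2⟩ := verticalQuery_spec s1 (by rw [p8, p11]; exact hb)
    (by rw [hp1]; exact hex) h13
  have C2 := C1.of_frame F2 (by decide)
  have q8 : s2.ireg 8 = s.ireg 8 := (F2.ireg 8 (by decide)).trans p8
  have q11 : s2.rarr 11 = s.rarr 11 := (F2.rarr 11 (by decide)).trans p11
  have hp2 : s2.pw2 = s.pw2 := (F2.pw2_eq (by decide)).trans hp1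
  have e13 : s2.ireg 13 = s1.ireg 13 := F2.ireg 13 (by decide)
  have e21 : s2.rarr 21 = s1.rarr 21 := F2.rarr 21 (by decide)
  rw [← e13, ← e21] at x1 x2
  rw [hp1] at h2
  rcases h2 with ⟨hz, hmin⟩ | ⟨hεx, hx⟩
  · refine ⟨_, s2.iset 8 0, E1.seq (E2.seq (.ite_true (by simp [BExp.Holds, RExp.eval, hz])
      (by simpa [IExp.eval] using Exec.iset 8 (.const 0) s2))), ?_, by simp, by simp,
      Or.inr ⟨by simp, by simpa using hmin⟩⟩
    simp only [BExp.cost, RExp.cost, IExp.cost]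
    omega
  have hc2 : ¬ (BExp.and (.rle (.reg 19) (.const 0)) (.rle (.const 0) (.reg 19))).Holds s2 := by
    rcases hεx with h | h <;> simp [BExp.Holds, RExp.eval, h]
  obtain ⟨t3, s3, E3, ht3, F3, e27, h3, hU, n1, n2⟩ := slopedQuery_spec s2
    (by rw [q8, q11]; exact hb) (by rw [hp2]; exact hex) (by rw [e13, q8, ← p8]; exact h13)
  have C3 := C2.of_frame F3 (by decide)
  have r8 : s3.ireg 8 = s.ireg 8 := (F3.ireg 8 (by decide)).trans q8
  have r11 : s3.rarr 11 = s.rarr 11 := (F3.rarr 11 (by decide)).trans q11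
  have hp3 : s3.pw2 = s.pw2 := (F3.pw2_eq (by decide)).trans hp2
  have f13 : s3.ireg 13 = s2.ireg 13 := F3.ireg 13 (by decide)
  have f21 : s3.rarr 21 = s2.rarr 21 := F3.rarr 21 (by decide)
  have f22 : s3.rarr 22 = s2.rarr 22 := F3.rarr 22 (by decide)
  have f25 : s3.rreg 25 = s2.rreg 25 := F3.rreg 25 (by decide)
  have f26 : s3.rreg 26 = s2.rreg 26 := F3.rreg 26 (by decide)
  rw [← f13, ← f21, ← f26] at x1 x2
  rw [← e27, ← f13, ← f21, ← f22, ← f26] at hU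
  rw [hp2, ← f25] at h3
  rw [← e27, ← f26] at hx
  rw [← e27] at hεx
  rcases h3 with ⟨hz, hmin⟩ | ⟨hεν, hy⟩
  · refine ⟨_, s3.iset 8 0, E1.seq (E2.seq (.ite_false hc2 (E3.seq (.ite_true
      (by simp [BExp.Holds, RExp.eval, hz])
      (by simpa [IExp.eval] using Exec.iset 8 (.const 0) s3))))), ?_, by simp, by simp,
      Or.inr ⟨by simp, by simpa using hmin⟩⟩
    simp only [BExp.cost, RExp.cost, IExp.cost]
    omega
  have hc3 : ¬ (BExp.and (.rle (.reg 19) (.const 0)) (.rle (.const 0) (.reg 19))).Holds s3 := by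
    rcases hεν with h | h <;> simp [BExp.Holds, RExp.eval, h]
  obtain ⟨t4, s4, E4, ht4, g1, g2, g3⟩ := pruneLines_spec [select] s3
  have hcard := prunable_card C3.hL C3.hR C3.hh C3.hX C3.hV hU C3.m1 C3.m2 x1 x2 n1 n2 hεx hεν
  have key := pruned_isMinPt (by rw [r8, r11]; exact hb) g1 g2 g3 hεx hεν
    (by rw [hp3]; exact hx) (by rw [hp3]; exact hy) (by rw [hp3]; exact hex)
  rw [hp3] at key
  refine ⟨_, s4, E1.seq (E2.seq (.ite_false hc2 (E3.seq (.ite_false hc3 E4)))), ?_, ?_, key.1,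
    Or.inl key.2⟩
  · simp only [BExp.cost, RExp.cost]
    omega
  · have h5 := g1 fun _ _ _ => 1
    simp only [Finset.sum_const, Finset.card_range, nsmul_eq_mul, mul_one] at h5
    have h6 : ∑ v ∈ Finset.range (s3.ireg 8), (if s3.Prunable v then (0 : ℝ) else 1)
        + ∑ v ∈ Finset.range (s3.ireg 8), (if s3.Prunable v then (1 : ℝ) else 0) = s3.ireg 8 := by
      rw [← Finset.sum_add_distrib, Finset.sum_congr rfl (g := fun _ => (1 : ℝ))]
      · simp
      · intro v _; split_ifs <;> norm_num
    have h7 : (s3.ireg 8 : ℝ) / 16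
        ≤ ∑ v ∈ Finset.range (s3.ireg 8), (if s3.Prunable v then (1 : ℝ) else 0) := hcard
    rw [← r8]
    have h8 : (16 * s4.ireg 8 : ℝ) ≤ 15 * s3.ireg 8 := by linarith
    exact_mod_cast h8

/-- Find a minimum point of `pw2`. -/
def search : Cmd := .while (.ile (.const 1) (.reg 8)) searchRound

set_option maxRecDepth 8000 in
theorem search_wr : search.wr selectWr ⊆ searchWr := searchRound_wr

/-- A round costs at most `600000` per line and removes a sixteenth of the lines, and `10000000 / 16
= 625000` pays for it. -/
theorem search_spec (s : Memory) (hb : ∀ v < s.ireg 8, 0 ≤ s.rarr 11 v)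
    (hex : ∃ x y, IsMinPt s.pw2 x y) :
    ∃ t s', Exec [select] search s t s' ∧ t ≤ s.ireg 8 * 10000000 + 10 ∧
      IsMinPt s.pw2 (s'.rreg 21) (s'.rreg 22) := by
  induction hm : s.ireg 8 using Nat.strong_induction_on generalizing s with
  | _ m ih =>
  rcases Nat.eq_zero_or_pos m with h | h
  · subst h
    refine ⟨_, s, .while_false (by simp [BExp.Holds, IExp.eval, hm]), ?_, ?_⟩
    · simp [BExp.cost, IExp.cost]
    -- Without lines the function is linear; having a minimum, it is zero, so whatever the point
    -- registers hold is a minimum point.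
    · obtain ⟨x, y, hmin⟩ := hex
      have hv : ∀ x' y', s.pw2 x' y' = s.rreg 11 * x' + s.rreg 12 * y' := by
        intro x' y'; simp [Memory.pw2, pw2, hm]
      have h1 : s.rreg 11 = 0 := by
        have := hmin (x - s.rreg 11) y
        rw [hv, hv] at this
        nlinarith [mul_self_nonneg (s.rreg 11)]
      have h2 : s.rreg 12 = 0 := by
        have := hmin x (y - s.rreg 12)
        rw [hv, hv] at this
        nlinarith [mul_self_nonneg (s.rreg 12)]
      intro x' y'
      rw [hv, hv, h1, h2]
      simp
  · obtain ⟨t1, s1, E1, ht1, hle, hb1, h1⟩ := searchRound_spec s (by omega) hb hex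
    have hB : (BExp.ile (.const 1) (.reg 8)).Holds s := by
      simp [BExp.Holds, IExp.eval, hm]; omega
    rw [hm] at ht1 hle
    rcases h1 with ⟨hex1, hmin1⟩ | ⟨h8, hmin⟩
    · obtain ⟨t2, s2, E2, ht2, h2⟩ := ih (s1.ireg 8) (by omega) s1 hb1 hex1 rfl
      refine ⟨_, s2, .while_true hB E1 E2, ?_, hmin1 _ _ h2⟩
      simp only [BExp.cost, IExp.cost]
      omega
    · refine ⟨_, s1, .while_true hB E1 (.while_false (by simp [BExp.Holds, IExp.eval, h8])), ?_,
        hmin⟩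
      simp only [BExp.cost, IExp.cost]
      omega

end Rounds

/-! ### Existence of dual solutions -/

section DualExistence

/-- The dual objective function of a linear program with two rows and variables in `[0, 1]`. -/
noncomputable def dual (N : ℕ) (c A D : ℕ → ℝ) (β κ x y : ℝ) : ℝ :=
  β * x + κ * y + ∑ v ∈ Finset.range N, max (c v - A v * x - D v * y) 0

variable {N : ℕ} {c A D : ℕ → ℝ} {β κ : ℝ}

theorem dual_swap (x y : ℝ) : dual N c A D β κ x y = dual N c D A κ β y x := by
  simp only [dual]
  rw [add_comm (β * x)]
  congr 1
  exact Finset.sum_congr rfl fun v _ => by rw [sub_right_comm]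

/-- For negative `x` the zero-profit column `v₀` alone contributes `-A v₀ * x`, which outweighs the
gain in `β * x`. This is the sign constraint on a multiplier, enforced by a slack column. -/
theorem dual_lower (hA : ∀ v < N, 0 ≤ A v) {v₀ : ℕ} (hv : v₀ < N) (hc : c v₀ = 0) (hD : D v₀ = 0)
    (hβ : β ≤ A v₀) (x y : ℝ) : dual N c A D β κ (max x 0) y ≤ dual N c A D β κ x y := by
  rcases le_total 0 x with hx | hx
  · rw [max_eq_left hx]
  · rw [max_eq_right hx]
    simp only [dual]
    have h : ∑ v ∈ Finset.range N, (max (c v - A v * 0 - D v * y) 0 +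
        if v = v₀ then -(β * x) else 0)
        ≤ ∑ v ∈ Finset.range N, max (c v - A v * x - D v * y) 0 := by
      refine Finset.sum_le_sum fun v hv => ?_
      have hAx := mul_nonpos_of_nonneg_of_nonpos (hA v (Finset.mem_range.1 hv)) hx
      split_ifs with h
      · subst h
        rw [hc, hD]
        have : β * x ≥ A v * x := mul_le_mul_of_nonpos_right hβ hx
        rw [max_eq_right (by simp)]
        exact le_max_of_le_left (by linarith)
      · rw [add_zero]
        exact max_le_max (by linarith) le_rfl
    rw [Finset.sum_add_distrib, Finset.sum_ite_eq' _ v₀, if_pos (Finset.mem_range.2 hv)] at h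
    linarith

/-- Beyond the bound every hinge that depends on `x` is zero, so a further increase only raises `β *
x`. Columns with `A v = 0` contribute zero to the bound because of division by zero, and they do not
depend on `x`. -/
theorem dual_upper (hA : ∀ v < N, 0 ≤ A v) (hD : ∀ v < N, 0 ≤ D v) (hβ : 0 ≤ β) {y : ℝ}
    (hy : 0 ≤ y) (x : ℝ) :
    dual N c A D β κ (min x (∑ v ∈ Finset.range N, |c v| / A v)) y ≤ dual N c A D β κ x y := by
  set Λ := ∑ v ∈ Finset.range N, |c v| / A v with hΛ
  rcases le_total x Λ with hx | hx
  · rw [min_eq_left hx]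
  · rw [min_eq_right hx]
    simp only [dual]
    have h1 : β * Λ ≤ β * x := mul_le_mul_of_nonneg_left hx hβ
    have h : ∑ v ∈ Finset.range N, max (c v - A v * Λ - D v * y) 0
        ≤ ∑ v ∈ Finset.range N, max (c v - A v * x - D v * y) 0 := by
      refine Finset.sum_le_sum fun v hv => ?_
      rcases (hA v (Finset.mem_range.1 hv)).eq_or_lt with h | h
      · rw [← h]; simp
      · have h2 : |c v| / A v ≤ Λ := Finset.single_le_sum (f := fun v => |c v| / A v)
          (fun v hv => div_nonneg (abs_nonneg _) (hA v (Finset.mem_range.1 hv))) hv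
        rw [div_le_iff₀ h] at h2
        have h3 := mul_nonneg (hD v (Finset.mem_range.1 hv)) hy
        have h4 := le_abs_self (c v)
        rw [max_eq_right (by linarith)]
        exact le_max_right _ _
    linarith

/-- Clamping both coordinates never increases the value, so a minimum over a compact box is global.
-/
theorem exists_isMinPt_dual (hA : ∀ v < N, 0 ≤ A v) (hD : ∀ v < N, 0 ≤ D v) (hβ : 0 ≤ β)
    (hκ : 0 ≤ κ) {v₀ v₁ : ℕ} (hv₀ : v₀ < N) (hv₁ : v₁ < N) (hc₀ : c v₀ = 0) (hc₁ : c v₁ = 0)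
    (hD₀ : D v₀ = 0) (hA₁ : A v₁ = 0) (hβ₀ : β ≤ A v₀) (hκ₁ : κ ≤ D v₁) :
    ∃ x y, IsMinPt (dual N c A D β κ) x y := by
  set Λ := ∑ v ∈ Finset.range N, |c v| / A v with hΛ
  set M := ∑ v ∈ Finset.range N, |c v| / D v with hM
  have hΛ0 : 0 ≤ Λ := Finset.sum_nonneg fun v hv =>
    div_nonneg (abs_nonneg _) (hA v (Finset.mem_range.1 hv))
  have hM0 : 0 ≤ M := Finset.sum_nonneg fun v hv =>
    div_nonneg (abs_nonneg _) (hD v (Finset.mem_range.1 hv))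
  have hcont : Continuous fun p : ℝ × ℝ => dual N c A D β κ p.1 p.2 := by
    unfold dual; fun_prop
  obtain ⟨⟨x, y⟩, -, hmin⟩ := ((isCompact_Icc (a := (0 : ℝ)) (b := Λ)).prod
    (isCompact_Icc (a := (0 : ℝ)) (b := M))).exists_isMinOn
    ⟨(0, 0), ⟨⟨le_rfl, hΛ0⟩, ⟨le_rfl, hM0⟩⟩⟩ hcont.continuousOn
  refine ⟨x, y, fun x' y' => ?_⟩
  have h1 : dual N c A D β κ (max x' 0) y' ≤ dual N c A D β κ x' y' :=
    dual_lower hA hv₀ hc₀ hD₀ hβ₀ x' y'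
  have h2 : dual N c A D β κ (max x' 0) (max y' 0) ≤ dual N c A D β κ (max x' 0) y' := by
    rw [dual_swap, dual_swap (y := y')]
    exact dual_lower hD hv₁ hc₁ hA₁ hκ₁ y' _
  have h3 : dual N c A D β κ (min (max x' 0) Λ) (max y' 0)
      ≤ dual N c A D β κ (max x' 0) (max y' 0) :=
    dual_upper hA hD hβ (le_max_right _ _) _
  have h4 : dual N c A D β κ (min (max x' 0) Λ) (min (max y' 0) M)
      ≤ dual N c A D β κ (min (max x' 0) Λ) (max y' 0) := by
    rw [dual_swap, dual_swap (y := max y' 0)]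
    exact dual_upper hD hA hκ (le_min (le_max_right _ _) hΛ0) _
  have h5 := hmin (a := (min (max x' 0) Λ, min (max y' 0) M))
    ⟨⟨le_min (le_max_right _ _) hΛ0, min_le_right _ _⟩,
      ⟨le_min (le_max_right _ _) hM0, min_le_right _ _⟩⟩
  exact h5.trans (h4.trans (h3.trans (h2.trans h1)))

/-- Replacing the second row by the sum of the rows corresponds to the substitution `(x + y, y)` in
the dual. It ensures that a column whose coefficient `B v` vanishes also has `A v = 0`: such a
column adds only a constant, so the division by `B v` is harmless. -/
theorem exists_isMinPt_pw2 {B : ℕ → ℝ} (hA : ∀ v < N, 0 ≤ A v) (hAB : ∀ v < N, A v ≤ B v)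
    (hβ : 0 ≤ β) (hκ : 0 ≤ κ) {v₀ v₁ : ℕ} (hv₀ : v₀ < N) (hv₁ : v₁ < N) (hc₀ : c v₀ = 0)
    (hc₁ : c v₁ = 0) (hD₀ : B v₀ = A v₀) (hA₁ : A v₁ = 0) (hβ₀ : β ≤ A v₀) (hκ₁ : κ ≤ B v₁) :
    ∃ x y, IsMinPt (pw2 N (fun v => c v / B v) (fun v => A v / B v) B β (β + κ)) x y := by
  obtain ⟨x, y, h⟩ := exists_isMinPt_dual (D := fun v => B v - A v) hA
    (fun v hv => sub_nonneg.2 (hAB v hv)) hβ hκ hv₀ hv₁ hc₀ hc₁ (by simp [hD₀]) hA₁ hβ₀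
    (by simpa [hA₁] using hκ₁)
  have e : ∀ x y, pw2 N (fun v => c v / B v) (fun v => A v / B v) B β (β + κ) x y +
      ∑ v ∈ Finset.range N, (if B v = 0 then max (c v) 0 else 0)
      = dual N c A (fun v => B v - A v) β κ (x + y) y := by
    intro x y
    have h : ∑ v ∈ Finset.range N, B v * max (c v / B v - A v / B v * x - y) 0 +
        ∑ v ∈ Finset.range N, (if B v = 0 then max (c v) 0 else 0)
        = ∑ v ∈ Finset.range N, max (c v - A v * (x + y) - (B v - A v) * y) 0 := by
      rw [← Finset.sum_add_distrib]
      refine Finset.sum_congr rfl fun v hv => ?_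
      have h1 := hA v (Finset.mem_range.1 hv)
      have h2 := hAB v (Finset.mem_range.1 hv)
      split_ifs with h0
      · have : A v = 0 := le_antisymm (h0 ▸ h2) h1
        simp [h0, this]
      · have hp : 0 < B v := lt_of_le_of_ne (h1.trans h2) (Ne.symm h0)
        rw [add_zero]
        have e1 : c v - A v * (x + y) - (B v - A v) * y = B v * (c v / B v - A v / B v * x - y) := by
          field_simp; ring
        rw [e1, mul_max_of_nonneg _ _ hp.le, mul_zero]
    simp only [pw2, dual]
    rw [← h]
    ring
  refine ⟨x - y, y, fun x' y' => ?_⟩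
  have h1 := h (x' + y') y'
  rw [← e] at h1
  have h2 := e (x - y) y
  rw [sub_add_cancel] at h2
  linarith

end DualExistence

/-! ### Recovering primal solutions -/

section Recovery

/-- The converse of `weighted_min`: at a minimum both one-sided derivatives have the right sign.
They are taken from the two-variable calculus, with all slopes zero. -/
theorem pw1_min_bounds {m : ℕ} {g b : ℕ → ℝ} {r u : ℝ}
    (h : ∀ u', pw1 m g (fun _ => 1) b r u ≤ pw1 m g (fun _ => 1) b r u') :
    ∑ v ∈ Finset.range m, (if u < g v then b v else 0) ≤ r ∧
      r ≤ ∑ v ∈ Finset.range m, (if u ≤ g v then b v else 0) := by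
  have e : ∀ t, pw2 m g (fun _ => 0) b 0 r 0 t = pw1 m g (fun _ => 1) b r t := by
    intro t; simp [pw1, pw2]
  have hl : ∀ t, pw2 m g (fun _ => 0) b 0 r 0 u
      ≤ pw2 m g (fun _ => 0) b 0 r (0 + t * 0) (u + t * 1) := by
    intro t
    rw [mul_zero, add_zero, e, e]
    exact h _
  have h1 := deriv_nonneg_of_line hl 1
  have h2 := deriv_nonneg_of_line hl (-1)
  simp only [pw2Deriv] at h1 h2
  constructor
  · have : ∑ v ∈ Finset.range m, b v * (if g v - 0 * 0 - u = 0 then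
        max (-(0 * (1 * 0) + 1 * 1)) 0 else if 0 ≤ g v - 0 * 0 - u then -(0 * (1 * 0) + 1 * 1)
          else 0) = -∑ v ∈ Finset.range m, (if u < g v then b v else 0) := by
      rw [← Finset.sum_neg_distrib]
      refine Finset.sum_congr rfl fun v _ => ?_
      rcases lt_trichotomy (g v) u with h | h | h
      · rw [if_neg (by linarith), if_neg (by linarith), if_neg (by linarith)]; ring
      · rw [if_pos (by linarith), if_neg (by linarith)]; norm_num
      · rw [if_neg (by linarith), if_pos (by linarith), if_pos (by linarith)]; ring
    rw [this] at h1
    linarith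
  · have : ∑ v ∈ Finset.range m, b v * (if g v - 0 * 0 - u = 0 then
        max (-(0 * (-1 * 0) + -1 * 1)) 0 else if 0 ≤ g v - 0 * 0 - u then
          -(0 * (-1 * 0) + -1 * 1) else 0) = ∑ v ∈ Finset.range m, (if u ≤ g v then b v else 0) := by
      refine Finset.sum_congr rfl fun v _ => ?_
      rcases lt_trichotomy (g v) u with h | h | h
      · rw [if_neg (by linarith), if_neg (by linarith), if_neg (by linarith)]; ring
      · rw [if_pos (by linarith), if_pos (by linarith)]; norm_num
      · rw [if_neg (by linarith), if_pos (by linarith), if_pos (by linarith)]; ring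
    rw [this] at h2
    linarith

/-- The primal solution that belongs to a direction of steepest descent. -/
noncomputable def recovered (ε u θ : ℝ) (ρ σ : ℕ → ℝ) (v : ℕ) : ℝ :=
  if 0 < ρ v ∨ ρ v = 0 ∧ u < -(ε * σ v) then 1 else if ρ v = 0 ∧ u = -(ε * σ v) then θ else 0

variable {m : ℕ} {γ σ b ρ : ℕ → ℝ} {r₁ r₂ x y ε u θ S E : ℝ}

/-- Minimality in `u` is a subgradient condition: `r₂` lies between the weight `S` of the columns
forced to one and the weight `S + E` that includes the ties, namely columns of zero reduced cost
that stay critical along the direction. The ties share the value `θ` that fills the second row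
exactly. The minimal derivative then becomes `ε` times the residual of the first row. The link
between `ρ` and `γ`, `σ` is needed only for `b v ≠ 0`, since the other columns do not contribute. -/
theorem recovered_spec (hb : ∀ v < m, 0 ≤ b v)
    (hρ : ∀ v < m, b v ≠ 0 → ρ v = b v * (γ v - σ v * x - y))
    (hmin : ∀ u', pw2Deriv m γ σ b r₁ r₂ x y (ε * 1 + u * 0) (ε * 0 + u * 1)
      ≤ pw2Deriv m γ σ b r₁ r₂ x y (ε * 1 + u' * 0) (ε * 0 + u' * 1))
    (hS : S = ∑ v ∈ Finset.range m, if 0 < ρ v ∨ ρ v = 0 ∧ u < -(ε * σ v) then b v else 0)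
    (hE : E = ∑ v ∈ Finset.range m, if 0 < ρ v ∨ ρ v = 0 ∧ u < -(ε * σ v) then 0 else
      if ρ v = 0 ∧ u = -(ε * σ v) then b v else 0)
    (hθ : θ = (r₂ - S) / E) :
    0 ≤ θ ∧ θ ≤ 1 ∧ ∑ v ∈ Finset.range m, b v * recovered ε u θ ρ σ v = r₂ ∧
      pw2Deriv m γ σ b r₁ r₂ x y (ε * 1 + u * 0) (ε * 0 + u * 1)
        = ε * (r₁ - ∑ v ∈ Finset.range m, b v * σ v * recovered ε u θ ρ σ v) := by
  -- in terms of the signs of `ρ`, the derivative decomposes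
  have sgn : ∀ v < m, b v ≠ 0 → (γ v - σ v * x - y = 0 ↔ ρ v = 0) ∧
      (0 ≤ γ v - σ v * x - y ↔ 0 ≤ ρ v) := by
    intro v hv h
    have hp : 0 < b v := lt_of_le_of_ne (hb v hv) (Ne.symm h)
    rw [hρ v hv h]
    exact ⟨by simp [h], by rw [mul_nonneg_iff_of_pos_left hp]⟩
  obtain ⟨b1, b2⟩ := pw1_min_bounds (m := m) (g := fun v => -(ε * (σ v * 1 + 0)))
    (b := fun v => if γ v - σ v * x - y = 0 then b v else 0)
    (r := r₁ * 0 + r₂ * 1 - ∑ v ∈ Finset.range m, (if γ v - σ v * x - y = 0 then 0 else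
          if 0 ≤ γ v - σ v * x - y then b v * (σ v * 0 + 1) else 0)) (u := u) (by
      intro u'
      have := hmin u'
      rw [pw2Deriv_line, pw2Deriv_line] at this
      simp only [mul_zero, zero_add] at this ⊢
      linarith)
  have s1 : S = ∑ v ∈ Finset.range m, (if γ v - σ v * x - y = 0 then 0 else
          if 0 ≤ γ v - σ v * x - y then b v * (σ v * 0 + 1) else 0) +
      ∑ v ∈ Finset.range m, (if u < -(ε * (σ v * 1 + 0)) then
        (if γ v - σ v * x - y = 0 then b v else 0) else 0) := by
    rw [hS, ← Finset.sum_add_distrib]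
    refine Finset.sum_congr rfl fun v hv => ?_
    by_cases h : b v = 0
    · simp [h]
    · obtain ⟨g1, g2⟩ := sgn v (Finset.mem_range.1 hv) h
      simp only [g1, g2, mul_one, add_zero, mul_zero, zero_add]
      rcases lt_trichotomy (ρ v) 0 with h | h | h
      · simp [h.ne, h.not_gt, h.not_ge]
      · simp [h]
      · simp [h.ne', h, h.le]
  have s2 : S + E = ∑ v ∈ Finset.range m, (if γ v - σ v * x - y = 0 then 0 else
          if 0 ≤ γ v - σ v * x - y then b v * (σ v * 0 + 1) else 0) +
      ∑ v ∈ Finset.range m, (if u ≤ -(ε * (σ v * 1 + 0)) then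
        (if γ v - σ v * x - y = 0 then b v else 0) else 0) := by
    rw [hS, hE, ← Finset.sum_add_distrib, ← Finset.sum_add_distrib]
    refine Finset.sum_congr rfl fun v hv => ?_
    by_cases h : b v = 0
    · simp [h]
    · obtain ⟨g1, g2⟩ := sgn v (Finset.mem_range.1 hv) h
      simp only [g1, g2, mul_one, add_zero, mul_zero, zero_add]
      rcases lt_trichotomy (ρ v) 0 with h | h | h
      · simp [h.ne, h.not_gt, h.not_ge]
      · rcases lt_trichotomy u (-(ε * σ v)) with h' | h' | h'
        · simp [h, h', h'.le]
        · simp [h, h']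
        · simp [h, h'.not_gt, h'.not_ge, h'.ne']
      · simp [h.ne', h, h.le]
  have hSr : S ≤ r₂ := by rw [s1]; linarith
  have hrE : r₂ ≤ S + E := by rw [s2]; linarith
  have hE0 : 0 ≤ E := by linarith
  have hθE : θ * E = r₂ - S := by
    -- If the ties have no weight then `r₂ = S`, and the quotient by zero does no harm.
    rcases hE0.eq_or_lt with h | h
    · rw [← h]; linarith
    · rw [hθ]; exact div_mul_cancel₀ _ h.ne'
  have hsum : ∑ v ∈ Finset.range m, b v * recovered ε u θ ρ σ v = r₂ := by
    have : ∑ v ∈ Finset.range m, b v * recovered ε u θ ρ σ v = S + θ * E := by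
      rw [hS, hE, Finset.mul_sum, ← Finset.sum_add_distrib]
      refine Finset.sum_congr rfl fun v _ => ?_
      unfold recovered
      split_ifs <;> ring
    rw [this, hθE]; ring
  refine ⟨by rw [hθ]; exact div_nonneg (by linarith) hE0, ?_, hsum, ?_⟩
  · rw [hθ]; exact div_le_one_of_le₀ (by linarith) hE0
  · have h1 : ∑ v ∈ Finset.range m, b v * (if γ v - σ v * x - y = 0 then
        max (-(σ v * (ε * 1 + u * 0) + (ε * 0 + u * 1))) 0 else if 0 ≤ γ v - σ v * x - y then
          -(σ v * (ε * 1 + u * 0) + (ε * 0 + u * 1)) else 0)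
        = ∑ v ∈ Finset.range m, (-ε * (b v * σ v * recovered ε u θ ρ σ v)
          - u * (b v * recovered ε u θ ρ σ v)) := by
      refine Finset.sum_congr rfl fun v hv => ?_
      by_cases h : b v = 0
      · simp [h]
      · obtain ⟨g1, g2⟩ := sgn v (Finset.mem_range.1 hv) h
        simp only [g1, g2, recovered]
        rcases lt_trichotomy (ρ v) 0 with h | h | h
        · simp [h.ne, h.not_gt, h.not_ge]
        · rcases lt_trichotomy u (-(ε * σ v)) with h' | h' | h'
          · rw [if_pos h, if_pos (Or.inr ⟨h, h'⟩), max_eq_left (by linarith)]; ring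
          · rw [if_pos h, if_neg (by simp [h, h']), if_pos ⟨h, h'⟩, max_eq_right (by linarith), h']
            ring
          · rw [if_pos h, if_neg (by simp [h, h'.le]), if_neg (by simp [h, h'.ne']),
              max_eq_right (by linarith)]; ring
        · rw [if_neg h.ne', if_pos h.le, if_pos (Or.inl h)]; ring
    rw [pw2Deriv, h1, Finset.sum_sub_distrib, ← Finset.mul_sum, ← Finset.mul_sum, hsum]
    ring

theorem recovered_bounds (h0 : 0 ≤ θ) (h1 : θ ≤ 1) (v : ℕ) :
    0 ≤ recovered ε u θ ρ σ v ∧ recovered ε u θ ρ σ v ≤ 1 := by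
  unfold recovered
  split_ifs
  · exact ⟨zero_le_one, le_rfl⟩
  · exact ⟨h0, h1⟩
  · exact ⟨le_rfl, zero_le_one⟩

theorem recovered_of_pos {v : ℕ} (h : 0 < ρ v) : recovered ε u θ ρ σ v = 1 := by
  rw [recovered, if_pos (Or.inl h)]

theorem recovered_of_neg {v : ℕ} (h : ρ v < 0) : recovered ε u θ ρ σ v = 0 := by
  simp [recovered, h.not_gt, h.ne]

end Recovery

/-! ### Purification -/

section Purification

/-- `z` is an optimal solution of the linear program with two rows, as certified by the dual
solution `(x, y)`. -/
structure Certified (N : ℕ) (c A B : ℕ → ℝ) (r₁ r₂ x y : ℝ) (z : ℕ → ℝ) : Prop where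
  nonneg : ∀ v < N, 0 ≤ z v
  le_one : ∀ v < N, z v ≤ 1
  row₁ : ∑ v ∈ Finset.range N, A v * z v = r₁
  row₂ : ∑ v ∈ Finset.range N, B v * z v = r₂
  of_pos : ∀ v < N, 0 < c v - A v * x - B v * y → z v = 1
  of_neg : ∀ v < N, c v - A v * x - B v * y < 0 → z v = 0

variable {N : ℕ} {c A B z z' : ℕ → ℝ} {r₁ r₂ x y : ℝ}

/-- Complementary slackness: on vectors that satisfy both rows the objective is the reduced cost
part plus a constant, and `z` maximizes the reduced cost part coordinate by coordinate. -/
theorem Certified.optimal (h : Certified N c A B r₁ r₂ x y z) (h0 : ∀ v < N, 0 ≤ z' v)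
    (h1 : ∀ v < N, z' v ≤ 1) (hA : ∑ v ∈ Finset.range N, A v * z' v = r₁)
    (hB : ∑ v ∈ Finset.range N, B v * z' v = r₂) :
    ∑ v ∈ Finset.range N, c v * z' v ≤ ∑ v ∈ Finset.range N, c v * z v := by
  have e : ∀ w : ℕ → ℝ, ∑ v ∈ Finset.range N, c v * w v
      = ∑ v ∈ Finset.range N, (c v - A v * x - B v * y) * w v
        + x * ∑ v ∈ Finset.range N, A v * w v + y * ∑ v ∈ Finset.range N, B v * w v := by
    intro w
    rw [Finset.mul_sum, Finset.mul_sum, ← Finset.sum_add_distrib, ← Finset.sum_add_distrib]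
    exact Finset.sum_congr rfl fun v _ => by ring
  rw [e, e z, hA, hB, h.row₁, h.row₂]
  gcongr ?_ + _ + _
  refine Finset.sum_le_sum fun v hv => ?_
  have hv := Finset.mem_range.1 hv
  rcases lt_trichotomy (c v - A v * x - B v * y) 0 with hl | hl | hl
  · rw [h.of_neg v hv hl, mul_zero]
    exact mul_nonpos_of_nonpos_of_nonneg hl.le (h0 v hv)
  · rw [hl, zero_mul, zero_mul]
  · rw [h.of_pos v hv hl]
    exact mul_le_mul_of_nonneg_left (h1 v hv) hl.le

/-- Both vectors are complementary to the same dual point, and this property is preserved by convex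
combinations, while the first row interpolates. -/
theorem Certified.combine {z₁ z₂ : ℕ → ℝ} {r₁' r₁'' η : ℝ}
    (h : Certified N c A B r₁' r₂ x y z₁) (h' : Certified N c A B r₁'' r₂ x y z₂)
    (h0 : 0 ≤ η) (h1 : η ≤ 1) (hr : η * r₁' + (1 - η) * r₁'' = r₁)
    (hz : ∀ v < N, z v = η * z₁ v + (1 - η) * z₂ v) : Certified N c A B r₁ r₂ x y z := by
  have e : ∀ w : ℕ → ℝ, ∑ v ∈ Finset.range N, w v * z v
      = η * ∑ v ∈ Finset.range N, w v * z₁ v + (1 - η) * ∑ v ∈ Finset.range N, w v * z₂ v := by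
    intro w
    rw [Finset.mul_sum, Finset.mul_sum, ← Finset.sum_add_distrib]
    exact Finset.sum_congr rfl fun v hv => by rw [hz v (Finset.mem_range.1 hv)]; ring
  have h1' : 0 ≤ 1 - η := by linarith
  refine ⟨fun v hv => ?_, fun v hv => ?_, ?_, ?_, fun v hv hp => ?_, fun v hv hp => ?_⟩
  · rw [hz v hv]
    exact add_nonneg (mul_nonneg h0 (h.nonneg v hv)) (mul_nonneg h1' (h'.nonneg v hv))
  · rw [hz v hv]
    have a := mul_le_mul_of_nonneg_left (h.le_one v hv) h0
    have b := mul_le_mul_of_nonneg_left (h'.le_one v hv) h1'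
    linarith
  · rw [e, h.row₁, h'.row₁, hr]
  · rw [e, h.row₂, h'.row₂]; ring
  · rw [hz v hv, h.of_pos v hv hp, h'.of_pos v hv hp]; ring
  · rw [hz v hv, h.of_neg v hv hp, h'.of_neg v hv hp]; ring

theorem sum_mul_update (f z : ℕ → ℝ) {v : ℕ} (hv : v < N) (a : ℝ) :
    ∑ j ∈ Finset.range N, f j * Function.update z v a j
      = ∑ j ∈ Finset.range N, f j * z j + f v * (a - z v) := by
  have : ∀ j, f j * Function.update z v a j = f j * z j + if j = v then f v * (a - z v) else 0 := by
    intro j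
    by_cases h : j = v
    · subst h; simp; ring
    · simp [h]
  simp only [this, Finset.sum_add_distrib]
  rw [Finset.sum_ite_eq' _ v, if_pos (Finset.mem_range.2 hv)]

/-- Move along the direction in which the column `v` is replaced by columns `u₁` and `u₂`. -/
noncomputable def shift (z : ℕ → ℝ) (v u₁ u₂ : ℕ) (κ₁ κ₂ t : ℝ) : ℕ → ℝ :=
  Function.update (Function.update (Function.update z v (z v - t)) u₁ (z u₁ + κ₁ * t)) u₂
    (z u₂ + κ₂ * t)

variable {v u₁ u₂ : ℕ} {κ₁ κ₂ t : ℝ}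

theorem shift_apply (h1 : u₁ ≠ v) (h2 : u₂ ≠ v) (h12 : u₁ ≠ u₂) (j : ℕ) :
    shift z v u₁ u₂ κ₁ κ₂ t j = if j = v then z v - t else if j = u₁ then z u₁ + κ₁ * t else
      if j = u₂ then z u₂ + κ₂ * t else z j := by
  unfold shift
  by_cases a : j = v
  · subst a; simp [h1.symm, h2.symm]
  · by_cases b : j = u₁
    · subst b; simp [h1, h12]
    · by_cases c : j = u₂
      · subst c; simp [h2, h12.symm]
      · simp [a, b, c]

/-- The relation between the columns keeps both rows. Only variables strictly between zero and one
change, and by complementarity these have reduced cost zero, so the certificate remains valid. -/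
theorem Certified.shift (h : Certified N c A B r₁ r₂ x y z) (hv : v < N) (hu₁ : u₁ < N)
    (hu₂ : u₂ < N) (h1 : u₁ ≠ v) (h2 : u₂ ≠ v) (h12 : u₁ ≠ u₂)
    (hA : A v = κ₁ * A u₁ + κ₂ * A u₂) (hB : B v = κ₁ * B u₁ + κ₂ * B u₂)
    (hz0 : 0 < z v) (hz1 : z v < 1) (ht0 : 0 ≤ t) (ht : t ≤ z v)
    (hm₁ : κ₁ * t = 0 ∨ 0 < z u₁ ∧ z u₁ < 1 ∧ 0 ≤ z u₁ + κ₁ * t ∧ z u₁ + κ₁ * t ≤ 1)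
    (hm₂ : κ₂ * t = 0 ∨ 0 < z u₂ ∧ z u₂ < 1 ∧ 0 ≤ z u₂ + κ₂ * t ∧ z u₂ + κ₂ * t ≤ 1) :
    Certified N c A B r₁ r₂ x y (shift z v u₁ u₂ κ₁ κ₂ t) := by
  have hs := shift_apply (z := z) (κ₁ := κ₁) (κ₂ := κ₂) (t := t) h1 h2 h12
  have hsum : ∀ f : ℕ → ℝ, f v = κ₁ * f u₁ + κ₂ * f u₂ →
      ∑ j ∈ Finset.range N, f j * ImprovableKnapsack.shift z v u₁ u₂ κ₁ κ₂ t j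
        = ∑ j ∈ Finset.range N, f j * z j := by
    intro f hf
    unfold ImprovableKnapsack.shift
    rw [sum_mul_update _ _ hu₂, sum_mul_update _ _ hu₁, sum_mul_update _ _ hv]
    rw [Function.update_of_ne h12.symm, Function.update_of_ne h2, Function.update_of_ne h1, hf]
    ring
  have key : ∀ j < N, (0 ≤ ImprovableKnapsack.shift z v u₁ u₂ κ₁ κ₂ t j ∧
      ImprovableKnapsack.shift z v u₁ u₂ κ₁ κ₂ t j ≤ 1) ∧
      (ImprovableKnapsack.shift z v u₁ u₂ κ₁ κ₂ t j = z j ∨ 0 < z j ∧ z j < 1) := by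
    intro j hj
    have h3 := h.nonneg j hj
    have h4 := h.le_one j hj
    rw [hs]
    split_ifs with a b c
    · subst a; exact ⟨⟨by linarith, by linarith⟩, Or.inr ⟨hz0, hz1⟩⟩
    · subst b
      rcases hm₁ with e | ⟨e1, e2, e3, e4⟩
      · rw [e, add_zero]; exact ⟨⟨h3, h4⟩, Or.inl rfl⟩
      · exact ⟨⟨e3, e4⟩, Or.inr ⟨e1, e2⟩⟩
    · subst c
      rcases hm₂ with e | ⟨e1, e2, e3, e4⟩
      · rw [e, add_zero]; exact ⟨⟨h3, h4⟩, Or.inl rfl⟩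
      · exact ⟨⟨e3, e4⟩, Or.inr ⟨e1, e2⟩⟩
    · exact ⟨⟨h3, h4⟩, Or.inl rfl⟩
  refine ⟨fun j hj => (key j hj).1.1, fun j hj => (key j hj).1.2, ?_, ?_, fun j hj hp => ?_,
    fun j hj hp => ?_⟩
  · rw [hsum A hA, h.row₁]
  · rw [hsum B hB, h.row₂]
  · have h5 := h.of_pos j hj hp
    rcases (key j hj).2 with e | ⟨_, e⟩
    · rw [e, h5]
    · exact absurd h5 e.ne
  · have h5 := h.of_neg j hj hp
    rcases (key j hj).2 with e | ⟨e, _⟩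
    · rw [e, h5]
    · exact absurd h5 e.ne'

/-- The columns `u₁` and `u₂` are independent, and the other ones among the first `v` columns and
the last two ones are integral. -/
structure Purified (M v u₁ u₂ : ℕ) (A B z : ℕ → ℝ) : Prop where
  lt₁ : u₁ < M + 2
  lt₂ : u₂ < M + 2
  out₁ : u₁ < v ∨ M ≤ u₁
  out₂ : u₂ < v ∨ M ≤ u₂
  det : A u₁ * B u₂ - A u₂ * B u₁ ≠ 0
  integral : ∀ j < M + 2, j < v ∨ M ≤ j → j ≠ u₁ → j ≠ u₂ → z j = 0 ∨ z j = 1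

theorem Purified.ne {M : ℕ} (h : Purified M v u₁ u₂ A B z) : u₁ ≠ u₂ := by
  rintro rfl
  exact h.det (by ring)

theorem Purified.swap {M : ℕ} (h : Purified M v u₁ u₂ A B z) : Purified M v u₂ u₁ A B z :=
  ⟨h.lt₂, h.lt₁, h.out₂, h.out₁, fun e => h.det (by linarith),
    fun j hj hj' a b => h.integral j hj hj' b a⟩

theorem Purified.skip {M : ℕ} (h : Purified M v u₁ u₂ A B z) (hz : z v = 0 ∨ z v = 1) :
    Purified M (v + 1) u₁ u₂ A B z :=
  ⟨h.lt₁, h.lt₂, h.out₁.imp_left fun h => by omega, h.out₂.imp_left fun h => by omega, h.det,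
    fun j hj hj' a b => by
      by_cases e : j = v
      · rw [e]; exact hz
      · exact h.integral j hj (hj'.imp_left fun h => by omega) a b⟩

theorem Purified.shift {M : ℕ} (h : Purified M v u₁ u₂ A B z) (hv : v < M) (ht : t = z v) :
    Purified M (v + 1) u₁ u₂ A B (shift z v u₁ u₂ κ₁ κ₂ t) := by
  have h1 : u₁ ≠ v := by have := h.out₁; omega
  have h2 : u₂ ≠ v := by have := h.out₂; omega
  refine ⟨h.lt₁, h.lt₂, h.out₁.imp_left fun h => by omega, h.out₂.imp_left fun h => by omega,
    h.det, fun j hj hj' a b => ?_⟩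
  rw [shift_apply h1 h2 h.ne]
  split_ifs with e
  · left; rw [ht]; ring
  · exact h.integral j hj (hj'.imp_left fun h => by omega) a b

/-- A basis exchange multiplies the determinant by `κ₁`. The column that leaves is integral after
the move, so only the new basis may be fractional. -/
theorem Purified.replace {M : ℕ} (h : Purified M v u₁ u₂ A B z) (hv : v < M)
    (hA : A v = κ₁ * A u₁ + κ₂ * A u₂) (hB : B v = κ₁ * B u₁ + κ₂ * B u₂) (hκ : κ₁ ≠ 0)
    (hint : z u₁ + κ₁ * t = 0 ∨ z u₁ + κ₁ * t = 1) :
    Purified M (v + 1) v u₂ A B (ImprovableKnapsack.shift z v u₁ u₂ κ₁ κ₂ t) := by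
  have h1 : u₁ ≠ v := by have := h.out₁; omega
  have h2 : u₂ ≠ v := by have := h.out₂; omega
  refine ⟨by omega, h.lt₂, Or.inl (by omega), h.out₂.imp_left fun h => by omega, ?_,
    fun j hj hj' a b => ?_⟩
  · have : A v * B u₂ - A u₂ * B v = κ₁ * (A u₁ * B u₂ - A u₂ * B u₁) := by rw [hA, hB]; ring
    rw [this]
    exact mul_ne_zero hκ h.det
  · rw [shift_apply h1 h2 h.ne]
    rw [if_neg a, if_neg b]
    split_ifs with e
    · exact hint
    · exact h.integral j hj (hj'.imp_left fun h => by omega) e b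

theorem shift_swap (h12 : u₁ ≠ u₂) :
    shift z v u₁ u₂ κ₁ κ₂ t = shift z v u₂ u₁ κ₂ κ₁ t := by
  unfold shift
  rw [Function.update_comm h12]

/-- The largest step for a column that is moved with speed `κ`. -/
noncomputable def cap (κ a d : ℝ) : ℝ :=
  if κ = 0 then d else if a ≤ 0 ∨ 1 ≤ a then 0 else if 0 ≤ κ then (1 - a) / κ else a / (0 - κ)

theorem cap_nonneg {κ a d : ℝ} (hd : 0 ≤ d) : 0 ≤ cap κ a d := by
  unfold cap
  split_ifs with h1 h2 h3
  · exact hd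
  · exact le_rfl
  · push Not at h2
    exact div_nonneg (by linarith) h3
  · push Not at h2
    exact div_nonneg (by linarith) (by linarith)

/-- A column at a bound may have nonzero reduced cost and must stay fixed even if the move would
lead inwards; its cap is therefore zero. -/
theorem cap_move {κ a d t : ℝ} (ht0 : 0 ≤ t) (ht : t ≤ cap κ a d) :
    κ * t = 0 ∨ 0 < a ∧ a < 1 ∧ 0 ≤ a + κ * t ∧ a + κ * t ≤ 1 := by
  unfold cap at ht
  split_ifs at ht with h1 h2 h3
  · left; rw [h1, zero_mul]
  · left; rw [le_antisymm ht ht0, mul_zero]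
  · push Not at h2
    right
    rw [le_div_iff₀ (lt_of_le_of_ne h3 (Ne.symm h1))] at ht
    exact ⟨h2.1, h2.2, add_nonneg h2.1.le (mul_nonneg h3 ht0), by linarith⟩
  · push Not at h2 h3
    right
    rw [le_div_iff₀ (by linarith)] at ht
    exact ⟨h2.1, h2.2, by linarith, by nlinarith⟩

theorem cap_hit {κ a d : ℝ} (hκ : κ ≠ 0) (h0 : 0 ≤ a) (h1 : a ≤ 1) :
    a + κ * cap κ a d = 0 ∨ a + κ * cap κ a d = 1 := by
  unfold cap
  rw [if_neg hκ]
  split_ifs with h2 h3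
  · rw [mul_zero, add_zero]
    rcases h2 with h | h
    · left; linarith
    · right; linarith
  · right; field_simp; ring
  · left; rw [zero_sub]; field_simp; ring

end Purification

/-! ### The linear program in equality form -/

section EqualityForm

/-- The objective coefficients of the columns: the plain copies, the improved copies, and two
slack columns. -/
noncomputable def KnapsackData.colProfit (I : KnapsackData n) (v : ℕ) : ℝ :=
  if v < n then toArray I.p v else toArray I.p (v - n)

/-- The entries of the columns in the knapsack row. -/
noncomputable def KnapsackData.colWeight (I : KnapsackData n) (v : ℕ) : ℝ :=
  if v < n then toArray I.w v else if v = n + n then I.B + 1 else toArray I.wHat (v - n)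

/-- The entries of the columns in the sum of the knapsack row and the cardinality row. -/
noncomputable def KnapsackData.colSum (I : KnapsackData n) (v : ℕ) : ℝ :=
  if v < n then toArray I.w v else if v = n + n then I.B + 1 else
    if n + n < v then I.k + 1 else toArray I.wHat (v - n) + 1

/-- The values of the copies. -/
def solution (n : ℕ) (Z : ℕ → ℝ) : CopyVar n → ℝ :=
  Sum.elim (fun i => Z i) (fun i => Z (n + i))

variable {I : KnapsackData n}

theorem toArray_fin (f : Fin n → ℝ) (i : Fin n) : toArray f i = f i := by simp [toArray]

theorem toArray_of_le (f : Fin n → ℝ) {i : ℕ} (h : n ≤ i) : toArray f i = 0 := by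
  simp [toArray, h.not_gt]

theorem toArray_nonneg {f : Fin n → ℝ} (h : ∀ i, 0 ≤ f i) (i : ℕ) : 0 ≤ toArray f i := by
  unfold toArray
  split_ifs
  · exact h _
  · exact le_rfl

theorem colProfit_plain (i : Fin n) : I.colProfit i = I.p i := by
  simp [KnapsackData.colProfit, toArray_fin]

theorem colProfit_improved (i : Fin n) : I.colProfit (n + i) = I.p i := by
  simp [KnapsackData.colProfit, toArray_fin]

theorem colProfit_slack₁ : I.colProfit (n + n) = 0 := by
  simp [KnapsackData.colProfit, toArray]

theorem colProfit_slack₂ : I.colProfit (n + n + 1) = 0 := by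
  rw [KnapsackData.colProfit, if_neg (by omega), toArray_of_le _ (by omega)]

theorem colWeight_plain (i : Fin n) : I.colWeight i = I.w i := by
  simp [KnapsackData.colWeight, toArray_fin]

theorem colWeight_improved (i : Fin n) : I.colWeight (n + i) = I.wHat i := by
  rw [KnapsackData.colWeight, if_neg (by omega), if_neg (by omega), Nat.add_sub_cancel_left,
    toArray_fin]

theorem colWeight_slack₁ : I.colWeight (n + n) = I.B + 1 := by
  simp [KnapsackData.colWeight]

theorem colWeight_slack₂ : I.colWeight (n + n + 1) = 0 := by
  rw [KnapsackData.colWeight, if_neg (by omega), if_neg (by omega), toArray_of_le _ (by omega)]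

theorem colSum_plain (i : Fin n) : I.colSum i = I.w i := by
  simp [KnapsackData.colSum, toArray_fin]

theorem colSum_improved (i : Fin n) : I.colSum (n + i) = I.wHat i + 1 := by
  rw [KnapsackData.colSum, if_neg (by omega), if_neg (by omega), if_neg (by omega),
    Nat.add_sub_cancel_left, toArray_fin]

theorem colSum_slack₁ : I.colSum (n + n) = I.B + 1 := by
  simp [KnapsackData.colSum]

theorem colSum_slack₂ : I.colSum (n + n + 1) = I.k + 1 := by
  rw [KnapsackData.colSum, if_neg (by omega), if_neg (by omega), if_pos (by omega)]

theorem KnapsackData.Valid.w_nonneg (hI : I.Valid) (i : Fin n) : 0 ≤ I.w i :=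
  (hI.wHat_nonneg i).trans (hI.wHat_le_w i)

theorem colWeight_nonneg (hI : I.Valid) (v : ℕ) : 0 ≤ I.colWeight v := by
  have := hI.B_nonneg
  unfold KnapsackData.colWeight
  split_ifs
  · exact toArray_nonneg hI.w_nonneg v
  · linarith
  · exact toArray_nonneg hI.wHat_nonneg _

theorem colWeight_le_colSum (I : KnapsackData n) (v : ℕ) : I.colWeight v ≤ I.colSum v := by
  unfold KnapsackData.colWeight KnapsackData.colSum
  split_ifs
  · exact le_rfl
  · exact le_rfl
  · rw [toArray_of_le _ (by omega)]; positivity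
  · linarith

theorem sum_columns (f : ℕ → ℝ) : ∑ v ∈ Finset.range (n + n + 2), f v
    = ∑ i : Fin n, f i + ∑ i : Fin n, f (n + i) + f (n + n) + f (n + n + 1) := by
  rw [Finset.sum_range_succ, Finset.sum_range_succ, Finset.sum_range_add, Finset.sum_range,
    Finset.sum_range]

theorem sum_colProfit (Z : ℕ → ℝ) : ∑ v ∈ Finset.range (n + n + 2), I.colProfit v * Z v
    = ∑ i : Fin n, I.p i * Z i + ∑ i : Fin n, I.p i * Z (n + i) := by
  rw [sum_columns]
  simp [colProfit_plain, colProfit_improved, colProfit_slack₁, colProfit_slack₂]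

theorem sum_colWeight (Z : ℕ → ℝ) : ∑ v ∈ Finset.range (n + n + 2), I.colWeight v * Z v
    = ∑ i : Fin n, I.w i * Z i + ∑ i : Fin n, I.wHat i * Z (n + i) + (I.B + 1) * Z (n + n) := by
  rw [sum_columns]
  simp [colWeight_plain, colWeight_improved, colWeight_slack₁, colWeight_slack₂]

theorem sum_colSum (Z : ℕ → ℝ) : ∑ v ∈ Finset.range (n + n + 2), I.colSum v * Z v
    = ∑ v ∈ Finset.range (n + n + 2), I.colWeight v * Z v
      + ∑ i : Fin n, Z (n + i) + (I.k + 1) * Z (n + n + 1) := by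
  rw [sum_colWeight, sum_columns]
  simp only [colSum_plain, colSum_improved, colSum_slack₁, colSum_slack₂, add_mul, one_mul,
    Finset.sum_add_distrib]
  ring

/-- Extend a vector on the copies by slacks. -/
noncomputable def extend (d : CopyVar n → ℝ) (s₁ s₂ : ℝ) (v : ℕ) : ℝ :=
  if h : v < n then d (Sum.inl ⟨v, h⟩) else if h : v - n < n then d (Sum.inr ⟨v - n, h⟩) else
    if v = n + n then s₁ else s₂

theorem extend_plain (d : CopyVar n → ℝ) (s₁ s₂ : ℝ) (i : Fin n) :
    extend d s₁ s₂ i = d (Sum.inl i) := by simp [extend]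

theorem extend_improved (d : CopyVar n → ℝ) (s₁ s₂ : ℝ) (i : Fin n) :
    extend d s₁ s₂ (n + i) = d (Sum.inr i) := by simp [extend]

theorem extend_slack₁ (d : CopyVar n → ℝ) (s₁ s₂ : ℝ) : extend d s₁ s₂ (n + n) = s₁ := by
  simp [extend]

theorem extend_slack₂ (d : CopyVar n → ℝ) (s₁ s₂ : ℝ) : extend d s₁ s₂ (n + n + 1) = s₂ := by
  unfold extend
  rw [dif_neg (by omega), dif_neg (by omega), if_neg (by omega)]

theorem column_cases {v : ℕ} (hv : v < n + n + 2) : (∃ i : Fin n, v = i) ∨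
    (∃ i : Fin n, v = n + i) ∨ v = n + n ∨ v = n + n + 1 := by
  by_cases h1 : v < n
  · exact Or.inl ⟨⟨v, h1⟩, rfl⟩
  · by_cases h2 : v - n < n
    · exact Or.inr (Or.inl ⟨⟨v - n, h2⟩, by simp; omega⟩)
    · omega

variable {Z : ℕ → ℝ} {x y : ℝ} {u₁ u₂ : ℕ}

/-- The linear program in equality form. -/
abbrev KnapsackData.Solves (I : KnapsackData n) (x y : ℝ) (Z : ℕ → ℝ) : Prop :=
  Certified (n + n + 2) I.colProfit I.colWeight I.colSum I.B (I.B + I.k) x y Z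

theorem KnapsackData.Solves.knapsack (h : I.Solves x y Z) :
    ∑ i : Fin n, I.w i * Z i + ∑ i : Fin n, I.wHat i * Z (n + i) + (I.B + 1) * Z (n + n)
      = I.B := by
  rw [← sum_colWeight]; exact h.row₁

theorem KnapsackData.Solves.cardinality (h : I.Solves x y Z) :
    ∑ i : Fin n, Z (n + i) + (I.k + 1) * Z (n + n + 1) = I.k := by
  have h2 := h.row₂
  rw [sum_colSum, h.row₁] at h2
  linarith

theorem KnapsackData.Solves.lpFeasible (hI : I.Valid) (h : I.Solves x y Z) :
    I.LPFeasible (solution n Z) := by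
  rw [lpFeasible_iff]
  have h1 := h.knapsack
  have h2 := h.cardinality
  have h3 := mul_nonneg (by linarith [hI.B_nonneg] : 0 ≤ I.B + 1) (h.nonneg (n + n) (by omega))
  have h4 := mul_nonneg (by positivity : 0 ≤ (I.k : ℝ) + 1) (h.nonneg (n + n + 1) (by omega))
  refine ⟨?_, ?_, ?_⟩
  · simp only [solution, Sum.elim_inl, Sum.elim_inr]; linarith
  · simp only [solution, Sum.elim_inr]; linarith
  · rintro (i | i)
    · exact ⟨h.nonneg i (by omega), h.le_one i (by omega)⟩
    · exact ⟨h.nonneg (n + i) (by omega), h.le_one (n + i) (by omega)⟩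

/-- A feasible point extends to the equality form by the normalized slacks of the two rows, which
lie in `[0, 1]`, and slacks carry no profit. -/
theorem KnapsackData.Solves.optimal (hI : I.Valid) (h : I.Solves x y Z) (z : CopyVar n → ℝ)
    (hz : I.LPFeasible z) : I.value z ≤ I.value (solution n Z) := by
  obtain ⟨z1, z2, z3⟩ := lpFeasible_iff.1 hz
  have hB : 0 < I.B + 1 := by linarith [hI.B_nonneg]
  have hk : (0 : ℝ) < I.k + 1 := by positivity
  have n1 : 0 ≤ ∑ i, I.w i * z (Sum.inl i) + ∑ i, I.wHat i * z (Sum.inr i) :=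
    add_nonneg (Finset.sum_nonneg fun i _ => mul_nonneg (hI.w_nonneg i) (z3 _).1)
      (Finset.sum_nonneg fun i _ => mul_nonneg (hI.wHat_nonneg i) (z3 _).1)
  have n2 : 0 ≤ ∑ i, z (Sum.inr i) := Finset.sum_nonneg fun i _ => (z3 _).1
  set W := ∑ i, I.w i * z (Sum.inl i) + ∑ i, I.wHat i * z (Sum.inr i) with hW
  set C := ∑ i, z (Sum.inr i) with hC
  set Z' := extend z ((I.B - W) / (I.B + 1)) ((I.k - C) / (I.k + 1)) with hZ'
  have hb : ∀ v < n + n + 2, 0 ≤ Z' v ∧ Z' v ≤ 1 := by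
    intro v hv
    rcases column_cases hv with ⟨i, rfl⟩ | ⟨i, rfl⟩ | rfl | rfl
    · rw [hZ', extend_plain]; exact z3 _
    · rw [hZ', extend_improved]; exact z3 _
    · rw [hZ', extend_slack₁]
      exact ⟨div_nonneg (by linarith) hB.le, (div_le_one hB).2 (by linarith)⟩
    · rw [hZ', extend_slack₂]
      exact ⟨div_nonneg (by linarith) hk.le, (div_le_one hk).2 (by linarith)⟩
  have e1 : ∑ v ∈ Finset.range (n + n + 2), I.colWeight v * Z' v = I.B := by
    rw [sum_colWeight]
    simp only [hZ', extend_plain, extend_improved, extend_slack₁]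
    rw [mul_div_cancel₀ _ hB.ne']
    linarith
  have e2 : ∑ v ∈ Finset.range (n + n + 2), I.colSum v * Z' v = I.B + I.k := by
    rw [sum_colSum, e1]
    simp only [hZ', extend_improved, extend_slack₂]
    rw [mul_div_cancel₀ _ hk.ne']
    linarith
  have := Certified.optimal h (fun v hv => (hb v hv).1) (fun v hv => (hb v hv).2) e1 e2
  rw [sum_colProfit, sum_colProfit] at this
  simp only [hZ', extend_plain, extend_improved] at this
  simpa [KnapsackData.value, solution, mul_add, Finset.sum_add_distrib] using this

/-- Purified solutions are optimal basic solutions. -/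
theorem isOptimalBasic_solution (hI : I.Valid) (h : I.Solves x y Z)
    (hp : Purified (n + n) (n + n) u₁ u₂ I.colWeight I.colSum Z) :
    I.IsOptimalBasic (solution n Z) := by
  refine ⟨isBasic_of_direction (h.lpFeasible hI) fun d hd hk hc => ?_, h.optimal hI⟩
  have hB : 0 < I.B + 1 := by linarith [hI.B_nonneg]
  have hk0 : (0 : ℝ) < I.k + 1 := by positivity
  rw [KnapsackData.Tight, sum_row_knapsack, sum_row_knapsack] at hk
  rw [KnapsackData.Tight, sum_row_cardinality, sum_row_cardinality] at hc
  simp only [solution, Sum.elim_inl, Sum.elim_inr, KnapsackData.rhs] at hk hc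
  set W := ∑ i, I.w i * d (Sum.inl i) + ∑ i, I.wHat i * d (Sum.inr i) with hW
  set C := ∑ i, d (Sum.inr i) with hC
  -- The slack components are chosen such that both rows vanish on the extended direction.
  set D := extend d (-W / (I.B + 1)) (-C / (I.k + 1)) with hD
  have e1 : ∑ v ∈ Finset.range (n + n + 2), I.colWeight v * D v = 0 := by
    rw [sum_colWeight]
    simp only [hD, extend_plain, extend_improved, extend_slack₁]
    rw [mul_div_cancel₀ _ hB.ne']
    linarith
  have e2 : ∑ v ∈ Finset.range (n + n + 2), I.colSum v * D v = 0 := by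
    rw [sum_colSum, e1]
    simp only [hD, extend_improved, extend_slack₂]
    rw [mul_div_cancel₀ _ hk0.ne']
    linarith
  have hsupp : ∀ v < n + n + 2, v ≠ u₁ → v ≠ u₂ → D v = 0 := by
    intro v hv h1 h2
    have hint := hp.integral v hv (by omega) h1 h2
    rcases column_cases hv with ⟨i, rfl⟩ | ⟨i, rfl⟩ | rfl | rfl
    · rw [hD, extend_plain]
      refine hd _ fun hf => ?_
      obtain ⟨f1, f2⟩ := mem_fractional.1 hf
      simp only [solution, Sum.elim_inl] at f1 f2
      rcases hint with e | e <;> linarith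
    · rw [hD, extend_improved]
      refine hd _ fun hf => ?_
      obtain ⟨f1, f2⟩ := mem_fractional.1 hf
      simp only [solution, Sum.elim_inr] at f1 f2
      rcases hint with e | e <;> linarith
    -- A slack of value zero means a tight row, which the direction keeps. The value one is
    -- impossible, as the coefficient `I.B + 1` exceeds the right-hand side.
    · rw [hD, extend_slack₁]
      have h3 := h.knapsack
      have n1 : 0 ≤ ∑ i : Fin n, I.w i * Z i + ∑ i : Fin n, I.wHat i * Z (n + i) :=
        add_nonneg (Finset.sum_nonneg fun i _ => mul_nonneg (hI.w_nonneg i)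
          (h.nonneg _ (by omega))) (Finset.sum_nonneg fun i _ =>
          mul_nonneg (hI.wHat_nonneg i) (h.nonneg _ (by omega)))
      rcases hint with e | e
      · rw [e, mul_zero, add_zero] at h3
        rw [hk h3]; simp
      · rw [e] at h3; linarith
    · rw [hD, extend_slack₂]
      have h3 := h.cardinality
      have n1 : 0 ≤ ∑ i : Fin n, Z (n + i) := Finset.sum_nonneg fun i _ => h.nonneg _ (by omega)
      rcases hint with e | e
      · rw [e, mul_zero, add_zero] at h3
        rw [hc h3]; simp
      · rw [e] at h3; linarith
  have hsum : ∀ f : ℕ → ℝ, ∑ v ∈ Finset.range (n + n + 2), f v * D v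
      = f u₁ * D u₁ + f u₂ * D u₂ := by
    intro f
    rw [← Finset.sum_pair (f := fun v => f v * D v) hp.ne]
    symm
    refine Finset.sum_subset ?_ ?_
    · intro v hv
      simp only [Finset.mem_insert, Finset.mem_singleton] at hv
      rcases hv with rfl | rfl
      · exact Finset.mem_range.2 hp.lt₁
      · exact Finset.mem_range.2 hp.lt₂
    · intro v hv hv'
      simp only [Finset.mem_insert, Finset.mem_singleton, not_or] at hv'
      rw [hsupp v (Finset.mem_range.1 hv) hv'.1 hv'.2, mul_zero]
  -- Two equations in the components at `u₁` and `u₂` with nonzero determinant.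
  rw [hsum] at e1 e2
  have hD1 : D u₁ = 0 := by
    have : (I.colWeight u₁ * I.colSum u₂ - I.colWeight u₂ * I.colSum u₁) * D u₁ = 0 := by
      linear_combination I.colSum u₂ * e1 - I.colWeight u₂ * e2
    exact (mul_eq_zero.1 this).resolve_left hp.det
  have hD2 : D u₂ = 0 := by
    have : (I.colWeight u₁ * I.colSum u₂ - I.colWeight u₂ * I.colSum u₁) * D u₂ = 0 := by
      linear_combination I.colWeight u₁ * e2 - I.colSum u₁ * e1
    exact (mul_eq_zero.1 this).resolve_left hp.det
  have hD0 : ∀ v < n + n + 2, D v = 0 := by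
    intro v hv
    by_cases h1 : v = u₁
    · rw [h1, hD1]
    · by_cases h2 : v = u₂
      · rw [h2, hD2]
      · exact hsupp v hv h1 h2
  funext v
  rcases v with i | i
  · rw [← extend_plain d (-W / (I.B + 1)) (-C / (I.k + 1)) i]; exact hD0 _ (by omega)
  · rw [← extend_improved d (-W / (I.B + 1)) (-C / (I.k + 1)) i]; exact hD0 _ (by omega)

/-- The initial basis. Its determinant `(I.B + 1) * (I.k + 1)` is nonzero even for `I.B = 0`, owing
to the added ones in the slack coefficients. -/
theorem purified_slacks (hI : I.Valid) (Z : ℕ → ℝ) :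
    Purified (n + n) 0 (n + n) (n + n + 1) I.colWeight I.colSum Z := by
  refine ⟨by omega, by omega, by omega, by omega, ?_, fun j hj hj' a b => by omega⟩
  rw [colWeight_slack₁, colWeight_slack₂, colSum_slack₁, colSum_slack₂]
  have hB : 0 < I.B + 1 := by linarith [hI.B_nonneg]
  have hk0 : (0 : ℝ) < I.k + 1 := by positivity
  have := mul_pos hB hk0
  intro h
  linarith

end EqualityForm

/-! ### Solving the linear program -/

section Solving

variable {I : KnapsackData n}

/-- Write the columns of the linear program. -/
def columns : Cmd :=
  .iset 9 (.add (.reg 0) (.reg 0)) ;; .iset 8 (.add (.reg 9) (.const 2)) ;;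
  .forLoop 10 8
    (.ite (.ile (.add (.reg 10) (.const 1)) (.reg 0))
      (.rstore 12 (.reg 10) (.get 0 (.reg 10)) ;; .rstore 13 (.reg 10) (.get 1 (.reg 10)) ;;
        .rstore 14 (.reg 10) (.get 1 (.reg 10)))
      (.rstore 12 (.reg 10) (.get 0 (.sub (.reg 10) (.reg 0))) ;;
        .ite (.and (.ile (.reg 10) (.reg 9)) (.ile (.reg 9) (.reg 10)))
          (.rstore 13 (.reg 10) (.add (.reg 0) (.const 1)) ;;
            .rstore 14 (.reg 10) (.add (.reg 0) (.const 1)))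
          (.rstore 13 (.reg 10) (.get 2 (.sub (.reg 10) (.reg 0))) ;;
            .ite (.ile (.add (.reg 9) (.const 1)) (.reg 10))
              (.rstore 14 (.reg 10) (.add (.cast (.reg 1)) (.const 1)))
              (.rstore 14 (.reg 10) (.add (.get 2 (.sub (.reg 10) (.reg 0))) (.const 1))))))

/-- The memory holds the instance and the columns of the linear program. -/
structure KnapsackData.Stored (I : KnapsackData n) (s : Memory) : Prop where
  n_eq : s.ireg 0 = n
  k_eq : s.ireg 1 = I.k
  B_eq : s.rreg 0 = I.B
  p_eq : s.rarr 0 = toArray I.p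
  wHat_eq : s.rarr 2 = toArray I.wHat
  two : s.ireg 9 = n + n
  profit : ∀ v < n + n + 2, s.rarr 12 v = I.colProfit v
  weight : ∀ v < n + n + 2, s.rarr 13 v = I.colWeight v
  sum : ∀ v < n + n + 2, s.rarr 14 v = I.colSum v
  out₀ : ∀ i, s.iarr 0 i = 0
  out₁ : ∀ i, s.iarr 1 i = 0

/-- The locations on which `KnapsackData.Stored` depends. -/
def storedLocs : List Loc :=
  [.I 0, .I 1, .R 0, .RA 0, .RA 2, .I 9, .RA 12, .RA 13, .RA 14, .IA 0, .IA 1]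

theorem KnapsackData.Stored.of_frame {s s' : Memory} {L : List Loc} (h : I.Stored s)
    (F : Frame L s s') (hL : ∀ x ∈ storedLocs, x ∉ L) : I.Stored s' := by
  simp only [storedLocs, List.mem_cons, List.not_mem_nil, or_false, forall_eq_or_imp,
    forall_eq] at hL
  obtain ⟨h0, h1, g0, a0, a2, h9, a12, a13, a14, b0, b1⟩ := hL
  obtain ⟨p1, p2, p3, p4, p5, p6, p7, p8, p9, p10, p11⟩ := h
  constructor <;> simpa only [F.ireg _ h0, F.ireg _ h1, F.rreg _ g0, F.rarr _ a0, F.rarr _ a2,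
    F.ireg _ h9, F.rarr _ a12, F.rarr _ a13, F.rarr _ a14, F.iarr _ b0, F.iarr _ b1]

set_option maxHeartbeats 1000000 in
theorem columns_spec (procs : List Cmd) (I : KnapsackData n) :
    ∃ t s', Exec procs columns I.input t s' ∧ t ≤ (n + n + 4) * 100 ∧ I.Stored s' := by
  obtain ⟨t, s', hex, ht, h1, hf⟩ := exec_forLoop procs (i := 10) (m := 8)
    (c := .ite (.ile (.add (.reg 10) (.const 1)) (.reg 0))
      (.rstore 12 (.reg 10) (.get 0 (.reg 10)) ;; .rstore 13 (.reg 10) (.get 1 (.reg 10)) ;;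
        .rstore 14 (.reg 10) (.get 1 (.reg 10)))
      (.rstore 12 (.reg 10) (.get 0 (.sub (.reg 10) (.reg 0))) ;;
        .ite (.and (.ile (.reg 10) (.reg 9)) (.ile (.reg 9) (.reg 10)))
          (.rstore 13 (.reg 10) (.add (.reg 0) (.const 1)) ;;
            .rstore 14 (.reg 10) (.add (.reg 0) (.const 1)))
          (.rstore 13 (.reg 10) (.get 2 (.sub (.reg 10) (.reg 0))) ;;
            .ite (.ile (.add (.reg 9) (.const 1)) (.reg 10))
              (.rstore 14 (.reg 10) (.add (.cast (.reg 1)) (.const 1)))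
              (.rstore 14 (.reg 10) (.add (.get 2 (.sub (.reg 10) (.reg 0))) (.const 1))))))
    rfl (by decide) (by decide) (by decide) (s := (I.input.iset 9 (n + n)).iset 8 (n + n + 2))
    (N := n + n + 2) (by simp)
    (fun k s' => ∀ v < k, s'.rarr 12 v = I.colProfit v ∧ s'.rarr 13 v = I.colWeight v ∧
      s'.rarr 14 v = I.colSum v)
    (by simp)
    (by
      rintro j s1 hj hi hf h1
      have e0 : s1.ireg 0 = n := (hf.ireg 0 (by decide)).trans (by simp [KnapsackData.input])
      have e1 : s1.ireg 1 = I.k := (hf.ireg 1 (by decide)).trans (by simp [KnapsackData.input])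
      have e9 : s1.ireg 9 = n + n := (hf.ireg 9 (by decide)).trans (by simp)
      have r0 : s1.rreg 0 = I.B := (hf.rreg 0 (by decide)).trans (by simp [KnapsackData.input])
      have a0 : s1.rarr 0 = toArray I.p :=
        (hf.rarr 0 (by decide)).trans (by simp [KnapsackData.input])
      have a1 : s1.rarr 1 = toArray I.w :=
        (hf.rarr 1 (by decide)).trans (by simp [KnapsackData.input])
      have a2 : s1.rarr 2 = toArray I.wHat :=
        (hf.rarr 2 (by decide)).trans (by simp [KnapsackData.input])
      have hfin : ∀ s2 : Memory, s2.rarr 12 = Function.update (s1.rarr 12) j (I.colProfit j) →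
          s2.rarr 13 = Function.update (s1.rarr 13) j (I.colWeight j) →
          s2.rarr 14 = Function.update (s1.rarr 14) j (I.colSum j) → ∀ v < j + 1,
          s2.rarr 12 v = I.colProfit v ∧ s2.rarr 13 v = I.colWeight v ∧
            s2.rarr 14 v = I.colSum v := by
        intro s2 h12 h13 h14 v hv
        rw [h12, h13, h14]
        rcases (Nat.lt_succ_iff.1 hv).lt_or_eq with h' | rfl
        · simpa [h'.ne] using h1 v h'
        · simp
      simp only [Cmd.wp, IExp.eval, RExp.eval, BExp.Holds, hi, e0, rstore_ireg, e9]
      refine ⟨fun ha => hfin _ ?_ ?_ ?_, fun ha => ⟨fun hb => hfin _ ?_ ?_ ?_,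
        fun hb => ⟨fun hc => hfin _ ?_ ?_ ?_, fun hc => hfin _ ?_ ?_ ?_⟩⟩⟩
      · simp [KnapsackData.colProfit, a0, show j < n by omega]
      · simp [KnapsackData.colWeight, a1, show j < n by omega]
      · simp [KnapsackData.colSum, a1, show j < n by omega]
      · simp [KnapsackData.colProfit, a0, show ¬ j < n by omega]
      · simp [KnapsackData.colWeight, r0, show j = n + n by omega]
      · simp [KnapsackData.colSum, r0, show j = n + n by omega]
      · simp [KnapsackData.colProfit, a0, show ¬ j < n by omega]
      · simp [KnapsackData.colWeight, a2, show ¬ j < n by omega, show j ≠ n + n by omega]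
      · simp [KnapsackData.colSum, e1, show ¬ j < n by omega, show j ≠ n + n by omega,
          show n + n < j by omega]
      · simp [KnapsackData.colProfit, a0, show ¬ j < n by omega]
      · simp [KnapsackData.colWeight, a2, show ¬ j < n by omega, show j ≠ n + n by omega]
      · simp [KnapsackData.colSum, a2, show ¬ j < n by omega, show j ≠ n + n by omega,
          show ¬ n + n < j by omega])
  have E1 : Exec procs (.iset 9 (.add (.reg 0) (.reg 0))) I.input _ _ := Exec.iset 9 _ _
  have E2 : Exec procs (.iset 8 (.add (.reg 9) (.const 2))) (I.input.iset 9 (n + n)) _ _ :=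
    Exec.iset 8 _ _
  have e1 : IExp.eval I.input (.add (.reg 0) (.reg 0)) = n + n := by
    simp [IExp.eval, KnapsackData.input]
  have e2 : IExp.eval (I.input.iset 9 (n + n)) (.add (.reg 9) (.const 2)) = n + n + 2 := by
    simp [IExp.eval]
  rw [e1] at E1
  rw [e2] at E2
  refine ⟨_, s', E1.seq (E2.seq hex), ?_, ?_⟩
  · refine (add_le_add_right (add_le_add_right ht _) _).trans ?_
    simp only [RExp.cost, Cmd.cost, IExp.cost, BExp.cost]
    omega
  · exact ⟨(hf.ireg 0 (by decide)).trans (by simp [KnapsackData.input]),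
      (hf.ireg 1 (by decide)).trans (by simp [KnapsackData.input]),
      (hf.rreg 0 (by decide)).trans (by simp [KnapsackData.input]),
      (hf.rarr 0 (by decide)).trans (by simp [KnapsackData.input]),
      (hf.rarr 2 (by decide)).trans (by simp [KnapsackData.input]),
      (hf.ireg 9 (by decide)).trans (by simp), fun v hv => (h1 v hv).1, fun v hv => (h1 v hv).2.1,
      fun v hv => (h1 v hv).2.2, fun i => by rw [hf.iarr 0 (by decide)]; simp [KnapsackData.input],
      fun i => by rw [hf.iarr 1 (by decide)]; simp [KnapsackData.input]⟩

/-- Write the lines of the dual problem. -/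
def load : Cmd :=
  .iset 8 (.add (.reg 9) (.const 2)) ;; .rset 11 (.reg 0) ;;
  .rset 12 (.add (.reg 0) (.cast (.reg 1))) ;;
  .forLoop 10 8
    (.rstore 9 (.reg 10) (.div (.get 12 (.reg 10)) (.get 14 (.reg 10))) ;;
      .rstore 10 (.reg 10) (.div (.get 13 (.reg 10)) (.get 14 (.reg 10))) ;;
      .rstore 11 (.reg 10) (.get 14 (.reg 10)))

/-- The memory holds the lines of the dual problem. -/
structure KnapsackData.Loaded (I : KnapsackData n) (s : Memory) : Prop where
  m_eq : s.ireg 8 = n + n + 2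
  r₁_eq : s.rreg 11 = I.B
  r₂_eq : s.rreg 12 = I.B + I.k
  γ_eq : ∀ v < n + n + 2, s.rarr 9 v = I.colProfit v / I.colSum v
  σ_eq : ∀ v < n + n + 2, s.rarr 10 v = I.colWeight v / I.colSum v
  b_eq : ∀ v < n + n + 2, s.rarr 11 v = I.colSum v

theorem KnapsackData.Loaded.of_frame {s s' : Memory} {L : List Loc} (h : I.Loaded s)
    (F : Frame L s s') (hL : ∀ x ∈ pw2Locs, x ∉ L) : I.Loaded s' := by
  simp only [pw2Locs, List.mem_cons, List.not_mem_nil, or_false, forall_eq_or_imp,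
    forall_eq] at hL
  obtain ⟨h8, h9, h10, h11, r11, r12⟩ := hL
  obtain ⟨p1, p2, p3, p4, p5, p6⟩ := h
  constructor <;> simpa only [F.ireg _ h8, F.rarr _ h9, F.rarr _ h10, F.rarr _ h11, F.rreg _ r11,
    F.rreg _ r12]

/-- The dual objective function. -/
noncomputable def KnapsackData.dual (I : KnapsackData n) : ℝ → ℝ → ℝ :=
  ImprovableKnapsack.pw2 (n + n + 2) (fun v => I.colProfit v / I.colSum v)
    (fun v => I.colWeight v / I.colSum v) I.colSum I.B (I.B + I.k)

theorem KnapsackData.Loaded.pw2_eq {s : Memory} (h : I.Loaded s) : s.pw2 = I.dual := by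
  funext x y
  rw [Memory.pw2, KnapsackData.dual, h.m_eq, h.r₁_eq, h.r₂_eq]
  simp only [pw2]
  congr 1
  refine Finset.sum_congr rfl fun v hv => ?_
  have hv := Finset.mem_range.1 hv
  rw [h.γ_eq v hv, h.σ_eq v hv, h.b_eq v hv]

/-- The slack columns play the roles of `v₀` and `v₁`: they have zero profit, and their coefficients
exceed the right-hand sides. -/
theorem exists_isMinPt (hI : I.Valid) : ∃ x y, IsMinPt I.dual x y := by
  refine exists_isMinPt_pw2 (fun v _ => colWeight_nonneg hI v)
    (fun v _ => colWeight_le_colSum I v) hI.B_nonneg (Nat.cast_nonneg _)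
    (v₀ := n + n) (v₁ := n + n + 1) (by omega) (by omega) colProfit_slack₁ colProfit_slack₂ ?_
    colWeight_slack₂ ?_ ?_
  · rw [colSum_slack₁, colWeight_slack₁]
  · rw [colWeight_slack₁]; linarith
  · rw [colSum_slack₂]; linarith

theorem load_spec (procs : List Cmd) (s : Memory) (h : I.Stored s) :
    ∃ t s', Exec procs load s t s' ∧ t ≤ (n + n + 4) * 100 ∧ I.Loaded s' := by
  have e1 : (IExp.add (.reg 9) (.const 2)).eval s = n + n + 2 := by
    simp [IExp.eval, h.two]
  have E1 : Exec procs (.iset 8 (.add (.reg 9) (.const 2))) s _ _ := Exec.iset 8 _ _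
  rw [e1] at E1
  have E2 : Exec procs (.rset 11 (.reg 0)) (s.iset 8 (n + n + 2)) _ _ := Exec.rset 11 _ _
  have e2 : (RExp.reg 0).eval (s.iset 8 (n + n + 2)) = I.B := by simp [RExp.eval, h.B_eq]
  rw [e2] at E2
  have E3 : Exec procs (.rset 12 (.add (.reg 0) (.cast (.reg 1))))
    ((s.iset 8 (n + n + 2)).rset 11 I.B) _ _ := Exec.rset 12 _ _
  have e3 : (RExp.add (.reg 0) (.cast (.reg 1))).eval ((s.iset 8 (n + n + 2)).rset 11 I.B)
      = I.B + I.k := by simp [RExp.eval, IExp.eval, h.B_eq, h.k_eq]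
  rw [e3] at E3
  obtain ⟨t, s', hex, ht, h1, hf⟩ := exec_forLoop procs (i := 10) (m := 8)
    (c := .rstore 9 (.reg 10) (.div (.get 12 (.reg 10)) (.get 14 (.reg 10))) ;;
      .rstore 10 (.reg 10) (.div (.get 13 (.reg 10)) (.get 14 (.reg 10))) ;;
      .rstore 11 (.reg 10) (.get 14 (.reg 10)))
    rfl (by decide) (by decide) (by decide)
    (s := ((s.iset 8 (n + n + 2)).rset 11 I.B).rset 12 (I.B + I.k)) (N := n + n + 2) (by simp)
    (fun k s' => ∀ v < k, s'.rarr 9 v = I.colProfit v / I.colSum v ∧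
      s'.rarr 10 v = I.colWeight v / I.colSum v ∧ s'.rarr 11 v = I.colSum v)
    (by simp)
    (by
      rintro j s1 hj hi hf h1
      have e12 : s1.rarr 12 = s.rarr 12 := hf.rarr 12 (by decide)
      have e13 : s1.rarr 13 = s.rarr 13 := hf.rarr 13 (by decide)
      have e14 : s1.rarr 14 = s.rarr 14 := hf.rarr 14 (by decide)
      simp only [Cmd.wp, IExp.eval, RExp.eval]
      intro v hv
      rcases (Nat.lt_succ_iff.1 hv).lt_or_eq with h' | rfl
      · simpa [hi, h'.ne] using h1 v h'
      · simp [hi, e12, e13, e14, h.profit _ hj, h.weight _ hj, h.sum _ hj])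
  refine ⟨_, s', E1.seq (E2.seq (E3.seq hex)), ?_, ?_⟩
  · refine (add_le_add_right (add_le_add_right (add_le_add_right ht _) _) _).trans ?_
    simp only [RExp.cost, Cmd.cost, IExp.cost]
    omega
  · exact ⟨(hf.ireg 8 (by decide)).trans (by simp), (hf.rreg 11 (by decide)).trans (by simp),
      (hf.rreg 12 (by decide)).trans (by simp), fun v hv => (h1 v hv).1,
      fun v hv => (h1 v hv).2.1, fun v hv => (h1 v hv).2.2⟩

/-- Solve the dual problem. -/
def solveDual : Cmd := columns ;; load ;; search ;; load

theorem solveDual_spec (hI : I.Valid) :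
    ∃ t s', Exec [select] solveDual I.input t s' ∧ t ≤ (n + n + 4) * 10001000 ∧
      I.Stored s' ∧ I.Loaded s' ∧ IsMinPt I.dual (s'.rreg 21) (s'.rreg 22) := by
  obtain ⟨t1, s1, E1, ht1, S1⟩ := columns_spec [select] I
  obtain ⟨t2, s2, E2, ht2, L2⟩ := load_spec [select] s1 S1
  have S2 := S1.of_frame (E2.frame (P := selectWr) select_wr) (by decide)
  obtain ⟨t3, s3, E3, ht3, h3⟩ := search_spec s2
    (by
      intro v hv
      rw [L2.m_eq] at hv
      rw [L2.b_eq v hv]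
      exact (colWeight_nonneg hI v).trans (colWeight_le_colSum I v))
    (by rw [L2.pw2_eq]; exact exists_isMinPt hI)
  have S3 := S2.of_frame ((E3.frame (P := selectWr) select_wr).mono search_wr) (by decide)
  -- The search may have overwritten the lines and the linear term; they are rebuilt from the stored
  -- columns.
  obtain ⟨t4, s4, E4, ht4, L4⟩ := load_spec [select] s3 S3
  have F4 := E4.frame (P := selectWr) select_wr
  refine ⟨_, s4, E1.seq (E2.seq (E3.seq E4)), ?_, S3.of_frame F4 (by decide), L4, ?_⟩
  · rw [L2.m_eq] at ht3
    omega
  · rw [F4.rreg 21 (by decide), F4.rreg 22 (by decide), ← L2.pw2_eq]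
    exact h3

end Solving

/-! ### Steepest directions at the dual minimum and the vectors that they determine -/

section PrimalSolution

variable {I : KnapsackData n}

/-- Set the sign of the side and find a direction of steepest descent. -/
def descent (ε : ℚ) : Cmd :=
  (.rset 19 (.const ε) ;; .rset 15 (.const 0) ;; .rset 16 (.const 1) ;; .rset 17 (.const 1) ;;
    .rset 18 (.const 0)) ;; steepest

/-- The locations that `descent` may write. -/
def descentWr : List Loc := [.R 15, .R 16, .R 17, .R 18, .R 19] ++ steepestWr

theorem descent_wr (ε : ℚ) : (descent ε).wr selectWr ⊆ descentWr := by
  intro x hx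
  simp only [descent, Cmd.wr, List.mem_append, List.mem_cons, List.not_mem_nil, or_false] at hx
  rcases hx with hx | hx
  · simp only [descentWr, List.mem_append, List.mem_cons]
    tauto
  · exact List.mem_append_right _ (steepest_wr hx)

theorem Memory.deriv_congr {s s' : Memory} (h8 : s'.ireg 8 = s.ireg 8)
    (h9 : s'.rarr 9 = s.rarr 9) (h10 : s'.rarr 10 = s.rarr 10) (h11 : s'.rarr 11 = s.rarr 11)
    (r11 : s'.rreg 11 = s.rreg 11) (r12 : s'.rreg 12 = s.rreg 12) (r21 : s'.rreg 21 = s.rreg 21)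
    (r22 : s'.rreg 22 = s.rreg 22) (r15 : s'.rreg 15 = 0) (r16 : s'.rreg 16 = 1)
    (r17 : s'.rreg 17 = 1) (r18 : s'.rreg 18 = 0) (ε u : ℝ) :
    s'.deriv ε u = pw2Deriv (s.ireg 8) (s.rarr 9) (s.rarr 10) (s.rarr 11) (s.rreg 11) (s.rreg 12)
      (s.rreg 21) (s.rreg 22) (ε * 1 + u * 0) (ε * 0 + u * 1) := by
  unfold Memory.deriv
  rw [h8, h9, h10, h11, r11, r12, r21, r22, r15, r16, r17, r18]

theorem descent_spec (ε : ℚ) (s : Memory) (hb : ∀ v < s.ireg 8, 0 ≤ s.rarr 11 v)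
    (hmin : IsMinPt s.pw2 (s.rreg 21) (s.rreg 22)) :
    ∃ t s', Exec [select] (descent ε) s t s' ∧ t ≤ (s.ireg 8 + 2) * 20600 ∧
      Frame descentWr s s' ∧ s'.rreg 19 = ε ∧
      ∀ u, pw2Deriv (s.ireg 8) (s.rarr 9) (s.rarr 10) (s.rarr 11) (s.rreg 11) (s.rreg 12)
          (s.rreg 21) (s.rreg 22) (ε * 1 + s'.rreg 2 * 0) (ε * 0 + s'.rreg 2 * 1)
        ≤ pw2Deriv (s.ireg 8) (s.rarr 9) (s.rarr 10) (s.rarr 11) (s.rreg 11) (s.rreg 12)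
          (s.rreg 21) (s.rreg 22) (ε * 1 + u * 0) (ε * 0 + u * 1) := by
  obtain ⟨t1, s1, E1, ht1, h19, h15, h16, h17, h18⟩ := exec_straight [select]
    (c := .rset 19 (.const ε) ;; .rset 15 (.const 0) ;; .rset 16 (.const 1) ;;
      .rset 17 (.const 1) ;; .rset 18 (.const 0)) rfl (s := s)
    (Q := fun s' => s'.rreg 19 = ε ∧ s'.rreg 15 = 0 ∧ s'.rreg 16 = 1 ∧ s'.rreg 17 = 1 ∧
      s'.rreg 18 = 0) (by simp [Cmd.wp, RExp.eval])
  have F1 := E1.frame (P := selectWr) select_wr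
  have hw : (Cmd.rset 19 (.const ε) ;; .rset 15 (.const 0) ;; .rset 16 (.const 1) ;;
      .rset 17 (.const 1) ;; .rset 18 (.const 0)).wr selectWr
      = [.R 19, .R 15, .R 16, .R 17, .R 18] := rfl
  rw [hw] at F1
  have e8 : s1.ireg 8 = s.ireg 8 := F1.ireg 8 (by decide)
  have e11 : s1.rarr 11 = s.rarr 11 := F1.rarr 11 (by decide)
  have hp : s1.pw2 = s.pw2 := F1.pw2_eq (by decide)
  have r21 : s1.rreg 21 = s.rreg 21 := F1.rreg 21 (by decide)
  have r22 : s1.rreg 22 = s.rreg 22 := F1.rreg 22 (by decide)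
  obtain ⟨t2, s2, E2, ht2, F2, h24, hle⟩ := steepest_spec s1 (by rw [e8, e11]; exact hb)
    (fun t => by rw [hp, r21, r22]; exact hmin _ _)
  have hd := Memory.deriv_congr e8 (F1.rarr 9 (by decide)) (F1.rarr 10 (by decide)) e11
    (F1.rreg 11 (by decide)) (F1.rreg 12 (by decide)) r21 r22 h15 h16 h17 h18
  have E := E1.seq E2
  refine ⟨_, s2, E, ?_, (E.frame select_wr).mono (descent_wr ε),
    (F2.rreg 19 (by decide)).trans h19, fun u => ?_⟩
  · simp only [Cmd.cost, RExp.cost] at ht1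
    rw [e8] at ht2
    omega
  · rw [← hd, ← hd, ← h19, ← h24]
    exact hle u

/-- The weights of the columns that the recovered solution uses fully, and partially. -/
def recoverySums : Cmd :=
  .rset 30 (.const 0) ;; .rset 31 (.const 0) ;;
  .forLoop 10 8
    (.rset 5 (.sub (.sub (.get 12 (.reg 10)) (.mul (.get 13 (.reg 10)) (.reg 21)))
        (.mul (.get 14 (.reg 10)) (.reg 22))) ;;
      .rset 6 (.sub (.const 0) (.mul (.reg 19) (.get 10 (.reg 10)))) ;;
      .ite (.rle (.reg 5) (.const 0))
        (.ite (.rle (.const 0) (.reg 5))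
          (.ite (.rle (.reg 6) (.reg 2))
            (.ite (.rle (.reg 2) (.reg 6)) (.rset 31 (.add (.reg 31) (.get 11 (.reg 10)))) .skip)
            (.rset 30 (.add (.reg 30) (.get 11 (.reg 10))))) .skip)
        (.rset 30 (.add (.reg 30) (.get 11 (.reg 10)))))

/-- Write the recovered solution to the real array `a`. -/
def recoveryValues (a : ℕ) : Cmd :=
  .rset 32 (.div (.sub (.reg 12) (.reg 30)) (.reg 31)) ;; .rset 33 (.const 0) ;;
  .forLoop 10 8
    (.rset 5 (.sub (.sub (.get 12 (.reg 10)) (.mul (.get 13 (.reg 10)) (.reg 21)))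
        (.mul (.get 14 (.reg 10)) (.reg 22))) ;;
      .rset 6 (.sub (.const 0) (.mul (.reg 19) (.get 10 (.reg 10)))) ;;
      .ite (.rle (.reg 5) (.const 0))
        (.ite (.rle (.const 0) (.reg 5))
          (.ite (.rle (.reg 6) (.reg 2))
            (.ite (.rle (.reg 2) (.reg 6)) (.rset 7 (.reg 32)) (.rset 7 (.const 0)))
            (.rset 7 (.const 1))) (.rset 7 (.const 0)))
        (.rset 7 (.const 1)) ;;
      .rstore a (.reg 10) (.reg 7) ;;
      .rset 33 (.add (.reg 33) (.mul (.get 13 (.reg 10)) (.reg 7))))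

/-- The reduced cost of a column at the point in registers `21` and `22`. -/
noncomputable def Memory.reduced (s : Memory) (v : ℕ) : ℝ :=
  s.rarr 12 v - s.rarr 13 v * s.rreg 21 - s.rarr 14 v * s.rreg 22

theorem recoverySums_spec (procs : List Cmd) (s : Memory) :
    ∃ t s', Exec procs recoverySums s t s' ∧ t ≤ (s.ireg 8 + 2) * 100 ∧
      s'.rreg 30 = ∑ v ∈ Finset.range (s.ireg 8),
        (if 0 < s.reduced v ∨ s.reduced v = 0 ∧ s.rreg 2 < -(s.rreg 19 * s.rarr 10 v) then
          s.rarr 11 v else 0) ∧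
      s'.rreg 31 = ∑ v ∈ Finset.range (s.ireg 8),
        (if 0 < s.reduced v ∨ s.reduced v = 0 ∧ s.rreg 2 < -(s.rreg 19 * s.rarr 10 v) then 0
          else if s.reduced v = 0 ∧ s.rreg 2 = -(s.rreg 19 * s.rarr 10 v) then
            s.rarr 11 v else 0) := by
  obtain ⟨t, s', hex, ht, ⟨h1, h2⟩, -⟩ := exec_forLoop procs (i := 10) (m := 8)
    (c := .rset 5 (.sub (.sub (.get 12 (.reg 10)) (.mul (.get 13 (.reg 10)) (.reg 21)))
        (.mul (.get 14 (.reg 10)) (.reg 22))) ;;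
      .rset 6 (.sub (.const 0) (.mul (.reg 19) (.get 10 (.reg 10)))) ;;
      .ite (.rle (.reg 5) (.const 0))
        (.ite (.rle (.const 0) (.reg 5))
          (.ite (.rle (.reg 6) (.reg 2))
            (.ite (.rle (.reg 2) (.reg 6)) (.rset 31 (.add (.reg 31) (.get 11 (.reg 10)))) .skip)
            (.rset 30 (.add (.reg 30) (.get 11 (.reg 10))))) .skip)
        (.rset 30 (.add (.reg 30) (.get 11 (.reg 10)))))
    rfl (by decide) (by decide) (by decide) (s := (s.rset 30 0).rset 31 0) (N := s.ireg 8) (by simp)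
    (fun k s' => s'.rreg 30 = ∑ v ∈ Finset.range k,
        (if 0 < s.reduced v ∨ s.reduced v = 0 ∧ s.rreg 2 < -(s.rreg 19 * s.rarr 10 v) then
          s.rarr 11 v else 0) ∧
      s'.rreg 31 = ∑ v ∈ Finset.range k,
        (if 0 < s.reduced v ∨ s.reduced v = 0 ∧ s.rreg 2 < -(s.rreg 19 * s.rarr 10 v) then 0
          else if s.reduced v = 0 ∧ s.rreg 2 = -(s.rreg 19 * s.rarr 10 v) then
            s.rarr 11 v else 0))
    (by simp)
    (by
      rintro j s1 hj hi hf ⟨h1, h2⟩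
      have e10 : s1.rarr 10 = s.rarr 10 := hf.rarr 10 (by decide)
      have e11 : s1.rarr 11 = s.rarr 11 := hf.rarr 11 (by decide)
      have e12 : s1.rarr 12 = s.rarr 12 := hf.rarr 12 (by decide)
      have e13 : s1.rarr 13 = s.rarr 13 := hf.rarr 13 (by decide)
      have e14 : s1.rarr 14 = s.rarr 14 := hf.rarr 14 (by decide)
      have r2 : s1.rreg 2 = s.rreg 2 := (hf.rreg 2 (by decide)).trans (by simp)
      have r19 : s1.rreg 19 = s.rreg 19 := (hf.rreg 19 (by decide)).trans (by simp)
      have r21 : s1.rreg 21 = s.rreg 21 := (hf.rreg 21 (by decide)).trans (by simp)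
      have r22 : s1.rreg 22 = s.rreg 22 := (hf.rreg 22 (by decide)).trans (by simp)
      have hρ : s.rarr 12 j - s.rarr 13 j * s.rreg 21 - s.rarr 14 j * s.rreg 22 = s.reduced j := rfl
      simp only [Cmd.wp, IExp.eval, RExp.eval, BExp.Holds]
      simp only [iset_rreg, rset_rreg, rset_rarr, rset_ireg, Finset.sum_range_succ, hi,
        h1, h2, e10, e11, e12, e13, e14, r2, r19, r21, r22, hρ]
      simp only [Rat.cast_zero, zero_sub]
      norm_num
      generalize s.rreg 19 * s.rarr 10 j = g
      generalize s.reduced j = ρ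
      generalize s.rreg 2 = u
      refine ⟨fun ha => ⟨fun hb => ⟨fun hc => ⟨fun hd => ?_, fun hd => ?_⟩, fun hc => ?_⟩,
        fun hb => ?_⟩, fun ha => ?_⟩
      · have e : ρ = 0 := le_antisymm ha hb
        have e' : u = -g := le_antisymm hd hc
        simp [e, e']
      · simp [ha.not_gt, hc.not_gt, hd.ne']
      · have e : ρ = 0 := le_antisymm ha hb
        simp [e, hc]
      · simp [hb.not_gt, hb.ne]
      · simp [ha])
  refine ⟨_, s', (Exec.rset 30 _ s).seq ((Exec.rset 31 _ _).seq (by simpa [RExp.eval] using hex)),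
    ?_, h1, h2⟩
  refine (add_le_add_right (add_le_add_right ht _) _).trans ?_
  simp only [RExp.cost, Cmd.cost, IExp.cost, BExp.cost]
  omega

theorem recoveryValues_spec {a : ℕ} (ha : 14 < a) (procs : List Cmd) (s : Memory) :
    ∃ t s', Exec procs (recoveryValues a) s t s' ∧ t ≤ (s.ireg 8 + 2) * 100 ∧
      (∀ v < s.ireg 8, s'.rarr a v = recovered (s.rreg 19) (s.rreg 2)
        ((s.rreg 12 - s.rreg 30) / s.rreg 31) s.reduced (s.rarr 10) v) ∧
      s'.rreg 33 = ∑ v ∈ Finset.range (s.ireg 8), s.rarr 13 v * s'.rarr a v := by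
  obtain ⟨t, s', hex, ht, ⟨h1, h2⟩, -⟩ := exec_forLoop procs (i := 10) (m := 8)
    (c := .rset 5 (.sub (.sub (.get 12 (.reg 10)) (.mul (.get 13 (.reg 10)) (.reg 21)))
        (.mul (.get 14 (.reg 10)) (.reg 22))) ;;
      .rset 6 (.sub (.const 0) (.mul (.reg 19) (.get 10 (.reg 10)))) ;;
      .ite (.rle (.reg 5) (.const 0))
        (.ite (.rle (.const 0) (.reg 5))
          (.ite (.rle (.reg 6) (.reg 2))
            (.ite (.rle (.reg 2) (.reg 6)) (.rset 7 (.reg 32)) (.rset 7 (.const 0)))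
            (.rset 7 (.const 1))) (.rset 7 (.const 0)))
        (.rset 7 (.const 1)) ;;
      .rstore a (.reg 10) (.reg 7) ;;
      .rset 33 (.add (.reg 33) (.mul (.get 13 (.reg 10)) (.reg 7))))
    rfl (by simp [Cmd.wr]) (by simp [Cmd.wr]) (by decide)
    (s := (s.rset 32 ((s.rreg 12 - s.rreg 30) / s.rreg 31)).rset 33 0) (N := s.ireg 8) (by simp)
    (fun k s' => (∀ v < k, s'.rarr a v = recovered (s.rreg 19) (s.rreg 2)
        ((s.rreg 12 - s.rreg 30) / s.rreg 31) s.reduced (s.rarr 10) v) ∧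
      s'.rreg 33 = ∑ v ∈ Finset.range k, s.rarr 13 v * s'.rarr a v)
    (by simp)
    (by
      rintro j s1 hj hi hf ⟨h1, h2⟩
      have e10 : s1.rarr 10 = s.rarr 10 := hf.rarr 10 (by simp [Cmd.wr]; omega)
      have e12 : s1.rarr 12 = s.rarr 12 := hf.rarr 12 (by simp [Cmd.wr]; omega)
      have e13 : s1.rarr 13 = s.rarr 13 := hf.rarr 13 (by simp [Cmd.wr]; omega)
      have e14 : s1.rarr 14 = s.rarr 14 := hf.rarr 14 (by simp [Cmd.wr]; omega)
      have r2 : s1.rreg 2 = s.rreg 2 := (hf.rreg 2 (by simp [Cmd.wr])).trans (by simp)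
      have r19 : s1.rreg 19 = s.rreg 19 := (hf.rreg 19 (by simp [Cmd.wr])).trans (by simp)
      have r21 : s1.rreg 21 = s.rreg 21 := (hf.rreg 21 (by simp [Cmd.wr])).trans (by simp)
      have r22 : s1.rreg 22 = s.rreg 22 := (hf.rreg 22 (by simp [Cmd.wr])).trans (by simp)
      have r32 : s1.rreg 32 = (s.rreg 12 - s.rreg 30) / s.rreg 31 :=
        (hf.rreg 32 (by simp [Cmd.wr])).trans (by simp)
      have hρ : s.rarr 12 j - s.rarr 13 j * s.rreg 21 - s.rarr 14 j * s.rreg 22 = s.reduced j := rfl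
      have hfin : ∀ s2 : Memory, s2.rarr a = Function.update (s1.rarr a) j
          (recovered (s.rreg 19) (s.rreg 2)
            ((s.rreg 12 - s.rreg 30) / s.rreg 31) s.reduced (s.rarr 10) j) →
          s2.rreg 33 = s1.rreg 33 + s.rarr 13 j * recovered (s.rreg 19) (s.rreg 2)
            ((s.rreg 12 - s.rreg 30) / s.rreg 31) s.reduced (s.rarr 10) j →
          (∀ v < j + 1, s2.rarr a v = recovered (s.rreg 19) (s.rreg 2)
            ((s.rreg 12 - s.rreg 30) / s.rreg 31) s.reduced (s.rarr 10) v) ∧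
          s2.rreg 33 = ∑ v ∈ Finset.range (j + 1), s.rarr 13 v * s2.rarr a v := by
        intro s2 ha h33
        constructor
        · intro v hv
          rw [ha]
          rcases (Nat.lt_succ_iff.1 hv).lt_or_eq with h' | rfl
          · simpa [h'.ne] using h1 v h'
          · simp
        · rw [h33, h2, Finset.sum_range_succ, ha]
          congr 1
          · refine Finset.sum_congr rfl fun v hv => ?_
            rw [Function.update_of_ne (Finset.mem_range.1 hv).ne]
          · simp
      have n13 : 13 ≠ a := by omega
      simp only [Cmd.wp, IExp.eval, RExp.eval, BExp.Holds]
      simp only [iset_rreg, rset_rreg, rset_rarr, rset_ireg, hi, e10, e12, e13, e14, r2, r19, r21,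
        r22, r32, hρ]
      refine ⟨fun ha => ⟨fun hb => ⟨fun hc => ⟨fun hd => hfin _ ?_ ?_, fun hd => hfin _ ?_ ?_⟩,
        fun hc => hfin _ ?_ ?_⟩, fun hb => hfin _ ?_ ?_⟩, fun ha => hfin _ ?_ ?_⟩
      all_goals
        norm_num at *
        try simp only [hi, e13, n13, if_false, mul_eq_mul_left_iff]
        try congr 1
        try congr 1
        unfold recovered
      · have e : s.reduced j = 0 := le_antisymm ha hb
        have e' : s.rreg 2 = -(s.rreg 19 * s.rarr 10 j) := le_antisymm hd hc
        simp [e, e']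
      · have e : s.reduced j = 0 := le_antisymm ha hb
        have e' : s.rreg 2 = -(s.rreg 19 * s.rarr 10 j) := le_antisymm hd hc
        simp [e, e']
      · simp [ha.not_gt, hc.not_gt, hd.ne']
      · simp [ha.not_gt, hc.not_gt, hd.ne']
      · have e : s.reduced j = 0 := le_antisymm ha hb
        simp [e, hc]
      · have e : s.reduced j = 0 := le_antisymm ha hb
        simp [e, hc]
      · simp [hb.not_gt, hb.ne]
      · simp [hb.not_gt, hb.ne]
      · simp [ha]
      · simp [ha])
  refine ⟨_, s', (Exec.rset 32 _ s).seq ((Exec.rset 33 _ _).seq (by simpa [RExp.eval] using hex)),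
    ?_, h1, h2⟩
  refine (add_le_add_right (add_le_add_right ht _) _).trans ?_
  simp only [RExp.cost, Cmd.cost, IExp.cost, BExp.cost]
  omega

end PrimalSolution

/-! ### Primal vectors from the two sides and their combination -/

section PrimalSolution

variable {I : KnapsackData n}

/-- Recover the primal solution on one side. -/
def recover (ε : ℚ) (a : ℕ) : Cmd := descent ε ;; recoverySums ;; recoveryValues a

/-- The locations that `recover` may write. -/
def recoverWr (a : ℕ) : List Loc :=
  .RA a :: [.R 5, .R 6, .R 7, .R 30, .R 31, .R 32, .R 33, .I 10] ++ descentWr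

theorem recover_wr (ε : ℚ) (a : ℕ) : (recover ε a).wr selectWr ⊆ recoverWr a := by
  intro x hx
  rw [recover, Cmd.wr, Cmd.wr, List.mem_append, List.mem_append] at hx
  rcases hx with hx | hx | hx
  · exact List.mem_append_right _ (descent_wr ε hx)
  · simp [recoverySums, Cmd.wr, Cmd.forLoop] at hx
    simp only [recoverWr, List.mem_append, List.mem_cons]
    tauto
  · simp [recoveryValues, Cmd.wr, Cmd.forLoop] at hx
    simp only [recoverWr, List.mem_append, List.mem_cons]
    tauto

/-- At a dual minimum every directional derivative is nonnegative, and the one computed here is `ε`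
times the residual of the knapsack row. So the two signs give vectors that use at most, respectively
at least, the capacity. -/
theorem recover_spec (hI : I.Valid) (ε : ℚ) {a : ℕ} (ha : 14 < a) (s : Memory) (hS : I.Stored s)
    (hL : I.Loaded s) (hmin : IsMinPt I.dual (s.rreg 21) (s.rreg 22)) :
    ∃ t s', Exec [select] (recover ε a) s t s' ∧ t ≤ (n + n + 4) * 20900 ∧
      Frame (recoverWr a) s s' ∧
      Certified (n + n + 2) I.colProfit I.colWeight I.colSum (s'.rreg 33) (I.B + I.k)
        (s.rreg 21) (s.rreg 22) (s'.rarr a) ∧ 0 ≤ ε * (I.B - s'.rreg 33) := by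
  have hb : ∀ v < s.ireg 8, 0 ≤ s.rarr 11 v := by
    intro v hv
    rw [hL.m_eq] at hv
    rw [hL.b_eq v hv]
    exact (colWeight_nonneg hI v).trans (colWeight_le_colSum I v)
  obtain ⟨t1, s1, E1, ht1, F1, h19, hle⟩ := descent_spec ε s hb (by rw [hL.pw2_eq]; exact hmin)
  obtain ⟨t2, s2, E2, ht2, h30, h31⟩ := recoverySums_spec [select] s1
  have F2 : Frame (recoverySums.wr selectWr) s1 s2 := E2.frame (P := selectWr) select_wr
  obtain ⟨t3, s3, E3, ht3, hz, h33⟩ := recoveryValues_spec ha [select] s2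
  have e8 : s1.ireg 8 = s.ireg 8 := F1.ireg 8 (by decide)
  have e10 : s1.rarr 10 = s.rarr 10 := F1.rarr 10 (by decide)
  have e11 : s1.rarr 11 = s.rarr 11 := F1.rarr 11 (by decide)
  have e13 : s1.rarr 13 = s.rarr 13 := F1.rarr 13 (by decide)
  have eρ : s1.reduced = s.reduced := by
    funext v
    simp only [Memory.reduced]
    rw [F1.rarr 12 (by decide), e13, F1.rarr 14 (by decide), F1.rreg 21 (by decide),
      F1.rreg 22 (by decide)]
  have f8 : s2.ireg 8 = s.ireg 8 := (F2.ireg 8 (by decide)).trans e8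
  have f10 : s2.rarr 10 = s.rarr 10 := (F2.rarr 10 (by decide)).trans e10
  have f13 : s2.rarr 13 = s.rarr 13 := (F2.rarr 13 (by decide)).trans e13
  have f2 : s2.rreg 2 = s1.rreg 2 := F2.rreg 2 (by decide)
  have f12 : s2.rreg 12 = s.rreg 12 := (F2.rreg 12 (by decide)).trans (F1.rreg 12 (by decide))
  have f19 : s2.rreg 19 = ε := (F2.rreg 19 (by decide)).trans h19
  have fρ : s2.reduced = s.reduced := by
    rw [← eρ]
    funext v
    simp only [Memory.reduced]
    rw [F2.rarr 12 (by decide), F2.rarr 13 (by decide), F2.rarr 14 (by decide),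
      F2.rreg 21 (by decide), F2.rreg 22 (by decide)]
  rw [e8, eρ, e10, e11, h19] at h30 h31
  rw [f8, f10, f2, f12, f19, fρ] at hz
  rw [f8, f13] at h33
  have hρ : ∀ v < n + n + 2, s.reduced v
      = I.colProfit v - I.colWeight v * s.rreg 21 - I.colSum v * s.rreg 22 := by
    intro v hv
    rw [Memory.reduced, hS.profit v hv, hS.weight v hv, hS.sum v hv]
  have hAB : ∀ v, I.colSum v = 0 → I.colWeight v = 0 := fun v h =>
    le_antisymm (h ▸ colWeight_le_colSum I v) (colWeight_nonneg hI v)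
  obtain ⟨t0, t1', hsum, hder⟩ := recovered_spec (ε := (ε : ℝ)) (u := s1.rreg 2) hb
    (ρ := s.reduced) (γ := s.rarr 9) (σ := s.rarr 10)
    (x := s.rreg 21) (y := s.rreg 22)
    (by
      intro v hv h0
      rw [hL.m_eq] at hv
      rw [hL.b_eq v hv] at h0 ⊢
      rw [hρ v hv, hL.γ_eq v hv, hL.σ_eq v hv]
      field_simp) hle h30 h31 rfl
  rw [hL.m_eq] at hz h33
  have hz' : ∀ v < n + n + 2, s3.rarr a v = recovered ε (s1.rreg 2)
      ((s.rreg 12 - s2.rreg 30) / s2.rreg 31) s.reduced (s.rarr 10) v := hz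
  have E := E1.seq (E2.seq E3)
  refine ⟨_, s3, E, ?_, (E.frame select_wr).mono (recover_wr ε a), ?_, ?_⟩
  · rw [hL.m_eq] at ht1 e8 f8
    rw [e8] at ht2
    rw [f8] at ht3
    omega
  · refine ⟨fun v hv => ?_, fun v hv => ?_, ?_, ?_, fun v hv hp => ?_, fun v hv hp => ?_⟩
    · rw [hz' v hv]; exact (recovered_bounds t0 t1' v).1
    · rw [hz' v hv]; exact (recovered_bounds t0 t1' v).2
    · rw [h33]
      exact Finset.sum_congr rfl fun v hv => by rw [hS.weight v (Finset.mem_range.1 hv)]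
    · rw [← hL.r₂_eq, ← hsum, hL.m_eq]
      refine Finset.sum_congr rfl fun v hv => ?_
      have hv := Finset.mem_range.1 hv
      rw [hz' v hv, hL.b_eq v hv]
    · rw [hz' v hv]; rw [← hρ v hv] at hp; exact recovered_of_pos hp
    · rw [hz' v hv]; rw [← hρ v hv] at hp; exact recovered_of_neg hp
  · have h0 := deriv_nonneg_of_line (m := s.ireg 8) (γ := s.rarr 9) (σ := s.rarr 10)
      (b := s.rarr 11) (r₁ := s.rreg 11) (r₂ := s.rreg 12) (x := s.rreg 21) (y := s.rreg 22)
      (dx := (ε : ℝ) * 1 + s1.rreg 2 * 0) (dy := (ε : ℝ) * 0 + s1.rreg 2 * 1)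
      (fun t => by
        rw [← hL.pw2_eq] at hmin
        exact hmin _ _) 1
    rw [one_mul, one_mul, hder, hL.r₁_eq, hL.m_eq] at h0
    convert h0 using 3
    rw [h33]
    refine Finset.sum_congr rfl fun v hv => ?_
    have hv := Finset.mem_range.1 hv
    rw [hz' v hv, hS.weight v hv, hL.b_eq v hv, hL.σ_eq v hv]
    by_cases h : I.colSum v = 0
    · rw [hAB v h]; simp
    · rw [mul_div_cancel₀ _ h]

/-- Combine the solutions that were recovered on both sides. -/
def combine : Cmd :=
  .rset 36 (.div (.sub (.reg 33) (.reg 0)) (.sub (.reg 33) (.reg 34))) ;;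
  .forLoop 10 8
    (.rstore 24 (.reg 10) (.add (.mul (.reg 36) (.get 15 (.reg 10)))
      (.mul (.sub (.const 1) (.reg 36)) (.get 16 (.reg 10)))))

theorem combine_spec (procs : List Cmd) (s : Memory) :
    ∃ t s', Exec procs combine s t s' ∧ t ≤ (s.ireg 8 + 2) * 100 ∧
      ∀ v < s.ireg 8, s'.rarr 24 v
        = (s.rreg 33 - s.rreg 0) / (s.rreg 33 - s.rreg 34) * s.rarr 15 v
          + (1 - (s.rreg 33 - s.rreg 0) / (s.rreg 33 - s.rreg 34)) * s.rarr 16 v := by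
  obtain ⟨t, s', hex, ht, h1, -⟩ := exec_forLoop procs (i := 10) (m := 8)
    (c := .rstore 24 (.reg 10) (.add (.mul (.reg 36) (.get 15 (.reg 10)))
      (.mul (.sub (.const 1) (.reg 36)) (.get 16 (.reg 10)))))
    rfl (by decide) (by decide) (by decide)
    (s := s.rset 36 ((s.rreg 33 - s.rreg 0) / (s.rreg 33 - s.rreg 34))) (N := s.ireg 8) (by simp)
    (fun k s' => ∀ v < k, s'.rarr 24 v
        = (s.rreg 33 - s.rreg 0) / (s.rreg 33 - s.rreg 34) * s.rarr 15 v
          + (1 - (s.rreg 33 - s.rreg 0) / (s.rreg 33 - s.rreg 34)) * s.rarr 16 v)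
    (by simp)
    (by
      rintro j s1 hj hi hf h1
      have e15 : s1.rarr 15 = s.rarr 15 := hf.rarr 15 (by decide)
      have e16 : s1.rarr 16 = s.rarr 16 := hf.rarr 16 (by decide)
      have r36 : s1.rreg 36 = (s.rreg 33 - s.rreg 0) / (s.rreg 33 - s.rreg 34) :=
        (hf.rreg 36 (by decide)).trans (by simp)
      simp only [Cmd.wp, IExp.eval, RExp.eval]
      intro v hv
      rcases (Nat.lt_succ_iff.1 hv).lt_or_eq with h' | rfl
      · simp [hi, h'.ne, h1 v h']
      · simp [hi, e15, e16, r36])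
  refine ⟨_, s', (Exec.rset 36 _ s).seq (by simpa [RExp.eval] using hex), ?_, h1⟩
  refine (add_le_add_right ht _).trans ?_
  simp only [RExp.cost, Cmd.cost, IExp.cost]
  omega

/-- Compute an optimal solution of the linear program in equality form. -/
def solvePrimal : Cmd :=
  recover 1 15 ;; .rset 34 (.reg 33) ;; recover (-1) 16 ;; combine

-- Both recovered vectors are complementary to the same dual point and bracket the right-hand side
-- of the first row, so some convex combination meets it exactly.
set_option maxRecDepth 8000 in
theorem solvePrimal_spec (hI : I.Valid) (s : Memory) (hS : I.Stored s)
    (hL : I.Loaded s) (hmin : IsMinPt I.dual (s.rreg 21) (s.rreg 22)) :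
    ∃ t s', Exec [select] solvePrimal s t s' ∧ t ≤ (n + n + 4) * 42000 ∧
      I.Stored s' ∧ ∃ x y, I.Solves x y (s'.rarr 24) := by
  obtain ⟨t1, s1, E1, ht1, F1, C1, h1⟩ := recover_spec hI 1 (a := 15) (by norm_num) s hS hL hmin
  have E2 : Exec [select] (.rset 34 (.reg 33)) s1 _ (s1.rset 34 (s1.rreg 33)) := Exec.rset 34 _ s1
  have F2 := E2.frame (P := selectWr) select_wr
  have S2 := (hS.of_frame F1 (by decide)).of_frame F2 (by decide)
  have L2 := (hL.of_frame F1 (by decide)).of_frame F2 (by decide)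
  have r21 : (s1.rset 34 (s1.rreg 33)).rreg 21 = s.rreg 21 :=
    (F2.rreg 21 (by decide)).trans (F1.rreg 21 (by decide))
  have r22 : (s1.rset 34 (s1.rreg 33)).rreg 22 = s.rreg 22 :=
    (F2.rreg 22 (by decide)).trans (F1.rreg 22 (by decide))
  obtain ⟨t3, s3, E3, ht3, F3, C3, h3⟩ := recover_spec hI (-1) (a := 16) (by norm_num) _ S2 L2
    (by rw [r21, r22]; exact hmin)
  rw [r21, r22] at C3
  have S3 := S2.of_frame F3 (by decide)
  obtain ⟨t4, s4, E4, ht4, h4⟩ := combine_spec [select] s3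
  have F4 := E4.frame (P := selectWr) select_wr
  have e34 : s3.rreg 34 = s1.rreg 33 := (F3.rreg 34 (by decide)).trans (by simp)
  have e15 : s3.rarr 15 = s1.rarr 15 := (F3.rarr 15 (by decide)).trans (by simp)
  have e8 : s3.ireg 8 = n + n + 2 := (L2.of_frame F3 (by decide)).m_eq
  rw [e34, e15, e8, S3.B_eq] at h4
  rw [e8] at ht4
  push_cast at h1 h3
  refine ⟨_, s4, E1.seq (E2.seq (E3.seq E4)), ?_, S3.of_frame F4 (by decide),
    s.rreg 21, s.rreg 22, C1.combine C3 (η := (s3.rreg 33 - I.B) / (s3.rreg 33 - s1.rreg 33))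
      (div_nonneg (by linarith) (by linarith)) (div_le_one_of_le₀ (by linarith) (by linarith)) ?_
      h4⟩
  · simp only [RExp.cost]
    omega
  -- If the two values of the row coincide, both equal `I.B`, and the weight zero that results from
  -- the division is as good as any.
  · rcases eq_or_ne (s3.rreg 33 - s1.rreg 33) 0 with h | h
    · rw [h, div_zero]; linarith
    · field_simp; ring

end PrimalSolution

/-! ### A single purification step -/

section PurificationProgram

variable {I : KnapsackData n}

/-- Compute the largest step for the column in index register `r`, which is moved with the speed in
real register `k`. -/
def capCmd (r k d : ℕ) : Cmd :=
  .ite (.and (.rle (.reg k) (.const 0)) (.rle (.const 0) (.reg k))) (.rset d (.reg 5))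
    (.ite (.rle (.get 24 (.reg r)) (.const 0)) (.rset d (.const 0))
      (.ite (.rle (.const 1) (.get 24 (.reg r))) (.rset d (.const 0))
        (.ite (.rle (.const 0) (.reg k))
          (.rset d (.div (.sub (.const 1) (.get 24 (.reg r))) (.reg k)))
          (.rset d (.div (.get 24 (.reg r)) (.sub (.const 0) (.reg k)))))))

theorem capCmd_wp (r k d : ℕ) (Q : Memory → Prop) (s : Memory)
    (h : Q (s.rset d (cap (s.rreg k) (s.rarr 24 (s.ireg r)) (s.rreg 5)))) :
    (capCmd r k d).wp Q s := by
  simp only [capCmd, Cmd.wp, RExp.eval, IExp.eval, BExp.Holds, Rat.cast_zero, Rat.cast_one]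
  unfold cap at h
  refine ⟨fun h1 => ?_, fun h1 => ⟨fun h2 => ?_, fun h2 => ⟨fun h3 => ?_,
    fun h3 => ⟨fun h4 => ?_, fun h4 => ?_⟩⟩⟩⟩
  · rwa [if_pos (le_antisymm h1.1 h1.2)] at h
  all_goals rw [if_neg (fun e => h1 ⟨e.le, e.ge⟩)] at h
  · rwa [if_pos (Or.inl h2)] at h
  · rwa [if_pos (Or.inr h3)] at h
  · rwa [if_neg (by tauto), if_pos h4] at h
  · rwa [if_neg (by tauto), if_neg h4] at h

/-- The part of a purification step that computes the new solution. -/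
def moveStep : Cmd :=
  .ite (.and (.rle (.reg 5) (.reg 33)) (.rle (.reg 5) (.reg 34)))
    (.rset 35 (.reg 5) ;; .iset 18 (.reg 15) ;; .iset 19 (.reg 16))
    (.ite (.rle (.reg 33) (.reg 34))
      (.rset 35 (.reg 33) ;; .iset 18 (.reg 10) ;; .iset 19 (.reg 16))
      (.rset 35 (.reg 34) ;; .iset 18 (.reg 15) ;; .iset 19 (.reg 10))) ;;
  .rstore 24 (.reg 10) (.sub (.get 24 (.reg 10)) (.reg 35)) ;;
  .rstore 24 (.reg 15) (.add (.get 24 (.reg 15)) (.mul (.reg 31) (.reg 35))) ;;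
  .rstore 24 (.reg 16) (.add (.get 24 (.reg 16)) (.mul (.reg 32) (.reg 35))) ;;
  .iset 15 (.reg 18) ;; .iset 16 (.reg 19)

/-- A purification step. -/
def purifyStep : Cmd :=
  .rset 5 (.get 24 (.reg 10)) ;;
  .ite (.rle (.reg 5) (.const 0)) .skip (.ite (.rle (.const 1) (.reg 5)) .skip
    (.rset 30 (.sub (.mul (.get 13 (.reg 15)) (.get 14 (.reg 16)))
        (.mul (.get 13 (.reg 16)) (.get 14 (.reg 15)))) ;;
      .rset 31 (.div (.sub (.mul (.get 13 (.reg 10)) (.get 14 (.reg 16)))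
        (.mul (.get 13 (.reg 16)) (.get 14 (.reg 10)))) (.reg 30)) ;;
      .rset 32 (.div (.sub (.mul (.get 13 (.reg 15)) (.get 14 (.reg 10)))
        (.mul (.get 13 (.reg 10)) (.get 14 (.reg 15)))) (.reg 30)) ;;
      capCmd 15 31 33 ;; capCmd 16 32 34 ;; moveStep))

/-- Turn the solution in array `24` into a basic one. -/
def purify : Cmd :=
  .iset 15 (.reg 9) ;; .iset 16 (.add (.reg 9) (.const 1)) ;; .forLoop 10 9 purifyStep

/-- The step is the minimum of `z v` and the two caps. If `z v` attains it, the column becomes zero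
and the basis stays; otherwise the basis column that blocks becomes integral, or already was, and is
exchanged for `v`. A step of length zero is a degenerate exchange. -/
theorem moveStep_wp {M : ℕ} {c A B : ℕ → ℝ} {r₁ r₂ x y : ℝ} {v u₁ u₂ : ℕ} {s : Memory}
    (h : Certified (M + 2) c A B r₁ r₂ x y (s.rarr 24)) (hp : Purified M v u₁ u₂ A B (s.rarr 24))
    (hv : v < M) (hi : s.ireg 10 = v) (hu₁ : s.ireg 15 = u₁) (hu₂ : s.ireg 16 = u₂)
    (hz0 : 0 < s.rarr 24 v) (hz1 : s.rarr 24 v < 1) (h5 : s.rreg 5 = s.rarr 24 v)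
    (hA : A v = s.rreg 31 * A u₁ + s.rreg 32 * A u₂)
    (hB : B v = s.rreg 31 * B u₁ + s.rreg 32 * B u₂)
    (h33 : s.rreg 33 = cap (s.rreg 31) (s.rarr 24 u₁) (s.rarr 24 v))
    (h34 : s.rreg 34 = cap (s.rreg 32) (s.rarr 24 u₂) (s.rarr 24 v)) :
    moveStep.wp (fun s' => Certified (M + 2) c A B r₁ r₂ x y (s'.rarr 24) ∧
      Purified M (v + 1) (s'.ireg 15) (s'.ireg 16) A B (s'.rarr 24)) s := by
  have n1 : u₁ ≠ v := by have := hp.out₁; omega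
  have n2 : u₂ ≠ v := by have := hp.out₂; omega
  have n12 := hp.ne
  have hshift : ∀ t, Function.update (Function.update (Function.update (s.rarr 24) v
      (s.rarr 24 v - t)) u₁ (s.rarr 24 u₁ + s.rreg 31 * t)) u₂ (s.rarr 24 u₂ + s.rreg 32 * t)
      = shift (s.rarr 24) v u₁ u₂ (s.rreg 31) (s.rreg 32) t := fun t => rfl
  have c1 := cap_nonneg (κ := s.rreg 31) (a := s.rarr 24 u₁) hz0.le
  have c2 := cap_nonneg (κ := s.rreg 32) (a := s.rarr 24 u₂) hz0.le
  rw [← h33] at c1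
  rw [← h34] at c2
  have hC : ∀ t, 0 ≤ t → t ≤ s.rarr 24 v → t ≤ s.rreg 33 → t ≤ s.rreg 34 →
      Certified (M + 2) c A B r₁ r₂ x y (shift (s.rarr 24) v u₁ u₂ (s.rreg 31) (s.rreg 32) t) :=
    fun t a b d e => h.shift (by omega) hp.lt₁ hp.lt₂ n1 n2 n12 hA hB hz0 hz1 a b
      (cap_move a (h33 ▸ d)) (cap_move a (h34 ▸ e))
  simp only [moveStep, Cmd.wp, IExp.eval, RExp.eval, BExp.Holds]
  simp [-sub_self, hi, hu₁, hu₂, h5, n1, n2, n12.symm, hshift]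
  refine ⟨fun a b => ⟨hC _ hz0.le le_rfl a b, hp.shift hv rfl⟩,
    fun a => ⟨fun b => ?_, fun b => ?_⟩⟩
  · have hlt : s.rreg 33 < s.rarr 24 v := by
      by_contra hc
      push Not at hc
      have := a hc
      linarith
    -- For speed zero the cap would be `z v` itself and could not be strictly smaller.
    have hκ : s.rreg 31 ≠ 0 := by
      intro e
      rw [h33, e, cap, if_pos rfl] at hlt
      exact lt_irrefl _ hlt
    refine ⟨hC _ c1 hlt.le le_rfl b, hp.replace hv hA hB hκ ?_⟩
    rw [h33]
    exact cap_hit hκ (h.nonneg _ hp.lt₁) (h.le_one _ hp.lt₁)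
  · have hlt : s.rreg 34 < s.rarr 24 v := by
      by_contra hc
      push Not at hc
      have := a (by linarith)
      linarith
    have hκ : s.rreg 32 ≠ 0 := by
      intro e
      rw [h34, e, cap, if_pos rfl] at hlt
      exact lt_irrefl _ hlt
    refine ⟨hC _ c2 hlt.le b.le le_rfl, ?_⟩
    rw [shift_swap n12]
    refine (hp.swap.replace hv (by linarith) (by linarith) hκ ?_).swap
    rw [h34]
    exact cap_hit hκ (h.nonneg _ hp.lt₂) (h.le_one _ hp.lt₂)

theorem wp_mono {c : Cmd} {Q Q' : Memory → Prop} {s : Memory} (hc : c.straight = true)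
    (h : c.wp Q s) (hQ : ∀ s', Q s' → Q' s') : c.wp Q' s :=
  wp_of_run hc (hQ _ (run_of_wp h))

end PurificationProgram

/-! ### Sweeping over all copies -/

section PurificationLoop

variable {I : KnapsackData n}

theorem purifyStep_wp {x y : ℝ} {v u₁ u₂ : ℕ} {s : Memory} (hS : I.Stored s)
    (h : I.Solves x y (s.rarr 24))
    (hp : Purified (n + n) v u₁ u₂ I.colWeight I.colSum (s.rarr 24)) (hv : v < n + n)
    (hi : s.ireg 10 = v) (hu₁ : s.ireg 15 = u₁) (hu₂ : s.ireg 16 = u₂) :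
    purifyStep.wp (fun s' => I.Solves x y (s'.rarr 24) ∧ Purified (n + n) (v + 1) (s'.ireg 15)
      (s'.ireg 16) I.colWeight I.colSum (s'.rarr 24)) s := by
  have h0 := h.nonneg v (by omega)
  have h1 := h.le_one v (by omega)
  rw [purifyStep, Cmd.wp, Cmd.wp, Cmd.wp]
  simp only [BExp.Holds, RExp.eval, IExp.eval, rset_rreg, Rat.cast_zero,
    hi]
  refine ⟨fun hz => ?_, fun hz => ?_⟩
  · simp only [Cmd.wp, rset_rarr, rset_ireg, hu₁, hu₂]
    exact ⟨h, hp.skip (Or.inl (le_antisymm hz h0))⟩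
  rw [Cmd.wp]
  simp only [BExp.Holds, RExp.eval, rset_rreg, Rat.cast_one]
  refine ⟨fun hz' => ?_, fun hz' => ?_⟩
  · simp only [Cmd.wp, rset_rarr, rset_ireg, hu₁, hu₂]
    exact ⟨h, hp.skip (Or.inr (le_antisymm h1 hz'))⟩
  have hlt₁ := hp.lt₁
  have hlt₂ := hp.lt₂
  rw [Cmd.wp, Cmd.wp, Cmd.wp, Cmd.wp, Cmd.wp, Cmd.wp, Cmd.wp]
  refine capCmd_wp _ _ _ _ _ ?_
  rw [Cmd.wp]
  refine capCmd_wp _ _ _ _ _ ?_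
  simp only [RExp.eval, IExp.eval, rset_rarr, rset_ireg, rset_rreg, hu₁, hu₂, hi,
    hS.weight v (by omega), hS.sum v (by omega), hS.weight u₁ hlt₁, hS.sum u₁ hlt₁,
    hS.weight u₂ hlt₂, hS.sum u₂ hlt₂]
  refine moveStep_wp (u₁ := u₁) (u₂ := u₂) h hp hv (by simp [hi]) (by simp [hu₁]) (by simp [hu₂])
    (not_le.1 hz) (not_le.1 hz') (by simp) ?_ ?_ ?_ ?_
  -- Cramer's rule for the coordinates of column `v` in the current basis.
  · simp only [rset_rreg]
    norm_num
    rw [div_mul_eq_mul_div, div_mul_eq_mul_div, ← add_div, eq_div_iff hp.det]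
    ring
  · simp only [rset_rreg]
    norm_num
    rw [div_mul_eq_mul_div, div_mul_eq_mul_div, ← add_div, eq_div_iff hp.det]
    ring
  · simp
  · simp

set_option maxRecDepth 8000 in
theorem purify_spec (hI : I.Valid) {x y : ℝ} (s : Memory) (hS : I.Stored s)
    (h : I.Solves x y (s.rarr 24)) :
    ∃ t s', Exec [select] purify s t s' ∧ t ≤ (n + n + 4) * 1000 ∧ I.Stored s' ∧
      I.Solves x y (s'.rarr 24) ∧ Purified (n + n) (n + n) (s'.ireg 15) (s'.ireg 16)
        I.colWeight I.colSum (s'.rarr 24) := by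
  obtain ⟨_, E0⟩ : ∃ t, Exec [select] (.iset 15 (.reg 9) ;; .iset 16 (.add (.reg 9) (.const 1)))
      s t ((s.iset 15 (n + n)).iset 16 (n + n + 1)) := by
    have := (Exec.iset (procs := [select]) 15 (.reg 9) s).seq
      (Exec.iset 16 (.add (.reg 9) (.const 1)) _)
    exact ⟨_, by simpa [IExp.eval, hS.two] using this⟩
  have hfr : ∀ s', Frame (.I 10 :: purifyStep.wr []) ((s.iset 15 (n + n)).iset 16 (n + n + 1)) s' →
      I.Stored s' := fun s' F =>
    (hS.of_frame (E0.frame (P := selectWr) select_wr) (by decide)).of_frame F (by decide)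
  obtain ⟨t, s', E, ht, ⟨h1, h2⟩, F⟩ := exec_forLoop [select] (i := 10) (m := 9) (c := purifyStep)
    rfl (by decide) (by decide) (by decide) (s := (s.iset 15 (n + n)).iset 16 (n + n + 1))
    (N := n + n) (by simp [hS.two])
    (fun k s' => I.Solves x y (s'.rarr 24) ∧ Purified (n + n) k (s'.ireg 15) (s'.ireg 16)
        I.colWeight I.colSum (s'.rarr 24))
    (by simpa using ⟨h, purified_slacks hI _⟩)
    (fun j s1 hj hi hf ⟨g1, g2⟩ => wp_mono rfl (purifyStep_wp (hfr s1 hf) g1 g2 hj hi rfl rfl)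
      (fun s2 hs2 => by simpa using hs2))
  refine ⟨_, s', (Exec.iset 15 _ s).seq ((Exec.iset 16 _ _).seq
    (by simpa [IExp.eval, hS.two] using E)), ?_, hfr s' F, h1, h2⟩
  have hc : purifyStep.cost ≤ 400 := by decide
  have := Nat.mul_le_mul_left (n + n + 2) (Nat.add_le_add_left hc 10)
  simp only [IExp.cost]
  omega

end PurificationLoop

/-! ### From fractional columns to the candidates -/

section Report

variable {I : KnapsackData n} {z : CopyVar n → ℝ} {Z : ℕ → ℝ}

/-- The column of a variable. -/
def CopyVar.index (v : CopyVar n) : ℕ :=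
  Sum.elim (fun i : Fin n => (i : ℕ)) (fun i : Fin n => n + i) v

theorem CopyVar.index_lt (v : CopyVar n) : v.index < n + n := by
  rcases v with i | i
  · exact i.isLt.trans_le (Nat.le_add_left n n)
  · exact Nat.add_lt_add_left i.isLt n

theorem CopyVar.index_injective : Function.Injective (CopyVar.index (n := n)) := by
  rintro (i | i) (j | j) h <;> simp only [CopyVar.index, Sum.elim_inl, Sum.elim_inr] at h
  · rw [Fin.ext h]
  · omega
  · omega
  · rw [Fin.ext (Nat.add_left_cancel h)]

theorem CopyVar.exists_index {u : ℕ} (hu : u < n + n) : ∃ v : CopyVar n, v.index = u := by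
  rcases column_cases (n := n) (v := u) (by omega) with ⟨i, rfl⟩ | ⟨i, rfl⟩ | h
  · exact ⟨Sum.inl i, rfl⟩
  · exact ⟨Sum.inr i, rfl⟩
  · omega

theorem CopyVar.item_eq (v : CopyVar n) :
    (v.item : ℕ) = if n ≤ v.index then v.index - n else v.index := by
  rcases v with i | i
  · rw [if_neg (by simp [CopyVar.index])]; rfl
  · rw [if_pos (by simp [CopyVar.index]), CopyVar.index, Sum.elim_inr, Nat.add_sub_cancel_left]; rfl

theorem solution_eq (Z : ℕ → ℝ) (v : CopyVar n) : solution n Z v = Z v.index := by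
  rcases v with i | i <;> rfl

open Classical in
/-- The item of a column that is fractional in `Z`, and `n` for other columns. -/
noncomputable def slotItem (n : ℕ) (Z : ℕ → ℝ) (u : ℕ) : ℕ :=
  if u < n + n ∧ 0 < Z u ∧ Z u < 1 then if n ≤ u then u - n else u else n

theorem slotItem_cases (n : ℕ) (Z : ℕ → ℝ) (u : ℕ) :
    (slotItem n Z u = n ∧ ∀ v ∈ fractional (solution n Z), v.index ≠ u) ∨
    ∃ v ∈ fractional (solution n Z), v.index = u ∧ slotItem n Z u = v.item := by
  by_cases h : u < n + n ∧ 0 < Z u ∧ Z u < 1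
  · obtain ⟨v, rfl⟩ := CopyVar.exists_index h.1
    exact Or.inr ⟨v, mem_fractional.2 (by rw [solution_eq]; exact h.2), rfl,
      by rw [slotItem, if_pos h, v.item_eq]⟩
  · refine Or.inl ⟨if_neg h, ?_⟩
    rintro v hv rfl
    rw [mem_fractional, solution_eq] at hv
    exact h ⟨v.index_lt, hv⟩

/-- The numbers `a` and `b` are the items of the fractional variables, in order of decreasing
improved weight, filled up with `n`. -/
def KnapsackData.Slots (I : KnapsackData n) (z : CopyVar n → ℝ) (a b : ℕ) : Prop :=
  (fractional z = ∅ ∧ a = n ∧ b = n) ∨ (∃ v, fractional z = {v} ∧ a = v.item ∧ b = n) ∨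
  ∃ u v, u ≠ v ∧ fractional z = {u, v} ∧ I.wHat v.item ≤ I.wHat u.item ∧ a = u.item ∧ b = v.item

/-- A purified vector can be fractional only in its two basis columns. The three clauses match the
tests by which the program orders the two slots. -/
theorem Purified.slots {u₁ u₂ : ℕ} {A B : ℕ → ℝ} (hI : I.Valid)
    (h : Purified (n + n) (n + n) u₁ u₂ A B Z) :
    (slotItem n Z u₁ = n → I.Slots (solution n Z) (slotItem n Z u₂) n) ∧
    (slotItem n Z u₁ ≠ n →
      toArray I.wHat (slotItem n Z u₂) ≤ toArray I.wHat (slotItem n Z u₁) →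
      I.Slots (solution n Z) (slotItem n Z u₁) (slotItem n Z u₂)) ∧
    (toArray I.wHat (slotItem n Z u₁) < toArray I.wHat (slotItem n Z u₂) →
      I.Slots (solution n Z) (slotItem n Z u₂) (slotItem n Z u₁)) := by
  have hsub : ∀ v ∈ fractional (solution n Z), v.index = u₁ ∨ v.index = u₂ := by
    intro v hv
    rw [mem_fractional, solution_eq] at hv
    by_contra hc
    push Not at hc
    have := v.index_lt
    rcases h.integral v.index (by omega) (by omega) hc.1 hc.2 with e | e <;> linarith [hv.1, hv.2]
  have hw := toArray_nonneg hI.wHat_nonneg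
  -- An empty slot holds `n`, which is beyond the end of the array and so has weight zero; it never
  -- strictly outweighs a fractional item.
  have hn : toArray I.wHat n = 0 := toArray_of_le _ le_rfl
  rcases slotItem_cases n Z u₁ with ⟨e₁, h₁⟩ | ⟨v₁, m₁, i₁, e₁⟩ <;>
    rcases slotItem_cases n Z u₂ with ⟨e₂, h₂⟩ | ⟨v₂, m₂, i₂, e₂⟩ <;> rw [e₁, e₂]
  · refine ⟨fun _ => Or.inl ⟨?_, rfl, rfl⟩, fun h => absurd rfl h, fun h => absurd h (lt_irrefl _)⟩
    refine Finset.eq_empty_of_forall_notMem fun v hv => ?_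
    rcases hsub v hv with h | h
    · exact h₁ v hv h
    · exact h₂ v hv h
  · have hf : fractional (solution n Z) = {v₂} := by
      ext v
      rw [Finset.mem_singleton]
      refine ⟨fun hv => ?_, fun hv => hv ▸ m₂⟩
      exact CopyVar.index_injective
        (((hsub v hv).resolve_left (h₁ v hv)).trans i₂.symm)
    exact ⟨fun _ => Or.inr (Or.inl ⟨v₂, hf, rfl, rfl⟩), fun h => absurd rfl h,
      fun _ => Or.inr (Or.inl ⟨v₂, hf, rfl, rfl⟩)⟩
  · have hf : fractional (solution n Z) = {v₁} := by
      ext v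
      rw [Finset.mem_singleton]
      refine ⟨fun hv => ?_, fun hv => hv ▸ m₁⟩
      exact CopyVar.index_injective
        (((hsub v hv).resolve_right (h₂ v hv)).trans i₁.symm)
    refine ⟨fun h => absurd h v₁.item.isLt.ne, fun _ _ => Or.inr (Or.inl ⟨v₁, hf, rfl, rfl⟩),
      fun h => ?_⟩
    rw [hn] at h
    exact absurd h (hw _).not_gt
  · have hne : v₁ ≠ v₂ := by
      rintro rfl
      exact h.ne (i₁.symm.trans i₂)
    have hf : fractional (solution n Z) = {v₁, v₂} := by
      ext v
      rw [Finset.mem_insert, Finset.mem_singleton]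
      refine ⟨fun hv => (hsub v hv).imp (fun h => ?_) (fun h => ?_), ?_⟩
      · exact CopyVar.index_injective (h.trans i₁.symm)
      · exact CopyVar.index_injective (h.trans i₂.symm)
      · rintro (rfl | rfl) <;> assumption
    rw [toArray_fin, toArray_fin]
    exact ⟨fun h => absurd h v₁.item.isLt.ne,
      fun _ h => Or.inr (Or.inr ⟨v₁, v₂, hne, hf, h, rfl, rfl⟩),
      fun h => Or.inr (Or.inr ⟨v₂, v₁, hne.symm, by rw [hf, Finset.pair_comm], h.le, rfl, rfl⟩)⟩

/-- The value `n` for a missing item adds no profit and selects no item, so one formula for each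
candidate covers all three cases. The first candidate is the only one whose presence has to be
tested, by `a < n`. -/
theorem KnapsackData.IsOptimalBasic.returns {a b : ℕ} (hz : I.IsOptimalBasic z)
    (hs : I.Slots z a b) {P₁ P₂ P₃ : ℝ} (h₁ : P₁ = toArray I.p a)
    (h₂ : P₂ = ∑ i ∈ integralPlain z, I.p i)
    (h₃ : P₃ = toArray I.p b + ∑ i ∈ integralImproved z, I.p i) :
    (a < n → P₂ ≤ P₁ → P₃ ≤ P₁ →
      AlgorithmReturns I ⟨∅, Finset.univ.filter fun i => (i : ℕ) = a⟩) ∧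
    (P₃ ≤ P₂ → (a < n → P₁ ≤ P₂) → AlgorithmReturns I ⟨integralPlain z, ∅⟩) ∧
    (P₂ ≤ P₃ → (a < n → P₁ ≤ P₃) → AlgorithmReturns I
      ⟨∅, Finset.univ.filter fun i => i ∈ integralImproved z ∨ (i : ℕ) = b⟩) := by
  classical
  have hn : toArray I.p n = 0 := toArray_of_le _ le_rfl
  have hitem : ∀ i : Fin n, (Finset.univ.filter fun j : Fin n => (j : ℕ) = i) = {i} := by
    intro i; ext j; simp [Fin.ext_iff]
  have himp : (Finset.univ.filter fun i : Fin n => i ∈ integralImproved z ∨ (i : ℕ) = n)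
      = integralImproved z := by
    ext i; simp [i.isLt.ne]
  have himp' : ∀ j : Fin n, (Finset.univ.filter fun i : Fin n =>
      i ∈ integralImproved z ∨ (i : ℕ) = j) = integralImproved z ∪ {j} := by
    intro j; ext i; simp [Fin.ext_iff, or_comm]
  rcases hs with ⟨hf, rfl, rfl⟩ | ⟨v, hf, rfl, rfl⟩ | ⟨u, v, huv, hf, hw, rfl, rfl⟩
  · rw [hn, zero_add] at h₃
    rw [himp]
    refine ⟨fun h => absurd h (lt_irrefl _), fun h _ => ⟨z, _, hz, .none hf, by simp, ?_⟩,
      fun h _ => ⟨z, _, hz, .none hf, by simp, ?_⟩⟩ <;>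
    · simp only [List.mem_cons, List.not_mem_nil, or_false, forall_eq_or_imp, forall_eq,
        profit_plain, profit_improved, ← h₂, ← h₃]
      exact ⟨by linarith, by linarith⟩
  · rw [hn, zero_add] at h₃
    rw [toArray_fin] at h₁
    have hlt := v.item.isLt
    rw [himp, hitem]
    refine ⟨fun _ h h' => ⟨z, _, hz, .one v hf, by simp, ?_⟩,
      fun h h' => ⟨z, _, hz, .one v hf, by simp, ?_⟩,
      fun h h' => ⟨z, _, hz, .one v hf, by simp, ?_⟩⟩ <;>
    · try replace h' := h' hlt
      simp only [List.mem_cons, List.not_mem_nil, or_false, forall_eq_or_imp, forall_eq,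
        profit_plain, profit_improved, Finset.sum_singleton, ← h₁, ← h₂, ← h₃]
      exact ⟨by linarith, by linarith, by linarith⟩
  · rw [toArray_fin] at h₁ h₃
    have hlt := u.item.isLt
    have hv : v.item ∉ integralImproved z := by
      obtain ⟨i, j, -, -, rfl, -⟩ := candidates_two hz.1 huv hf
      have hj : Sum.inr j ∈ fractional z := by simp [hf]
      rw [mem_integralImproved]
      exact (mem_fractional.1 hj).2.ne
    have h₃' : ∑ i ∈ integralImproved z ∪ {v.item}, I.p i = P₃ := by
      rw [Finset.sum_union (by simpa using hv), Finset.sum_singleton, h₃, add_comm]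
    rw [himp', hitem]
    refine ⟨fun _ h h' => ⟨z, _, hz, .two u v huv hf hw, by simp, ?_⟩,
      fun h h' => ⟨z, _, hz, .two u v huv hf hw, by simp, ?_⟩,
      fun h h' => ⟨z, _, hz, .two u v huv hf hw, by simp, ?_⟩⟩ <;>
    · try replace h' := h' hlt
      simp only [List.mem_cons, List.not_mem_nil, or_false, forall_eq_or_imp, forall_eq,
        profit_plain, profit_improved, Finset.sum_singleton, ← h₁, ← h₂, h₃']
      exact ⟨by linarith, by linarith, by linarith⟩

end Report

/-! ### Writing a best candidate, and the complete program -/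

section ReportProgram

variable {I : KnapsackData n} {z : CopyVar n → ℝ} {Z : ℕ → ℝ}

/-- Write the item of the column in index register `r` to index register `d`. -/
def slotCmd (r d : ℕ) : Cmd :=
  .ite (.and (.not (.ile (.reg 9) (.reg r)))
      (.and (.not (.rle (.get 24 (.reg r)) (.const 0))) (.not (.rle (.const 1) (.get 24 (.reg r))))))
    (.ite (.ile (.reg 0) (.reg r)) (.iset d (.sub (.reg r) (.reg 0))) (.iset d (.reg r)))
    (.iset d (.reg 0))

theorem slotCmd_wp (r d : ℕ) (Q : Memory → Prop) (s : Memory) (h0 : s.ireg 0 = n)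
    (h9 : s.ireg 9 = n + n) (h : Q (s.iset d (slotItem n (s.rarr 24) (s.ireg r)))) :
    (slotCmd r d).wp Q s := by
  simp only [slotCmd, Cmd.wp, RExp.eval, IExp.eval, BExp.Holds, Rat.cast_zero, Rat.cast_one, h0, h9,
    not_le]
  unfold slotItem at h
  refine ⟨fun h1 => ⟨fun h2 => ?_, fun h2 => ?_⟩, fun h1 => ?_⟩
  · rwa [if_pos h1, if_pos h2] at h
  · rwa [if_pos h1, if_neg (not_le.2 h2)] at h
  · rwa [if_neg h1] at h

/-- Find the items of the fractional variables. -/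
def findSlots : Cmd :=
  slotCmd 15 17 ;; slotCmd 16 18 ;;
  .ite (.ile (.reg 0) (.reg 17)) (.iset 17 (.reg 18) ;; .iset 18 (.reg 0))
    (.ite (.rle (.get 2 (.reg 18)) (.get 2 (.reg 17))) .skip
      (.iset 19 (.reg 17) ;; .iset 17 (.reg 18) ;; .iset 18 (.reg 19)))

theorem findSlots_wp (hI : I.Valid) {s : Memory} {A B : ℕ → ℝ} (hS : I.Stored s)
    (h : Purified (n + n) (n + n) (s.ireg 15) (s.ireg 16) A B (s.rarr 24)) :
    findSlots.wp (fun s' => I.Slots (solution n (s.rarr 24)) (s'.ireg 17) (s'.ireg 18)) s := by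
  obtain ⟨h1, h2, h3⟩ := h.slots hI
  have hlt : ∀ u, slotItem n (s.rarr 24) u ≤ n := by
    intro u
    rcases slotItem_cases n (s.rarr 24) u with ⟨e, -⟩ | ⟨v, -, -, e⟩
    · exact e.le
    · exact e.le.trans v.item.isLt.le
  have hle := hlt (s.ireg 15)
  rw [findSlots, Cmd.wp]
  refine slotCmd_wp (n := n) _ _ _ _ hS.n_eq hS.two ?_
  rw [Cmd.wp]
  refine slotCmd_wp (n := n) _ _ _ _ (by simp [hS.n_eq]) (by simp [hS.two]) ?_
  simp only [Cmd.wp, RExp.eval, IExp.eval, BExp.Holds]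
  simp [hS.n_eq, hS.wHat_eq]
  refine ⟨fun h => h1 (le_antisymm hle h), fun h => ⟨fun h' => h2 h.ne h', fun h' => h3 h'⟩⟩

/-- Compute the profits of the candidates. -/
def candidateProfits : Cmd :=
  .rset 36 (.get 0 (.reg 17)) ;; .rset 37 (.const 0) ;; .rset 38 (.get 0 (.reg 18)) ;;
  .forLoop 10 0
    (.ite (.rle (.const 1) (.get 24 (.reg 10))) (.rset 37 (.add (.reg 37) (.get 0 (.reg 10))))
        .skip ;;
      .ite (.rle (.const 1) (.get 24 (.add (.reg 0) (.reg 10))))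
        (.rset 38 (.add (.reg 38) (.get 0 (.reg 10)))) .skip)

theorem candidateProfits_spec (procs : List Cmd) {s : Memory} (hS : I.Stored s) :
    ∃ t s', Exec procs candidateProfits s t s' ∧ t ≤ (n + 2) * 100 ∧
      s'.rreg 36 = toArray I.p (s.ireg 17) ∧
      s'.rreg 37 = ∑ v ∈ Finset.range n, (if 1 ≤ s.rarr 24 v then toArray I.p v else 0) ∧
      s'.rreg 38 = toArray I.p (s.ireg 18)
        + ∑ v ∈ Finset.range n, (if 1 ≤ s.rarr 24 (n + v) then toArray I.p v else 0) := by
  obtain ⟨t, s', E, ht, ⟨h36, h37, h38⟩, -⟩ := exec_forLoop procs (i := 10) (m := 0)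
    (c := .ite (.rle (.const 1) (.get 24 (.reg 10)))
        (.rset 37 (.add (.reg 37) (.get 0 (.reg 10)))) .skip ;;
      .ite (.rle (.const 1) (.get 24 (.add (.reg 0) (.reg 10))))
        (.rset 38 (.add (.reg 38) (.get 0 (.reg 10)))) .skip)
    rfl (by decide) (by decide) (by decide)
    (s := ((s.rset 36 (toArray I.p (s.ireg 17))).rset 37 0).rset 38 (toArray I.p (s.ireg 18)))
    (N := n) (by simp [hS.n_eq])
    (fun k s' => s'.rreg 36 = toArray I.p (s.ireg 17) ∧
      s'.rreg 37 = ∑ v ∈ Finset.range k, (if 1 ≤ s.rarr 24 v then toArray I.p v else 0) ∧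
      s'.rreg 38 = toArray I.p (s.ireg 18)
        + ∑ v ∈ Finset.range k, (if 1 ≤ s.rarr 24 (n + v) then toArray I.p v else 0))
    (by simp)
    (by
      rintro j s1 hj hi hf ⟨h36, h37, h38⟩
      have e0 : s1.rarr 0 = toArray I.p := (hf.rarr 0 (by decide)).trans (by simp [hS.p_eq])
      have e24 : s1.rarr 24 = s.rarr 24 := hf.rarr 24 (by decide)
      have i0 : s1.ireg 0 = n := (hf.ireg 0 (by decide)).trans (by simp [hS.n_eq])
      simp only [Cmd.wp, IExp.eval, RExp.eval, BExp.Holds, Rat.cast_one]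
      refine ⟨fun h1 => ⟨fun h2 => ?_, fun h2 => ?_⟩, fun h1 => ⟨fun h2 => ?_, fun h2 => ?_⟩⟩ <;>
        simp_all [Finset.sum_range_succ, add_assoc])
  refine ⟨_, s', (Exec.rset 36 _ s).seq ((Exec.rset 37 _ _).seq ((Exec.rset 38 _ _).seq
    (by simpa [RExp.eval, IExp.eval, hS.p_eq] using E))), ?_, h36, h37, h38⟩
  refine (add_le_add_right (add_le_add_right (add_le_add_right ht _) _) _).trans ?_
  simp only [RExp.cost, Cmd.cost, IExp.cost, BExp.cost]
  omega

/-- Write the best candidate. -/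
def writeBest : Cmd :=
  .ite (.and (.not (.ile (.reg 0) (.reg 17)))
      (.and (.rle (.reg 37) (.reg 36)) (.rle (.reg 38) (.reg 36))))
    (.istore 1 (.reg 17) (.const 1))
    (.ite (.rle (.reg 38) (.reg 37))
      (.forLoop 10 0 (.ite (.rle (.const 1) (.get 24 (.reg 10)))
        (.istore 0 (.reg 10) (.const 1)) .skip))
      (.istore 1 (.reg 18) (.const 1) ;;
        .forLoop 10 0 (.ite (.rle (.const 1) (.get 24 (.add (.reg 0) (.reg 10))))
          (.istore 1 (.reg 10) (.const 1)) .skip)))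

theorem writePlain_spec (procs : List Cmd) {s : Memory} (hS : I.Stored s) :
    ∃ t s', Exec procs (.forLoop 10 0 (.ite (.rle (.const 1) (.get 24 (.reg 10)))
        (.istore 0 (.reg 10) (.const 1)) .skip)) s t s' ∧ t ≤ (n + 2) * 100 ∧
      (∀ v < n, (s'.iarr 0 v = 1 ↔ 1 ≤ s.rarr 24 v)) ∧ ∀ v, s'.iarr 1 v = 0 := by
  obtain ⟨t, s', E, ht, ⟨h1, -⟩, F⟩ := exec_forLoop procs (i := 10) (m := 0)
    (c := .ite (.rle (.const 1) (.get 24 (.reg 10))) (.istore 0 (.reg 10) (.const 1)) .skip)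
    rfl (by decide) (by decide) (by decide) (s := s) (N := n) hS.n_eq
    (fun k s' => (∀ v < k, (s'.iarr 0 v = 1 ↔ 1 ≤ s.rarr 24 v)) ∧ ∀ v, k ≤ v → s'.iarr 0 v = 0)
    (by simp [hS.out₀])
    (by
      rintro j s1 hj hi hf ⟨h1, h2⟩
      have e24 : s1.rarr 24 = s.rarr 24 := hf.rarr 24 (by decide)
      simp only [Cmd.wp, IExp.eval, RExp.eval, BExp.Holds, Rat.cast_one, hi, e24]
      refine ⟨fun h => ⟨fun v hv => ?_, fun v hv => ?_⟩, fun h => ⟨fun v hv => ?_, fun v hv => ?_⟩⟩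
      · rcases Nat.lt_succ_iff_lt_or_eq.1 hv with hv | rfl
        · simpa [hv.ne] using h1 v hv
        · simpa using h
      · simpa [show v ≠ j by omega] using h2 v (by omega)
      · rcases Nat.lt_succ_iff_lt_or_eq.1 hv with hv | rfl
        · simpa using h1 v hv
        · simpa [h2 v le_rfl] using h
      · simpa using h2 v (by omega))
  refine ⟨t, s', E, ht.trans ?_, h1, fun v => ?_⟩
  · simp only [RExp.cost, Cmd.cost, IExp.cost, BExp.cost]
    omega
  · rw [F.iarr 1 (by decide)]
    exact hS.out₁ v

/-- Entries that are already one are kept, because the rounded-up item is marked beforehand. An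
empty slot marks index `n`, which the output does not read. -/
theorem writeImproved_spec (procs : List Cmd) {s : Memory} (h0 : s.ireg 0 = n) :
    ∃ t s', Exec procs (.forLoop 10 0 (.ite (.rle (.const 1) (.get 24 (.add (.reg 0) (.reg 10))))
          (.istore 1 (.reg 10) (.const 1)) .skip)) s t s' ∧ t ≤ (n + 2) * 100 ∧
      (∀ v < n, (s'.iarr 1 v = 1 ↔ 1 ≤ s.rarr 24 (n + v) ∨ s.iarr 1 v = 1)) ∧
      s'.iarr 0 = s.iarr 0 := by
  obtain ⟨t, s', E, ht, ⟨h1, -⟩, F⟩ := exec_forLoop procs (i := 10) (m := 0)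
    (c := .ite (.rle (.const 1) (.get 24 (.add (.reg 0) (.reg 10))))
      (.istore 1 (.reg 10) (.const 1)) .skip)
    rfl (by decide) (by decide) (by decide) (s := s) (N := n) h0
    (fun k s' => (∀ v < k, (s'.iarr 1 v = 1 ↔ 1 ≤ s.rarr 24 (n + v) ∨ s.iarr 1 v = 1)) ∧
      ∀ v, k ≤ v → s'.iarr 1 v = s.iarr 1 v)
    (by simp)
    (by
      rintro j s1 hj hi hf ⟨h1, h2⟩
      have e24 : s1.rarr 24 = s.rarr 24 := hf.rarr 24 (by decide)
      have i0 : s1.ireg 0 = n := (hf.ireg 0 (by decide)).trans h0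
      simp only [Cmd.wp, IExp.eval, RExp.eval, BExp.Holds, Rat.cast_one, hi, e24, i0]
      refine ⟨fun h => ⟨fun v hv => ?_, fun v hv => ?_⟩, fun h => ⟨fun v hv => ?_, fun v hv => ?_⟩⟩
      · rcases Nat.lt_succ_iff_lt_or_eq.1 hv with hv | rfl
        · simpa [hv.ne] using h1 v hv
        · simp [h]
      · simpa [show v ≠ j by omega] using h2 v (by omega)
      · rcases Nat.lt_succ_iff_lt_or_eq.1 hv with hv | rfl
        · simpa using h1 v hv
        · simp [h2 v le_rfl, h]
      · simpa using h2 v (by omega))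
  refine ⟨t, s', E, ht.trans ?_, h1, F.iarr 0 (by decide)⟩
  simp only [RExp.cost, Cmd.cost, IExp.cost, BExp.cost]
  omega

theorem writeBest_spec (procs : List Cmd) {s : Memory} (hS : I.Stored s)
    {J K : Finset (Fin n)} (hJ : ∀ i : Fin n, i ∈ J ↔ 1 ≤ s.rarr 24 i)
    (hK : ∀ i : Fin n, i ∈ K ↔ 1 ≤ s.rarr 24 (n + i)) :
    ∃ t s', Exec procs writeBest s t s' ∧ t ≤ (n + 3) * 100 ∧
      ((s.ireg 17 < n ∧ s.rreg 37 ≤ s.rreg 36 ∧ s.rreg 38 ≤ s.rreg 36 ∧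
          s'.output n = ⟨∅, Finset.univ.filter fun i => (i : ℕ) = s.ireg 17⟩) ∨
        (s.rreg 38 ≤ s.rreg 37 ∧ (s.ireg 17 < n → s.rreg 36 ≤ s.rreg 37) ∧
          s'.output n = ⟨J, ∅⟩) ∨
        (s.rreg 37 ≤ s.rreg 38 ∧ (s.ireg 17 < n → s.rreg 36 ≤ s.rreg 38) ∧
          s'.output n = ⟨∅, Finset.univ.filter fun i => i ∈ K ∨ (i : ℕ) = s.ireg 18⟩)) := by
  by_cases h : s.ireg 17 < n ∧ s.rreg 37 ≤ s.rreg 36 ∧ s.rreg 38 ≤ s.rreg 36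
  · refine ⟨_, _, .ite_true (by simpa [BExp.Holds, IExp.eval, RExp.eval, hS.n_eq] using h)
      (.istore _ _ _ _), ?_, Or.inl ⟨h.1, h.2.1, h.2.2, ?_⟩⟩
    · simp only [RExp.cost, IExp.cost, BExp.cost]
      omega
    · simp only [Memory.output, Memory.istore, IExp.eval, Selection.mk.injEq]
      constructor
      · ext i; simp [hS.out₀]
      · ext i
        by_cases e : (i : ℕ) = s.ireg 17 <;> simp [Function.update_apply, hS.out₁, e]
  have hb : ¬ (BExp.and (.not (.ile (.reg 0) (.reg 17)))
      (.and (.rle (.reg 37) (.reg 36)) (.rle (.reg 38) (.reg 36)))).Holds s := by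
    simpa [BExp.Holds, IExp.eval, RExp.eval, hS.n_eq] using h
  by_cases h' : s.rreg 38 ≤ s.rreg 37
  · obtain ⟨t, s', E, ht, h1, h2⟩ := writePlain_spec procs hS
    refine ⟨_, s', .ite_false hb (.ite_true h' E), ?_, Or.inr (Or.inl ⟨h', fun hlt => ?_, ?_⟩)⟩
    · simp only [RExp.cost, IExp.cost, BExp.cost]
      omega
    · by_contra hc
      exact h ⟨hlt, by linarith, by linarith⟩
    · simp only [Memory.output, Selection.mk.injEq]
      constructor
      · ext i; simp [h1 i i.isLt, hJ]
      · ext i; simp [h2]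
  · obtain ⟨t, s', E, ht, h1, h2⟩ := writeImproved_spec procs (n := n)
      (s := s.istore 1 (s.ireg 18) 1) hS.n_eq
    refine ⟨_, s', .ite_false hb (.ite_false h' ((Exec.istore 1 _ _ s).seq E)), ?_,
      Or.inr (Or.inr ⟨by linarith, fun hlt => ?_, ?_⟩)⟩
    · simp only [RExp.cost, IExp.cost, BExp.cost]
      omega
    · by_contra hc
      exact h ⟨hlt, by linarith, by linarith⟩
    · simp only [Memory.output, Selection.mk.injEq]
      constructor
      · ext i; simp [h2, Memory.istore, hS.out₀]
      · ext i
        have hi := h1 i i.isLt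
        simp only [Memory.istore, Function.update_self, Function.update_apply, hS.out₁] at hi
        simp [hi, hK]

/-- Write the output. -/
def report : Cmd := findSlots ;; candidateProfits ;; writeBest

set_option maxRecDepth 8000 in
theorem report_spec (hI : I.Valid) {s : Memory} {x y : ℝ} (hS : I.Stored s)
    (h : I.Solves x y (s.rarr 24))
    (hp : Purified (n + n) (n + n) (s.ireg 15) (s.ireg 16) I.colWeight I.colSum (s.rarr 24)) :
    ∃ t s', Exec [select] report s t s' ∧ t ≤ (n + 4) * 1000 ∧
      AlgorithmReturns I (s'.output n) := by
  obtain ⟨t1, s1, E1, ht1, h1⟩ := exec_straight [select] rfl (findSlots_wp hI hS hp)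
  have F1 := E1.frame (P := selectWr) select_wr
  have S1 := hS.of_frame F1 (by decide)
  have z1 : s1.rarr 24 = s.rarr 24 := F1.rarr 24 (by decide)
  obtain ⟨t2, s2, E2, ht2, h36, h37, h38⟩ := candidateProfits_spec [select] S1
  have F2 := E2.frame (P := selectWr) select_wr
  have S2 := S1.of_frame F2 (by decide)
  have z2 : s2.rarr 24 = s.rarr 24 := (F2.rarr 24 (by decide)).trans z1
  have hJ : ∀ i : Fin n, i ∈ integralPlain (solution n (s.rarr 24)) ↔ 1 ≤ s.rarr 24 i := by
    intro i
    rw [mem_integralPlain]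
    exact ⟨fun e => e.ge, fun e => le_antisymm (h.le_one i (by omega)) e⟩
  have hK : ∀ i : Fin n, i ∈ integralImproved (solution n (s.rarr 24))
      ↔ 1 ≤ s.rarr 24 (n + i) := by
    intro i
    rw [mem_integralImproved]
    exact ⟨fun e => e.ge, fun e => le_antisymm (h.le_one (n + i) (by omega)) e⟩
  obtain ⟨t3, s3, E3, ht3, h3⟩ := writeBest_spec [select] S2 (by rw [z2]; exact hJ)
    (by rw [z2]; exact hK)
  obtain ⟨r1, r2, r3⟩ := (isOptimalBasic_solution hI h hp).returns h1 h36
    (h37.trans (by simp [Finset.sum_range, z1, toArray_fin, ← hJ, Finset.sum_ite_mem]))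
    (h38.trans (by simp [Finset.sum_range, z1, toArray_fin, ← hK, Finset.sum_ite_mem]))
  rw [F2.ireg 17 (by decide), F2.ireg 18 (by decide)] at h3
  refine ⟨_, s3, E1.seq (E2.seq E3), ?_, ?_⟩
  · have hc : findSlots.cost ≤ 400 := by decide
    omega
  · rcases h3 with ⟨a, b, c, e⟩ | ⟨a, b, e⟩ | ⟨a, b, e⟩ <;> rw [e]
    · exact r1 a b c
    · exact r2 a b
    · exact r3 a b

/-- The program for the real random access machine. -/
def algorithm : Program := ⟨solveDual ;; solvePrimal ;; purify ;; report, [select]⟩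

theorem algorithm_runsInLinearTime : algorithm.RunsAlgorithmInLinearTime := by
  -- The phases cost about `10044000 * (n + n + 4)` steps in total, and `n + n + 4 ≤ 4 * (n + 1)`.
  refine ⟨50000000, fun n I hI => ?_⟩
  obtain ⟨t1, s1, E1, ht1, S1, L1, hmin⟩ := solveDual_spec hI
  obtain ⟨t2, s2, E2, ht2, S2, x, y, h2⟩ := solvePrimal_spec hI s1 S1 L1 hmin
  obtain ⟨t3, s3, E3, ht3, S3, h3, hp⟩ := purify_spec hI s2 S2 h2
  obtain ⟨t4, s4, E4, ht4, h4⟩ := report_spec hI S3 h3 hp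
  exact ⟨_, s4, E1.seq (E2.seq (E3.seq E4)), by omega, h4⟩

end ReportProgram

end ImprovableKnapsack

theorem mainTheorem6 :
    (∀ (n : ℕ) (I : KnapsackData n), I.Valid →
      -- basic solutions of the LP relaxation
      (∀ z, I.IsBasic z →
        (fractional z).card ≤ 2 ∧
        ((fractional z).card = 2 → ∃ i j : Fin n, i ≠ j ∧
          fractional z = {Sum.inr i, Sum.inr j} ∧ z (Sum.inr i) + z (Sum.inr j) = 1)) ∧
      ∃ opt ckp : ℝ, I.IsOptValue opt ∧ I.IsCKPOptValue ckp ∧ opt ≤ ckp ∧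
        -- the candidate solutions
        (∀ z, I.IsOptimalBasic z →
          (∃ L, Candidates I z L) ∧
          ∀ L, Candidates I z L →
            (∀ S ∈ L, I.FeasibleSelection S) ∧ opt ≤ (L.map I.profit).sum) ∧
        -- the approximation ratio
        (∀ S, AlgorithmReturns I S → I.FeasibleSelection S ∧ opt ≤ 3 * I.profit S)) ∧
    -- the running time
    ∃ P : Program, P.RunsAlgorithmInLinearTime := by
  refine ⟨fun n I hI => ⟨fun z hz => ⟨card_fractional_le_two hz, fractional_of_card_eq_two hz⟩, ?_⟩,
    algorithm, algorithm_runsInLinearTime⟩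
  obtain ⟨opt, hopt⟩ := exists_isOptValue hI
  obtain ⟨ckp, hckp⟩ := exists_isCKPOptValue hI
  refine ⟨opt, ckp, hopt, hckp, optValue_le_ckpOptValue hopt hckp, fun z hz =>
    ⟨exists_candidates hz.1, fun L hL => ⟨candidates_feasible hI hz.1 hL,
      (optValue_le_value hI hopt hz.2).trans (value_le_sum_candidates hI hz hL)⟩⟩, ?_⟩
  rintro S ⟨z, L, hz, hL, hS, hmax⟩
  exact ⟨candidates_feasible hI hz.1 hL S hS,
    (optValue_le_value hI hopt hz.2).trans (value_le_three_mul hI hz hL hmax)⟩
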